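/- Let $q\ge 3$, $\lambda_q=2\cos(\pi/q)$, and let $G_q\subset PSL(2,\mathbb R)$ be the Hecke group generated by $S=\begin{pmatrix}0&1\\-1&0\end{pmatrix}$ and $T=\begin{pmatrix}1&\lambda_q\\0&1\end{pmatrix}$; put $R=ST^{-1}$, $\rho=e^{\pi i/q}$, and $v_k=R^k(\infty)$, so that $0=v_1<v_2<\dots<v_q=\infty$. *Tessellation.* Even lines, even edges and odd edges are the $G_q$-translates of the geodesics $(0,\infty)$, $(\sqrt{-1},\infty)$ and $(\rho,\infty)$; even and odd vertices are the translates of $\sqrt{-1}$ and $\rho$. Let $\Phi$ be the hyperbolic triangle with vertices $0,\rho,\infty$. For $r\mid q$, $1\le r<q$, an $r$-cluster is a $G_q$-translate of $\Phi_r=\Phi\cup R\Phi\cup\dots\cup R^{r-1}\Phi$; a $q$-gon is a $G_q$-translate of $\Phi\cup R\Phi\cup\dots\cup R^{q-1}\Phi$. Clusters and $q$-gons are called tiles. The cusps of $g\Phi_r$ are $gv_1,\dots,gv_r,gv_q$, and those of the $q$-gon are $gv_1,\dots,gv_q$. *Special polygons.* A special polygon is a pair $(P,I)$, where $P$ is a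 hyperbolically convex union of finitely many tiles, any two of which are disjoint in the upper half plane or meet there in an even line, such that $0$ and $\infty$ are cusps of $P$, and $I\subset G_q$ is a set of side pairings of $P$, taken up to inversion (so $I=I^{-1}$), subject to the following rules. Each $\gamma\in I$ maps some side to a different side, with $\gamma(P)$ and $P$ having disjoint interiors, and each side is mapped to a different side by exactly one element of $I$. The sides are: - the odd edges in $\partial P$ (odd sides); each is paired with the other odd edge of the same $r$-cluster of $P$, with which it makes the internal angle $2r\pi/q$ at an odd vertex of $P$; - for each even line in $\partial P$, either its two even edges (even sides, meeting at an even vertex of $P$), which are then paired with each other, or the whole line (a free side), which is then paired with another free side. *Hecke–Farey symbols.* The fraction $a/b$ is in reduced form if $b\ge 0$ and $(a,b)^{t}$ is the first column of a matrix representing an element of $G_q$. A Hecke–Farey sequence is a finite sequence $-\infty=x_{-1}<x_0<\dots<x_n<x_{n+1}=\infty$ with $x_i\in\mathbb Q(\lambda_q)$ for $0\le i\le n$, some $x_i=0$, and $x_i=a_i/b_i$ in reduced form for all $i$ (with $x_{-1}=-1/0$, $x_{n+1}=1/0$), such that, for every interval $\{x_i,x_{i+1}\}$, either $a_{i+1}b_i-a_ib_{i+1}=1$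 (an ordinary interval) or there are $r\mid q$, $1<r<q$, and $g\in G_q$ with $g(v_r)=x_i$, $g(v_q)=x_{i+1}$ (an $r$-interval). A Hecke–Farey symbol is a Hecke–Farey sequence with a side pairing on each interval, at least two of these side pairings being distinct (a pairing and its inverse counting as the same one). Put $A_i=\begin{pmatrix}a_{i+1}&a_i\\b_{i+1}&b_i\end{pmatrix}$. An $r$-interval carries $gR^rg^{-1}$ (symbol $e_r(g)$). An ordinary interval is either even (symbol $\circ$, side pairing $A_iSA_i^{-1}$), or odd (symbol $\bullet$, side pairing $A_iRA_i^{-1}$), or free, that is, paired with exactly one other free interval $\{x_j,x_{j+1}\}$, with side pairing $\begin{pmatrix}a_j&-a_{j+1}\\b_j&-b_{j+1}\end{pmatrix}A_i^{-1}$ or its inverse. **Proposition.** There is a one-to-one correspondence (bijection) between the set of special polygons and the set of Hecke–Farey symbols. Under it, a special polygon $(P,I)$ corresponds to a symbol $F$ if and only if the cusps of $P$ are the points of the sequence of $F$ (with $\pm\infty$ identified), the odd vertices of $P$ are the points $g(\rho)$ and $A_i(\rho)$ given by the symbols $e_r(g)$ and $\bullet$ of $F$, the even vertices of $P$ are the points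 $A_i(\sqrt{-1})$ given by the symbols $\circ$ of $F$, and $I$ is the set of side pairings of $F$ together with their inverses. -/

import Mathlib

open scoped MatrixGroups Pointwise UpperHalfPlane

namespace HeckeFarey

/-! ### The group `PSL(2, ℝ)` acting on the upper half plane and on its boundary -/

theorem center_smul_upperHalfPlane (g : SL(2, ℝ)) (hg : g ∈ Subgroup.center SL(2, ℝ)) (z : ℍ) :
    g • z = z := by
  obtain ⟨r, hr, h⟩ := Matrix.SpecialLinearGroup.mem_center_iff.1 hg
  have hr0 : (r : ℂ) ≠ 0 := by
    rintro h0
    have : r = 0 := by exact_mod_cast h0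
    simp [this] at hr
  have h00 : g 0 0 = r := by rw [← h]; simp
  have h01 : g 0 1 = 0 := by rw [← h]; simp
  have h10 : g 1 0 = 0 := by rw [← h]; simp
  have h11 : g 1 1 = r := by rw [← h]; simp
  apply UpperHalfPlane.ext
  rw [UpperHalfPlane.coe_specialLinearGroup_apply]
  simp [h00, h01, h10, h11, hr0]

theorem center_smul_onePoint (g : SL(2, ℝ)) (hg : g ∈ Subgroup.center SL(2, ℝ))
    (c : OnePoint ℝ) : (g : GL (Fin 2) ℝ) • c = c := by
  obtain ⟨r, hr, h⟩ := Matrix.SpecialLinearGroup.mem_center_iff.1 hg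
  have hr0 : r ≠ 0 := by
    rintro rfl
    simp at hr
  have h00 : g 0 0 = r := by rw [← h]; simp
  have h01 : g 0 1 = 0 := by rw [← h]; simp
  have h10 : g 1 0 = 0 := by rw [← h]; simp
  have h11 : g 1 1 = r := by rw [← h]; simp
  cases c with
  | infty => rw [OnePoint.smul_infty_eq_ite]; simp [h10]
  | coe c => rw [OnePoint.smul_some_eq_ite]; simp [h00, h01, h10, h11, hr0]

/-- The action of `PSL(2, ℝ)` on the upper half plane by Möbius transformations. -/
noncomputable instance : MulAction PSL(2, ℝ) ℍ :=
  MulAction.compHom ℍ <|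
    QuotientGroup.lift (Subgroup.center SL(2, ℝ)) (MulAction.toPermHom SL(2, ℝ) ℍ)
      (fun g hg => Equiv.ext fun z => center_smul_upperHalfPlane g hg z)

/-- The action of `PSL(2, ℝ)` on `ℝ ∪ {∞}` by Möbius transformations. -/
noncomputable instance : MulAction PSL(2, ℝ) (OnePoint ℝ) :=
  MulAction.compHom (OnePoint ℝ) <|
    QuotientGroup.lift (Subgroup.center SL(2, ℝ))
      ((MulAction.toPermHom (GL (Fin 2) ℝ) (OnePoint ℝ)).comp
        Matrix.SpecialLinearGroup.toGL)
      (fun g hg => Equiv.ext fun c => center_smul_onePoint g hg c)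

theorem mk_smul_upperHalfPlane (g : SL(2, ℝ)) (z : ℍ) : (g : PSL(2, ℝ)) • z = g • z := rfl

theorem mk_smul_onePoint (g : SL(2, ℝ)) (c : OnePoint ℝ) :
    (g : PSL(2, ℝ)) • c = (g : GL (Fin 2) ℝ) • c := rfl

/-! ### The Hecke group -/

/-- `λ_q = 2 cos (π / q)`. -/
noncomputable def lam (q : ℕ) : ℝ := 2 * Real.cos (Real.pi / q)

/-- The matrix of `S : z ↦ -1 / z`. -/
def matS : SL(2, ℝ) := ⟨!![0, 1; -1, 0], by simp [Matrix.det_fin_two]⟩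

/-- The matrix of `T : z ↦ z + λ_q`. -/
noncomputable def matT (q : ℕ) : SL(2, ℝ) := ⟨!![1, lam q; 0, 1], by simp [Matrix.det_fin_two]⟩

/-- The matrix of `R = S T⁻¹`, the counterclockwise rotation of angle `2π / q` about
`exp (π i / q)`. -/
noncomputable def matR (q : ℕ) : SL(2, ℝ) := matS * (matT q)⁻¹

/-- `S` in `PSL(2, ℝ)`. -/
def S : PSL(2, ℝ) := (matS : PSL(2, ℝ))

/-- `R = S T⁻¹` in `PSL(2, ℝ)`. -/
noncomputable def R (q : ℕ) : PSL(2, ℝ) := (matR q : PSL(2, ℝ))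

/-- The (inhomogeneous) Hecke group `G_q`, generated by `S` and `T` in `PSL(2, ℝ)`. -/
noncomputable def heckeGroup (q : ℕ) : Subgroup PSL(2, ℝ) :=
  Subgroup.closure {S, (matT q : PSL(2, ℝ))}

/-! ### Edges, special triangles, clusters and `q`-gons

All subsets are taken in the upper half plane `ℍ`; cusps are points of `OnePoint ℝ = ℝ ∪ {∞}`. -/

/-- The even line `(0, ∞)`. -/
def baseLine : Set ℍ := {z | z.re = 0}

/-- The even edge joining `i` to `∞`. -/
def baseEvenEdge : Set ℍ := {z | z.re = 0 ∧ 1 ≤ z.im}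

/-- The odd edge joining `exp (π i / q)` to `∞`. -/
def baseOddEdge (q : ℕ) : Set ℍ :=
  {z | z.re = Real.cos (Real.pi / q) ∧ Real.sin (Real.pi / q) ≤ z.im}

/-- The hyperbolic triangle `Φ` with vertices `0`, `exp (π i / q)` and `∞`: it is bounded by the
geodesics `(0, ∞)`, `(exp (π i / q), ∞)` and `(0, exp (π i / q))`, which lie on `Re z = 0`,
`2 Re z = λ_q` and `λ_q |z|² = 2 Re z`. -/
def triangle (q : ℕ) : Set ℍ :=
  {z | 0 ≤ z.re ∧ 2 * z.re ≤ lam q ∧ 2 * z.re ≤ lam q * (z.re ^ 2 + z.im ^ 2)}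

/-- `Φ ∪ R Φ ∪ ⋯ ∪ R^(r-1) Φ`. For `r ∣ q`, `1 ≤ r < q`, this is `Φ_r`; for `r = q` it is the ideal
`q`-gon of depth one in the right half plane (the `q` triangles going once around
`exp (π i / q)`). -/
def fan (q r : ℕ) : Set ℍ := ⋃ k ∈ Finset.range r, (R q ^ k) • triangle q

/-- The cusps `0 = v_1 < v_2 < ⋯ < v_q = ∞` of the depth one `q`-gon in the right half plane:
`R` rotates this `q`-gon counterclockwise, `∞ ↦ 0 = v_1 ↦ v_2 ↦ ⋯ ↦ v_q = ∞`. -/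
noncomputable def baseCusp (q k : ℕ) : OnePoint ℝ := (R q ^ k) • OnePoint.infty

/-- Even lines of the tessellation. -/
def IsEvenLine (q : ℕ) (s : Set ℍ) : Prop := ∃ g ∈ heckeGroup q, s = g • baseLine

/-- Odd edges of the tessellation. -/
def IsOddEdge (q : ℕ) (s : Set ℍ) : Prop := ∃ g ∈ heckeGroup q, s = g • baseOddEdge q

/-- `z` is an even vertex of the tessellation: a translate of `i`. -/
def IsEvenVertex (q : ℕ) (z : ℍ) : Prop :=
  ∃ g ∈ heckeGroup q, ∃ w : ℍ, (w : ℂ) = Complex.I ∧ z = g • w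

/-- `w` is the point `exp (π i / q)`. -/
def IsBaseOddVertex (q : ℕ) (w : ℍ) : Prop := (w : ℂ) = Complex.exp (Real.pi * Complex.I / q)

/-- `z` is an odd vertex of the tessellation: a translate of `exp (π i / q)`. -/
def IsOddVertex (q : ℕ) (z : ℍ) : Prop :=
  ∃ g ∈ heckeGroup q, ∃ w : ℍ, IsBaseOddVertex q w ∧ z = g • w

/-- The ideal `q`-gons of the tessellation by even lines. -/
def IsQGon (q : ℕ) (t : Set ℍ) : Prop := ∃ g ∈ heckeGroup q, t = g • fan q q

/-- The `r`-clusters (`r ∣ q`, `1 ≤ r < q`). -/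
def IsCluster (q r : ℕ) (t : Set ℍ) : Prop :=
  r ∣ q ∧ 1 ≤ r ∧ r < q ∧ ∃ g ∈ heckeGroup q, t = g • fan q r

/-- A tile is a `q`-gon or a cluster. -/
def IsTile (q : ℕ) (t : Set ℍ) : Prop := IsQGon q t ∨ ∃ r, IsCluster q r t

/-- Hyperbolic convexity: with two points, the set contains the geodesic segment joining them. -/
def IsHypConvex (P : Set ℍ) : Prop :=
  ∀ z ∈ P, ∀ w ∈ P, ∀ p : ℍ, dist z p + dist p w = dist z w → p ∈ P

/-- Convex hyperbolic polygons: convex unions of finitely many tiles, two different tiles meeting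
in `ℍ` (if at all) in an even line. -/
def IsConvexPolygon (q : ℕ) (P : Set ℍ) : Prop :=
  IsHypConvex P ∧ ∃ tiles : Set (Set ℍ), tiles.Finite ∧ (∀ t ∈ tiles, IsTile q t) ∧
    (∀ t ∈ tiles, ∀ t' ∈ tiles, t ≠ t' → t ∩ t' = ∅ ∨ IsEvenLine q (t ∩ t')) ∧
    P = ⋃₀ tiles

/-- `c` is a cusp of `P`: an ideal vertex of one of the special triangles (the translates of `Φ`)
of which `P` consists. -/
def IsCuspOf (q : ℕ) (P : Set ℍ) (c : OnePoint ℝ) : Prop :=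
  ∃ g ∈ heckeGroup q, g • triangle q ⊆ P ∧
    (c = g • ((0 : ℝ) : OnePoint ℝ) ∨ c = g • OnePoint.infty)

/-! ### Special polygons -/

/-- Odd sides: the odd edges in the boundary of `P`. -/
def IsOddSide (q : ℕ) (P : Set ℍ) (s : Set ℍ) : Prop := IsOddEdge q s ∧ s ⊆ frontier P

/-- The even line `g (0, ∞)` lies in the boundary of `P` and `I` contains an element which maps
its even edge `g (i, ∞)` to its other even edge `g (i, 0) = g S (i, ∞)`. -/
def IsFoldedLine (P : Set ℍ) (I : Set PSL(2, ℝ)) (g : PSL(2, ℝ)) : Prop :=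
  g • baseLine ⊆ frontier P ∧ ∃ γ ∈ I, γ • (g • baseEvenEdge) = (g * S) • baseEvenEdge

/-- Even sides: the even edges whose even line lies in the boundary of `P` and which are paired
with the other even edge of that line. -/
def IsEvenSide (q : ℕ) (P : Set ℍ) (I : Set PSL(2, ℝ)) (s : Set ℍ) : Prop :=
  ∃ g ∈ heckeGroup q, IsFoldedLine P I g ∧ s = g • baseEvenEdge

/-- Free sides: the even lines in the boundary of `P` whose two even edges are not paired with
each other. -/
def IsFreeSide (q : ℕ) (P : Set ℍ) (I : Set PSL(2, ℝ)) (s : Set ℍ) : Prop :=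
  ∃ g ∈ heckeGroup q, s = g • baseLine ∧ s ⊆ frontier P ∧ ¬ IsFoldedLine P I g

/-- The sides of `(P, I)`. -/
def IsSide (q : ℕ) (P : Set ℍ) (I : Set PSL(2, ℝ)) (s : Set ℍ) : Prop :=
  IsOddSide q P s ∨ IsEvenSide q P I s ∨ IsFreeSide q P I s

/-- A special polygon `(P, I)`. The side pairings are taken up to inversion, that is, `I` contains
with a pairing from `s` to `t` its inverse, the pairing from `t` to `s`. -/
@[ext]
structure SpecialPolygon (q : ℕ) where
  /-- the polygon -/
  P : Set ℍ
  /-- the side pairings -/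
  I : Set PSL(2, ℝ)
  convexPolygon : IsConvexPolygon q P
  /-- side pairings are elements of `G_q` -/
  mem_heckeGroup : ∀ γ ∈ I, γ ∈ heckeGroup q
  inv_mem : ∀ γ ∈ I, γ⁻¹ ∈ I
  /-- a side pairing maps `P` to the other side of the image side -/
  disjoint_interior : ∀ γ ∈ I, Disjoint (γ • interior P) (interior P)
  /-- every element of `I` maps some side to another side -/
  pairs : ∀ γ ∈ I, ∃ s, IsSide q P I s ∧ IsSide q P I (γ • s) ∧ γ • s ≠ s
  /-- every side is mapped to another side by exactly one element of `I` -/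
  paired : ∀ s, IsSide q P I s → ∃! γ, γ ∈ I ∧ IsSide q P I (γ • s) ∧ γ • s ≠ s
  /-- an odd side is paired with the other odd side of the same `r`-cluster `g Φ_r`; the two odd
  edges `g (y, ∞)`, `g R^r (y, ∞)`, with `y = exp (π i / q)`, meet in the odd vertex `g y` with
  internal angle `2 r π / q` -/
  odd_paired : ∀ s, IsOddSide q P s → ∃ t, IsOddSide q P t ∧ t ≠ s ∧ (∃ γ ∈ I, γ • s = t) ∧
    ∃ g ∈ heckeGroup q, ∃ r, r ∣ q ∧ 1 ≤ r ∧ r < q ∧ g • fan q r ⊆ P ∧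
      ({s, t} : Set (Set ℍ)) = {g • baseOddEdge q, (g * R q ^ r) • baseOddEdge q}
  /-- a free side is paired with another free side (an even line in the boundary which is not a
  free side consists of two even sides paired with each other, by definition) -/
  free_paired : ∀ s, IsFreeSide q P I s → ∃ t, IsFreeSide q P I t ∧ t ≠ s ∧ ∃ γ ∈ I, γ • s = t
  zero_cusp : IsCuspOf q P ((0 : ℝ) : OnePoint ℝ)
  infty_cusp : IsCuspOf q P OnePoint.infty

namespace SpecialPolygon

variable {q : ℕ} (M : SpecialPolygon q)

/-- The free vertices (cusps) of a special polygon. -/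
def freeVertices : Set (OnePoint ℝ) := {c | IsCuspOf q M.P c}

/-- The odd vertices of a special polygon: the odd vertices of the tessellation at the end of its
odd sides. -/
def oddVertices : Set ℍ := {z | IsOddVertex q z ∧ ∃ s, IsOddSide q M.P s ∧ z ∈ s}

/-- The even vertices of a special polygon: the even vertices of the tessellation at the end of its
even sides. -/
def evenVertices : Set ℍ := {z | IsEvenVertex q z ∧ ∃ s, IsEvenSide q M.P M.I s ∧ z ∈ s}

end SpecialPolygon

/-! ### Hecke-Farey sequences and symbols -/

/-- `a / b` is in reduced form: `b ≥ 0` and `a`, `b` is the first column of (a matrix of) an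
element of `G_q`. -/
def IsReduced (q : ℕ) (a b : ℝ) : Prop :=
  0 ≤ b ∧ ∃ g : SL(2, ℝ), (g : PSL(2, ℝ)) ∈ heckeGroup q ∧ g 0 0 = a ∧ g 1 0 = b

/-- The point `a / b` of `ℝ ∪ {∞}`, with `a / 0 = ∞`. -/
noncomputable def toPoint (a b : ℝ) : OnePoint ℝ :=
  if b = 0 then OnePoint.infty else ((a / b : ℝ) : OnePoint ℝ)

/-- The interval from `a / b` to `a' / b'` is an `r`-interval with `g ∈ G_q`: `r ∣ q`, `1 < r < q`,
`g v_r = a / b` and `g v_q = a' / b'`. -/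
def IsClusterInterval (q : ℕ) (a b a' b' : ℝ) (r : ℕ) (g : PSL(2, ℝ)) : Prop :=
  r ∣ q ∧ 1 < r ∧ r < q ∧ g ∈ heckeGroup q ∧
    g • baseCusp q r = toPoint a b ∧ g • baseCusp q q = toPoint a' b'

/-- A Hecke-Farey sequence `-∞ = x_{-1} < x_0 < ⋯ < x_n < x_{n+1} = ∞`, given by the reduced forms
of its terms. Indices are shifted by one: `num j / den j` is the reduced form of `x_{j-1}`. -/
structure HeckeFareySequence (q : ℕ) where
  /-- the number of finite terms, minus one -/
  n : ℕ
  /-- numerators of the reduced forms -/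
  num : Fin (n + 3) → ℝ
  /-- denominators of the reduced forms -/
  den : Fin (n + 3) → ℝ
  num_first : num 0 = -1
  den_first : den 0 = 0
  num_last : num (Fin.last (n + 2)) = 1
  den_last : den (Fin.last (n + 2)) = 0
  den_pos : ∀ j, 0 < j → j < Fin.last (n + 2) → 0 < den j
  reduced : ∀ j, IsReduced q (num j) (den j)
  mem_field : ∀ j, num j / den j ∈ IntermediateField.adjoin ℚ {lam q}
  increasing : ∀ i j, 0 < i → i < j → j < Fin.last (n + 2) → num i / den i < num j / den j
  zero_mem : ∃ j, 0 < j ∧ j < Fin.last (n + 2) ∧ num j / den j = 0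
  cluster : ∀ i : Fin (n + 2), num i.succ * den i.castSucc - num i.castSucc * den i.succ ≠ 1 →
    ∃ r g, IsClusterInterval q (num i.castSucc) (den i.castSucc) (num i.succ) (den i.succ) r g

/-- The possible decorations of the `m` intervals of a Hecke-Farey sequence: `e_r(g)`, `∘`, `•`, or
a free interval paired with the `j`-th interval (only the pairing induced by the natural number
labels of the free intervals matters). -/
inductive IntervalLabel (m : ℕ) where
  | cluster : IntervalLabel m
  | even : IntervalLabel m
  | odd : IntervalLabel m
  | free (j : Fin m) : IntervalLabel m

namespace HeckeFareySequence

variable {q : ℕ} (F : HeckeFareySequence q)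

/-- The `j`-th term, as a point of `ℝ ∪ {∞}`. -/
noncomputable def point (j : Fin (F.n + 3)) : OnePoint ℝ := toPoint (F.num j) (F.den j)

/-- The `i`-th interval is an ordinary interval. -/
def IsOrdinary (i : Fin (F.n + 2)) : Prop :=
  F.num i.succ * F.den i.castSucc - F.num i.castSucc * F.den i.succ = 1

/-- `A` is the matrix with columns the reduced forms of the right and the left end point of the
`i`-th interval (so `A` maps `0` to the left end point and `∞` to the right one). -/
def IsIntervalMatrix (i : Fin (F.n + 2)) (A : SL(2, ℝ)) : Prop :=
  (A : Matrix (Fin 2) (Fin 2) ℝ) =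
    !![F.num i.succ, F.num i.castSucc; F.den i.succ, F.den i.castSucc]

/-- The `i`-th interval is an `r`-interval, with `g`. -/
def IsRInterval (i : Fin (F.n + 2)) (r : ℕ) (g : PSL(2, ℝ)) : Prop :=
  IsClusterInterval q (F.num i.castSucc) (F.den i.castSucc) (F.num i.succ) (F.den i.succ) r g

/-- `γ` is the side pairing carried by the `i`-th interval when its decoration is `l`. For a free
interval `i` paired with `j` this is the element that maps the even line of `i` to the even line
of `j`, reversing the order of the end points; its inverse belongs to the decoration of `j`. -/
def IsPairing (i : Fin (F.n + 2)) (l : IntervalLabel (F.n + 2)) (γ : PSL(2, ℝ)) : Prop :=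
  match l with
  | .cluster => ∃ r g, F.IsRInterval i r g ∧ γ = g * R q ^ r * g⁻¹
  | .even => ∃ A : SL(2, ℝ), F.IsIntervalMatrix i A ∧ γ = (A * matS * A⁻¹ : SL(2, ℝ))
  | .odd => ∃ A : SL(2, ℝ), F.IsIntervalMatrix i A ∧ γ = (A * matR q * A⁻¹ : SL(2, ℝ))
  | .free j => ∃ A B : SL(2, ℝ), F.IsIntervalMatrix i A ∧
      (B : Matrix (Fin 2) (Fin 2) ℝ) =
        !![F.num j.castSucc, -F.num j.succ; F.den j.castSucc, -F.den j.succ] ∧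
      γ = (B * A⁻¹ : SL(2, ℝ))

end HeckeFareySequence

/-- A Hecke-Farey symbol: a Hecke-Farey sequence with a side pairing on each interval. The
intervals that are not ordinary carry `e_r(g)`, the ordinary ones `∘`, `•` or are paired freely
with another one, and there are at least two distinct side pairings (a pairing and its inverse
being the same). -/
structure HeckeFareySymbol (q : ℕ) extends HeckeFareySequence q where
  label : Fin (n + 2) → IntervalLabel (n + 2)
  cluster_iff : ∀ i, label i = .cluster ↔ ¬ toHeckeFareySequence.IsOrdinary i
  free_symm : ∀ i j, label i = .free j → i ≠ j ∧ label j = .free i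
  two_pairings : ∃ i j γ δ, toHeckeFareySequence.IsPairing i (label i) γ ∧
    toHeckeFareySequence.IsPairing j (label j) δ ∧ γ ≠ δ ∧ γ ≠ δ⁻¹

namespace HeckeFareySymbol

variable {q : ℕ} (F : HeckeFareySymbol q)

/-- The points of the sequence, `±∞` being the same point. -/
def points : Set (OnePoint ℝ) := Set.range F.point

/-- The odd vertices described by the symbol: `g (exp (π i / q))` for `e_r(g)` and
`A (exp (π i / q))` for `•`. -/
def oddVertices : Set ℍ :=
  {z | ∃ i, ∃ w : ℍ, IsBaseOddVertex q w ∧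
    ((F.label i = .cluster ∧ ∃ r g, F.IsRInterval i r g ∧ z = g • w) ∨
      (F.label i = .odd ∧ ∃ A : SL(2, ℝ), F.IsIntervalMatrix i A ∧ z = A • w))}

/-- The even vertices described by the symbol: `A (i)` for `∘`. -/
def evenVertices : Set ℍ :=
  {z | ∃ i, ∃ w : ℍ, (w : ℂ) = Complex.I ∧
    F.label i = .even ∧ ∃ A : SL(2, ℝ), F.IsIntervalMatrix i A ∧ z = A • w}

/-- The side pairings of the symbol and their inverses. -/
def pairings : Set PSL(2, ℝ) :=
  {γ | ∃ i, F.IsPairing i (F.label i) γ ∨ F.IsPairing i (F.label i) γ⁻¹}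

end HeckeFareySymbol

/-- The special polygon `M` and the Hecke-Farey symbol `F` correspond to each other: the free
vertices of `M` are the points of the sequence, its odd vertices are those where `e_r(g)` or `•`
occurs, its even vertices are those where `∘` occurs, and its side pairings are those of `F`. -/
def Corresponds {q : ℕ} (M : SpecialPolygon q) (F : HeckeFareySymbol q) : Prop :=
  M.freeVertices = F.points ∧ M.oddVertices = F.oddVertices ∧
    M.evenVertices = F.evenVertices ∧ M.I = F.pairings

end HeckeFarey

/-!
Both a special polygon and a Hecke-Farey symbol are described by a finite set `𝒢` of elements of the
Hecke group, the elements `g` for which the triangle `g Φ` belongs to the polygon, together with the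
side pairings. The proof translates each of the two notions into this combinatorial language.

*The group.* The `q`-gons of the tessellation form a tree: an element of `G_q` other than a power of
`R` maps the `q`-gon around `exp (π i / q)` beyond one of its sides (`R_pow_or_beyond`). Hence `g Φ` lies
on one side of `(0, ∞)` for every `g ∈ G_q`; the predicate `Pos` tells on which, and the rules for
`Pos` under multiplication by `S` and `R` give a ping-pong calculus with the sets `beyond g r` of
triangles cut off by an even line (`r = 0`) or by an `r`-cluster (`r ≥ 1`). That the entries of a
matrix in `G_q` vanish or have absolute value at least one makes reduced forms unique.

*The polygons.* A convex union of finitely many tiles is the same as a finite set `𝒢` which is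
`IsTriangulated`: every `q`-gon meets it in nothing, in a cluster or in everything, and `𝒢` is convex
in the tree (`isTriangulated_of_isConvexPolygon`, `IsTriangulated.isConvexPolygon`). Such a set is
bounded by pieces `IsPiece 𝒢 g r`, its even boundary lines and its clusters, and its complement is the
disjoint union of the sets `beyond g r` (`IsTriangulated.exists_piece`). On the boundary circle, the
arcs of the pieces are the gaps between the cusps (`IsTriangulated.exists_inArc`); so the pieces are
enumerated by the intervals of the increasing sequence of the cusps
(`IsTriangulated.exists_enumeration`).

*The symbols.* Conversely, each interval of a symbol cuts off a set `beyond g r`; these sets are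
disjoint, since they lie over disjoint intervals of the real line, and what remains is a triangulated
set `region` with the given boundary pieces (`isMatch_region`). The side pairings of the symbol pair the
sides of the region in the required way: a pairing `γ` has a source, a piece beyond which `γ⁻¹ 𝒢` lies
(`IsMatch.exists_source`), and this piece determines `γ` up to inversion.

*The correspondence.* A polygon and a symbol correspond to each other if and only if they have the same
pieces and the same pairings (`corresponds_iff`). For this it remains to be seen that points, vertices
and pairings determine the symbol (`eq_of_data`). The points determine the sequence. The odd and even
vertices determine the decorations; here two intervals of rank one with a common rotation centre
coincide, and an even vertex belongs to two intervals only if both half planes along its line are cut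
off, which the requirement of two distinct side pairings excludes.
-/
namespace HeckeFarey

/-! ### Sines and powers of `R` -/

/-- `sn q x = sin (x π / q) / sin (π / q)`; the entries of the powers of `R` are of this form. -/
noncomputable def sn (q : ℕ) (x : ℝ) : ℝ := Real.sin (x * (Real.pi / q)) / Real.sin (Real.pi / q)

section
variable {q : ℕ}

theorem theta_pos (hq : 3 ≤ q) : 0 < Real.pi / q := by
  have : (0 : ℝ) < q := by exact_mod_cast (by omega : 0 < q)
  positivity

theorem q_mul_theta (hq : 3 ≤ q) : (q : ℝ) * (Real.pi / q) = Real.pi := by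
  have : (q : ℝ) ≠ 0 := by exact_mod_cast (by omega : q ≠ 0)
  field_simp

theorem three_theta_le (hq : 3 ≤ q) : 3 * (Real.pi / q) ≤ Real.pi := by
  have h := q_mul_theta hq
  have h3 : (3 : ℝ) ≤ q := by exact_mod_cast hq
  nlinarith [theta_pos hq]

theorem sin_theta_pos (hq : 3 ≤ q) : 0 < Real.sin (Real.pi / q) :=
  Real.sin_pos_of_pos_of_lt_pi (theta_pos hq) (by linarith [three_theta_le hq, theta_pos hq])

theorem one_le_lam (hq : 3 ≤ q) : 1 ≤ lam q := by
  have h : Real.cos (Real.pi / 3) ≤ Real.cos (Real.pi / q) :=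
    Real.cos_le_cos_of_nonneg_of_le_pi (theta_pos hq).le (by linarith [Real.pi_pos])
      (by linarith [three_theta_le hq])
  rw [Real.cos_pi_div_three] at h
  unfold lam; linarith

theorem lam_lt_two (hq : 3 ≤ q) : lam q < 2 := by
  have h : Real.cos (Real.pi / q) < Real.cos 0 :=
    Real.cos_lt_cos_of_nonneg_of_le_pi le_rfl (by linarith [three_theta_le hq, theta_pos hq])
      (theta_pos hq)
  rw [Real.cos_zero] at h
  unfold lam; linarith

theorem sn_zero : sn q 0 = 0 := by simp [sn]

theorem sn_one (hq : 3 ≤ q) : sn q 1 = 1 := by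
  simp [sn, (sin_theta_pos hq).ne']

theorem sn_self (hq : 3 ≤ q) : sn q q = 0 := by
  rw [sn, q_mul_theta hq]; simp

theorem sn_neg (x : ℝ) : sn q (-x) = - sn q x := by
  simp [sn, neg_mul, Real.sin_neg, neg_div]

theorem sn_add_one (x : ℝ) : sn q (x + 1) = lam q * sn q x - sn q (x - 1) := by
  have : Real.sin ((x + 1) * (Real.pi / q)) =
      lam q * Real.sin (x * (Real.pi / q)) - Real.sin ((x - 1) * (Real.pi / q)) := by
    rw [add_mul, sub_mul, one_mul, Real.sin_add, Real.sin_sub, lam]; ring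
  simp only [sn, this]; ring

theorem sn_sub_self (hq : 3 ≤ q) (x : ℝ) : sn q (q - x) = sn q x := by
  rw [sn, sub_mul, q_mul_theta hq, Real.sin_pi_sub, sn]

theorem sn_det (hq : 3 ≤ q) (x : ℝ) : sn q x * sn q x - sn q (x - 1) * sn q (x + 1) = 1 := by
  have h := (sin_theta_pos hq).ne'
  have h1 := Real.sin_sq_add_cos_sq (Real.pi / q)
  have h2 := Real.sin_sq_add_cos_sq (x * (Real.pi / q))
  simp only [sn]
  rw [add_mul, sub_mul, one_mul, Real.sin_add, Real.sin_sub]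
  generalize Real.sin (x * (Real.pi / q)) = c at *
  generalize Real.cos (x * (Real.pi / q)) = d at *
  generalize Real.sin (Real.pi / q) = a at *
  generalize Real.cos (Real.pi / q) = b at *
  field_simp
  linear_combination (-c ^ 2) * h1 + a ^ 2 * h2

theorem one_le_sn (hq : 3 ≤ q) {x : ℝ} (h1 : 1 ≤ x) (h2 : x ≤ q - 1) : 1 ≤ sn q x := by
  have hs := sin_theta_pos hq
  rw [sn, le_div_iff₀ hs, one_mul]
  have ht := theta_pos hq
  have hqt := q_mul_theta hq
  set t := Real.pi / q
  by_cases hx : x * t ≤ Real.pi / 2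
  · apply Real.sin_le_sin_of_le_of_le_pi_div_two _ hx (by nlinarith)
    linarith [Real.pi_pos]
  · rw [← Real.sin_pi_sub (x * t)]
    apply Real.sin_le_sin_of_le_of_le_pi_div_two
    · linarith [Real.pi_pos]
    · linarith
    · nlinarith

theorem sn_pos (hq : 3 ≤ q) {x : ℝ} (h1 : 0 < x) (h2 : x < q) : 0 < sn q x := by
  have ht := theta_pos hq
  have hqt := q_mul_theta hq
  refine div_pos (Real.sin_pos_of_pos_of_lt_pi (by positivity) ?_) (sin_theta_pos hq)
  nlinarith

theorem sn_two (hq : 3 ≤ q) : sn q 2 = lam q := by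
  have := sn_add_one (q := q) 1
  norm_num [sn_one hq, sn_zero] at this
  exact this

theorem sl_mul_apply (A B : SL(2, ℝ)) (i j : Fin 2) :
    (A * B) i j = A i 0 * B 0 j + A i 1 * B 1 j := by
  rw [Matrix.SpecialLinearGroup.coe_mul, Matrix.mul_apply, Fin.sum_univ_two]

theorem matS_coe : (matS : Matrix (Fin 2) (Fin 2) ℝ) = !![0, 1; -1, 0] := rfl

theorem matT_coe : (matT q : Matrix (Fin 2) (Fin 2) ℝ) = !![1, lam q; 0, 1] := rfl

theorem sl_ext_iff {A B : SL(2, ℝ)} : A = B ↔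
    A 0 0 = B 0 0 ∧ A 0 1 = B 0 1 ∧ A 1 0 = B 1 0 ∧ A 1 1 = B 1 1 := by
  constructor
  · rintro rfl; simp
  · rintro ⟨h1, h2, h3, h4⟩
    ext i j; fin_cases i <;> fin_cases j <;> assumption

theorem matR_coe : ((matR q : SL(2, ℝ)) : Matrix (Fin 2) (Fin 2) ℝ) = !![0, 1; -1, lam q] := by
  rw [matR, Matrix.SpecialLinearGroup.coe_mul, Matrix.SpecialLinearGroup.coe_inv, matS_coe,
    matT_coe, Matrix.adjugate_fin_two]
  simp

theorem matR_pow_coe (hq : 3 ≤ q) (k : ℕ) :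
    ((matR q ^ k : SL(2, ℝ)) : Matrix (Fin 2) (Fin 2) ℝ) =
      !![-sn q (k - 1), sn q k; -sn q k, sn q (k + 1)] := by
  induction k with
  | zero => simp [sn_zero, sn_neg, sn_one hq, Matrix.one_fin_two]
  | succ k ih =>
    rw [pow_succ', Matrix.SpecialLinearGroup.coe_mul, ih, matR_coe]
    have h1 := sn_add_one (q := q) k
    have h2 := sn_add_one (q := q) (k + 1)
    push_cast
    rw [add_sub_cancel_right] at h2 ⊢
    rw [h2]
    ext i j
    fin_cases i <;> fin_cases j <;> simp <;> linarith

theorem matR_pow_q (hq : 3 ≤ q) : matR q ^ q = -1 := by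
  apply Subtype.ext
  rw [matR_pow_coe hq]
  have h1 : sn q (q - 1) = 1 := by rw [sn_sub_self hq, sn_one hq]
  have h2 : sn q ((q : ℝ) + 1) = -1 := by
    rw [sn_add_one, sn_self hq, h1]; ring
  ext i j
  fin_cases i <;> fin_cases j <;> simp [h1, h2, sn_self hq]

/-! ### `PSL(2, ℝ)` -/

theorem psl_eq_iff (A B : SL(2, ℝ)) : (A : PSL(2, ℝ)) = B ↔ A = B ∨ A = -B := by
  rw [QuotientGroup.eq, Matrix.SpecialLinearGroup.mem_center_iff]
  constructor
  · rintro ⟨r, hr, h⟩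
    have hr2 : (r - 1) * (r + 1) = 0 := by
      have : r ^ 2 = 1 := by exact hr
      linarith
    have hB : B = A * (A⁻¹ * B) := by group
    rcases mul_eq_zero.1 hr2 with h1 | h1
    · left
      have : A⁻¹ * B = 1 := by
        apply Subtype.ext; rw [← h, show r = 1 by linarith]; simp
      rw [this] at hB; simp [hB]
    · right
      have : A⁻¹ * B = -1 := by
        apply Subtype.ext; rw [← h, show r = -1 by linarith]
        ext i j; fin_cases i <;> fin_cases j <;> simp
      rw [this] at hB; simp [hB]
  · rintro (h | h)
    · refine ⟨1, by simp, ?_⟩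
      rw [h]; simp
    · refine ⟨-1, by simp, ?_⟩
      rw [h]
      have : (-B)⁻¹ * B = -1 := by
        apply mul_left_cancel (a := -B); simp
      rw [this]
      ext i j; fin_cases i <;> fin_cases j <;> simp

theorem coe_mul_psl (A B : SL(2, ℝ)) : ((A * B : SL(2, ℝ)) : PSL(2, ℝ)) = A * B := rfl

theorem neg_one_psl : ((-1 : SL(2, ℝ)) : PSL(2, ℝ)) = 1 :=
  (psl_eq_iff (-1) 1).2 (Or.inr rfl)

theorem S_mul_S : S * S = 1 := by
  rw [S, ← coe_mul_psl, ← neg_one_psl]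
  congr 1
  simp [sl_ext_iff, sl_mul_apply, matS_coe]

theorem S_inv : S⁻¹ = S := inv_eq_of_mul_eq_one_left S_mul_S

theorem R_pow_coe (k : ℕ) : R q ^ k = ((matR q ^ k : SL(2, ℝ)) : PSL(2, ℝ)) := rfl

theorem R_pow_q (hq : 3 ≤ q) : R q ^ q = 1 := by
  rw [R_pow_coe, matR_pow_q hq, neg_one_psl]

theorem T_inv_eq : (matT q : PSL(2, ℝ))⁻¹ = S * R q := by
  have : R q = S * (matT q : PSL(2, ℝ))⁻¹ := rfl
  rw [this, ← mul_assoc, S_mul_S, one_mul]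

theorem T_eq : (matT q : PSL(2, ℝ)) = (R q)⁻¹ * S := by
  rw [← inv_inv (matT q : PSL(2, ℝ)), T_inv_eq, mul_inv_rev, S_inv]

theorem S_mem : S ∈ heckeGroup q := Subgroup.subset_closure (by simp)
theorem T_mem : (matT q : PSL(2, ℝ)) ∈ heckeGroup q := Subgroup.subset_closure (by simp)
theorem R_mem : R q ∈ heckeGroup q := (heckeGroup q).mul_mem S_mem ((heckeGroup q).inv_mem T_mem)

/-! ### Normal form -/

/-- The monoid generated by the elements `R ^ k * S`, `1 ≤ k < q`. -/
inductive IsPosWord (q : ℕ) : PSL(2, ℝ) → Prop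
  | one : IsPosWord q 1
  | cons (k : ℕ) (w : PSL(2, ℝ)) : 1 ≤ k → k < q → IsPosWord q w → IsPosWord q (R q ^ k * S * w)

/-- `g` is a positive word up to factors `S` on the left and on the right. -/
def HasNormalForm (q : ℕ) (g : PSL(2, ℝ)) : Prop :=
  ∃ w, IsPosWord q w ∧ (g = w ∨ g = S * w ∨ g = w * S ∨ g = S * w * S)

theorem HasNormalForm.S_mul {g : PSL(2, ℝ)} (h : HasNormalForm q g) : HasNormalForm q (S * g) := by
  obtain ⟨w, hw, h | h | h | h⟩ := h <;> refine ⟨w, hw, ?_⟩ <;> subst h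
  · simp
  · simp [← mul_assoc, S_mul_S]
  · simp [mul_assoc]
  · simp [← mul_assoc, S_mul_S]

theorem HasNormalForm.mul_S {g : PSL(2, ℝ)} (h : HasNormalForm q g) : HasNormalForm q (g * S) := by
  obtain ⟨w, hw, h | h | h | h⟩ := h <;> refine ⟨w, hw, ?_⟩ <;> subst h
  · simp
  · simp
  · simp [mul_assoc, S_mul_S]
  · simp [mul_assoc, S_mul_S]

theorem hasNormalForm_R_pow_mul (hq : 3 ≤ q) {w : PSL(2, ℝ)} (hw : IsPosWord q w) {j : ℕ}
    (hj : j < q) : HasNormalForm q (R q ^ j * w) := by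
  cases hw with
  | one =>
    rcases Nat.eq_zero_or_pos j with rfl | hj0
    · exact ⟨1, .one, by simp⟩
    · exact ⟨_, .cons j 1 hj0 hj .one, by simp [mul_assoc, S_mul_S]⟩
  | cons k w hk hkq hw =>
    have e : R q ^ j * (R q ^ k * S * w) = R q ^ (j + k) * S * w := by
      rw [pow_add]; group
    rw [e]
    rcases lt_trichotomy (j + k) q with h | h | h
    · exact ⟨_, .cons (j + k) w (by omega) h hw, by simp⟩
    · refine ⟨w, hw, ?_⟩
      rw [h, R_pow_q hq]; simp
    · refine ⟨_, .cons (j + k - q) w (by omega) (by omega) hw, ?_⟩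
      have : R q ^ (j + k) = R q ^ (j + k - q) := by
        conv_lhs => rw [show j + k = (j + k - q) + q by omega, pow_add, R_pow_q hq, mul_one]
      rw [this]; simp

theorem hasNormalForm_R_pow_mul' (hq : 3 ≤ q) {g : PSL(2, ℝ)} (hg : HasNormalForm q g) {j : ℕ}
    (hj : j < q) : HasNormalForm q (R q ^ j * g) := by
  obtain ⟨w, hw, h | h | h | h⟩ := hg
  · rw [h]; exact hasNormalForm_R_pow_mul hq hw hj
  · rcases Nat.eq_zero_or_pos j with rfl | hj0
    · refine ⟨w, hw, ?_⟩; simp [h]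
    · exact ⟨_, .cons j w hj0 hj hw, by simp [h, mul_assoc]⟩
  · rw [h, ← mul_assoc]; exact (hasNormalForm_R_pow_mul hq hw hj).mul_S
  · rcases Nat.eq_zero_or_pos j with rfl | hj0
    · refine ⟨w, hw, ?_⟩; simp [h]
    · refine ⟨_, .cons j w hj0 hj hw, ?_⟩
      simp [h, mul_assoc]

/-- The normal form of the free product of `⟨S⟩` and `⟨R⟩`. -/
theorem hasNormalForm (hq : 3 ≤ q) {g : PSL(2, ℝ)} (hg : g ∈ heckeGroup q) :
    HasNormalForm q g := by
  induction hg using Subgroup.closure_induction_left with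
  | one => exact ⟨1, .one, by simp⟩
  | mul_left x hx y hy ih =>
    rcases hx with rfl | hx
    · exact ih.S_mul
    · rw [Set.mem_singleton_iff.1 hx, T_eq, mul_assoc]
      have : (R q)⁻¹ = R q ^ (q - 1) := by
        apply inv_eq_of_mul_eq_one_left
        rw [← pow_succ, show q - 1 + 1 = q by omega, R_pow_q hq]
      rw [this]
      exact hasNormalForm_R_pow_mul' hq ih.S_mul (by omega)
  | inv_mul_cancel x hx y hy ih =>
    rcases hx with rfl | hx
    · rw [S_inv]; exact ih.S_mul
    · rw [Set.mem_singleton_iff.1 hx, T_inv_eq, mul_assoc]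
      have := hasNormalForm_R_pow_mul' hq ih (j := 1) (by omega)
      rw [pow_one] at this
      exact this.S_mul

/-! ### Entries of the matrices in the Hecke group -/

/-- `0`, or of absolute value at least one. -/
def IsBig (x : ℝ) : Prop := x = 0 ∨ 1 ≤ |x|

theorem isBig_neg {x : ℝ} : IsBig (-x) ↔ IsBig x := by simp [IsBig]

theorem exists_posMatrix (hq : 3 ≤ q) {w : PSL(2, ℝ)} (hw : IsPosWord q w) :
    ∃ M : SL(2, ℝ), (M : PSL(2, ℝ)) = w ∧ 1 ≤ M 0 0 ∧ 1 ≤ M 1 1 ∧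
      (M 0 1 = 0 ∨ 1 ≤ M 0 1) ∧ (M 1 0 = 0 ∨ 1 ≤ M 1 0) := by
  induction hw with
  | one => exact ⟨1, rfl, by simp⟩
  | cons k w hk hkq _ ih =>
    obtain ⟨M, rfl, h00, h11, h01, h10⟩ := ih
    refine ⟨-(matR q ^ k * matS * M), ?_, ?_⟩
    · have : ((-(matR q ^ k * matS * M) : SL(2, ℝ)) : PSL(2, ℝ)) =
        ((matR q ^ k * matS * M : SL(2, ℝ)) : PSL(2, ℝ)) := (psl_eq_iff _ _).2 (Or.inr rfl)
      rw [this]; rfl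
    · have hk1 : (1 : ℝ) ≤ k := by exact_mod_cast hk
      have hk2 : (k : ℝ) ≤ q - 1 := by
        have : (k : ℝ) + 1 ≤ q := by exact_mod_cast hkq
        linarith
      have s0 : 1 ≤ sn q k := one_le_sn hq hk1 hk2
      have sm : sn q (k - 1) = 0 ∨ 1 ≤ sn q (k - 1) := by
        rcases eq_or_lt_of_le hk with h | h
        · left; rw [← h]; simp [sn_zero]
        · right
          have : (2 : ℝ) ≤ k := by exact_mod_cast h
          exact one_le_sn hq (by linarith) (by linarith)
      have sp : sn q (k + 1) = 0 ∨ 1 ≤ sn q (k + 1) := by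
        rcases eq_or_lt_of_le (Nat.succ_le_of_lt hkq) with h | h
        · left
          have : (k : ℝ) + 1 = q := by exact_mod_cast h
          rw [this, sn_self hq]
        · right
          have : (k : ℝ) + 1 + 1 ≤ q := by exact_mod_cast h
          exact one_le_sn hq (by linarith) (by linarith)
      have e : ((-(matR q ^ k * matS * M) : SL(2, ℝ)) : Matrix (Fin 2) (Fin 2) ℝ) =
          !![sn q k * M 0 0 + sn q (k - 1) * M 1 0, sn q k * M 0 1 + sn q (k - 1) * M 1 1;
             sn q (k + 1) * M 0 0 + sn q k * M 1 0, sn q (k + 1) * M 0 1 + sn q k * M 1 1] := by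
        rw [Matrix.SpecialLinearGroup.coe_neg, Matrix.SpecialLinearGroup.coe_mul,
          Matrix.SpecialLinearGroup.coe_mul, matR_pow_coe hq]
        ext i j
        fin_cases i <;> fin_cases j <;>
          simp [matS_coe, Matrix.vecMul, dotProduct, Fin.sum_univ_two] <;> ring
      rw [e]
      simp only [Matrix.of_apply, Matrix.cons_val', Matrix.cons_val_zero, Matrix.cons_val_one,
        Matrix.cons_val_fin_one]
      have n01 : 0 ≤ M 0 1 := by rcases h01 with h | h <;> linarith
      have n10 : 0 ≤ M 1 0 := by rcases h10 with h | h <;> linarith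
      have nm : 0 ≤ sn q (k - 1) := by rcases sm with h | h <;> linarith
      have np : 0 ≤ sn q (k + 1) := by rcases sp with h | h <;> linarith
      refine ⟨by nlinarith, by nlinarith, ?_, ?_⟩
      · rcases h01 with h | h
        · rcases sm with h' | h'
          · left; simp [h, h']
          · right; nlinarith
        · right; nlinarith
      · rcases h10 with h | h
        · rcases sp with h' | h'
          · left; simp [h, h']
          · right; nlinarith
        · right; nlinarith

/-- Every entry of a matrix in the Hecke group is zero or at least one in absolute value. -/
theorem isBig_entry (hq : 3 ≤ q) (A : SL(2, ℝ)) (hA : (A : PSL(2, ℝ)) ∈ heckeGroup q)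
    (i j : Fin 2) : IsBig (A i j) := by
  obtain ⟨w, hw, h⟩ := hasNormalForm hq hA
  obtain ⟨M, rfl, h00, h11, h01, h10⟩ := exists_posMatrix hq hw
  have hM : ∀ i j, IsBig (M i j) := by
    have h0 : ∀ x : ℝ, x = 0 ∨ 1 ≤ x → IsBig x := fun x hx =>
      hx.imp id (fun h => h.trans (le_abs_self x))
    intro i j
    fin_cases i <;> fin_cases j
    · exact h0 _ (Or.inr h00)
    · exact h0 _ h01
    · exact h0 _ h10
    · exact h0 _ (Or.inr h11)
  have hneg : ∀ B : SL(2, ℝ), (∀ i j, IsBig (B i j)) → (A : PSL(2, ℝ)) = B →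
      ∀ i j, IsBig (A i j) := by
    intro B hB hAB i j
    rcases (psl_eq_iff A B).1 hAB with h | h
    · rw [h]; exact hB i j
    · rw [h, Matrix.SpecialLinearGroup.coe_neg, Matrix.neg_apply, isBig_neg]; exact hB i j
  have hSM : ∀ B : SL(2, ℝ), (∀ i j, IsBig (B i j)) → ∀ i j, IsBig ((matS * B) i j) := by
    intro B hB i j
    have := hB 0 0; have := hB 0 1; have := hB 1 0; have := hB 1 1
    fin_cases i <;> fin_cases j <;>
      simpa [matS_coe, sl_mul_apply, isBig_neg]
  have hMS : ∀ B : SL(2, ℝ), (∀ i j, IsBig (B i j)) → ∀ i j, IsBig ((B * matS) i j) := by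
    intro B hB i j
    have := hB 0 0; have := hB 0 1; have := hB 1 0; have := hB 1 1
    fin_cases i <;> fin_cases j <;>
      simpa [matS_coe, sl_mul_apply, isBig_neg]
  rcases h with h | h | h | h
  · exact hneg M hM h i j
  · exact hneg (matS * M) (hSM _ hM) h i j
  · exact hneg (M * matS) (hMS _ hM) h i j
  · exact hneg (matS * M * matS) (hMS _ (hSM _ hM)) h i j

end

section
variable {q : ℕ}

/-! ### Parabolic elements, reduced fractions and the field of definition -/

/-- The matrix of the translation `z ↦ z + x`. -/
def matU (x : ℝ) : SL(2, ℝ) := ⟨!![1, x; 0, 1], by simp [Matrix.det_fin_two]⟩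

theorem matU_coe (x : ℝ) : (matU x : Matrix (Fin 2) (Fin 2) ℝ) = !![1, x; 0, 1] := rfl

theorem matU_add (x y : ℝ) : matU (x + y) = matU x * matU y := by
  simp [sl_ext_iff, sl_mul_apply, matU_coe, add_comm]

theorem matU_mem (n : ℤ) : (matU (n * lam q) : PSL(2, ℝ)) ∈ heckeGroup q := by
  have hT : (matU (lam q) : PSL(2, ℝ)) ∈ heckeGroup q := T_mem
  have hT' : (matU (-lam q) : PSL(2, ℝ)) ∈ heckeGroup q := by
    have : (matU (-lam q) : PSL(2, ℝ)) = (matU (lam q) : PSL(2, ℝ))⁻¹ := by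
      apply eq_inv_of_mul_eq_one_left
      rw [← coe_mul_psl, ← matU_add, neg_add_cancel]
      have : matU 0 = 1 := by simp [sl_ext_iff, matU_coe]
      rw [this]; rfl
    rw [this]; exact (heckeGroup q).inv_mem hT
  induction n using Int.induction_on with
  | zero =>
    have : matU 0 = 1 := by simp [sl_ext_iff, matU_coe]
    simp only [Int.cast_zero, zero_mul, this]
    exact (heckeGroup q).one_mem
  | succ n ih =>
    push_cast at ih ⊢
    rw [add_mul, one_mul, matU_add, coe_mul_psl]
    exact (heckeGroup q).mul_mem ih hT
  | pred n ih =>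
    push_cast at ih ⊢
    rw [sub_mul, one_mul, sub_eq_add_neg, matU_add, coe_mul_psl]
    exact (heckeGroup q).mul_mem ih hT'

/-- Since `λ < 2`, no translation length strictly between two multiples of `λ` can differ from both
by at least one. -/
theorem exists_eq_int_mul_lam (hq : 3 ≤ q) {x : ℝ} (h : ∀ n : ℤ, IsBig (x - n * lam q)) :
    ∃ n : ℤ, x = n * lam q := by
  have hl := one_le_lam hq
  have hl2 := lam_lt_two hq
  have hl0 : 0 < lam q := by linarith
  refine ⟨⌊x / lam q⌋, ?_⟩
  have h1 : ⌊x / lam q⌋ * lam q ≤ x := by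
    rw [← le_div_iff₀ hl0]; exact Int.floor_le _
  have h2 : x < (⌊x / lam q⌋ + 1) * lam q := by
    rw [← div_lt_iff₀ hl0]; exact Int.lt_floor_add_one _
  rcases h ⌊x / lam q⌋ with h3 | h3
  · linarith
  · have h4 := h (⌊x / lam q⌋ + 1)
    push_cast at h4
    rcases h4 with h4 | h4
    · linarith
    · rw [abs_of_nonneg (by linarith)] at h3
      rw [abs_of_neg (by linarith)] at h4
      linarith

theorem det_eq (A : SL(2, ℝ)) : A 0 0 * A 1 1 - A 0 1 * A 1 0 = 1 := by
  have := A.2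
  rwa [Matrix.det_fin_two] at this

theorem sl_inv_coe (A : SL(2, ℝ)) :
    ((A⁻¹ : SL(2, ℝ)) : Matrix (Fin 2) (Fin 2) ℝ) = !![A 1 1, -A 0 1; -A 1 0, A 0 0] := by
  rw [Matrix.SpecialLinearGroup.coe_inv, Matrix.adjugate_fin_two]

/-- The stabilizer of `∞` in the Hecke group consists of translations. -/
theorem eq_matU_of_lower_left (hq : 3 ≤ q) {A : SL(2, ℝ)} (hA : (A : PSL(2, ℝ)) ∈ heckeGroup q)
    (h : A 1 0 = 0) : ∃ x, A = matU x ∨ A = -matU x := by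
  have hd := det_eq A
  rw [h, mul_zero, sub_zero] at hd
  have h0 : A 0 0 ≠ 0 := by intro h; simp [h] at hd
  have h1 : A 1 1 ≠ 0 := by intro h; simp [h] at hd
  have b0 := (isBig_entry hq A hA 0 0).resolve_left h0
  have b1 := (isBig_entry hq A hA 1 1).resolve_left h1
  rcases lt_or_gt_of_ne h0 with h0 | h0
  · have h1' : A 1 1 < 0 := by by_contra hc; nlinarith
    rw [abs_of_neg h0] at b0
    rw [abs_of_neg h1'] at b1
    refine ⟨-A 0 1, Or.inr ?_⟩
    simp [sl_ext_iff, matU_coe, h]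
    constructor <;> nlinarith
  · have h1' : 0 < A 1 1 := by by_contra hc; nlinarith
    rw [abs_of_pos h0] at b0
    rw [abs_of_pos h1'] at b1
    refine ⟨A 0 1, Or.inl ?_⟩
    simp [sl_ext_iff, matU_coe, h]
    constructor <;> nlinarith

theorem isBig_translation (hq : 3 ≤ q) {B : SL(2, ℝ)} (hB : (B : PSL(2, ℝ)) ∈ heckeGroup q)
    (h : B 1 0 = 1) : ∃ n : ℤ, B 0 0 = n * lam q := by
  apply exists_eq_int_mul_lam hq
  intro n
  have hm : ((matU ((-n : ℤ) * lam q) * B : SL(2, ℝ)) : PSL(2, ℝ)) ∈ heckeGroup q := by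
    rw [coe_mul_psl]; exact (heckeGroup q).mul_mem (matU_mem _) hB
  have := isBig_entry hq _ hm 0 0
  simpa [sl_mul_apply, matU_coe, h, sub_eq_add_neg] using this

theorem matU_mem_iff (hq : 3 ≤ q) {x : ℝ} (h : (matU x : PSL(2, ℝ)) ∈ heckeGroup q) :
    ∃ n : ℤ, x = n * lam q := by
  apply exists_eq_int_mul_lam hq
  intro n
  have hm : ((matU ((-n : ℤ) * lam q) * matU x : SL(2, ℝ)) : PSL(2, ℝ)) ∈ heckeGroup q := by
    rw [coe_mul_psl]; exact (heckeGroup q).mul_mem (matU_mem _) h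
  have := isBig_entry hq _ hm 0 1
  simpa [sl_mul_apply, matU_coe, sub_eq_add_neg] using this

/-- A matrix of determinant one both of whose columns occur as first columns of elements of the
Hecke group belongs to the Hecke group. -/
theorem mem_of_columns (hq : 3 ≤ q) {A B C : SL(2, ℝ)} (hB : (B : PSL(2, ℝ)) ∈ heckeGroup q)
    (hC : (C : PSL(2, ℝ)) ∈ heckeGroup q) (h00 : A 0 0 = B 0 0) (h10 : A 1 0 = B 1 0)
    (h01 : A 0 1 = C 0 0) (h11 : A 1 1 = C 1 0) : (A : PSL(2, ℝ)) ∈ heckeGroup q := by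
  have hm : ((B⁻¹ * C : SL(2, ℝ)) : PSL(2, ℝ)) ∈ heckeGroup q := by
    rw [coe_mul_psl]; exact (heckeGroup q).mul_mem ((heckeGroup q).inv_mem hB) hC
  have hdA := det_eq A
  have hdB := det_eq B
  rw [h00, h10, h01, h11] at hdA
  have e1 : (B⁻¹ * C) 1 0 = 1 := by
    simp only [sl_mul_apply, sl_inv_coe]; simp; linarith
  obtain ⟨n, hn⟩ := isBig_translation hq hm e1
  have hA : A = B * matU (n * lam q) := by
    rw [sl_mul_apply, sl_inv_coe] at hn
    simp at hn
    rw [sl_ext_iff]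
    simp only [sl_mul_apply, matU_coe]
    simp [h00, h10, h01, h11]
    rw [← hn]
    constructor
    · linear_combination (-C 0 0) * hdB + B 0 1 * hdA
    · linear_combination (-C 1 0) * hdB + B 1 1 * hdA
  rw [hA, coe_mul_psl]
  exact (heckeGroup q).mul_mem hB (matU_mem n)

/-- Elements of the Hecke group mapping `∞` to the same point have the same first column up to
sign. -/
theorem column_unique (hq : 3 ≤ q) {A B : SL(2, ℝ)} (hA : (A : PSL(2, ℝ)) ∈ heckeGroup q)
    (hB : (B : PSL(2, ℝ)) ∈ heckeGroup q) (h : A 0 0 * B 1 0 = B 0 0 * A 1 0) :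
    (A 0 0 = B 0 0 ∧ A 1 0 = B 1 0) ∨ (A 0 0 = -B 0 0 ∧ A 1 0 = -B 1 0) := by
  have hm : ((A⁻¹ * B : SL(2, ℝ)) : PSL(2, ℝ)) ∈ heckeGroup q := by
    rw [coe_mul_psl]; exact (heckeGroup q).mul_mem ((heckeGroup q).inv_mem hA) hB
  obtain ⟨x, hx⟩ := eq_matU_of_lower_left hq hm (by
    simp only [sl_mul_apply, sl_inv_coe]; simp; linarith)
  have hB' : B = A * (A⁻¹ * B) := by group
  rcases hx with hx | hx
  · left
    rw [hx] at hB'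
    rw [hB']; simp only [sl_mul_apply, matU_coe]; simp
  · right
    rw [hx] at hB'
    rw [hB']; simp only [sl_mul_apply, Matrix.SpecialLinearGroup.coe_neg, matU_coe]; simp

theorem isReduced_unique (hq : 3 ≤ q) {a b a' b' : ℝ} (h : IsReduced q a b)
    (h' : IsReduced q a' b') (hb : 0 < b) (hb' : 0 < b') (he : a / b = a' / b') :
    a = a' ∧ b = b' := by
  obtain ⟨-, A, hA, rfl, rfl⟩ := h
  obtain ⟨-, B, hB, rfl, rfl⟩ := h'
  rw [div_eq_div_iff hb.ne' hb'.ne'] at he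
  rcases column_unique hq hA hB he with h | h
  · exact h
  · linarith [h.2]

theorem entries_mem_field (A : SL(2, ℝ)) (hA : (A : PSL(2, ℝ)) ∈ heckeGroup q) (i j : Fin 2) :
    A i j ∈ IntermediateField.adjoin ℚ {lam q} := by
  set K := IntermediateField.adjoin ℚ {lam q}
  have hl : lam q ∈ K := IntermediateField.mem_adjoin_simple_self ℚ _
  have hmul : ∀ A B : SL(2, ℝ), (∀ i j, A i j ∈ K) → (∀ i j, B i j ∈ K) →
      ∀ i j, (A * B) i j ∈ K := by
    intro A B hA hB i j
    rw [sl_mul_apply]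
    exact K.add_mem (K.mul_mem (hA _ _) (hB _ _)) (K.mul_mem (hA _ _) (hB _ _))
  have hS : ∀ i j, matS i j ∈ K := by
    intro i j
    fin_cases i <;> fin_cases j <;> simp [matS_coe, K.zero_mem, K.one_mem]
  have hT : ∀ i j, matT q i j ∈ K := by
    intro i j
    fin_cases i <;> fin_cases j <;> simp [matT_coe, K.zero_mem, K.one_mem, hl]
  have hinv : ∀ A : SL(2, ℝ), (∀ i j, A i j ∈ K) → ∀ i j, (A⁻¹) i j ∈ K := by
    intro A hA i j
    rw [sl_inv_coe]
    fin_cases i <;> fin_cases j <;> simp [hA]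
  have key : ∀ g ∈ heckeGroup q, ∃ B : SL(2, ℝ), (B : PSL(2, ℝ)) = g ∧ ∀ i j, B i j ∈ K := by
    intro g hg
    induction hg using Subgroup.closure_induction with
    | mem x hx =>
      rcases hx with rfl | hx
      · exact ⟨matS, rfl, hS⟩
      · exact ⟨matT q, (Set.mem_singleton_iff.1 hx).symm, hT⟩
    | one =>
      refine ⟨1, rfl, fun i j => ?_⟩
      fin_cases i <;> fin_cases j <;> simp [K.zero_mem, K.one_mem]
    | mul x y _ _ hx hy =>
      obtain ⟨A, rfl, hA⟩ := hx
      obtain ⟨B, rfl, hB⟩ := hy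
      exact ⟨A * B, rfl, hmul A B hA hB⟩
    | inv x _ hx =>
      obtain ⟨A, rfl, hA⟩ := hx
      exact ⟨A⁻¹, rfl, hinv A hA⟩
  obtain ⟨B, hB, hBK⟩ := key _ hA
  rcases (psl_eq_iff B A).1 hB with h | h
  · rw [← h]; exact hBK i j
  · have : A = -B := by rw [h]; simp
    rw [this, Matrix.SpecialLinearGroup.coe_neg, Matrix.neg_apply]
    exact K.neg_mem (hBK i j)

/-! ### Möbius transformations in coordinates -/

theorem re_sl_smul (A : SL(2, ℝ)) (z : ℍ) :
    (A • z).re * ((A 1 0 * z.re + A 1 1) ^ 2 + (A 1 0 * z.im) ^ 2) =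
      A 0 0 * A 1 0 * (z.re ^ 2 + z.im ^ 2) + (A 0 0 * A 1 1 + A 0 1 * A 1 0) * z.re
        + A 0 1 * A 1 1 := by
  have h := UpperHalfPlane.coe_specialLinearGroup_apply A z
  have hd : (A 1 0 * z.re + A 1 1) ^ 2 + (A 1 0 * z.im) ^ 2 ≠ 0 := by
    intro h0
    have h1 : A 1 0 * z.im = 0 := by nlinarith [sq_nonneg (A 1 0 * z.re + A 1 1)]
    have h2 : A 1 0 = 0 := by simpa [z.im_ne_zero] using h1
    have hdet := det_eq A
    rw [h2] at h0 hdet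
    have : A 1 1 = 0 := by simpa using h0
    rw [this] at hdet; simp at hdet
  have hr : (A • z).re = ((A • z : ℍ) : ℂ).re := rfl
  rw [hr, h, Complex.div_re]
  simp [Complex.normSq_apply]
  rw [← add_div]
  have e : (A 1 0 * z.re + A 1 1) * (A 1 0 * z.re + A 1 1) + A 1 0 * z.im * (A 1 0 * z.im) =
    (A 1 0 * z.re + A 1 1) ^ 2 + (A 1 0 * z.im) ^ 2 := by ring
  rw [e, div_mul_cancel₀ _ hd]
  ring

theorem denom_pos (A : SL(2, ℝ)) (z : ℍ) :
    0 < (A 1 0 * z.re + A 1 1) ^ 2 + (A 1 0 * z.im) ^ 2 := by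
  have hd : (A 1 0 * z.re + A 1 1) ^ 2 + (A 1 0 * z.im) ^ 2 ≠ 0 := by
    intro h0
    have h1 : A 1 0 * z.im = 0 := by nlinarith [sq_nonneg (A 1 0 * z.re + A 1 1)]
    have h2 : A 1 0 = 0 := by simpa [z.im_ne_zero] using h1
    have hdet := det_eq A
    rw [h2] at h0 hdet
    have : A 1 1 = 0 := by simpa using h0
    rw [this] at hdet; simp at hdet
  positivity

theorem im_sl_smul (A : SL(2, ℝ)) (z : ℍ) :
    (A • z).im * ((A 1 0 * z.re + A 1 1) ^ 2 + (A 1 0 * z.im) ^ 2) = z.im := by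
  have h := UpperHalfPlane.coe_specialLinearGroup_apply A z
  have hd := (denom_pos A z).ne'
  have hr : (A • z).im = ((A • z : ℍ) : ℂ).im := rfl
  rw [hr, h, Complex.div_im]
  simp [Complex.normSq_apply]
  have e : (A 1 0 * z.re + A 1 1) * (A 1 0 * z.re + A 1 1) + A 1 0 * z.im * (A 1 0 * z.im) =
    (A 1 0 * z.re + A 1 1) ^ 2 + (A 1 0 * z.im) ^ 2 := by ring
  rw [← sub_div, e, div_mul_cancel₀ _ hd]
  linear_combination z.im * det_eq A

end

/-! ### Rays and sectors around the odd vertex -/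

/-- The Hecke group as a group of its own. -/
abbrev Gam (q : ℕ) := ↥(heckeGroup q)

/-- `S` as an element of the Hecke group. -/
def gS (q : ℕ) : Gam q := ⟨S, S_mem⟩

/-- `R` as an element of the Hecke group. -/
noncomputable def gR (q : ℕ) : Gam q := ⟨R q, R_mem⟩

/-- The sine, up to a positive factor depending on `z`, of the angle at `exp (π i / q)` from the ray
`R ^ t (exp (π i / q), ∞)` to `z`. -/
noncomputable def ray (q : ℕ) (t : ℝ) (z : ℍ) : ℝ :=
  -sn q (2 * t) * (z.re ^ 2 + z.im ^ 2) + 2 * sn q (2 * t - 1) * z.re - sn q (2 * t - 2)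

/-- The closed sector at `exp (π i / q)` between the rays number `k` and `k + 1`. -/
def sector (q : ℕ) (k : ℕ) : Set ℍ := {z | 0 ≤ ray q k z ∧ ray q (k + 1) z ≤ 0}

section
variable {q : ℕ}

/-- The point `exp (π i / q)`. -/
noncomputable def rho (hq : 3 ≤ q) : ℍ :=
  ⟨⟨Real.cos (Real.pi / q), Real.sin (Real.pi / q)⟩, sin_theta_pos hq⟩

theorem rho_re (hq : 3 ≤ q) : (rho hq).re = Real.cos (Real.pi / q) := rfl
theorem rho_im (hq : 3 ≤ q) : (rho hq).im = Real.sin (Real.pi / q) := rfl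

theorem isBaseOddVertex_iff (hq : 3 ≤ q) (w : ℍ) : IsBaseOddVertex q w ↔ w = rho hq := by
  have h : Complex.exp (Real.pi * Complex.I / q) = ((rho hq : ℍ) : ℂ) := by
    have : (Real.pi * Complex.I / q : ℂ) = ((Real.pi / q : ℝ) : ℂ) * Complex.I := by
      push_cast; ring
    rw [this, Complex.exp_mul_I, ← Complex.ofReal_cos, ← Complex.ofReal_sin]
    apply Complex.ext
    · rw [UpperHalfPlane.coe_re, rho_re]; simp [-Complex.ofReal_cos, -Complex.ofReal_sin]
    · rw [UpperHalfPlane.coe_im, rho_im]; simp [-Complex.ofReal_cos, -Complex.ofReal_sin]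
  rw [IsBaseOddVertex, h, UpperHalfPlane.coe_inj]

theorem ray_zero (hq : 3 ≤ q) (z : ℍ) : ray q 0 z = lam q - 2 * z.re := by
  have h1 : sn q (-1) = -1 := by rw [sn_neg, sn_one hq]
  have h2 : sn q (-2) = -lam q := by rw [sn_neg, sn_two hq]
  simp [ray, sn_zero, h1, h2]; ring

theorem ray_one (hq : 3 ≤ q) (z : ℍ) :
    ray q 1 z = 2 * z.re - lam q * (z.re ^ 2 + z.im ^ 2) := by
  have : (2 : ℝ) * 1 - 1 = 1 := by norm_num
  simp only [ray, this, mul_one, sub_self, sn_zero, sn_two hq]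
  rw [show (2 : ℝ) - 1 = 1 by norm_num, sn_one hq]; ring

theorem R_smul_facts (z : ℍ) :
    (R q • z).re * ((lam q - z.re) ^ 2 + z.im ^ 2) = lam q - z.re ∧
    ((R q • z).re ^ 2 + (R q • z).im ^ 2) * ((lam q - z.re) ^ 2 + z.im ^ 2) = 1 ∧
    0 < (lam q - z.re) ^ 2 + z.im ^ 2 := by
  have h1 := re_sl_smul (matR q) z
  have h2 := im_sl_smul (matR q) z
  have h3 := denom_pos (matR q) z
  rw [matR_coe] at h1 h2 h3
  simp at h1 h2 h3
  have e : (-z.re + lam q) ^ 2 + z.im ^ 2 = (lam q - z.re) ^ 2 + z.im ^ 2 := by ring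
  rw [e] at h1 h2 h3
  have e1 : (R q • z).re = (matR q • z).re := rfl
  have e2 : (R q • z).im = (matR q • z).im := rfl
  rw [e1, e2]
  set D := (lam q - z.re) ^ 2 + z.im ^ 2
  refine ⟨by linarith, ?_, h3⟩
  have : (((matR q • z).re ^ 2 + (matR q • z).im ^ 2) * D) * D = 1 * D := by
    have : ((matR q • z).re * D) ^ 2 + ((matR q • z).im * D) ^ 2 = D := by
      rw [h1, h2]; ring
    linear_combination this
  exact mul_right_cancel₀ h3.ne' this

theorem ray_R_smul (t : ℝ) (z : ℍ) :
    ray q t (R q • z) * ((lam q - z.re) ^ 2 + z.im ^ 2) = ray q (t - 1) z := by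
  obtain ⟨h1, h2, -⟩ := R_smul_facts (q := q) z
  have r1 := sn_add_one (q := q) (2 * t - 1)
  have r2 := sn_add_one (q := q) (2 * t - 2)
  have r3 := sn_add_one (q := q) (2 * t - 3)
  ring_nf at r1 r2 r3
  have e1 : 2 * (t - 1) = -2 + t * 2 := by ring
  have e2 : 2 * (t - 1) - 1 = -3 + t * 2 := by ring
  have e3 : 2 * (t - 1) - 2 = -4 + t * 2 := by ring
  have e4 : 2 * t = t * 2 := by ring
  have e5 : 2 * t - 1 = -1 + t * 2 := by ring
  have e6 : 2 * t - 2 = -2 + t * 2 := by ring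
  simp only [ray]
  rw [e2, e3, e1, e5, e6, e4]
  have e7 : (-sn q (t * 2) * ((R q • z).re ^ 2 + (R q • z).im ^ 2) +
      2 * sn q (-1 + t * 2) * (R q • z).re - sn q (-2 + t * 2)) *
        ((lam q - z.re) ^ 2 + z.im ^ 2) =
      -sn q (t * 2) * 1 + 2 * sn q (-1 + t * 2) * (lam q - z.re) -
        sn q (-2 + t * 2) * ((lam q - z.re) ^ 2 + z.im ^ 2) := by
    linear_combination (-sn q (t * 2)) * h2 + 2 * sn q (-1 + t * 2) * h1
  rw [e7]
  generalize sn q (t * 2) = a0 at *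
  generalize sn q (-1 + t * 2) = a1 at *
  generalize sn q (-2 + t * 2) = a2 at *
  generalize sn q (-3 + t * 2) = a3 at *
  generalize sn q (-4 + t * 2) = a4 at *
  subst r1
  rw [r2, show a4 = lam q * a3 - a2 by linarith]
  ring

theorem ray_R_smul_nonneg (t : ℝ) (z : ℍ) : 0 ≤ ray q t (R q • z) ↔ 0 ≤ ray q (t - 1) z := by
  rw [← ray_R_smul t z, mul_nonneg_iff_of_pos_right (R_smul_facts z).2.2]

theorem ray_R_smul_nonpos (t : ℝ) (z : ℍ) : ray q t (R q • z) ≤ 0 ↔ ray q (t - 1) z ≤ 0 := by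
  have := (R_smul_facts (q := q) z).2.2
  rw [← ray_R_smul t z]
  constructor
  · intro h; exact mul_nonpos_of_nonpos_of_nonneg h this.le
  · intro h; by_contra hc; push Not at hc; linarith [mul_pos hc this]

theorem smul_mem_sector_succ (k : ℕ) (z : ℍ) : R q • z ∈ sector q (k + 1) ↔ z ∈ sector q k := by
  simp only [sector, Set.mem_ofPred_eq, ray_R_smul_nonneg, ray_R_smul_nonpos]
  push_cast
  simp

theorem R_pow_smul_mem_sector (k : ℕ) (z : ℍ) : R q ^ k • z ∈ sector q k ↔ z ∈ sector q 0 := by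
  induction k with
  | zero => simp
  | succ k ih => rw [pow_succ', mul_smul, smul_mem_sector_succ, ih]

/-- The values of `ray` at `z` are given by the polar coordinates of `z` about `exp (π i / q)`. -/
theorem ray_polar_aux (hq : 3 ≤ q) (z : ℍ) : ∃ A φ : ℝ, 0 ≤ A ∧ (A = 0 → z = rho hq) ∧
    ∀ t, ray q t z = A * Real.sin (φ - 2 * t * (Real.pi / q)) := by
  have hs := sin_theta_pos hq
  have h2 : Real.sin (2 * (Real.pi / q)) = _ := Real.sin_two_mul _
  have h3 : Real.cos (2 * (Real.pi / q)) = _ := Real.cos_two_mul _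
  have h1 := Real.sin_sq_add_cos_sq (Real.pi / q)
  let ζ : ℂ := ⟨(z.re ^ 2 + z.im ^ 2 - lam q * z.re + Real.cos (2 * (Real.pi / q))) /
    Real.sin (Real.pi / q), lam q - 2 * z.re⟩
  refine ⟨‖ζ‖, ζ.arg, norm_nonneg _, ?_, ?_⟩
  · intro h0
    have h0' : ζ = 0 := norm_eq_zero.1 h0
    have hre : (z.re ^ 2 + z.im ^ 2 - lam q * z.re + Real.cos (2 * (Real.pi / q))) /
      Real.sin (Real.pi / q) = 0 := congrArg Complex.re h0'
    have him : lam q - 2 * z.re = 0 := congrArg Complex.im h0'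
    rw [div_eq_zero_iff, or_iff_left hs.ne', h3] at hre
    have hx : z.re = Real.cos (Real.pi / q) := by unfold lam at him; linarith
    apply UpperHalfPlane.ext_re_im
    · rw [rho_re, hx]
    · rw [rho_im]
      have : z.im ^ 2 = Real.sin (Real.pi / q) ^ 2 := by
        rw [lam, hx] at hre; nlinarith
      exact (sq_eq_sq₀ z.im_pos.le hs.le).1 this
  · intro t
    have e1 : ‖ζ‖ * Real.cos ζ.arg = _ := Complex.norm_mul_cos_arg ζ
    have e2 : ‖ζ‖ * Real.sin ζ.arg = _ := Complex.norm_mul_sin_arg ζ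
    have e3 : ‖ζ‖ * Real.sin (ζ.arg - 2 * t * (Real.pi / q)) =
        ζ.im * Real.cos (2 * t * (Real.pi / q)) - ζ.re * Real.sin (2 * t * (Real.pi / q)) := by
      rw [Real.sin_sub, ← e1, ← e2]; ring
    rw [e3]
    have e4 : (2 * t - 1) * (Real.pi / q) = 2 * t * (Real.pi / q) - Real.pi / q := by ring
    have e5 : (2 * t - 2) * (Real.pi / q) = 2 * t * (Real.pi / q) - 2 * (Real.pi / q) := by ring
    simp only [ray, sn, e4, e5, ζ, Real.sin_sub, h2, h3, lam]
    generalize Real.sin (2 * t * (Real.pi / q)) = a at *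
    generalize Real.cos (2 * t * (Real.pi / q)) = b at *
    have hs' := hs.ne'
    generalize Real.sin (Real.pi / q) = c at *
    generalize Real.cos (Real.pi / q) = d at *
    field_simp
    ring

theorem ray_polar (hq : 3 ≤ q) (t₀ : ℝ) (z : ℍ) : ∃ A φ : ℝ, 0 ≤ A ∧ (A = 0 → z = rho hq) ∧
    2 * t₀ * (Real.pi / q) ≤ φ ∧ φ < 2 * t₀ * (Real.pi / q) + 2 * Real.pi ∧
    ∀ t, ray q t z = A * Real.sin (φ - 2 * t * (Real.pi / q)) := by
  obtain ⟨A, φ, hA, hA0, h⟩ := ray_polar_aux hq z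
  have hp := Real.two_pi_pos
  set m := ⌊(φ - 2 * t₀ * (Real.pi / q)) / (2 * Real.pi)⌋ with hm
  have h1 := Int.floor_le ((φ - 2 * t₀ * (Real.pi / q)) / (2 * Real.pi))
  have h2 := Int.lt_floor_add_one ((φ - 2 * t₀ * (Real.pi / q)) / (2 * Real.pi))
  rw [← hm, le_div_iff₀ hp] at h1
  rw [← hm, div_lt_iff₀ hp] at h2
  refine ⟨A, φ - m * (2 * Real.pi), hA, hA0, by linarith, by linarith, fun t => ?_⟩
  rw [h t, show φ - m * (2 * Real.pi) - 2 * t * (Real.pi / q) =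
    φ - 2 * t * (Real.pi / q) - m * (2 * Real.pi) by ring, Real.sin_sub_int_mul_two_pi]

theorem sector_polar (hq : 3 ≤ q) {k : ℕ} {z : ℍ} (hz : z ∈ sector q k) :
    ∃ A φ : ℝ, 0 ≤ A ∧ (A = 0 → z = rho hq) ∧
    2 * k * (Real.pi / q) ≤ φ ∧ φ ≤ 2 * (k + 1) * (Real.pi / q) ∧
    ∀ t, ray q t z = A * Real.sin (φ - 2 * t * (Real.pi / q)) := by
  obtain ⟨A, φ, hA, hA0, h1, h2, h⟩ := ray_polar hq k z
  have ht := theta_pos hq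
  have h3 := three_theta_le hq
  rcases hA.eq_or_lt with hA' | hA'
  · refine ⟨0, 2 * k * (Real.pi / q), le_rfl, fun _ => hA0 hA'.symm, le_rfl, by nlinarith, ?_⟩
    intro t; rw [h t, ← hA']; simp
  · refine ⟨A, φ, hA, hA0, h1, ?_, h⟩
    obtain ⟨hz1, hz2⟩ := hz
    rw [h, mul_nonneg_iff_of_pos_left hA'] at hz1
    have hz2 : Real.sin (φ - 2 * (k + 1) * (Real.pi / q)) ≤ 0 := by
      by_contra hc; push Not at hc
      rw [h] at hz2; linarith [mul_pos hA' hc]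
    by_contra hc
    push Not at hc
    set ψ := φ - 2 * k * (Real.pi / q) with hψ
    have e : φ - 2 * (k + 1) * (Real.pi / q) = ψ - 2 * (Real.pi / q) := by rw [hψ]; ring
    rw [e] at hz2
    have hp := Real.pi_pos
    have hψ1 : ψ ≤ Real.pi := by
      by_contra hc'; push Not at hc'
      have := Real.sin_neg_of_neg_of_neg_pi_lt (x := ψ - 2 * Real.pi) (by linarith) (by linarith)
      rw [Real.sin_sub_two_pi] at this
      linarith
    have := Real.sin_pos_of_pos_of_lt_pi (x := ψ - 2 * (Real.pi / q)) (by linarith) (by linarith)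
    linarith

theorem exists_sector (hq : 3 ≤ q) (z : ℍ) : ∃ k < q, z ∈ sector q k := by
  obtain ⟨A, φ, hA, -, h1, h2, h⟩ := ray_polar hq 0 z
  have ht := theta_pos hq
  have h3 := three_theta_le hq
  have hqt := q_mul_theta hq
  have hp := Real.pi_pos
  simp only [mul_zero, zero_mul, zero_add] at h1 h2
  have h4 : (0:ℝ) ≤ φ / (2 * (Real.pi / q)) := by positivity
  have h5 := Nat.floor_le h4
  have h6 := Nat.lt_floor_add_one (φ / (2 * (Real.pi / q)))
  set k := ⌊φ / (2 * (Real.pi / q))⌋₊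
  rw [le_div_iff₀ (by positivity)] at h5
  rw [div_lt_iff₀ (by positivity)] at h6
  refine ⟨k, ?_, ?_, ?_⟩
  · have : (k : ℝ) < q := by nlinarith
    exact_mod_cast this
  · rw [h]
    exact mul_nonneg hA (Real.sin_nonneg_of_nonneg_of_le_pi (by linarith) (by linarith))
  · rw [h]
    exact mul_nonpos_of_nonneg_of_nonpos hA
      (Real.sin_nonpos_of_nonpos_of_neg_pi_le (by linarith) (by linarith))

/-- Different sectors overlap in a ray only. -/
theorem sector_inter (hq : 3 ≤ q) {k : ℕ} (hk : 0 < k) (hkq : k < q) {z : ℍ}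
    (h0 : z ∈ sector q 0) (hz : z ∈ sector q k) :
    z = rho hq ∨ (k = 1 ∧ ray q 1 z = 0) ∨ (k = q - 1 ∧ ray q 0 z = 0) := by
  obtain ⟨A, φ, hA, hA0, h1, h2, h⟩ := sector_polar hq h0
  have ht := theta_pos hq
  have h3 := three_theta_le hq
  have hqt := q_mul_theta hq
  have hp := Real.pi_pos
  rcases hA.eq_or_lt with hA' | hA'
  · exact Or.inl (hA0 hA'.symm)
  right
  obtain ⟨hz1, hz2⟩ := hz
  rw [h, mul_nonneg_iff_of_pos_left hA'] at hz1
  have hz2 : Real.sin (φ - 2 * (k + 1) * (Real.pi / q)) ≤ 0 := by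
    by_contra hc; push Not at hc
    rw [h] at hz2; linarith [mul_pos hA' hc]
  simp only [Nat.cast_zero, mul_zero, zero_mul, zero_add, mul_one] at h1 h2
  have hk1 : (1 : ℝ) ≤ k := by exact_mod_cast hk
  have hk2 : (k : ℝ) + 1 ≤ q := by exact_mod_cast hkq
  have hkt : Real.pi / q ≤ k * (Real.pi / q) := by nlinarith
  have hkt2 : (k + 1) * (Real.pi / q) ≤ Real.pi := by nlinarith
  by_cases hc : φ = 2 * k * (Real.pi / q)
  · left
    have hk' : (k : ℝ) = 1 := by
      have : (k : ℝ) * (Real.pi / q) ≤ 1 * (Real.pi / q) := by linarith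
      exact le_antisymm (le_of_mul_le_mul_right this ht) hk1
    refine ⟨by exact_mod_cast hk', ?_⟩
    rw [h, hc, hk']; simp
  · right
    have hlt : φ - 2 * k * (Real.pi / q) < 0 := by
      rcases lt_or_gt_of_ne hc with h' | h'
      · linarith
      · exfalso; linarith
    have hle : φ - 2 * k * (Real.pi / q) ≤ -Real.pi := by
      by_contra hc'; push Not at hc'
      linarith [Real.sin_neg_of_neg_of_neg_pi_lt hlt hc']
    by_cases hc2 : φ - 2 * (k + 1) * (Real.pi / q) = - (2 * Real.pi)
    · have hφ : φ = 0 := by linarith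
      have hk3 : ((k : ℝ) + 1) * (Real.pi / q) = q * (Real.pi / q) := by linarith
      have hk4 := mul_right_cancel₀ ht.ne' hk3
      refine ⟨?_, ?_⟩
      · have : k + 1 = q := by exact_mod_cast hk4
        omega
      · rw [h, hφ]; simp
    · exfalso
      have hgt : - (2 * Real.pi) < φ - 2 * (k + 1) * (Real.pi / q) :=
        lt_of_le_of_ne (by linarith) (Ne.symm hc2)
      have := Real.sin_pos_of_pos_of_lt_pi (x := φ - 2 * (k + 1) * (Real.pi / q) + 2 * Real.pi)
        (by linarith) (by linarith)
      rw [Real.sin_add_two_pi] at this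
      linarith

/-- A convex wedge at `exp (π i / q)` is the union of the sectors in it. -/
theorem mem_wedge_iff (hq : 3 ≤ q) {r : ℕ} (hr : 1 ≤ r) (hrq : 2 * r ≤ q) (z : ℍ) :
    (0 ≤ ray q 0 z ∧ ray q r z ≤ 0) ↔ ∃ k < r, z ∈ sector q k := by
  have ht := theta_pos hq
  have h3 := three_theta_le hq
  have hqt := q_mul_theta hq
  have hp := Real.pi_pos
  have hr' : 2 * (r * (Real.pi / q)) ≤ Real.pi := by
    have : (2 : ℝ) * r ≤ q := by exact_mod_cast hrq
    nlinarith
  have hr1 : (1 : ℝ) ≤ r := by exact_mod_cast hr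
  constructor
  · rintro ⟨hz1, hz2⟩
    obtain ⟨A, φ, hA, hA0, h1, h2, h⟩ := ray_polar hq 0 z
    rcases hA.eq_or_lt with hA' | hA'
    · exact ⟨0, hr, by rw [sector]; constructor <;> rw [h, ← hA'] <;> simp⟩
    rw [h, mul_nonneg_iff_of_pos_left hA'] at hz1
    have hz2 : Real.sin (φ - 2 * r * (Real.pi / q)) ≤ 0 := by
      by_contra hc; push Not at hc
      rw [h] at hz2; linarith [mul_pos hA' hc]
    simp only [mul_zero, zero_mul, zero_add, sub_zero] at h1 h2 hz1
    have hφ1 : φ ≤ Real.pi := by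
      by_contra hc'; push Not at hc'
      have := Real.sin_neg_of_neg_of_neg_pi_lt (x := φ - 2 * Real.pi) (by linarith) (by linarith)
      rw [Real.sin_sub_two_pi] at this
      linarith
    have hφ2 : φ ≤ 2 * (r * (Real.pi / q)) := by
      by_contra hc; push Not at hc
      have := Real.sin_pos_of_pos_of_lt_pi (x := φ - 2 * r * (Real.pi / q)) (by linarith)
        (by nlinarith)
      linarith
    have h4 : (0:ℝ) ≤ φ / (2 * (Real.pi / q)) := by positivity
    have h5 := Nat.floor_le h4
    have h6 := Nat.lt_floor_add_one (φ / (2 * (Real.pi / q)))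
    set k := ⌊φ / (2 * (Real.pi / q))⌋₊
    rw [le_div_iff₀ (by positivity)] at h5
    rw [div_lt_iff₀ (by positivity)] at h6
    have hkr : k ≤ r := by
      have : (k : ℝ) ≤ r := by
        by_contra hc; push Not at hc; nlinarith
      exact_mod_cast this
    rcases hkr.lt_or_eq with hkr | hkr
    · refine ⟨k, hkr, ?_, ?_⟩
      · rw [h]
        exact mul_nonneg hA (Real.sin_nonneg_of_nonneg_of_le_pi (by linarith) (by linarith))
      · rw [h]
        exact mul_nonpos_of_nonneg_of_nonpos hA
          (Real.sin_nonpos_of_nonpos_of_neg_pi_le (by linarith) (by linarith))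
    · rw [hkr] at h5
      have hφ : φ = 2 * r * (Real.pi / q) := by linarith
      refine ⟨r - 1, by omega, ?_, ?_⟩
      · rw [h, Nat.cast_sub hr, hφ]
        apply mul_nonneg hA (Real.sin_nonneg_of_nonneg_of_le_pi _ _) <;> push_cast <;> linarith
      · rw [h, Nat.cast_sub hr, hφ]
        push_cast
        simp
  · rintro ⟨k, hk, hz⟩
    obtain ⟨A, φ, hA, hA0, h1, h2, h⟩ := sector_polar hq hz
    have hk0 : (0 : ℝ) ≤ k := by positivity
    have hk1 : (k : ℝ) + 1 ≤ r := by exact_mod_cast hk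
    have hkt : (k + 1) * (Real.pi / q) ≤ r * (Real.pi / q) := by nlinarith
    have hkt0 : 0 ≤ k * (Real.pi / q) := by positivity
    constructor
    · rw [h]
      exact mul_nonneg hA (Real.sin_nonneg_of_nonneg_of_le_pi (by linarith) (by linarith))
    · rw [h]
      exact mul_nonpos_of_nonneg_of_nonpos hA
        (Real.sin_nonpos_of_nonpos_of_neg_pi_le (by linarith) (by linarith))

end

/-! ### Triangles and `q`-gons -/

section
variable {q : ℕ}

theorem S_smul_re (z : ℍ) : (S • z).re * (z.re ^ 2 + z.im ^ 2) = -z.re := by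
  have h1 := re_sl_smul matS z
  rw [matS_coe] at h1
  simp at h1
  exact h1

theorem S_smul_im (z : ℍ) : (S • z).im * (z.re ^ 2 + z.im ^ 2) = z.im := by
  have h1 := im_sl_smul matS z
  rw [matS_coe] at h1
  simp at h1
  exact h1

theorem normSq_pos (z : ℍ) : 0 < z.re ^ 2 + z.im ^ 2 := by
  have := z.im_pos
  positivity

theorem S_smul_re_nonneg (z : ℍ) : 0 ≤ (S • z).re ↔ z.re ≤ 0 := by
  have h1 := S_smul_re z
  have h2 := normSq_pos z
  constructor <;> intro h
  · nlinarith
  · by_contra hc; push Not at hc; nlinarith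

theorem S_smul_re_nonpos (z : ℍ) : (S • z).re ≤ 0 ↔ 0 ≤ z.re := by
  have h1 := S_smul_re z
  have h2 := normSq_pos z
  constructor <;> intro h
  · nlinarith
  · by_contra hc; push Not at hc; nlinarith

theorem S_smul_S_smul (z : ℍ) : S • S • z = z := by
  rw [← mul_smul, S_mul_S, one_smul]

theorem mem_triangle_iff (hq : 3 ≤ q) (z : ℍ) : z ∈ triangle q ↔ 0 ≤ z.re ∧ z ∈ sector q 0 := by
  have h0 := ray_zero hq z
  have h1 := ray_one hq z
  simp only [triangle, sector, Set.mem_ofPred_eq, Nat.cast_zero, zero_add, h0, h1]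
  constructor
  · rintro ⟨a, b, c⟩; exact ⟨a, by linarith, by linarith⟩
  · rintro ⟨a, b, c⟩; exact ⟨a, by linarith, by linarith⟩

theorem rays_of_re_nonpos (hq : 3 ≤ q) {z : ℍ} (h : z.re ≤ 0) : 0 < ray q 0 z ∧ ray q 1 z < 0 := by
  have hl := one_le_lam hq
  rw [ray_zero hq, ray_one hq]
  have := normSq_pos z
  constructor <;> nlinarith

theorem mem_sector_zero {z : ℍ} (h0 : 0 ≤ ray q 0 z) (h1 : ray q 1 z ≤ 0) : z ∈ sector q 0 := by
  simp only [sector, Set.mem_ofPred_eq, Nat.cast_zero, zero_add]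
  exact ⟨h0, h1⟩

theorem ray_of_mem_sector_zero {z : ℍ} (h : z ∈ sector q 0) : 0 ≤ ray q 0 z ∧ ray q 1 z ≤ 0 := by
  simpa [sector] using h

theorem mem_sector_of_re_nonpos (hq : 3 ≤ q) {z : ℍ} (h : z.re ≤ 0) : z ∈ sector q 0 :=
  mem_sector_zero (rays_of_re_nonpos hq h).1.le (rays_of_re_nonpos hq h).2.le

theorem rho_re_pos (hq : 3 ≤ q) : 0 < (rho hq).re := by
  have := one_le_lam hq
  rw [rho_re]; unfold lam at this; linarith

theorem not_mem_sector_of_interior (hq : 3 ≤ q) {z : ℍ} (h0 : 0 < ray q 0 z) (h1 : ray q 1 z < 0)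
    {k : ℕ} (hk : 0 < k) (hkq : k < q) : z ∉ sector q k := by
  intro hz
  rcases sector_inter hq hk hkq (mem_sector_zero h0.le h1.le) hz with h | h | h
  · rw [h, ray_zero hq, rho_re, lam] at h0; linarith
  · linarith [h.2]
  · linarith [h.2]

/-- `R ^ k`, `0 < k < q`, maps the sector number `0`, which contains the left half plane, to the
right half plane. -/
theorem re_R_pow_smul_pos (hq : 3 ≤ q) {z : ℍ} (hz : z ∈ sector q 0) {k : ℕ} (hk : 0 < k)
    (hkq : k < q) : 0 < (R q ^ k • z).re := by
  by_contra hc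
  push Not at hc
  obtain ⟨h0, h1⟩ := rays_of_re_nonpos hq hc
  exact not_mem_sector_of_interior hq h0 h1 hk hkq ((R_pow_smul_mem_sector k z).2 hz)

theorem R_smul_rho (hq : 3 ≤ q) : R q • rho hq = rho hq := by
  obtain ⟨h1, h2, -⟩ := R_smul_facts (q := q) (rho hq)
  have hc : lam q - (rho hq).re = Real.cos (Real.pi / q) := by rw [rho_re, lam]; ring
  have h := Real.cos_sq_add_sin_sq (Real.pi / q)
  rw [hc, rho_im, h, mul_one] at h1 h2
  apply UpperHalfPlane.ext_re_im
  · rw [h1, rho_re]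
  · rw [rho_im]
    rw [h1] at h2
    exact (sq_eq_sq₀ (R q • rho hq).im_pos.le (sin_theta_pos hq).le).1 (by linarith)

theorem R_pow_smul_rho (hq : 3 ≤ q) (k : ℕ) : R q ^ k • rho hq = rho hq := by
  induction k with
  | zero => simp
  | succ k ih => rw [pow_succ, mul_smul, R_smul_rho, ih]

/-- A point in the interior of the triangle `Φ`. -/
noncomputable def tau (q : ℕ) : ℍ := ⟨⟨lam q / 4, 1⟩, one_pos⟩

theorem tau_re : (tau q).re = lam q / 4 := rfl
theorem tau_im : (tau q).im = 1 := rfl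

/-- The interior of the triangle `Φ`. -/
def openTriangle (q : ℕ) : Set ℍ := {z | 0 < z.re ∧ 0 < ray q 0 z ∧ ray q 1 z < 0}

theorem tau_mem (hq : 3 ≤ q) : tau q ∈ openTriangle q := by
  have hl := one_le_lam hq
  refine ⟨by rw [tau_re]; linarith, ?_, ?_⟩
  · rw [ray_zero hq, tau_re]; linarith
  · rw [ray_one hq, tau_re, tau_im]; nlinarith [sq_nonneg (lam q / 4)]

theorem openTriangle_subset (hq : 3 ≤ q) : openTriangle q ⊆ triangle q := fun _ h =>
  (mem_triangle_iff hq _).2 ⟨h.1.le, mem_sector_zero h.2.1.le h.2.2.le⟩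

theorem rho_mem_sector (hq : 3 ≤ q) : rho hq ∈ sector q 0 := by
  apply mem_sector_zero
  · rw [ray_zero hq, rho_re, lam]; linarith
  · rw [ray_one hq, rho_re, rho_im, lam, add_comm, Real.sin_sq_add_cos_sq]; linarith

theorem rho_mem_triangle (hq : 3 ≤ q) : rho hq ∈ triangle q :=
  (mem_triangle_iff hq _).2 ⟨(rho_re_pos hq).le, rho_mem_sector hq⟩

theorem baseLine_subset_triangle (hq : 3 ≤ q) : baseLine ⊆ triangle q := fun z hz => by
  have hz : z.re = 0 := hz
  exact (mem_triangle_iff hq _).2 ⟨hz.ge, mem_sector_of_re_nonpos hq hz.le⟩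

theorem mem_fan_iff {r : ℕ} {z : ℍ} :
    z ∈ fan q r ↔ ∃ k < r, ∃ w ∈ triangle q, z = R q ^ k • w := by
  simp only [fan, Set.mem_iUnion, Finset.mem_range, exists_prop, Set.mem_smul_set]
  constructor
  · rintro ⟨k, hk, w, hw, rfl⟩; exact ⟨k, hk, w, hw, rfl⟩
  · rintro ⟨k, hk, w, hw, rfl⟩; exact ⟨k, hk, w, hw, rfl⟩

theorem triangle_subset_fan {r : ℕ} (hr : 1 ≤ r) : triangle q ⊆ fan q r := fun z hz =>
  mem_fan_iff.2 ⟨0, hr, z, hz, by simp⟩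

theorem R_pow_mod (hq : 3 ≤ q) (k : ℕ) : R q ^ (k % q) = R q ^ k := by
  conv_rhs => rw [← Nat.div_add_mod k q, pow_add, pow_mul, R_pow_q hq, one_pow, one_mul]

theorem R_pow_smul_mem_fan (hq : 3 ≤ q) (j : ℕ) {z : ℍ} (hz : z ∈ fan q q) :
    R q ^ j • z ∈ fan q q := by
  obtain ⟨k, hk, w, hw, rfl⟩ := mem_fan_iff.1 hz
  refine mem_fan_iff.2 ⟨(j + k) % q, Nat.mod_lt _ (by omega), w, hw, ?_⟩
  rw [R_pow_mod hq, pow_add, mul_smul]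

theorem re_nonneg_of_mem_fan (hq : 3 ≤ q) {r : ℕ} (hr : r ≤ q) {z : ℍ} (hz : z ∈ fan q r) :
    0 ≤ z.re := by
  obtain ⟨k, hk, w, hw, rfl⟩ := mem_fan_iff.1 hz
  rw [mem_triangle_iff hq] at hw
  rcases Nat.eq_zero_or_pos k with rfl | hk0
  · simpa using hw.1
  · exact (re_R_pow_smul_pos hq hw.2 hk0 (by omega)).le

/-! ### Position of translates of the `q`-gon -/

theorem IsPosWord.re_nonneg (hq : 3 ≤ q) {w : PSL(2, ℝ)} (hw : IsPosWord q w) {z : ℍ}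
    (hz : 0 ≤ z.re) : 0 ≤ (w • z).re := by
  induction hw with
  | one => simpa using hz
  | cons k w hk hkq _ ih =>
    rw [mul_smul, mul_smul]
    exact (re_R_pow_smul_pos hq (mem_sector_of_re_nonpos hq ((S_smul_re_nonpos _).2 ih)) hk hkq).le

theorem IsPosWord.mul_S (hq : 3 ≤ q) {w : PSL(2, ℝ)} (hw : IsPosWord q w) :
    w = 1 ∨ (∃ k, 1 ≤ k ∧ k < q ∧ w * S = R q ^ k) ∨
      ∃ k, 1 ≤ k ∧ k < q ∧ ∀ z ∈ fan q q, ∃ y : ℍ, y.re ≤ 0 ∧ (w * S) • z = R q ^ k • y := by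
  induction hw with
  | one => exact Or.inl rfl
  | cons k w hk hkq _ ih =>
    right
    have e : R q ^ k * S * w * S = R q ^ k * S * (w * S) := by group
    rcases ih with rfl | ⟨j, hj, hjq, h⟩ | ⟨j, hj, hjq, h⟩
    · exact Or.inl ⟨k, hk, hkq, by simp [mul_assoc, S_mul_S]⟩
    · refine Or.inr ⟨k, hk, hkq, fun z hz => ⟨S • (R q ^ j • z), ?_, ?_⟩⟩
      · rw [S_smul_re_nonpos]
        exact re_nonneg_of_mem_fan hq le_rfl (R_pow_smul_mem_fan hq j hz)
      · rw [e, h, mul_smul, mul_smul]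
    · refine Or.inr ⟨k, hk, hkq, fun z hz => ?_⟩
      obtain ⟨y, hy, h'⟩ := h z hz
      refine ⟨S • ((w * S) • z), ?_, ?_⟩
      · rw [S_smul_re_nonpos, h']
        exact (re_R_pow_smul_pos hq (mem_sector_of_re_nonpos hq hy) hj hjq).le
      · rw [e, mul_smul, mul_smul]

/-- An element of the Hecke group is a rotation `R ^ k`, or it maps the `q`-gon beyond an even line
bounding the `q`-gon. -/
theorem R_pow_or_beyond (hq : 3 ≤ q) {g : PSL(2, ℝ)} (hg : g ∈ heckeGroup q) :
    (∃ k < q, g = R q ^ k) ∨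
      ∃ k < q, ∀ z ∈ fan q q, ∃ y : ℍ, y.re ≤ 0 ∧ g • z = R q ^ k • y := by
  obtain ⟨w, hw, h⟩ := hasNormalForm hq hg
  have pos : ∀ z ∈ fan q q, 0 ≤ (w • z).re := fun z hz =>
    hw.re_nonneg hq (re_nonneg_of_mem_fan hq le_rfl hz)
  have posS := hw.mul_S hq
  rcases h with rfl | rfl | rfl | rfl
  · cases hw with
    | one => exact Or.inl ⟨0, by omega, by simp⟩
    | cons k w hk hkq hw =>
      refine Or.inr ⟨k, hkq, fun z hz => ⟨S • w • z, ?_, ?_⟩⟩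
      · rw [S_smul_re_nonpos]
        exact hw.re_nonneg hq (re_nonneg_of_mem_fan hq le_rfl hz)
      · rw [mul_smul, mul_smul]
  · refine Or.inr ⟨0, by omega, fun z hz => ⟨(S * w) • z, ?_, by simp⟩⟩
    rw [mul_smul, S_smul_re_nonpos]
    exact pos z hz
  · rcases posS with rfl | ⟨k, hk, hkq, h⟩ | ⟨k, hk, hkq, h⟩
    · refine Or.inr ⟨0, by omega, fun z hz => ⟨S • z, ?_, by simp⟩⟩
      rw [S_smul_re_nonpos]
      exact re_nonneg_of_mem_fan hq le_rfl hz
    · exact Or.inl ⟨k, hkq, h⟩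
    · exact Or.inr ⟨k, hkq, h⟩
  · have key : ∀ z ∈ fan q q, w = 1 ∨ 0 ≤ ((w * S) • z).re := by
      intro z hz
      rcases posS with h | ⟨k, hk, hkq, h⟩ | ⟨k, hk, hkq, h⟩
      · exact Or.inl h
      · right; rw [h]
        exact re_nonneg_of_mem_fan hq le_rfl (R_pow_smul_mem_fan hq k hz)
      · right
        obtain ⟨y, hy, h⟩ := h z hz
        rw [h]
        exact (re_R_pow_smul_pos hq (mem_sector_of_re_nonpos hq hy) hk hkq).le
    by_cases hw1 : w = 1
    · exact Or.inl ⟨0, by omega, by simp [hw1, S_mul_S]⟩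
    · refine Or.inr ⟨0, by omega, fun z hz => ⟨(S * w * S) • z, ?_, by simp⟩⟩
      rw [mul_assoc, mul_smul, S_smul_re_nonpos]
      exact (key z hz).resolve_left hw1

theorem fan_one_side (hq : 3 ≤ q) {g : PSL(2, ℝ)} (hg : g ∈ heckeGroup q) :
    (∀ z ∈ fan q q, 0 ≤ (g • z).re) ∨ (∀ z ∈ fan q q, (g • z).re ≤ 0) := by
  rcases R_pow_or_beyond hq hg with ⟨k, hk, rfl⟩ | ⟨k, hk, h⟩
  · exact Or.inl fun z hz => re_nonneg_of_mem_fan hq le_rfl (R_pow_smul_mem_fan hq k hz)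
  · rcases Nat.eq_zero_or_pos k with rfl | hk0
    · right; intro z hz
      obtain ⟨y, hy, h⟩ := h z hz
      rw [h]; simpa using hy
    · left; intro z hz
      obtain ⟨y, hy, h⟩ := h z hz
      rw [h]
      exact (re_R_pow_smul_pos hq (mem_sector_of_re_nonpos hq hy) hk0 hk).le

theorem tau_mem_fan (hq : 3 ≤ q) : tau q ∈ fan q q :=
  triangle_subset_fan (by omega) (openTriangle_subset hq (tau_mem hq))

/-- The point `y √-1`. -/
noncomputable def iPt (y : ℝ) (hy : 0 < y) : ℍ := ⟨⟨0, y⟩, hy⟩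

theorem iPt_re (y : ℝ) (hy : 0 < y) : (iPt y hy).re = 0 := rfl
theorem iPt_im (y : ℝ) (hy : 0 < y) : (iPt y hy).im = y := rfl

theorem mem_fan_of_re_eq_zero (hq : 3 ≤ q) {z : ℍ} (h : z.re = 0) : z ∈ fan q q :=
  triangle_subset_fan (by omega) (baseLine_subset_triangle hq h)

theorem not_fan_in_line (hq : 3 ≤ q) (g : PSL(2, ℝ)) : ¬ ∀ z ∈ fan q q, (g • z).re = 0 := by
  induction g using QuotientGroup.induction_on with
  | H A =>
    intro h
    have h1 := re_sl_smul A (iPt 1 one_pos)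
    have h2 := re_sl_smul A (iPt 2 two_pos)
    have h3 := re_sl_smul A (tau q)
    have e1 : (A • iPt 1 one_pos).re = 0 := h _ (mem_fan_of_re_eq_zero hq (iPt_re _ _))
    have e2 : (A • iPt 2 two_pos).re = 0 := h _ (mem_fan_of_re_eq_zero hq (iPt_re _ _))
    have e3 : (A • tau q).re = 0 := h _ (tau_mem_fan hq)
    rw [e1, iPt_re, iPt_im] at h1
    rw [e2, iPt_re, iPt_im] at h2
    rw [e3, tau_re, tau_im] at h3
    have hac : A 0 0 * A 1 0 = 0 := by nlinarith
    have hbd : A 0 1 * A 1 1 = 0 := by nlinarith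
    have hl := one_le_lam hq
    have h4 : (A 0 0 * A 1 1 + A 0 1 * A 1 0) * (lam q / 4) = 0 := by
      rw [hac, hbd] at h3; linarith
    have h5 : A 0 0 * A 1 1 + A 0 1 * A 1 0 = 0 := by
      rcases mul_eq_zero.1 h4 with h | h
      · exact h
      · linarith
    have hd := det_eq A
    have h6 : A 0 0 * A 1 1 = 1 / 2 := by linarith
    have h7 : A 1 0 = 0 := by
      rcases mul_eq_zero.1 hac with h | h
      · rw [h] at h6; norm_num at h6
      · exact h
    rw [h7] at hd; linarith

/-- Two triangles of the tessellation meet only if they belong to the same `q`-gon or share an even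
line. -/
theorem meet_cases (hq : 3 ≤ q) {g : PSL(2, ℝ)} (hg : g ∈ heckeGroup q) {z w : ℍ}
    (hz : z ∈ triangle q) (hw : w ∈ triangle q) (h : z = g • w) :
    (∃ k < q, g = R q ^ k) ∨ (g = S ∧ z.re = 0) := by
  rcases R_pow_or_beyond hq hg with h1 | ⟨k, hk, h1⟩
  · exact Or.inl h1
  right
  have hwQ : w ∈ fan q q := triangle_subset_fan (by omega) hw
  have hz' := (mem_triangle_iff hq z).1 hz
  have beyond : ∀ {z y : ℍ} {k : ℕ}, k < q → z ∈ sector q 0 → y.re ≤ 0 → z = R q ^ k • y →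
      k = 0 := by
    intro z y k hk hz hy h
    by_contra hk0
    have e : y = R q ^ (q - k) • z := by
      rw [h, ← mul_smul, ← pow_add, Nat.sub_add_cancel hk.le, R_pow_q hq, one_smul]
    have := re_R_pow_smul_pos hq hz (k := q - k) (by omega) (by omega)
    rw [← e] at this
    linarith
  obtain ⟨y, hy, h2⟩ := h1 w hwQ
  rw [← h] at h2
  obtain rfl := beyond hk hz'.2 hy h2
  have hz0 : z.re = 0 := by
    rw [h2] at hz' ⊢
    simp only [pow_zero, one_smul] at hz' ⊢
    linarith [hz'.1]
  refine ⟨?_, hz0⟩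
  have hSz : (S • z).re ≤ 0 := (S_smul_re_nonpos z).2 hz0.ge
  have hSz' : 0 ≤ (S • z).re := (S_smul_re_nonneg z).2 hz0.le
  have hSzs := mem_sector_of_re_nonpos hq hSz
  rcases R_pow_or_beyond hq ((heckeGroup q).mul_mem S_mem hg) with ⟨j, hj, h3⟩ | ⟨j, hj, h3⟩
  · have hj0 : j = 0 := by
      by_contra hj0
      have h4 : S • z = R q ^ j • w := by rw [h, ← mul_smul, h3]
      have := re_R_pow_smul_pos hq ((mem_triangle_iff hq w).1 hw).2 (k := j) (by omega) hj
      rw [← h4] at this; linarith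
    rw [hj0, pow_zero] at h3
    exact (eq_inv_of_mul_eq_one_right h3).trans S_inv
  · exfalso
    obtain ⟨y', hy', h4⟩ := h3 w hwQ
    rw [mul_smul, ← h] at h4
    obtain rfl := beyond hj hSzs hy' h4
    refine not_fan_in_line hq g fun x hx => ?_
    obtain ⟨a, ha, ha'⟩ := h1 x hx
    obtain ⟨b, hb, hb'⟩ := h3 x hx
    rw [pow_zero, one_smul] at ha' hb'
    rw [← hb', mul_smul, S_smul_re_nonpos] at hb
    rw [← ha'] at ha
    linarith

theorem eq_one_of_openTriangle (hq : 3 ≤ q) {g : PSL(2, ℝ)} (hg : g ∈ heckeGroup q) {z w : ℍ}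
    (hz : z ∈ openTriangle q) (hw : w ∈ triangle q) (h : z = g • w) : g = 1 := by
  rcases meet_cases hq hg (openTriangle_subset hq hz) hw h with ⟨k, hk, rfl⟩ | ⟨-, h0⟩
  · rcases Nat.eq_zero_or_pos k with rfl | hk0
    · simp
    · exfalso
      apply not_mem_sector_of_interior hq hz.2.1 hz.2.2 hk0 hk
      rw [h, R_pow_smul_mem_sector]
      exact ((mem_triangle_iff hq w).1 hw).2
  · exact absurd h0 hz.1.ne'

theorem eq_one_or_S (hq : 3 ≤ q) {g : PSL(2, ℝ)} (hg : g ∈ heckeGroup q) {z w : ℍ}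
    (hz : z.re = 0) (hw : w ∈ triangle q) (h : z = g • w) : g = 1 ∨ g = S := by
  rcases meet_cases hq hg (baseLine_subset_triangle hq hz) hw h with ⟨k, hk, rfl⟩ | ⟨h1, -⟩
  · rcases Nat.eq_zero_or_pos k with rfl | hk0
    · simp
    · exfalso
      have := re_R_pow_smul_pos hq ((mem_triangle_iff hq w).1 hw).2 hk0 hk
      rw [← h] at this; linarith
  · exact Or.inr h1

theorem line_eq (hq : 3 ≤ q) {g : PSL(2, ℝ)} (hg : g ∈ heckeGroup q) {z w : ℍ}
    (hz : z.re = 0) (hw : w.re = 0) (h : z = g • w) : g = 1 ∨ g = S :=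
  eq_one_or_S hq hg hz (baseLine_subset_triangle hq hw) h

theorem mem_baseOddEdge_iff (hq : 3 ≤ q) (z : ℍ) :
    z ∈ baseOddEdge q ↔ z ∈ triangle q ∧ ray q 0 z = 0 := by
  rw [mem_triangle_iff hq, baseOddEdge, Set.mem_ofPred_eq, ray_zero hq]
  have hc := rho_re_pos hq
  rw [rho_re] at hc
  have hs := sin_theta_pos hq
  have h1 := Real.sin_sq_add_cos_sq (Real.pi / q)
  constructor
  · rintro ⟨h2, h3⟩
    refine ⟨⟨by rw [h2]; exact hc.le, mem_sector_zero ?_ ?_⟩, ?_⟩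
    · rw [ray_zero hq, h2, lam]; linarith
    · have h4 := pow_le_pow_left₀ hs.le h3 2
      have h5 := mul_le_mul_of_nonneg_left h4 hc.le
      rw [ray_one hq, h2, lam]
      nlinarith
    · rw [h2, lam]; ring
  · rintro ⟨⟨h2, h3⟩, h4⟩
    have h5 := (ray_of_mem_sector_zero h3).2
    have h6 : z.re = Real.cos (Real.pi / q) := by rw [lam] at h4; linarith
    refine ⟨h6, ?_⟩
    rw [ray_one hq, h6, lam] at h5
    have h7 : 1 ≤ Real.cos (Real.pi / q) ^ 2 + z.im ^ 2 := by nlinarith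
    exact (sq_le_sq₀ hs.le z.im_pos.le).1 (by linarith)

theorem eq_rho_of_rays (hq : 3 ≤ q) {z : ℍ} (h0 : ray q 0 z = 0) (h1 : ray q 1 z = 0) :
    z = rho hq := by
  have h : z.re = Real.cos (Real.pi / q) := by rw [ray_zero hq, lam] at h0; linarith
  have hc := rho_re_pos hq
  rw [rho_re] at hc
  have hs := sin_theta_pos hq
  have h2 := Real.sin_sq_add_cos_sq (Real.pi / q)
  apply UpperHalfPlane.ext_re_im
  · rw [h, rho_re]
  · rw [rho_im]
    apply (sq_eq_sq₀ z.im_pos.le hs.le).1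
    rw [ray_one hq, h, lam] at h1
    have : Real.cos (Real.pi / q) * (Real.cos (Real.pi / q) ^ 2 + z.im ^ 2 - 1) = 0 := by linarith
    rcases mul_eq_zero.1 this with h | h <;> linarith

theorem R_inv_eq_pow (hq : 3 ≤ q) : (R q)⁻¹ = R q ^ (q - 1) := by
  apply inv_eq_of_mul_eq_one_left
  rw [← pow_succ, show q - 1 + 1 = q by omega, R_pow_q hq]

/-- Only two triangles contain a given point of an odd edge other than its odd vertex. -/
theorem eq_one_or_R_inv (hq : 3 ≤ q) {g : PSL(2, ℝ)} (hg : g ∈ heckeGroup q) {z w : ℍ}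
    (hz : z ∈ baseOddEdge q) (hz' : z ≠ rho hq) (hw : w ∈ triangle q) (h : z = g • w) :
    g = 1 ∨ g = (R q)⁻¹ := by
  obtain ⟨hzt, h0⟩ := (mem_baseOddEdge_iff hq z).1 hz
  rcases meet_cases hq hg hzt hw h with ⟨k, hk, rfl⟩ | ⟨-, h2⟩
  · rcases Nat.eq_zero_or_pos k with rfl | hk0
    · simp
    · have hzk : z ∈ sector q k := by
        rw [h, R_pow_smul_mem_sector]; exact ((mem_triangle_iff hq w).1 hw).2
      rcases sector_inter hq hk0 hk ((mem_triangle_iff hq z).1 hzt).2 hzk with h3 | h3 | h3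
      · exact absurd h3 hz'
      · exact absurd (eq_rho_of_rays hq h0 h3.2) hz'
      · right; rw [h3.1, R_inv_eq_pow hq]
  · exfalso
    have : z.re = Real.cos (Real.pi / q) := hz.1
    have hc := rho_re_pos hq
    rw [rho_re] at hc; linarith

theorem rho_not_mem_line (hq : 3 ≤ q) {g : PSL(2, ℝ)} (hg : g ∈ heckeGroup q) :
    (g • rho hq).re ≠ 0 := by
  intro h0
  have := rho_re_pos hq
  rcases eq_one_or_S hq hg h0 (rho_mem_triangle hq) rfl with rfl | rfl
  · rw [one_smul] at h0; linarith
  · have := (S_smul_re_nonneg (rho hq)).1 h0.ge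
    linarith

/-- An odd vertex in the triangle `Φ` is the vertex of `Φ`. -/
theorem odd_vertex_in_triangle (hq : 3 ≤ q) {g : PSL(2, ℝ)} (hg : g ∈ heckeGroup q)
    (h : g • rho hq ∈ triangle q) : ∃ k < q, g = R q ^ k := by
  rcases meet_cases hq hg h (rho_mem_triangle hq) rfl with h | h
  · exact h
  · exact absurd h.2 (rho_not_mem_line hq hg)

end

/-! ### Sides of the base line -/

section
variable {q : ℕ}

/-- The triangle `g Φ` lies in the right half plane. -/
def Pos (g : Gam q) : Prop := 0 < (g • tau q).re

theorem gam_smul_def (g : Gam q) (z : ℍ) : g • z = (g : PSL(2, ℝ)) • z := rfl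
theorem gS_smul (z : ℍ) : gS q • z = S • z := rfl
theorem gR_pow_smul (k : ℕ) (z : ℍ) : gR q ^ k • z = R q ^ k • z := rfl
theorem gS_mul_gS : gS q * gS q = 1 := Subtype.ext S_mul_S
theorem gS_inv : (gS q)⁻¹ = gS q := Subtype.ext S_inv
theorem gR_pow_q (hq : 3 ≤ q) : gR q ^ q = 1 := Subtype.ext (R_pow_q hq)

theorem gR_pow_mod (hq : 3 ≤ q) (k : ℕ) : gR q ^ (k % q) = gR q ^ k := Subtype.ext (R_pow_mod hq k)

theorem mul_gS_mul_gS (g : Gam q) : g * gS q * gS q = g := by rw [mul_assoc, gS_mul_gS, mul_one]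

theorem gR_pow_inv (hq : 3 ≤ q) {k : ℕ} (hk : k ≤ q) : (gR q ^ k)⁻¹ = gR q ^ (q - k) := by
  apply inv_eq_of_mul_eq_one_left
  rw [← pow_add, Nat.sub_add_cancel hk, gR_pow_q hq]

theorem mem_triangle_tau (hq : 3 ≤ q) : tau q ∈ triangle q := openTriangle_subset hq (tau_mem hq)

theorem pos_one (hq : 3 ≤ q) : Pos (1 : Gam q) := by
  rw [Pos, one_smul]; exact (tau_mem hq).1

theorem re_smul_tau_ne_zero (hq : 3 ≤ q) (g : Gam q) : (g • tau q).re ≠ 0 := by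
  intro h0
  have := (tau_mem hq).1
  rcases eq_one_or_S hq g.2 h0 (mem_triangle_tau hq) rfl with h | h
  · rw [gam_smul_def, h, one_smul] at h0; linarith
  · rw [gam_smul_def, h] at h0
    have := (S_smul_re_nonneg _).1 h0.ge
    linarith

theorem not_pos_iff (hq : 3 ≤ q) (g : Gam q) : ¬ Pos g ↔ (g • tau q).re < 0 := by
  rw [Pos, not_lt]
  exact ⟨fun h => lt_of_le_of_ne h (re_smul_tau_ne_zero hq g), le_of_lt⟩

theorem Pos.re_nonneg (hq : 3 ≤ q) {g : Gam q} (h : Pos g) {z : ℍ} (hz : z ∈ fan q q) :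
    0 ≤ (g • z).re := by
  rcases fan_one_side hq g.2 with h1 | h1
  · exact h1 z hz
  · exact absurd h (not_lt.2 (h1 _ (tau_mem_fan hq)))

theorem re_nonpos_of_not_pos (hq : 3 ≤ q) {g : Gam q} (h : ¬ Pos g) {z : ℍ} (hz : z ∈ fan q q) :
    (g • z).re ≤ 0 := by
  rcases fan_one_side hq g.2 with h1 | h1
  · have := h1 _ (tau_mem_fan hq)
    exact absurd ((not_pos_iff hq g).1 h) (not_lt.2 this)
  · exact h1 z hz

theorem pos_S_mul (hq : 3 ≤ q) (g : Gam q) : Pos (gS q * g) ↔ ¬ Pos g := by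
  rw [not_pos_iff hq, Pos, mul_smul, gS_smul]
  have := S_smul_re (g • tau q)
  have := normSq_pos (g • tau q)
  constructor <;> intro h <;> nlinarith

theorem not_pos_S (hq : 3 ≤ q) : ¬ Pos (gS q) := by
  have := pos_S_mul hq (1 : Gam q)
  rw [mul_one] at this
  rw [this, not_not]; exact pos_one hq

theorem pos_mul_R_pow (hq : 3 ≤ q) (g : Gam q) (k : ℕ) : Pos (g * gR q ^ k) ↔ Pos g := by
  have hm := R_pow_smul_mem_fan hq k (tau_mem_fan hq)
  have h2 := re_smul_tau_ne_zero hq (g * gR q ^ k)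
  have e : (g * gR q ^ k) • tau q = g • (R q ^ k • tau q) := by rw [mul_smul, gR_pow_smul]
  constructor
  · intro h
    by_contra hc
    have := re_nonpos_of_not_pos hq hc hm
    rw [Pos, e] at h; linarith
  · intro h
    have := h.re_nonneg hq hm
    rw [Pos, e]
    rw [e] at h2
    exact lt_of_le_of_ne this h2.symm

theorem pos_R_pow (hq : 3 ≤ q) (k : ℕ) : Pos (gR q ^ k) := by
  have := pos_mul_R_pow hq (1 : Gam q) k
  rw [one_mul] at this
  exact this.2 (pos_one hq)

theorem pos_mul_S (hq : 3 ≤ q) {g : Gam q} (h1 : g ≠ 1) (hS : g ≠ gS q) :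
    Pos (g * gS q) ↔ Pos g := by
  have key : (g • iPt 1 one_pos).re ≠ 0 := by
    intro h0
    rcases line_eq hq g.2 h0 (iPt_re 1 one_pos) rfl with h | h
    · exact h1 (Subtype.ext h)
    · exact hS (Subtype.ext h)
  have e : (g * gS q) • (S • iPt 1 one_pos) = g • iPt 1 one_pos := by
    rw [mul_smul, gS_smul, S_smul_S_smul]
  have m1 : iPt 1 one_pos ∈ fan q q := mem_fan_of_re_eq_zero hq (iPt_re 1 one_pos)
  have m2 : S • iPt 1 one_pos ∈ fan q q := by
    apply mem_fan_of_re_eq_zero hq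
    have := S_smul_re (iPt 1 one_pos)
    simpa [iPt_re, iPt_im] using this
  constructor
  · intro h
    by_contra hc
    have a := re_nonpos_of_not_pos hq hc m1
    have b := h.re_nonneg hq m2
    rw [e] at b
    exact key (le_antisymm a b)
  · intro h
    by_contra hc
    have a := re_nonpos_of_not_pos hq hc m2
    have b := h.re_nonneg hq m1
    rw [e] at a
    exact key (le_antisymm a b)

theorem pos_R_pow_mul (hq : 3 ≤ q) {g : Gam q} (h : ¬ Pos g) {k : ℕ} (hk : 0 < k) (hkq : k < q) :
    Pos (gR q ^ k * g) := by
  rw [Pos, mul_smul, gR_pow_smul]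
  rw [not_pos_iff hq] at h
  exact re_R_pow_smul_pos hq (mem_sector_of_re_nonpos hq h.le) hk hkq

theorem R_pow_or_not_pos (hq : 3 ≤ q) (g : Gam q) :
    ∃ k < q, g = gR q ^ k ∨ ¬ Pos ((gR q ^ k)⁻¹ * g) := by
  rcases R_pow_or_beyond hq g.2 with ⟨k, hk, h⟩ | ⟨k, hk, h⟩
  · exact ⟨k, hk, Or.inl (Subtype.ext h)⟩
  · refine ⟨k, hk, Or.inr ?_⟩
    obtain ⟨y, hy, h⟩ := h _ (tau_mem_fan hq)
    rw [Pos, not_lt, mul_smul]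
    have : (gR q ^ k)⁻¹ • g • tau q = y := by
      rw [inv_smul_eq_iff]; exact h
    rw [this]; exact hy

/-- Even lines do not cross: the line of a triangle on one side of the base line bounds a half plane
contained in that side. -/
theorem Pos.nested (hq : 3 ≤ q) {g : Gam q} (hg : Pos g) :
    (∀ h : Gam q, Pos (g⁻¹ * h) → Pos h) ∨ (∀ h : Gam q, ¬ Pos (g⁻¹ * h) → Pos h) := by
  obtain ⟨w, hw, hgw⟩ := hasNormalForm hq g.2
  have key : ∀ (h : Gam q), 0 ≤ (h • tau q).re → Pos h := fun h h0 =>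
    lt_of_le_of_ne h0 (re_smul_tau_ne_zero hq h).symm
  have htau : 0 ≤ (tau q).re := (tau_mem hq).1.le
  rcases hgw with e | e | e | e
  · left
    intro h hp
    apply key
    have : h • tau q = w • ((g⁻¹ * h) • tau q) := by
      rw [← e, mul_smul]; exact (smul_inv_smul g _).symm
    rw [this]
    exact hw.re_nonneg hq hp.le
  · exfalso
    have : g • tau q = S • w • tau q := by rw [gam_smul_def, e, mul_smul]
    rw [Pos, this] at hg
    have := (S_smul_re_nonpos _).2 (hw.re_nonneg hq htau)
    linarith
  · right
    intro h hp
    apply key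
    have : h • tau q = w • (S • ((g⁻¹ * h) • tau q)) := by
      rw [← mul_smul, ← e, mul_smul]; exact (smul_inv_smul g _).symm
    rw [this]
    apply hw.re_nonneg hq
    rw [S_smul_re_nonneg]
    rw [Pos, not_lt] at hp
    exact hp
  · have e' : g • tau q = S • ((w * S) • tau q) := by
      rw [gam_smul_def, e, mul_assoc, mul_smul]
    rcases hw.mul_S hq with rfl | ⟨k, hk, hkq, h⟩ | ⟨k, hk, hkq, h⟩
    · left
      intro h hp
      have : g = 1 := Subtype.ext (by rw [e]; simp [S_mul_S])
      simpa [this] using hp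
    · exfalso
      rw [h] at e'
      have := (S_smul_re_nonpos (R q ^ k • tau q)).2
        (re_nonneg_of_mem_fan hq le_rfl (R_pow_smul_mem_fan hq k (tau_mem_fan hq)))
      rw [Pos, e'] at hg; linarith
    · exfalso
      obtain ⟨y, hy, h⟩ := h _ (tau_mem_fan hq)
      have h1 := (re_R_pow_smul_pos hq (mem_sector_of_re_nonpos hq hy) hk hkq).le
      rw [← h] at h1
      have := (S_smul_re_nonpos _).2 h1
      rw [Pos, e'] at hg; linarith

theorem R_pow_ne_one (hq : 3 ≤ q) {k : ℕ} (hk : 0 < k) (hkq : k < q) : gR q ^ k ≠ 1 := by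
  intro h
  have h1 := pos_R_pow_mul hq (not_pos_S hq) hk hkq
  rw [h, one_mul] at h1
  exact not_pos_S hq h1

theorem R_pow_injective (hq : 3 ≤ q) {j k : ℕ} (hj : j < q) (hk : k < q)
    (h : gR q ^ j = gR q ^ k) : j = k := by
  wlog hjk : j ≤ k generalizing j k with H
  · exact (H hk hj h.symm (by omega)).symm
  by_contra hne
  apply R_pow_ne_one hq (k := k - j) (by omega) (by omega)
  have : gR q ^ k = gR q ^ (k - j) * gR q ^ j := by rw [← pow_add]; congr 1; omega
  rw [this] at h
  exact (mul_eq_right.1 h.symm)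

theorem gS_ne_one (hq : 3 ≤ q) : gS q ≠ 1 := fun h => not_pos_S hq (h ▸ pos_one hq)

/-! ### Branches of the tree of triangles -/

/-- The triangle `g Φ` and all triangles beyond its even line. -/
def branch (g : Gam q) : Set (Gam q) := {h | h = g ∨ ¬ Pos (g⁻¹ * h)}

theorem self_mem_branch (g : Gam q) : g ∈ branch g := Or.inl rfl

theorem mul_S_mem_branch (hq : 3 ≤ q) {g h : Gam q} (hh : h ∈ branch g) : h * gS q ∈ branch g := by
  rcases hh with rfl | hh
  · right; rw [← mul_assoc, inv_mul_cancel, one_mul]; exact not_pos_S hq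
  · by_cases h1 : g⁻¹ * h = 1
    · rw [h1] at hh; exact absurd (pos_one hq) hh
    by_cases h2 : g⁻¹ * h = gS q
    · left
      rw [inv_mul_eq_iff_eq_mul] at h2
      rw [h2, mul_gS_mul_gS]
    · right
      rw [← mul_assoc, pos_mul_S hq h1 h2]; exact hh

theorem mul_R_pow_mem_branch (hq : 3 ≤ q) {g h : Gam q} (hh : h ∈ branch g) (hne : h ≠ g) (k : ℕ) :
    h * gR q ^ k ∈ branch g := by
  right
  rw [← mul_assoc, pos_mul_R_pow hq]
  exact hh.resolve_left hne

theorem exists_mem_branch (hq : 3 ≤ q) (g h : Gam q) : ∃ k < q, h ∈ branch (g * gR q ^ k) := by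
  obtain ⟨k, hk, h'⟩ := R_pow_or_not_pos hq (g⁻¹ * h)
  refine ⟨k, hk, h'.imp ?_ ?_⟩
  · intro h; rw [← h]; group
  · intro h; rw [mul_inv_rev, mul_assoc]; exact h

theorem pos_of_mem_branch (hq : 3 ≤ q) {g h : Gam q} {j k : ℕ} (hj : j < q) (hk : k < q)
    (hjk : j ≠ k) (hh : h ∈ branch (g * gR q ^ k)) : Pos ((g * gR q ^ j)⁻¹ * h) := by
  have e : ∀ x : Gam q, (g * gR q ^ j)⁻¹ * (g * gR q ^ k * x) = gR q ^ ((q - j + k) % q) * x := by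
    intro x
    rw [gR_pow_mod hq, pow_add, mul_inv_rev, gR_pow_inv hq hj.le]; group
  rcases hh with rfl | hh
  · have := e 1
    rw [mul_one, mul_one] at this
    rw [this]; exact pos_R_pow hq _
  · have := e ((g * gR q ^ k)⁻¹ * h)
    rw [mul_inv_cancel_left] at this
    rw [this]
    refine pos_R_pow_mul hq hh ?_ (Nat.mod_lt _ (by omega))
    apply Nat.pos_of_ne_zero
    intro h0
    have := Nat.dvd_of_mod_eq_zero h0
    obtain ⟨c, hc⟩ := this
    have : c < 2 := by
      by_contra h2; push Not at h2
      have := Nat.mul_le_mul_left q h2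
      omega
    interval_cases c <;> omega

theorem branch_disjoint (hq : 3 ≤ q) {g h : Gam q} {j k : ℕ} (hj : j < q) (hk : k < q)
    (h1 : h ∈ branch (g * gR q ^ j)) (h2 : h ∈ branch (g * gR q ^ k)) : j = k := by
  by_contra hjk
  have h3 := pos_of_mem_branch hq hj hk hjk h2
  have h4 := pos_of_mem_branch hq hk hj (Ne.symm hjk) h1
  rcases h1 with h1 | h1
  · rcases h2 with h2 | h2
    · rw [h1] at h2
      exact hjk (R_pow_injective hq hj hk (mul_left_cancel h2))
    · exact h2 h4
  · exact h1 h3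

/-! ### Boundary pieces -/

/-- The triangles beyond a boundary piece: the half plane beyond the line of `g` for `r = 0`, and
the complementary sector together with all that lies beyond it for an `r`-cluster. -/
def beyond (g : Gam q) (r : ℕ) : Set (Gam q) :=
  {h | (r = 0 ∧ Pos (g⁻¹ * h)) ∨ (1 ≤ r ∧ ∃ k, r ≤ k ∧ k < q ∧ h ∈ branch (g * gR q ^ k))}

/-- The boundary pieces of a set of triangles: for `r = 0`, an even line with `g Φ` outside and
`g S Φ` inside; for `r ≥ 1`, an `r`-cluster `g Φ_r` whose complement in the `q`-gon is outside. -/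
def IsPiece (𝒢 : Set (Gam q)) (g : Gam q) (r : ℕ) : Prop :=
  (r = 0 ∧ g ∉ 𝒢 ∧ g * gS q ∈ 𝒢) ∨
    (r ∣ q ∧ 1 ≤ r ∧ r < q ∧ ∀ k < q, g * gR q ^ k ∈ 𝒢 ↔ k < r)

theorem mem_beyond_zero {g h : Gam q} : h ∈ beyond g 0 ↔ Pos (g⁻¹ * h) := by simp [beyond]

theorem mem_beyond_of_one_le {g h : Gam q} {r : ℕ} (hr : 1 ≤ r) :
    h ∈ beyond g r ↔ ∃ k, r ≤ k ∧ k < q ∧ h ∈ branch (g * gR q ^ k) := by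
  simp only [beyond, Set.mem_ofPred_eq]
  constructor
  · rintro (⟨h0, -⟩ | ⟨-, h⟩)
    · omega
    · exact h
  · exact fun h => Or.inr ⟨hr, h⟩

theorem mul_S_mem_beyond (hq : 3 ≤ q) {g h : Gam q} {r : ℕ} (hr : 1 ≤ r) (hh : h ∈ beyond g r) :
    h * gS q ∈ beyond g r := by
  rw [mem_beyond_of_one_le hr] at hh ⊢
  obtain ⟨k, h1, h2, h3⟩ := hh
  exact ⟨k, h1, h2, mul_S_mem_branch hq h3⟩

theorem mul_S_mem_beyond_zero (hq : 3 ≤ q) {g h : Gam q} (hh : h ∈ beyond g 0) (hne : h ≠ g) :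
    h * gS q ∈ beyond g 0 := by
  rw [mem_beyond_zero] at hh ⊢
  rw [← mul_assoc, pos_mul_S hq]
  · exact hh
  · intro h; rw [inv_mul_eq_one] at h; exact hne h.symm
  · intro h; rw [h] at hh; exact not_pos_S hq hh

theorem mul_R_pow_mem_beyond_zero (hq : 3 ≤ q) {g h : Gam q} (hh : h ∈ beyond g 0) (k : ℕ) :
    h * gR q ^ k ∈ beyond g 0 := by
  rw [mem_beyond_zero] at hh ⊢
  rw [← mul_assoc, pos_mul_R_pow hq]; exact hh

theorem mul_R_pow_mem_beyond (hq : 3 ≤ q) {g h : Gam q} {r : ℕ} (hh : h ∈ beyond g r)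
    (hne : r = 0 ∨ ∀ j, h ≠ g * gR q ^ j) (k : ℕ) : h * gR q ^ k ∈ beyond g r := by
  rcases Nat.eq_zero_or_pos r with rfl | hr
  · exact mul_R_pow_mem_beyond_zero hq hh k
  · have hne := hne.resolve_left hr.ne'
    rw [mem_beyond_of_one_le hr] at hh ⊢
    obtain ⟨j, h1, h2, h3⟩ := hh
    exact ⟨j, h1, h2, mul_R_pow_mem_branch hq h3 (hne j) k⟩

theorem mul_R_pow_mem_beyond_iff (hq : 3 ≤ q) {g : Gam q} {r k : ℕ} (hr : 1 ≤ r) (hk : k < q) :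
    g * gR q ^ k ∈ beyond g r ↔ r ≤ k := by
  rw [mem_beyond_of_one_le hr]
  constructor
  · rintro ⟨j, h1, h2, h3⟩
    rwa [branch_disjoint hq hk h2 (self_mem_branch _) h3]
  · exact fun h => ⟨k, h, hk, self_mem_branch _⟩

/-- The combinatorial form of a convex union of finitely many tiles: a finite set of triangles which
meets each `q`-gon in all of it, in a cluster or not at all, and which contains the triangles along
every even line separating two of its elements. -/
structure IsTriangulated (𝒢 : Set (Gam q)) : Prop where
  tile : ∀ g ∈ 𝒢, (∀ k, g * gR q ^ k ∈ 𝒢) ∨ ∃ g₀ r j, IsPiece 𝒢 g₀ r ∧ j < r ∧ g = g₀ * gR q ^ j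
  convex : ∀ g h₁ h₂, h₁ ∈ 𝒢 → h₂ ∈ 𝒢 → Pos (g⁻¹ * h₁) → ¬ Pos (g⁻¹ * h₂) → g ∈ 𝒢

theorem IsTriangulated.disjoint_beyond (hq : 3 ≤ q) {𝒢 : Set (Gam q)} (h𝒢 : IsTriangulated 𝒢)
    {g h : Gam q} {r : ℕ} (hp : IsPiece 𝒢 g r) (hh : h ∈ beyond g r) : h ∉ 𝒢 := by
  intro hm
  rcases hp with ⟨rfl, h1, h2⟩ | ⟨-, hr, hrq, h1⟩
  · rw [mem_beyond_zero] at hh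
    refine h1 (h𝒢.convex g h _ hm h2 hh ?_)
    rw [inv_mul_cancel_left]; exact not_pos_S hq
  · rw [mem_beyond_of_one_le hr] at hh
    obtain ⟨k, hk, hkq, hh⟩ := hh
    have hk𝒢 : g * gR q ^ k ∉ 𝒢 := by rw [h1 k hkq]; omega
    rcases hh with rfl | hh
    · exact hk𝒢 hm
    · have hg : g ∈ 𝒢 := by
        have := (h1 0 (by omega)).2 hr
        simpa using this
      refine hk𝒢 (h𝒢.convex _ g h hg hm ?_ hh)
      have := pos_of_mem_branch hq (g := g) (h := g) (j := k) (k := 0) hkq (by omega) (by omega)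
        (by simpa using self_mem_branch g)
      exact this

/-- The Hecke group is generated by `S` and `R`, in a form suitable for walks from `1`. -/
theorem gam_induction {p : Gam q → Prop} (h1 : p 1) (hS : ∀ g, p g → p (g * gS q))
    (hR : ∀ g k, p g → p (g * gR q ^ k)) (hq : 3 ≤ q) (g : Gam q) : p g := by
  have key : ∀ w : PSL(2, ℝ), IsPosWord q w → ∀ g : Gam q, p g → ∀ h : Gam q, (h : PSL(2, ℝ)) = w →
      p (g * h) := by
    intro w hw
    induction hw with
    | one => intro g hg h hh; rw [show h = 1 from Subtype.ext hh, mul_one]; exact hg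
    | cons k w hk hkq hw ih =>
      intro g hg h hh
      have := ih (g * gR q ^ k * gS q) (hS _ (hR _ k hg)) ((gS q)⁻¹ * (gR q ^ k)⁻¹ * h) (by
        have : ((((gS q)⁻¹ * (gR q ^ k)⁻¹ * h : Gam q)) : PSL(2, ℝ)) = S⁻¹ * (R q ^ k)⁻¹ * h := rfl
        rw [this, hh]; group)
      convert this using 1; group
  obtain ⟨w, hw, h⟩ := hasNormalForm hq g.2
  have hw' : ∀ x : Gam q, (x : PSL(2, ℝ)) = w → p x := fun x hx => by
    simpa using key w hw 1 h1 x hx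
  have hw'' : ∀ x : Gam q, (x : PSL(2, ℝ)) = w → p (gS q * x) := fun x hx =>
    key w hw (gS q) (by simpa using hS 1 h1) x hx
  have hwmem : ∀ x : Gam q, (x : PSL(2, ℝ)) = w * S → ((x * gS q : Gam q) : PSL(2, ℝ)) = w := by
    intro x hx
    have : ((x * gS q : Gam q) : PSL(2, ℝ)) = x * S := rfl
    rw [this, hx, mul_assoc, S_mul_S, mul_one]
  have e0 : ((gS q * g : Gam q) : PSL(2, ℝ)) = S * g := rfl
  rcases h with h | h | h | h
  · exact hw' g h
  · have := hw'' (gS q * g) (by rw [e0, h, ← mul_assoc, S_mul_S, one_mul])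
    rwa [← mul_assoc, gS_mul_gS, one_mul] at this
  · have := hS _ (hw' (g * gS q) (hwmem g h))
    rwa [mul_gS_mul_gS] at this
  · have h' : ((gS q * g : Gam q) : PSL(2, ℝ)) = w * S := by
      rw [e0, h, ← mul_assoc, ← mul_assoc, S_mul_S, one_mul]
    have := hS _ (hw'' (gS q * g * gS q) (hwmem _ h'))
    rwa [← mul_assoc, ← mul_assoc, gS_mul_gS, one_mul, mul_gS_mul_gS] at this

/-- Every triangle outside lies beyond a boundary piece. -/
theorem IsTriangulated.exists_piece (hq : 3 ≤ q) {𝒢 : Set (Gam q)} (h𝒢 : IsTriangulated 𝒢)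
    (hbase : 1 ∈ 𝒢 ∨ gS q ∈ 𝒢) (h : Gam q) (hh : h ∉ 𝒢) : ∃ g r, IsPiece 𝒢 g r ∧ h ∈ beyond g r := by
  have hS : ∀ g, (g ∈ 𝒢 ∨ ∃ a r, IsPiece 𝒢 a r ∧ g ∈ beyond a r) →
      (g * gS q ∈ 𝒢 ∨ ∃ a r, IsPiece 𝒢 a r ∧ g * gS q ∈ beyond a r) := by
    rintro g (hg | ⟨a, r, hp, hg⟩)
    · by_cases hgS : g * gS q ∈ 𝒢
      · exact Or.inl hgS
      · refine Or.inr ⟨g * gS q, 0, Or.inl ⟨rfl, hgS, ?_⟩, ?_⟩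
        · rwa [mul_gS_mul_gS]
        · rw [mem_beyond_zero, inv_mul_cancel]; exact pos_one hq
    · rcases Nat.eq_zero_or_pos r with rfl | hr
      · by_cases hga : g = a
        · left; rw [hga]
          rcases hp with ⟨-, -, h⟩ | ⟨-, h, -⟩
          · exact h
          · omega
        · exact Or.inr ⟨a, 0, hp, mul_S_mem_beyond_zero hq hg hga⟩
      · exact Or.inr ⟨a, r, hp, mul_S_mem_beyond hq hr hg⟩
  have hR : ∀ g k, (g ∈ 𝒢 ∨ ∃ a r, IsPiece 𝒢 a r ∧ g ∈ beyond a r) →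
      (g * gR q ^ k ∈ 𝒢 ∨ ∃ a r, IsPiece 𝒢 a r ∧ g * gR q ^ k ∈ beyond a r) := by
    have hpiece : ∀ a r j, IsPiece 𝒢 a r → 1 ≤ r →
      (a * gR q ^ j ∈ 𝒢 ∨ ∃ a' r, IsPiece 𝒢 a' r ∧ a * gR q ^ j ∈ beyond a' r) := by
      intro a r j hp hr
      rcases hp with ⟨h, -⟩ | ⟨h1, h2, h3, h4⟩
      · omega
      have hj := Nat.mod_lt j (show q > 0 by omega)
      rw [← gR_pow_mod hq j]
      by_cases hjr : j % q < r
      · exact Or.inl ((h4 _ hj).2 hjr)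
      · exact Or.inr ⟨a, r, Or.inr ⟨h1, h2, h3, h4⟩,
          (mul_R_pow_mem_beyond_iff hq hr hj).2 (by omega)⟩
    rintro g k (hg | ⟨a, r, hp, hg⟩)
    · rcases h𝒢.tile g hg with h1 | ⟨g₀, r, j, hp, hj, rfl⟩
      · exact Or.inl (h1 k)
      · rw [mul_assoc, ← pow_add]
        exact hpiece _ _ _ hp (by omega)
    · by_cases hc : r = 0 ∨ ∀ j, g ≠ a * gR q ^ j
      · exact Or.inr ⟨a, r, hp, mul_R_pow_mem_beyond hq hg hc k⟩
      · push Not at hc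
        obtain ⟨hr, j, rfl⟩ := hc
        rw [mul_assoc, ← pow_add]
        exact hpiece _ _ _ hp (by omega)
  have h1 : (1 : Gam q) ∈ 𝒢 ∨ ∃ a r, IsPiece 𝒢 a r ∧ 1 ∈ beyond a r := by
    rcases hbase with h | h
    · exact Or.inl h
    · have := hS _ (Or.inl h)
      rwa [gS_mul_gS] at this
  exact (gam_induction (p := fun g => g ∈ 𝒢 ∨ ∃ a r, IsPiece 𝒢 a r ∧ g ∈ beyond a r)
    h1 hS hR hq h).resolve_left hh

theorem IsPiece.inner_mem {𝒢 : Set (Gam q)} {g : Gam q} {r : ℕ} (hp : IsPiece 𝒢 g r) (hr : 1 ≤ r) :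
    g ∈ 𝒢 := by
  rcases hp with ⟨rfl, -⟩ | ⟨h1, h2, h3, h4⟩
  · omega
  · simpa using (h4 0 (by omega)).2 hr

/-- Two boundary pieces of clusters in the same `q`-gon coincide. -/
theorem IsPiece.unique_in_gon (hq : 3 ≤ q) {𝒢 : Set (Gam q)} {g : Gam q} {r r' j : ℕ}
    (hp : IsPiece 𝒢 g r) (hr : 1 ≤ r) (hp' : IsPiece 𝒢 (g * gR q ^ j) r') (hr' : 1 ≤ r') :
    g * gR q ^ j = g ∧ r = r' := by
  obtain ⟨-, -, hrq, h1⟩ := hp.resolve_left (by omega)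
  obtain ⟨-, -, hrq', h2⟩ := hp'.resolve_left (by omega)
  rw [← gR_pow_mod hq j] at h2 ⊢
  have hj := Nat.mod_lt j (show q > 0 by omega)
  set m := j % q
  have hm : m = 0 := by
    by_contra hm
    have ha : m < r := (h1 m hj).1 (by simpa using (h2 0 (by omega)).2 hr')
    have hb : g * gR q ^ m * gR q ^ (q - 1) ∉ 𝒢 := by
      rw [h2 (q - 1) (by omega)]; omega
    rw [mul_assoc, ← pow_add, show m + (q - 1) = (m - 1) + q by omega, pow_add, gR_pow_q hq,
      mul_one] at hb
    exact hb ((h1 _ (by omega)).2 (by omega))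
  rw [hm, pow_zero, mul_one] at h2 ⊢
  refine ⟨rfl, ?_⟩
  rcases lt_trichotomy r r' with h | h | h
  · exact absurd ((h2 r hrq).2 h) (by rw [h1 r hrq]; omega)
  · exact h
  · exact absurd ((h1 r' hrq').2 h) (by rw [h2 r' hrq']; omega)

end

/-! ### The action on cusps -/

section
variable {q : ℕ}

theorem smul_infty_eq (A : SL(2, ℝ)) :
    (A : PSL(2, ℝ)) • (OnePoint.infty : OnePoint ℝ) = toPoint (A 0 0) (A 1 0) := by
  rw [mk_smul_onePoint, OnePoint.smul_infty_eq_ite, toPoint]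
  rfl

theorem smul_real_eq (A : SL(2, ℝ)) (x : ℝ) :
    (A : PSL(2, ℝ)) • (x : OnePoint ℝ) = toPoint (A 0 0 * x + A 0 1) (A 1 0 * x + A 1 1) := by
  rw [mk_smul_onePoint, OnePoint.smul_some_eq_ite, toPoint]
  rfl

/-- `c` is a positive real number. -/
def PosPt (c : OnePoint ℝ) : Prop := ∃ x : ℝ, 0 < x ∧ c = (x : OnePoint ℝ)

theorem posPt_coe {x : ℝ} : PosPt (x : OnePoint ℝ) ↔ 0 < x := by
  constructor
  · rintro ⟨y, hy, h⟩; rwa [OnePoint.coe_injective h]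
  · exact fun h => ⟨x, h, rfl⟩

theorem not_posPt_infty : ¬ PosPt (OnePoint.infty) := by
  rintro ⟨x, -, h⟩; exact OnePoint.infty_ne_coe x h

theorem posPt_toPoint {a b : ℝ} : PosPt (toPoint a b) ↔ 0 < a * b := by
  unfold toPoint
  split_ifs with h
  · simp [not_posPt_infty, h]
  · rw [posPt_coe]
    have hb : 0 < b ^ 2 := by positivity
    rw [← mul_pos_iff_of_pos_right hb]
    have : a / b * b ^ 2 = a * b := by field_simp
    rw [this]

theorem gam_smul_cusp (g : Gam q) (c : OnePoint ℝ) : g • c = (g : PSL(2, ℝ)) • c := rfl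

theorem gS_smul_infty : gS q • (OnePoint.infty : OnePoint ℝ) = ((0 : ℝ) : OnePoint ℝ) := by
  have := smul_infty_eq matS
  rw [gam_smul_cusp]
  refine this.trans ?_
  simp [matS_coe, toPoint]

theorem gS_smul_zero : gS q • ((0 : ℝ) : OnePoint ℝ) = OnePoint.infty := by
  rw [← gS_smul_infty (q := q), ← mul_smul, gS_mul_gS, one_smul]

theorem not_posPt_of_S {c : OnePoint ℝ} (h : PosPt (gS q • c)) : ¬ PosPt c := by
  rintro ⟨x, hx, rfl⟩
  have e : gS q • (x : OnePoint ℝ) = _ := smul_real_eq matS x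
  rw [e, posPt_toPoint] at h
  simp [matS_coe] at h
  linarith

theorem posPt_S_coe {x : ℝ} : PosPt (gS q • (x : OnePoint ℝ)) ↔ x < 0 := by
  have e : gS q • (x : OnePoint ℝ) = _ := smul_real_eq matS x
  rw [e, posPt_toPoint]
  simp [matS_coe]

theorem pos_of_posPt_infty (hq : 3 ≤ q) {g : Gam q} (h : PosPt (g • OnePoint.infty)) : Pos g := by
  obtain ⟨A, hA⟩ := QuotientGroup.mk_surjective (g : PSL(2, ℝ))
  have e : g • (OnePoint.infty : OnePoint ℝ) = toPoint (A 0 0) (A 1 0) := by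
    rw [gam_smul_cusp, ← hA]; exact smul_infty_eq A
  rw [e, posPt_toPoint] at h
  by_contra hg
  set y := 1 + |A 0 1 * A 1 1| / (A 0 0 * A 1 0)
  have hy1 : 1 ≤ y := by
    have : 0 ≤ |A 0 1 * A 1 1| / (A 0 0 * A 1 0) := by positivity
    linarith
  have hy : 0 < y := by linarith
  have h1 := re_nonpos_of_not_pos hq hg (mem_fan_of_re_eq_zero hq (iPt_re y hy))
  have e2 : g • iPt y hy = A • iPt y hy := by rw [gam_smul_def, ← hA]; rfl
  rw [e2] at h1
  have h2 := re_sl_smul A (iPt y hy)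
  have h3 := denom_pos A (iPt y hy)
  rw [iPt_re, iPt_im] at h2 h3
  have h4 : A 0 0 * A 1 0 * y ^ 2 + A 0 1 * A 1 1 ≤ 0 := by
    have := mul_nonpos_of_nonpos_of_nonneg h1 h3.le
    rw [h2] at this; linarith
  have h5 : A 0 0 * A 1 0 * y = A 0 0 * A 1 0 + |A 0 1 * A 1 1| := by
    rw [show y = 1 + |A 0 1 * A 1 1| / (A 0 0 * A 1 0) from rfl, mul_add, mul_one,
      mul_div_cancel₀ _ h.ne']
  have h6 : A 0 0 * A 1 0 * y ≤ A 0 0 * A 1 0 * y ^ 2 := by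
    apply mul_le_mul_of_nonneg_left _ h.le; nlinarith
  linarith [neg_abs_le (A 0 1 * A 1 1)]

theorem pos_of_posPt_zero (hq : 3 ≤ q) {g : Gam q} (h : PosPt (g • ((0 : ℝ) : OnePoint ℝ))) :
    Pos g := by
  rw [← gS_smul_infty (q := q), ← mul_smul] at h
  by_cases h1 : g = 1
  · rw [h1]; exact pos_one hq
  by_cases h2 : g = gS q
  · rw [h2, gS_mul_gS, one_smul] at h; exact absurd h not_posPt_infty
  · exact (pos_mul_S hq h1 h2).1 (pos_of_posPt_infty hq h)

/-- The real number `v_k = R ^ k (∞)`. -/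
noncomputable def vtx (q : ℕ) (k : ℕ) : ℝ := sn q (k - 1) / sn q k

theorem sn_pos_nat (hq : 3 ≤ q) {k : ℕ} (hk : 1 ≤ k) (hkq : k < q) : 0 < sn q k :=
  sn_pos hq (by exact_mod_cast hk) (by exact_mod_cast hkq)

theorem gR_pow_smul_infty (hq : 3 ≤ q) {k : ℕ} (hk : 1 ≤ k) (hkq : k < q) :
    gR q ^ k • (OnePoint.infty : OnePoint ℝ) = (vtx q k : OnePoint ℝ) := by
  have e : gR q ^ k • (OnePoint.infty : OnePoint ℝ) = _ := smul_infty_eq (matR q ^ k)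
  rw [e, matR_pow_coe hq]
  have := sn_pos_nat hq hk hkq
  simp [toPoint, this.ne', vtx]

theorem gR_smul_zero (k : ℕ) :
    gR q ^ k • ((0 : ℝ) : OnePoint ℝ) = gR q ^ (k + 1) • (OnePoint.infty : OnePoint ℝ) := by
  have e : gR q • (OnePoint.infty : OnePoint ℝ) = _ := smul_infty_eq (matR q)
  have : gR q • (OnePoint.infty : OnePoint ℝ) = ((0 : ℝ) : OnePoint ℝ) := by
    rw [e, matR_coe]; simp [toPoint]
  rw [pow_succ, mul_smul, this]

theorem vtx_one : vtx q 1 = 0 := by simp [vtx, sn_zero]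

theorem vtx_lt_succ (hq : 3 ≤ q) {k : ℕ} (hk : 1 ≤ k) (hkq : k + 1 < q) :
    vtx q k < vtx q (k + 1) := by
  have h1 := sn_pos_nat hq hk (by omega : k < q)
  have h2 := sn_pos_nat hq (by omega : 1 ≤ k + 1) hkq
  push_cast at h2
  rw [vtx, vtx, div_lt_div_iff₀ h1 (by push_cast; exact h2)]
  have := sn_det hq k
  push_cast
  rw [add_sub_cancel_right]
  linarith

theorem vtx_le (hq : 3 ≤ q) {j k : ℕ} (hj : 1 ≤ j) (hjk : j ≤ k) (hkq : k < q) :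
    vtx q j ≤ vtx q k := by
  induction k, hjk using Nat.le_induction with
  | base => exact le_rfl
  | succ k hk ih => exact (ih (by omega)).trans (vtx_lt_succ hq (by omega) hkq).le

theorem vtx_lt (hq : 3 ≤ q) {j k : ℕ} (hj : 1 ≤ j) (hjk : j < k) (hkq : k < q) :
    vtx q j < vtx q k :=
  (vtx_lt_succ hq hj (by omega)).trans_le (vtx_le hq (by omega) hjk hkq)

theorem vtx_nonneg (hq : 3 ≤ q) {k : ℕ} (hk : 1 ≤ k) (hkq : k < q) : 0 ≤ vtx q k := by
  rw [← vtx_one (q := q)]; exact vtx_le hq le_rfl hk hkq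

theorem vtx_pos (hq : 3 ≤ q) {k : ℕ} (hk : 2 ≤ k) (hkq : k < q) : 0 < vtx q k := by
  rw [← vtx_one (q := q)]; exact vtx_lt hq le_rfl hk hkq

theorem gR_pow_inv_smul_coe (hq : 3 ≤ q) (k : ℕ) (x : ℝ) :
    (gR q ^ k)⁻¹ • (x : OnePoint ℝ) =
      toPoint (sn q (k + 1) * x - sn q k) (sn q k * x - sn q (k - 1)) := by
  have e : (gR q ^ k)⁻¹ • (x : OnePoint ℝ) = _ := smul_real_eq ((matR q ^ k)⁻¹) x
  rw [e, sl_inv_coe, matR_pow_coe hq]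
  simp [sub_eq_add_neg]

/-- The points beyond `v_j`, on the side away from the edge `(v_k, v_(k+1))`, are positive after
rotating that edge to `(∞, 0)`. -/
theorem posPt_R_pow_inv (hq : 3 ≤ q) {k : ℕ} (hkq : k + 1 < q) {x : ℝ} (hx : vtx q (k + 1) < x) :
    PosPt ((gR q ^ k)⁻¹ • (x : OnePoint ℝ)) := by
  rw [gR_pow_inv_smul_coe hq, posPt_toPoint]
  have h2 := sn_pos_nat hq (by omega : 1 ≤ k + 1) hkq
  have hx' := hx
  rw [vtx, div_lt_iff₀ h2] at hx'
  push_cast at hx' h2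
  rw [add_sub_cancel_right] at hx'
  apply mul_pos
  · linarith
  · rcases Nat.eq_zero_or_pos k with rfl | hk
    · have : sn q (-1) = -1 := by rw [sn_neg, sn_one hq]
      simp [sn_zero, this]
    · have h1 := sn_pos_nat hq hk (by omega : k < q)
      have h3 := (vtx_lt_succ hq hk hkq).trans hx
      rw [vtx, div_lt_iff₀ h1] at h3
      linarith

theorem posPt_gap (hq : 3 ≤ q) {k : ℕ} (hk : 1 ≤ k) (hkq : k < q) {x : ℝ} (h1 : vtx q k < x)
    (h2 : k + 1 < q → x < vtx q (k + 1)) : PosPt ((gR q ^ k * gS q)⁻¹ • (x : OnePoint ℝ)) := by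
  have s1 := sn_pos_nat hq hk hkq
  rw [vtx, div_lt_iff₀ s1] at h1
  have e : (gR q ^ k * gS q)⁻¹ • (x : OnePoint ℝ) = _ := smul_real_eq ((matR q ^ k * matS)⁻¹) x
  rw [e, posPt_toPoint, sl_inv_coe]
  simp only [sl_mul_apply, matR_pow_coe hq, matS_coe]
  simp
  apply mul_pos_of_neg_of_neg
  · linarith
  · rcases Nat.lt_or_ge (k + 1) q with h | h
    · have s2 := sn_pos_nat hq (by omega : 1 ≤ k + 1) h
      have h3 := h2 h
      rw [vtx, lt_div_iff₀ s2] at h3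
      push_cast at h3
      rw [add_sub_cancel_right] at h3
      linarith
    · have : (k : ℝ) + 1 = q := by exact_mod_cast (by omega : k + 1 = q)
      rw [this, sn_self hq]; linarith

theorem exists_gap (y : ℝ) {m : ℕ} (hm : 1 ≤ m) (hy : ∀ k, 1 ≤ k → k ≤ m → y ≠ vtx q k) :
    y < 0 ∨ (∃ k, 1 ≤ k ∧ k < m ∧ vtx q k < y ∧ y < vtx q (k + 1)) ∨ vtx q m < y := by
  induction m, hm using Nat.le_induction with
  | base =>
    have := hy 1 le_rfl le_rfl
    rw [vtx_one] at this ⊢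
    rcases lt_or_gt_of_ne this with h | h
    · exact Or.inl h
    · exact Or.inr (Or.inr h)
  | succ m hm ih =>
    rcases ih fun k h1 h2 => hy k h1 (by omega) with h | ⟨k, h1, h2, h3⟩ | h
    · exact Or.inl h
    · exact Or.inr (Or.inl ⟨k, h1, by omega, h3⟩)
    · right
      rcases lt_or_gt_of_ne (hy (m + 1) (by omega) le_rfl) with h' | h'
      · exact Or.inl ⟨m, hm, by omega, h, h'⟩
      · exact Or.inr h'

/-! ### Cusps and boundary pieces -/

/-- The cusps of a union of triangles. -/
def cuspSet (𝒢 : Set (Gam q)) : Set (OnePoint ℝ) :=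
  {c | ∃ g ∈ 𝒢, c = g • ((0 : ℝ) : OnePoint ℝ) ∨ c = g • OnePoint.infty}

/-- `c` lies in the open arc of the boundary cut off by a boundary piece: the arc from `g 0` to
`g ∞` for `r = 0`, the arc from `g v_r` to `g ∞` for `r ≥ 1`. -/
def InArc (g : Gam q) (r : ℕ) (c : OnePoint ℝ) : Prop :=
  (r = 0 ∧ PosPt (g⁻¹ • c)) ∨ (1 ≤ r ∧ ∃ x : ℝ, vtx q r < x ∧ g⁻¹ • c = (x : OnePoint ℝ))

/-- A triangle with a cusp inside the arc of a boundary piece lies beyond that piece. -/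
theorem mem_beyond_of_inArc (hq : 3 ≤ q) {g h : Gam q} {r : ℕ} (hrq : r < q) {c : OnePoint ℝ}
    (hc : InArc g r c) (hh : c = h • ((0 : ℝ) : OnePoint ℝ) ∨ c = h • OnePoint.infty) :
    h ∈ beyond g r := by
  have key : ∀ k : Gam q, PosPt (k • c) → Pos (k * h) := by
    intro k hk
    rcases hh with rfl | rfl
    · rw [← mul_smul] at hk; exact pos_of_posPt_zero hq hk
    · rw [← mul_smul] at hk; exact pos_of_posPt_infty hq hk
  rcases hc with ⟨rfl, hc⟩ | ⟨hr, x, hx, hc⟩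
  · rw [mem_beyond_zero]
    exact key _ hc
  · rw [mem_beyond_of_one_le hr]
    obtain ⟨k, hkq, hk⟩ := exists_mem_branch hq g h
    refine ⟨k, ?_, hkq, hk⟩
    by_contra hkr
    push Not at hkr
    have hx' : vtx q (k + 1) < x := (vtx_le hq (by omega) hkr hrq).trans_lt hx
    rcases hk with rfl | hk
    · rcases hh with rfl | rfl
      · rw [mul_smul, inv_smul_smul, gR_smul_zero, gR_pow_smul_infty hq (by omega) (by omega)] at hc
        linarith [OnePoint.coe_injective hc]
      · rw [mul_smul, inv_smul_smul] at hc
        rcases Nat.eq_zero_or_pos k with rfl | hk0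
        · rw [pow_zero, one_smul] at hc; exact OnePoint.infty_ne_coe _ hc
        · rw [gR_pow_smul_infty hq hk0 hkq] at hc
          have := OnePoint.coe_injective hc
          linarith [vtx_lt_succ hq hk0 (by omega : k + 1 < q)]
    · apply hk
      apply key
      rw [mul_inv_rev, mul_smul, hc]
      exact posPt_R_pow_inv hq (by omega) hx'

theorem exists_inArc_aux (hq : 3 ≤ q) {𝒢 : Set (Gam q)} (h𝒢 : IsTriangulated 𝒢) (hfin : 𝒢.Finite)
    {c : OnePoint ℝ} (hc : c ∉ cuspSet 𝒢) (n : ℕ) :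
    ∀ g : Gam q, {h ∈ 𝒢 | Pos (g⁻¹ * h)}.ncard ≤ n → (g ∈ 𝒢 ∨ g * gS q ∈ 𝒢) → PosPt (g⁻¹ • c) →
      ∃ a r, IsPiece 𝒢 a r ∧ InArc a r c := by
  induction n with
  | zero =>
    intro g hn hg hp
    by_cases hg𝒢 : g ∈ 𝒢
    · exfalso
      have : g ∈ {h ∈ 𝒢 | Pos (g⁻¹ * h)} := ⟨hg𝒢, by rw [inv_mul_cancel]; exact pos_one hq⟩
      have h2 := (Set.ncard_eq_zero (hfin.subset (Set.sep_subset _ _))).1 (Nat.le_zero.1 hn)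
      rw [h2] at this; exact this
    · exact ⟨g, 0, Or.inl ⟨rfl, hg𝒢, hg.resolve_left hg𝒢⟩, Or.inl ⟨rfl, hp⟩⟩
  | succ n ih =>
    intro g hn hg hp
    by_cases hg𝒢 : g ∈ 𝒢
    swap
    · exact ⟨g, 0, Or.inl ⟨rfl, hg𝒢, hg.resolve_left hg𝒢⟩, Or.inl ⟨rfl, hp⟩⟩
    -- crossing another even line of the same `q`-gon decreases the number of triangles ahead
    have step : ∀ (a : Gam q) (j k : ℕ), j < q → k < q → g = a * gR q ^ j → a * gR q ^ k ∈ 𝒢 →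
        PosPt ((gR q ^ k * gS q)⁻¹ • a⁻¹ • c) → ∃ a r, IsPiece 𝒢 a r ∧ InArc a r c := by
      intro a j k hj hk hgj hk𝒢 hkp
      have hjk : j ≠ k := by
        rintro rfl
        rw [mul_inv_rev, mul_smul, gS_inv, ← mul_smul _ _ c, ← mul_inv_rev, ← hgj] at hkp
        exact not_posPt_of_S hkp hp
      refine ih (a * gR q ^ k * gS q) ?_ (Or.inr (by rwa [mul_gS_mul_gS])) ?_
      · have hsub : {h ∈ 𝒢 | Pos ((a * gR q ^ k * gS q)⁻¹ * h)} ⊂ {h ∈ 𝒢 | Pos (g⁻¹ * h)} := by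
          refine ⟨fun h ⟨h1, h2⟩ => ⟨h1, ?_⟩, fun hsub => ?_⟩
          · rw [mul_inv_rev, gS_inv, mul_assoc, pos_S_mul hq] at h2
            rw [hgj]
            exact pos_of_mem_branch hq hj hk hjk (Or.inr h2)
          · have := (hsub (a := g) ⟨hg𝒢, by rw [inv_mul_cancel]; exact pos_one hq⟩).2
            rw [mul_inv_rev, gS_inv, mul_assoc, pos_S_mul hq] at this
            apply this
            rw [hgj]
            exact pos_of_mem_branch hq hk hj (Ne.symm hjk) (self_mem_branch _)
        have := Set.ncard_lt_ncard hsub (hfin.subset (Set.sep_subset _ _))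
        omega
      · rw [mul_assoc a, mul_inv_rev, mul_smul]; exact hkp
    rcases h𝒢.tile g hg𝒢 with hfull | ⟨a, r, j, hpc, hjr, hgj⟩
    · obtain ⟨x, hx, hgc⟩ := hp
      have hne : ∀ k, 1 ≤ k → k ≤ q - 1 → x ≠ vtx q k := by
        rintro k hk hkq rfl
        apply hc
        refine ⟨_, hfull k, Or.inr ?_⟩
        rw [mul_smul, gR_pow_smul_infty hq hk (by omega), ← hgc, smul_inv_smul]
      rcases exists_gap x (by omega) hne with h | ⟨k, hk1, hk2, h1, h2⟩ | h
      · linarith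
      · refine step g 0 k (by omega) (by omega) (by simp) (hfull k) ?_
        rw [hgc]
        exact posPt_gap hq hk1 (by omega) h1 fun _ => h2
      · refine step g 0 (q - 1) (by omega) (by omega) (by simp) (hfull _) ?_
        rw [hgc]
        exact posPt_gap hq (by omega) (by omega) h fun _ => by omega
    · obtain ⟨-, hr, hrq, hmem⟩ := hpc.resolve_left (by omega)
      have hm : ∀ k < r, a * gR q ^ k ∈ 𝒢 := fun k hk => (hmem k (by omega)).2 hk
      induction hac : a⁻¹ • c using OnePoint.rec with
      | infty =>
        exfalso
        apply hc
        refine ⟨_, hm 0 hr, Or.inr ?_⟩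
        rw [pow_zero, mul_one, ← hac, smul_inv_smul]
      | coe y =>
        have hne : ∀ k, 1 ≤ k → k ≤ r → y ≠ vtx q k := by
          rintro k hk hkr rfl
          apply hc
          refine ⟨_, hm (k - 1) (by omega), Or.inl ?_⟩
          rw [mul_smul, gR_smul_zero, Nat.sub_add_cancel hk, gR_pow_smul_infty hq hk (by omega),
            ← hac, smul_inv_smul]
        rcases exists_gap y hr hne with h | ⟨k, hk1, hk2, h1, h2⟩ | h
        · refine step a j 0 (by omega) (by omega) hgj (hm 0 hr) ?_
          rw [hac, pow_zero, one_mul, gS_inv, posPt_S_coe]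
          exact h
        · refine step a j k (by omega) (by omega) hgj (hm k hk2) ?_
          rw [hac]
          exact posPt_gap hq hk1 (by omega) h1 fun _ => h2
        · exact ⟨a, r, hpc, Or.inr ⟨hr, y, h, hac⟩⟩

/-- Every boundary point other than a cusp lies in the arc of a boundary piece. -/
theorem IsTriangulated.exists_inArc (hq : 3 ≤ q) {𝒢 : Set (Gam q)} (h𝒢 : IsTriangulated 𝒢)
    (hfin : 𝒢.Finite) (hbase : 1 ∈ 𝒢 ∨ gS q ∈ 𝒢) {c : OnePoint ℝ} (hc : c ∉ cuspSet 𝒢) :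
    ∃ a r, IsPiece 𝒢 a r ∧ InArc a r c := by
  have h0 : c ≠ ((0 : ℝ) : OnePoint ℝ) := by
    rintro rfl
    apply hc
    rcases hbase with h | h
    · exact ⟨_, h, Or.inl (by rw [one_smul])⟩
    · exact ⟨_, h, Or.inr (by rw [gS_smul_infty])⟩
  have h1 : c ≠ OnePoint.infty := by
    rintro rfl
    apply hc
    rcases hbase with h | h
    · exact ⟨_, h, Or.inr (by rw [one_smul])⟩
    · exact ⟨_, h, Or.inl (by rw [gS_smul_zero])⟩
  induction c using OnePoint.rec with
  | infty => exact absurd rfl h1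
  | coe x =>
    have hx : x ≠ 0 := fun h => h0 (by rw [h])
    rcases lt_or_gt_of_ne hx with hx | hx
    · refine exists_inArc_aux hq h𝒢 hfin hc _ (gS q) le_rfl ?_ ?_
      · rw [gS_mul_gS]; exact hbase.symm
      · rw [gS_inv, posPt_S_coe]; exact hx
    · refine exists_inArc_aux hq h𝒢 hfin hc _ 1 le_rfl ?_ ?_
      · rw [one_mul]; exact hbase
      · rw [inv_one, one_smul, posPt_coe]; exact hx

theorem IsTriangulated.mem_of_cusps (hq : 3 ≤ q) {𝒢 : Set (Gam q)} (h𝒢 : IsTriangulated 𝒢)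
    {a : Gam q} (hpos : ∀ h ∈ 𝒢, Pos (a⁻¹ * h)) (h0 : a • ((0 : ℝ) : OnePoint ℝ) ∈ cuspSet 𝒢)
    (h1 : a • OnePoint.infty ∈ cuspSet 𝒢) : a ∈ 𝒢 := by
  by_contra ha
  obtain ⟨h, hh, hhc⟩ := h0
  obtain ⟨g, hg, hgc⟩ := h1
  have posc : ∀ (c : OnePoint ℝ) (h k : Gam q),
      (c = h • ((0 : ℝ) : OnePoint ℝ) ∨ c = h • OnePoint.infty) → PosPt (k • c) → Pos (k * h) := by
    rintro c h k (rfl | rfl) hk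
    · rw [← mul_smul] at hk; exact pos_of_posPt_zero hq hk
    · rw [← mul_smul] at hk; exact pos_of_posPt_infty hq hk
  have notzero : ∀ h ∈ 𝒢, h ∉ branch a := by
    rintro h hh (rfl | hb)
    · exact ha hh
    · exact hb (hpos h hh)
  have hb1 : h ∈ branch (a * gR q ^ 1) := by
    obtain ⟨k, hk, hb⟩ := exists_mem_branch hq a h
    rcases Nat.lt_or_ge k 2 with hk2 | hk2
    · interval_cases k
      · rw [pow_zero, mul_one] at hb; exact absurd hb (notzero h hh)
      · exact hb
    exfalso
    rcases hb with rfl | hb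
    · rcases hhc with hc | hc
      · rw [mul_smul, smul_left_cancel_iff, gR_smul_zero] at hc
        rcases Nat.lt_or_ge (k + 1) q with h' | h'
        · rw [gR_pow_smul_infty hq (by omega) h'] at hc
          linarith [OnePoint.coe_injective hc, vtx_pos hq (by omega : 2 ≤ k + 1) h']
        · rw [show k + 1 = q by omega, gR_pow_q hq, one_smul] at hc
          exact OnePoint.coe_ne_infty _ hc
      · rw [mul_smul, smul_left_cancel_iff, gR_pow_smul_infty hq (by omega) hk] at hc
        linarith [OnePoint.coe_injective hc, vtx_pos hq hk2 hk]
    · apply hb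
      apply posc _ h _ hhc
      rw [mul_inv_rev, mul_smul, inv_smul_smul, gR_pow_inv hq hk.le, gR_smul_zero,
        gR_pow_smul_infty hq (by omega) (by omega), posPt_coe]
      exact vtx_pos hq (by omega) (by omega)
  have hb2 : g ∈ branch (a * gR q ^ (q - 1)) := by
    obtain ⟨k, hk, hb⟩ := exists_mem_branch hq a g
    rcases Nat.eq_zero_or_pos k with rfl | hk0
    · rw [pow_zero, mul_one] at hb; exact absurd hb (notzero g hg)
    by_cases hkq : k = q - 1
    · rwa [hkq] at hb
    exfalso
    rcases hb with rfl | hb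
    · rcases hgc with hc | hc
      · rw [mul_smul, smul_left_cancel_iff, gR_smul_zero,
          gR_pow_smul_infty hq (by omega) (by omega)] at hc
        exact OnePoint.infty_ne_coe _ hc
      · rw [mul_smul, smul_left_cancel_iff, gR_pow_smul_infty hq (by omega) hk] at hc
        exact OnePoint.infty_ne_coe _ hc
    · apply hb
      apply posc _ g _ hgc
      rw [mul_inv_rev, mul_smul, inv_smul_smul, gR_pow_inv hq hk.le,
        gR_pow_smul_infty hq (by omega) (by omega), posPt_coe]
      exact vtx_pos hq (by omega) (by omega)
  have hR : a * gR q ^ 1 ∈ 𝒢 := by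
    rcases hb1 with h' | h'
    · rwa [← h']
    · exact h𝒢.convex _ g h hg hh
        (pos_of_mem_branch hq (by omega) (by omega) (by omega) hb2) h'
  have hR' : a * gR q ^ (q - 1) ∈ 𝒢 := by
    rcases hb2 with h' | h'
    · rwa [← h']
    · exact h𝒢.convex _ h g hh hg
        (pos_of_mem_branch hq (by omega) (by omega) (by omega) hb1) h'
  rcases h𝒢.tile _ hR with hfull | ⟨b, r, j, hp, hj, hab⟩
  · have := hfull (q - 1)
    rw [mul_assoc, ← pow_add, show 1 + (q - 1) = q by omega, gR_pow_q hq, mul_one] at this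
    exact ha this
  · obtain ⟨hdvd, hr, hrq, hmem⟩ := hp.resolve_left (by omega)
    have haj : a = b * gR q ^ (j + (q - 1)) := by
      rw [pow_add, ← mul_assoc, ← hab, mul_assoc, ← pow_add, show 1 + (q - 1) = q by omega,
        gR_pow_q hq, mul_one]
    rcases Nat.eq_zero_or_pos j with rfl | hj0
    · have h2r : 2 * r ≤ q := by
        obtain ⟨c, hc⟩ := hdvd
        have : 2 ≤ c := by
          by_contra h2; push Not at h2
          interval_cases c <;> omega
        rw [hc, mul_comm]; exact Nat.mul_le_mul_left r this
      have : a * gR q ^ (q - 1) = b * gR q ^ (q - 2) := by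
        rw [haj, mul_assoc, ← pow_add, show 0 + (q - 1) + (q - 1) = (q - 2) + q by omega, pow_add,
          gR_pow_q hq, mul_one]
      rw [this, hmem _ (by omega)] at hR'
      have : q = 3 := by omega
      subst this
      interval_cases r
      omega
    · apply ha
      rw [haj, show j + (q - 1) = (j - 1) + q by omega, pow_add, gR_pow_q hq, mul_one]
      exact (hmem _ (by omega)).2 (by omega)

theorem IsTriangulated.base (hq : 3 ≤ q) {𝒢 : Set (Gam q)} (h𝒢 : IsTriangulated 𝒢)
    (h0 : ((0 : ℝ) : OnePoint ℝ) ∈ cuspSet 𝒢) (h1 : OnePoint.infty ∈ cuspSet 𝒢) :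
    1 ∈ 𝒢 ∨ gS q ∈ 𝒢 := by
  by_cases hpos : ∀ h ∈ 𝒢, Pos h
  · left
    apply h𝒢.mem_of_cusps hq
    · simpa using hpos
    · rwa [one_smul]
    · rwa [one_smul]
  · by_cases hneg : ∀ h ∈ 𝒢, ¬ Pos h
    · right
      apply h𝒢.mem_of_cusps hq
      · intro h hh
        rw [gS_inv, pos_S_mul hq]; exact hneg h hh
      · rwa [gS_smul_zero]
      · rwa [gS_smul_infty]
    · push Not at hpos hneg
      obtain ⟨h, hh, hh'⟩ := hpos
      obtain ⟨g, hg, hg'⟩ := hneg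
      left
      exact h𝒢.convex 1 g h hg hh (by simpa using hg') (by simpa using hh')

end

/-! ### Unions of triangles -/

instance : IsIsometricSMul PSL(2, ℝ) ℍ where
  isometry_smul g := by
    induction g using QuotientGroup.induction_on with
    | H A => exact isometry_smul ℍ A

section
variable {q : ℕ}

instance : IsIsometricSMul (Gam q) ℍ where
  isometry_smul g := isometry_smul ℍ (g : PSL(2, ℝ))

/-- The union of the triangles `g Φ` with `g ∈ 𝒢`. -/
def poly (𝒢 : Set (Gam q)) : Set ℍ := {z | ∃ g ∈ 𝒢, g⁻¹ • z ∈ triangle q}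

theorem eq_of_mem_openTriangle (hq : 3 ≤ q) {g h : Gam q} {z : ℍ} (hg : g⁻¹ • z ∈ openTriangle q)
    (hh : h⁻¹ • z ∈ triangle q) : g = h := by
  have := eq_one_of_openTriangle hq (g⁻¹ * h).2 hg hh (by
    change _ = (g⁻¹ * h) • h⁻¹ • z
    rw [mul_smul, smul_inv_smul])
  have h1 : g⁻¹ * h = 1 := Subtype.ext this
  exact (inv_mul_eq_one.1 h1)

theorem continuous_ray (t : ℝ) : Continuous (ray q t) := by
  unfold ray
  have := UpperHalfPlane.continuous_re
  have := UpperHalfPlane.continuous_im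
  fun_prop

theorem isOpen_openTriangle : IsOpen (openTriangle q) :=
  (isOpen_lt continuous_const UpperHalfPlane.continuous_re).inter
    ((isOpen_lt continuous_const (continuous_ray 0)).inter
      (isOpen_lt (continuous_ray 1) continuous_const))

theorem isClosed_triangle (hq : 3 ≤ q) : IsClosed (triangle q) := by
  have : triangle q = {z | 0 ≤ z.re} ∩ ({z | 0 ≤ ray q 0 z} ∩ {z | ray q 1 z ≤ 0}) := by
    ext z
    rw [mem_triangle_iff hq]
    simp only [sector, Set.mem_ofPred_eq, Nat.cast_zero, zero_add, Set.mem_inter_iff]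
  rw [this]
  exact (isClosed_le continuous_const UpperHalfPlane.continuous_re).inter
    ((isClosed_le continuous_const (continuous_ray 0)).inter
      (isClosed_le (continuous_ray 1) continuous_const))

theorem triangle_subset_closure (hq : 3 ≤ q) : triangle q ⊆ closure (openTriangle q) := by
  intro z hz
  obtain ⟨h0, h1, h2⟩ := hz
  have hy := z.im_pos
  have hl := one_le_lam hq
  have hl2 := lam_lt_two hq
  -- a path from `z` into the interior: inwards horizontally, and upwards
  let f : ℝ → ℍ := fun t => UpperHalfPlane.mk
    ⟨z.re + |t| * (lam q / 4 - z.re), z.im + |t| * (2 / z.im)⟩ (by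
      have : 0 ≤ |t| * (2 / z.im) := by positivity
      change 0 < z.im + _
      linarith)
  have hf : Continuous f := by
    apply UpperHalfPlane.isEmbedding_coe.continuous_iff.2
    have : (fun t : ℝ => (f t : ℂ)) = fun t : ℝ =>
        ((z.re + |t| * (lam q / 4 - z.re) : ℝ) : ℂ) +
          ((z.im + |t| * (2 / z.im) : ℝ) : ℂ) * Complex.I := by
      funext t
      apply Complex.ext <;> simp [f]
    change Continuous (fun t : ℝ => (f t : ℂ))
    rw [this]
    fun_prop
  have hf0 : f 0 = z := by
    apply UpperHalfPlane.ext
    apply Complex.ext <;> simp [f]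
  rw [← hf0]
  refine map_mem_closure (s := Set.Ioo 0 1) hf ?_ ?_
  · rw [closure_Ioo (by norm_num)]; simp
  · rintro t ⟨ht0, ht1⟩
    have er : (f t).re = z.re + t * (lam q / 4 - z.re) := by
      change z.re + |t| * _ = _; rw [abs_of_pos ht0]
    have ei : (f t).im = z.im + t * (2 / z.im) := by
      change z.im + |t| * _ = _; rw [abs_of_pos ht0]
    refine ⟨?_, ?_, ?_⟩
    · rw [er]; nlinarith
    · rw [ray_zero hq, er]; nlinarith
    · rw [ray_one hq, er, ei]
      have h3 : (z.im + t * (2 / z.im)) ^ 2 ≥ z.im ^ 2 + 4 * t := by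
        have : (z.im + t * (2 / z.im)) ^ 2 = z.im ^ 2 + 4 * t + (t * (2 / z.im)) ^ 2 := by
          field_simp; ring
        nlinarith [sq_nonneg (t * (2 / z.im))]
      have h4 : (z.re + t * (lam q / 4 - z.re)) ^ 2 ≥
          z.re ^ 2 + 2 * z.re * (t * (lam q / 4 - z.re)) := by
        nlinarith [sq_nonneg (t * (lam q / 4 - z.re))]
      have h5 : z.re * (lam q / 4 - z.re) ≥ -1 / 2 := by nlinarith
      have h6 : lam q * (2 * t * (z.re * (lam q / 4 - z.re)) + 4 * t) ≥ 3 * t := by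
        have : 3 * t ≤ 2 * t * (z.re * (lam q / 4 - z.re)) + 4 * t := by nlinarith
        nlinarith
      have h7 : 2 * (t * (lam q / 4 - z.re)) < 3 * t := by nlinarith
      nlinarith

theorem isOpen_preimage_smul {U : Set ℍ} (hU : IsOpen U) (g : Gam q) : IsOpen {z | g • z ∈ U} :=
  hU.preimage (continuous_const_smul g)

theorem isClosed_preimage_smul {U : Set ℍ} (hU : IsClosed U) (g : Gam q) :
    IsClosed {z | g • z ∈ U} :=
  hU.preimage (continuous_const_smul g)

theorem isClosed_poly (hq : 3 ≤ q) {𝒢 : Set (Gam q)} (hfin : 𝒢.Finite) : IsClosed (poly 𝒢) := by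
  have : poly 𝒢 = ⋃ g ∈ 𝒢, {z | g⁻¹ • z ∈ triangle q} := by
    ext z; simp [poly]
  rw [this]
  exact hfin.isClosed_biUnion fun g _ => isClosed_preimage_smul (isClosed_triangle hq) _

/-- An open set meeting a triangle meets its interior. -/
theorem exists_mem_openTriangle (hq : 3 ≤ q) {U : Set ℍ} (hU : IsOpen U) {g : Gam q} {z : ℍ}
    (hz : z ∈ U) (hg : g⁻¹ • z ∈ triangle q) : ∃ p ∈ U, g⁻¹ • p ∈ openTriangle q := by
  have h1 := isOpen_preimage_smul hU g
  obtain ⟨p, hp, hp'⟩ := mem_closure_iff.1 (triangle_subset_closure hq hg) _ h1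
    (by change g • g⁻¹ • z ∈ U; rwa [smul_inv_smul])
  exact ⟨g • p, hp, by rwa [inv_smul_smul]⟩

theorem smul_triangle_subset_poly (hq : 3 ≤ q) {𝒢 : Set (Gam q)} (g : Gam q) :
    g • triangle q ⊆ poly 𝒢 ↔ g ∈ 𝒢 := by
  constructor
  · intro h
    obtain ⟨k, hk, hk'⟩ := h (Set.smul_mem_smul_set (mem_triangle_tau hq))
    have : g = k := eq_of_mem_openTriangle hq (by rw [inv_smul_smul]; exact tau_mem hq) hk'
    rwa [this]
  · rintro hg _ ⟨z, hz, rfl⟩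
    exact ⟨g, hg, by change g⁻¹ • g • z ∈ _; rwa [inv_smul_smul]⟩

theorem not_mem_interior_poly (hq : 3 ≤ q) {𝒢 : Set (Gam q)} {g : Gam q} {z : ℍ} (hg : g ∉ 𝒢)
    (hz : g⁻¹ • z ∈ triangle q) : z ∉ interior (poly 𝒢) := by
  intro h
  obtain ⟨p, hp, hp'⟩ := exists_mem_openTriangle hq isOpen_interior h hz
  obtain ⟨k, hk, hk'⟩ := interior_subset hp
  rw [eq_of_mem_openTriangle hq hp' hk'] at hg
  exact hg hk

theorem mem_interior_poly_of_openTriangle {𝒢 : Set (Gam q)} (hq : 3 ≤ q) {g : Gam q} (hg : g ∈ 𝒢)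
    {z : ℍ} (hz : g⁻¹ • z ∈ openTriangle q) : z ∈ interior (poly 𝒢) :=
  mem_interior.2 ⟨{z | g⁻¹ • z ∈ openTriangle q},
    fun _ h => ⟨g, hg, openTriangle_subset hq h⟩, isOpen_preimage_smul isOpen_openTriangle _, hz⟩

theorem disjoint_interior_poly (hq : 3 ≤ q) {𝒢 : Set (Gam q)} (γ : Gam q) :
    Disjoint (γ • interior (poly 𝒢)) (interior (poly 𝒢)) ↔ ∀ g ∈ 𝒢, γ * g ∉ 𝒢 := by
  constructor
  · intro h g hg hγ
    have e : (γ * g)⁻¹ • (γ * g) • tau q = tau q := inv_smul_smul _ _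
    have m1 : g • tau q ∈ interior (poly 𝒢) :=
      mem_interior_poly_of_openTriangle hq hg (by rw [inv_smul_smul]; exact tau_mem hq)
    have m2 : (γ * g) • tau q ∈ interior (poly 𝒢) :=
      mem_interior_poly_of_openTriangle hq hγ (by rw [e]; exact tau_mem hq)
    rw [mul_smul] at m2
    exact Set.disjoint_left.1 h (Set.smul_mem_smul_set m1) m2
  · intro h
    rw [Set.disjoint_left]
    rintro _ ⟨z, hz, rfl⟩ hz'
    obtain ⟨g, hg, hgz⟩ := interior_subset hz
    refine not_mem_interior_poly hq (h g hg) ?_ hz'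
    change (γ * g)⁻¹ • γ • z ∈ _
    rwa [mul_inv_rev, mul_smul, inv_smul_smul]

/-! ### Sides of a union of triangles -/

theorem mem_frontier_poly_of_ne (hq : 3 ≤ q) {𝒢 : Set (Gam q)} {g h : Gam q} (hg : g ∈ 𝒢)
    (hh : h ∉ 𝒢) {z : ℍ} (hz : g⁻¹ • z ∈ triangle q) (hz' : h⁻¹ • z ∈ triangle q) :
    z ∈ frontier (poly 𝒢) :=
  ⟨subset_closure ⟨g, hg, hz⟩, not_mem_interior_poly hq hh hz'⟩

theorem mem_triangle_of_line (hq : 3 ≤ q) {z : ℍ} (hz : z.re = 0) : z ∈ triangle q :=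
  baseLine_subset_triangle hq hz

theorem S_smul_re_zero {z : ℍ} (hz : z.re = 0) : (S • z).re = 0 :=
  le_antisymm ((S_smul_re_nonpos z).2 hz.ge) ((S_smul_re_nonneg z).2 hz.le)

theorem mem_frontier_poly_line (hq : 3 ≤ q) {𝒢 : Set (Gam q)} (hfin : 𝒢.Finite) {g : Gam q} {z : ℍ}
    (hz : z.re = 0) : g • z ∈ frontier (poly 𝒢) ↔ ¬ (g ∈ 𝒢 ↔ g * gS q ∈ 𝒢) := by
  have e1 : g⁻¹ • g • z = z := inv_smul_smul _ _
  have e2 : (g * gS q)⁻¹ • g • z = S • z := by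
    rw [mul_inv_rev, mul_smul, e1, gS_inv, gS_smul]
  have m1 := mem_triangle_of_line hq hz
  have m2 := mem_triangle_of_line hq (S_smul_re_zero hz)
  constructor
  · rintro ⟨hc, hi⟩ h
    rw [(isClosed_poly hq hfin).closure_eq] at hc
    obtain ⟨k, hk, hk'⟩ := hc
    have hk2 := eq_one_or_S hq (g⁻¹ * k).2 hz hk' (by
      change _ = (g⁻¹ * k) • k⁻¹ • g • z
      rw [mul_smul, smul_inv_smul, e1])
    have hg : g ∈ 𝒢 ∧ g * gS q ∈ 𝒢 := by
      rcases hk2 with h2 | h2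
      · have : g⁻¹ * k = 1 := Subtype.ext h2
        have : g ∈ 𝒢 := by rwa [inv_mul_eq_one.1 this]
        exact ⟨this, h.1 this⟩
      · have : g⁻¹ * k = gS q := Subtype.ext h2
        rw [inv_mul_eq_iff_eq_mul] at this
        have : g * gS q ∈ 𝒢 := by rwa [← this]
        exact ⟨h.2 this, this⟩
    apply hi
    -- the line has a neighbourhood covered by the two triangles along it
    let V : Set ℍ := {w | 0 < ray q 0 w} ∩ {w | ray q 1 w < 0}
    have hV : IsOpen V := (isOpen_lt continuous_const (continuous_ray 0)).inter
      (isOpen_lt (continuous_ray 1) continuous_const)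
    have hmem : ∀ w : ℍ, w.re ≤ 0 → w ∈ V := fun w hw => rays_of_re_nonpos hq hw
    have htri : ∀ w ∈ V, 0 ≤ w.re → w ∈ triangle q := fun w hw h =>
      (mem_triangle_iff hq w).2 ⟨h, mem_sector_zero hw.1.le hw.2.le⟩
    refine mem_interior.2 ⟨{w | g⁻¹ • w ∈ V} ∩ {w | (g * gS q)⁻¹ • w ∈ V}, ?_,
      (isOpen_preimage_smul hV _).inter (isOpen_preimage_smul hV _), ?_⟩
    · rintro w ⟨h1, h2⟩
      rcases le_total 0 (g⁻¹ • w).re with h3 | h3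
      · exact ⟨g, hg.1, htri _ h1 h3⟩
      · refine ⟨_, hg.2, htri _ h2 ?_⟩
        rw [mul_inv_rev, mul_smul, gS_inv, gS_smul]
        exact (S_smul_re_nonneg _).2 h3
    · constructor
      · change g⁻¹ • g • z ∈ V
        rw [e1]; exact hmem _ hz.le
      · change (g * gS q)⁻¹ • g • z ∈ V
        rw [e2]; exact hmem _ (S_smul_re_zero hz).le
  · intro h
    rw [← e1] at m1
    rw [← e2] at m2
    by_cases hg : g ∈ 𝒢
    · have : g * gS q ∉ 𝒢 := fun h' => h ⟨fun _ => h', fun _ => hg⟩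
      exact mem_frontier_poly_of_ne hq hg this m1 m2
    · have : g * gS q ∈ 𝒢 := by
        by_contra h'; exact h ⟨fun h => absurd h hg, fun h => absurd h h'⟩
      exact mem_frontier_poly_of_ne hq this hg m2 m1

theorem line_subset_frontier (hq : 3 ≤ q) {𝒢 : Set (Gam q)} (hfin : 𝒢.Finite) {g : Gam q} :
    g • baseLine ⊆ frontier (poly 𝒢) ↔ ¬ (g ∈ 𝒢 ↔ g * gS q ∈ 𝒢) := by
  constructor
  · intro h
    exact (mem_frontier_poly_line hq hfin (iPt_re 1 one_pos)).1
      (h (Set.smul_mem_smul_set (iPt_re 1 one_pos)))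
  · rintro h _ ⟨z, hz, rfl⟩
    exact (mem_frontier_poly_line hq hfin hz).2 h

theorem R_smul_oddEdge (hq : 3 ≤ q) {z : ℍ} (hz : z ∈ baseOddEdge q) :
    R q • z ∈ triangle q ∧ 0 < (R q • z).re ∧ ray q 1 (R q • z) = 0 ∧
      (z ≠ rho hq → 0 < ray q 0 (R q • z)) := by
  obtain ⟨hzt, h0⟩ := (mem_baseOddEdge_iff hq z).1 hz
  have hs := ((mem_triangle_iff hq z).1 hzt).2
  have hpos := re_R_pow_smul_pos hq hs (k := 1) one_pos (by omega)
  rw [pow_one] at hpos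
  obtain ⟨f1, f2, f3⟩ := R_smul_facts (q := q) z
  have h1 := (ray_of_mem_sector_zero hs).2
  have hl := one_le_lam hq
  have hray1 : ray q 1 (R q • z) = 0 := by
    have := ray_R_smul (q := q) 1 z
    rw [sub_self, h0] at this
    exact (mul_eq_zero.1 this).resolve_right f3.ne'
  have e : ray q 0 (R q • z) * ((lam q - z.re) ^ 2 + z.im ^ 2) = - ray q 1 z := by
    rw [ray_zero hq] at h0
    rw [ray_zero hq, ray_one hq, sub_mul, mul_assoc, f1]
    have : z.re = lam q / 2 := by linarith
    rw [this]; ring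
  have h2 : 0 ≤ ray q 0 (R q • z) := by
    by_contra hc; push Not at hc
    nlinarith [mul_neg_of_neg_of_pos hc f3]
  refine ⟨(mem_triangle_iff hq _).2 ⟨hpos.le, mem_sector_zero h2 hray1.le⟩, hpos, hray1, ?_⟩
  intro hne
  refine lt_of_le_of_ne h2 fun h => hne (eq_rho_of_rays hq h0 ?_)
  rw [← h, zero_mul] at e; linarith

/-- The point of the odd edge above its odd vertex by one. -/
noncomputable def edgePt (hq : 3 ≤ q) : ℍ :=
  ⟨⟨Real.cos (Real.pi / q), Real.sin (Real.pi / q) + 1⟩, by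
    have := sin_theta_pos hq; change 0 < Real.sin (Real.pi / q) + 1; linarith⟩

theorem edgePt_mem (hq : 3 ≤ q) : edgePt hq ∈ baseOddEdge q := by
  refine ⟨rfl, ?_⟩
  change _ ≤ Real.sin (Real.pi / q) + 1
  linarith

theorem edgePt_ne (hq : 3 ≤ q) : edgePt hq ≠ rho hq := by
  intro h
  have h1 : (edgePt hq).im = (rho hq).im := by rw [h]
  have h2 : (edgePt hq).im = Real.sin (Real.pi / q) + 1 := rfl
  rw [h2, rho_im] at h1
  linarith

theorem rho_mem_oddEdge (hq : 3 ≤ q) : rho hq ∈ baseOddEdge q := ⟨rfl, le_rfl⟩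

theorem oddEdge_subset_frontier (hq : 3 ≤ q) {𝒢 : Set (Gam q)} (hfin : 𝒢.Finite) {g : Gam q} :
    g • baseOddEdge q ⊆ frontier (poly 𝒢) ↔ ¬ (g ∈ 𝒢 ↔ g * (gR q)⁻¹ ∈ 𝒢) := by
  have e1 : ∀ z : ℍ, g⁻¹ • g • z = z := fun z => inv_smul_smul _ _
  have e2 : ∀ z : ℍ, (g * (gR q)⁻¹)⁻¹ • g • z = R q • z := fun z => by
    rw [mul_inv_rev, mul_smul, e1, inv_inv]; rfl
  constructor
  · intro hsub h
    have hz := edgePt_mem hq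
    have hne := edgePt_ne hq
    obtain ⟨hc, hi⟩ := hsub (Set.smul_mem_smul_set hz)
    set z := edgePt hq
    rw [(isClosed_poly hq hfin).closure_eq] at hc
    obtain ⟨k, hk, hk'⟩ := hc
    have hk2 := eq_one_or_R_inv hq (g⁻¹ * k).2 hz hne hk' (by
      change _ = (g⁻¹ * k) • k⁻¹ • g • z
      rw [mul_smul, smul_inv_smul, e1])
    have hg : g ∈ 𝒢 ∧ g * (gR q)⁻¹ ∈ 𝒢 := by
      rcases hk2 with h2 | h2
      · have : g⁻¹ * k = 1 := Subtype.ext h2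
        have : g ∈ 𝒢 := by rwa [inv_mul_eq_one.1 this]
        exact ⟨this, h.1 this⟩
      · have : g⁻¹ * k = (gR q)⁻¹ := Subtype.ext h2
        rw [inv_mul_eq_iff_eq_mul] at this
        have : g * (gR q)⁻¹ ∈ 𝒢 := by rwa [← this]
        exact ⟨h.2 this, this⟩
    apply hi
    obtain ⟨hzt, h0⟩ := (mem_baseOddEdge_iff hq z).1 hz
    obtain ⟨-, r2, r3, r4⟩ := R_smul_oddEdge hq hz
    let V : Set ℍ := {w | ray q 1 w < 0} ∩ {w | 0 < w.re}
    let W : Set ℍ := {w | 0 < ray q 0 w} ∩ {w | 0 < w.re}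
    have hV : IsOpen V := (isOpen_lt (continuous_ray 1) continuous_const).inter
      (isOpen_lt continuous_const UpperHalfPlane.continuous_re)
    have hW : IsOpen W := (isOpen_lt continuous_const (continuous_ray 0)).inter
      (isOpen_lt continuous_const UpperHalfPlane.continuous_re)
    refine mem_interior.2 ⟨{w | g⁻¹ • w ∈ V} ∩ {w | (g * (gR q)⁻¹)⁻¹ • w ∈ W}, ?_,
      (isOpen_preimage_smul hV _).inter (isOpen_preimage_smul hW _), ?_⟩
    · rintro w ⟨⟨h1, h2⟩, h3, h4⟩
      change ray q 1 (g⁻¹ • w) < 0 at h1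
      change 0 < (g⁻¹ • w).re at h2
      change 0 < ray q 0 _ at h3
      change 0 < UpperHalfPlane.re _ at h4
      rcases le_total 0 (ray q 0 (g⁻¹ • w)) with h5 | h5
      · exact ⟨g, hg.1, (mem_triangle_iff hq _).2 ⟨h2.le, mem_sector_zero h5 h1.le⟩⟩
      · refine ⟨_, hg.2, (mem_triangle_iff hq _).2 ⟨h4.le, mem_sector_zero h3.le ?_⟩⟩
        have : (g * (gR q)⁻¹)⁻¹ • w = R q • (g⁻¹ • w) := by
          rw [mul_inv_rev, mul_smul, inv_inv]; rfl
        rw [this, ray_R_smul_nonpos, sub_self]; exact h5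
    · have hs := ((mem_triangle_iff hq z).1 hzt)
      constructor
      · change g⁻¹ • g • z ∈ V
        rw [e1]
        refine ⟨lt_of_le_of_ne (ray_of_mem_sector_zero hs.2).2
          fun h => hne (eq_rho_of_rays hq h0 h), ?_⟩
        change 0 < Real.cos (Real.pi / q)
        exact rho_re_pos hq
      · change (g * (gR q)⁻¹)⁻¹ • g • z ∈ W
        rw [e2]; exact ⟨r4 hne, r2⟩
  · rintro h _ ⟨z, hz, rfl⟩
    have m1 := ((mem_baseOddEdge_iff hq z).1 hz).1
    have m2 := (R_smul_oddEdge hq hz).1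
    rw [← e1 z] at m1
    rw [← e2] at m2
    by_cases hg : g ∈ 𝒢
    · have : g * (gR q)⁻¹ ∉ 𝒢 := fun h' => h ⟨fun _ => h', fun _ => hg⟩
      exact mem_frontier_poly_of_ne hq hg this m1 m2
    · have : g * (gR q)⁻¹ ∈ 𝒢 := by
        by_contra h'; exact h ⟨fun h => absurd h hg, fun h => absurd h h'⟩
      exact mem_frontier_poly_of_ne hq this hg m2 m1

theorem oddEdge_injective (hq : 3 ≤ q) {g h : Gam q} (e : g • baseOddEdge q = h • baseOddEdge q) :
    g = h := by
  have h1 : g • edgePt hq ∈ h • baseOddEdge q := e ▸ Set.smul_mem_smul_set (edgePt_mem hq)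
  obtain ⟨w, hw, hw'⟩ := h1
  have hw' : h • w = g • edgePt hq := hw'
  have hwt := ((mem_baseOddEdge_iff hq w).1 hw).1
  rcases eq_one_or_R_inv hq (g⁻¹ * h).2 (edgePt_mem hq) (edgePt_ne hq) hwt (by
    change _ = (g⁻¹ * h) • w
    rw [mul_smul, hw', inv_smul_smul]) with h2 | h2
  · have : g⁻¹ * h = 1 := Subtype.ext h2
    exact inv_mul_eq_one.1 this
  · have h3 : g⁻¹ * h = (gR q)⁻¹ := Subtype.ext h2
    rw [inv_mul_eq_iff_eq_mul] at h3
    have h4 : w = R q • edgePt hq := by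
      rw [h3, mul_smul, smul_left_cancel_iff, inv_smul_eq_iff] at hw'
      exact hw'
    have h5 := (R_smul_oddEdge hq (edgePt_mem hq)).2.2.2 (edgePt_ne hq)
    rw [← h4, ((mem_baseOddEdge_iff hq w).1 hw).2] at h5
    exact absurd h5 (lt_irrefl _)

theorem line_injective (hq : 3 ≤ q) {g h : Gam q} {z w : ℍ} (hz : z.re = 0) (hw : w.re = 0)
    (e : g • z = h • w) : h = g ∨ h = g * gS q := by
  rcases line_eq hq (g⁻¹ * h).2 hz hw (by
    change _ = (g⁻¹ * h) • w
    rw [mul_smul, ← e, inv_smul_smul]) with h2 | h2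
  · have : g⁻¹ * h = 1 := Subtype.ext h2
    exact Or.inl (inv_mul_eq_one.1 this).symm
  · have : g⁻¹ * h = gS q := Subtype.ext h2
    exact Or.inr (inv_mul_eq_iff_eq_mul.1 this)

theorem eq_or_eq_of_line (hq : 3 ≤ q) {g h : Gam q} (e : g • baseLine = h • baseLine) :
    h = g ∨ h = g * gS q := by
  have h1 : g • iPt 1 one_pos ∈ h • baseLine :=
    e ▸ Set.smul_mem_smul_set (iPt_re 1 one_pos)
  obtain ⟨w, hw, hw'⟩ := h1
  exact line_injective hq (iPt_re 1 one_pos) hw hw'.symm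

theorem gS_smul_line : gS q • baseLine = baseLine := by
  have h : gS q • baseLine ⊆ baseLine := by
    rintro _ ⟨z, hz, rfl⟩
    exact S_smul_re_zero hz
  refine h.antisymm fun z hz => ?_
  rw [Set.mem_smul_set_iff_inv_smul_mem, gS_inv]
  exact h (Set.smul_mem_smul_set hz)

theorem S_iPt_im (y : ℝ) (hy : 0 < y) : (S • iPt y hy).im * y = 1 := by
  have := S_smul_im (iPt y hy)
  rw [iPt_re, iPt_im] at this
  have h2 : ((S • iPt y hy).im * y) * y = 1 * y := by linarith
  exact mul_right_cancel₀ hy.ne' h2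

theorem baseEvenEdge_subset : baseEvenEdge ⊆ baseLine := fun _ h => h.1

theorem evenEdge_injective (hq : 3 ≤ q) {g h : Gam q} (e : g • baseEvenEdge = h • baseEvenEdge) :
    g = h := by
  have hm : iPt 2 two_pos ∈ baseEvenEdge := ⟨rfl, by rw [iPt_im]; norm_num⟩
  have h1 : g • iPt 2 two_pos ∈ h • baseEvenEdge := e ▸ Set.smul_mem_smul_set hm
  obtain ⟨w, hw, hw'⟩ := h1
  have hw' : h • w = g • iPt 2 two_pos := hw'
  rcases line_injective hq (iPt_re 2 two_pos) hw.1 hw'.symm with h2 | rfl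
  · exact h2.symm
  · rw [mul_smul, smul_left_cancel_iff] at hw'
    have h3 : w = S • iPt 2 two_pos := by
      rw [← hw', gS_smul, S_smul_S_smul]
    have h4 := S_iPt_im 2 two_pos
    have h5 := hw.2
    rw [h3] at h5
    linarith

theorem evenEdge_ne_line (hq : 3 ≤ q) (g h : Gam q) : g • baseEvenEdge ≠ h • baseLine := by
  intro e
  have hm : iPt 2 two_pos ∈ baseEvenEdge := ⟨rfl, by rw [iPt_im]; norm_num⟩
  have h1 : g • iPt 2 two_pos ∈ h • baseLine := e ▸ Set.smul_mem_smul_set hm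
  obtain ⟨w, hw, hw'⟩ := h1
  have e2 : g • baseLine = h • baseLine := by
    rcases line_injective hq (iPt_re 2 two_pos) hw hw'.symm with rfl | rfl
    · rfl
    · rw [mul_smul, gS_smul_line]
  have h3 : g • (S • iPt 2 two_pos) ∈ g • baseEvenEdge := by
    rw [e, ← e2]
    exact Set.smul_mem_smul_set (S_smul_re_zero (iPt_re 2 two_pos))
  rw [Set.smul_mem_smul_set_iff] at h3
  have h4 := S_iPt_im 2 two_pos
  have := h3.2
  linarith

theorem oddEdge_not_subset_line (hq : 3 ≤ q) (g h : Gam q) : ¬ g • baseOddEdge q ⊆ h • baseLine := by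
  intro e
  have h1 := e (Set.smul_mem_smul_set (rho_mem_oddEdge hq))
  rw [Set.mem_smul_set_iff_inv_smul_mem, ← mul_smul] at h1
  exact rho_not_mem_line hq (h⁻¹ * g).2 h1

end

/-! ### Hyperbolic segments and half planes -/

/-- A Möbius transformation moves two given points to the imaginary axis. -/
theorem exists_smul_re_eq_zero (z w : ℍ) : ∃ A : SL(2, ℝ), (A • z).re = 0 ∧ (A • w).re = 0 := by
  by_cases h : z.re = w.re
  · let A : SL(2, ℝ) := ⟨!![1, -z.re; 0, 1], by simp [Matrix.det_fin_two]⟩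
    have hA : ∀ p : ℍ, p.re = z.re → (A • p).re = 0 := by
      intro p hp
      have := re_sl_smul A p
      simpa [A, hp] using this
    exact ⟨A, hA z rfl, hA w h.symm⟩
  · -- the geodesic through `z` and `w` has the end points `c - s` and `c + s`
    have hd : z.re - w.re ≠ 0 := sub_ne_zero.2 h
    set c := ((z.re ^ 2 + z.im ^ 2) - (w.re ^ 2 + w.im ^ 2)) / (2 * (z.re - w.re)) with hc
    set s := Real.sqrt ((z.re - c) ^ 2 + z.im ^ 2) with hs
    have hpos : 0 < (z.re - c) ^ 2 + z.im ^ 2 := by have := z.im_pos; positivity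
    have hs2 : s ^ 2 = (z.re - c) ^ 2 + z.im ^ 2 := Real.sq_sqrt hpos.le
    have hs0 : 0 < s := Real.sqrt_pos.2 hpos
    have hw : s ^ 2 = (w.re - c) ^ 2 + w.im ^ 2 := by
      have : c * (2 * (z.re - w.re)) = (z.re ^ 2 + z.im ^ 2) - (w.re ^ 2 + w.im ^ 2) := by
        rw [hc]; field_simp
      rw [hs2]; linarith
    set m := Real.sqrt (2 * s) with hm
    have hm2 : m * m = 2 * s := Real.mul_self_sqrt (by linarith)
    have hm0 : m ≠ 0 := (Real.sqrt_pos.2 (by linarith)).ne'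
    let A : SL(2, ℝ) := ⟨!![1 / m, -(c - s) / m; -1 / m, (c + s) / m], by
      rw [Matrix.det_fin_two_of]
      field_simp
      linarith⟩
    have hA : ∀ p : ℍ, s ^ 2 = (p.re - c) ^ 2 + p.im ^ 2 → (A • p).re = 0 := by
      intro p hp
      have h1 := re_sl_smul A p
      have h2 := denom_pos A p
      have h3 : A 0 0 * A 1 0 * (p.re ^ 2 + p.im ^ 2) + (A 0 0 * A 1 1 + A 0 1 * A 1 0) * p.re
          + A 0 1 * A 1 1 = 0 := by
        simp only [A, Matrix.of_apply, Matrix.cons_val', Matrix.cons_val_zero, Matrix.cons_val_one,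
          Matrix.cons_val_fin_one]
        field_simp
        linarith
      rw [h3] at h1
      exact (mul_eq_zero.1 h1).resolve_right h2.ne'
    exact ⟨A, hA z hs2, hA w hw⟩

/-- Two points are joined by a connected set of points between them. -/
theorem exists_preconnected_between (z w : ℍ) : ∃ s : Set ℍ, IsPreconnected s ∧ z ∈ s ∧ w ∈ s ∧
    ∀ p ∈ s, dist z p + dist p w = dist z w := by
  obtain ⟨A, hz, hw⟩ := exists_smul_re_eq_zero z w
  let f : ℝ → ℍ := fun t => iPt (Real.exp t) (Real.exp_pos t)
  have hf : Continuous f := by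
    apply UpperHalfPlane.isEmbedding_coe.continuous_iff.2
    have : (fun t : ℝ => (f t : ℂ)) = fun t : ℝ => ((Real.exp t : ℝ) : ℂ) * Complex.I := by
      funext t
      apply Complex.ext <;> simp [f, iPt, -Complex.ofReal_exp]
    change Continuous (fun t : ℝ => (f t : ℂ))
    rw [this]
    fun_prop
  have hlog : ∀ p : ℍ, p.re = 0 → f (Real.log p.im) = p := by
    intro p hp
    apply UpperHalfPlane.ext
    apply Complex.ext
    · exact hp.symm
    · exact Real.exp_log p.im_pos
  have hdist : ∀ a b, dist (f a) (f b) = dist a b := by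
    intro a b
    rw [UpperHalfPlane.dist_of_re_eq (by rfl)]
    simp only [f, iPt_im, Real.log_exp]
  set a := Real.log (A • z).im
  set b := Real.log (A • w).im
  refine ⟨(fun p : ℍ => A⁻¹ • p) '' (f '' Set.uIcc a b), ?_, ?_, ?_, ?_⟩
  · exact (isPreconnected_uIcc.image f hf.continuousOn).image _
      (continuous_const_smul A⁻¹).continuousOn
  · exact ⟨A • z, ⟨a, Set.left_mem_uIcc, hlog _ hz⟩, inv_smul_smul _ _⟩
  · exact ⟨A • w, ⟨b, Set.right_mem_uIcc, hlog _ hw⟩, inv_smul_smul _ _⟩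
  · rintro _ ⟨_, ⟨t, ht, rfl⟩, rfl⟩
    change dist z (A⁻¹ • f t) + dist (A⁻¹ • f t) w = dist z w
    rw [← dist_smul A z (A⁻¹ • f t), ← dist_smul A (A⁻¹ • f t) w, ← dist_smul A z w, smul_inv_smul,
      ← hlog _ hz, ← hlog _ hw, hdist, hdist, hdist]
    rw [← segment_eq_uIcc] at ht
    exact dist_add_dist_of_mem_segment ht

/-- The half planes bounded by vertical lines are convex: replacing a point outside by a suitable
point of the boundary line decreases its distance to all points of the half plane. -/
theorem isHypConvex_halfPlane (a c : ℝ) : IsHypConvex {z | 0 ≤ a * (z.re - c)} := by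
  intro z hz w hw p hp
  by_contra hpn
  have hpn : a * (p.re - c) < 0 := by simpa using hpn
  set y := Real.sqrt ((p.re - c) ^ 2 + p.im ^ 2)
  have him := p.im_pos
  have hne : p.re - c ≠ 0 := by rintro h; rw [h] at hpn; simp at hpn
  have hy2 : y ^ 2 = (p.re - c) ^ 2 + p.im ^ 2 := Real.sq_sqrt (by positivity)
  have hy : p.im < y := by
    apply Real.lt_sqrt_of_sq_lt
    have : 0 < (p.re - c) ^ 2 := by positivity
    linarith
  have hy0 : 0 < y := him.trans hy
  let p' : ℍ := ⟨⟨c, y⟩, hy0⟩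
  have key : ∀ u : ℍ, 0 ≤ a * (u.re - c) → dist u p' < dist u p := by
    intro u hu
    have h1 : (u.re - c) * (p.re - c) ≤ 0 := by
      by_contra h
      push Not at h
      have h2 := mul_nonpos_of_nonneg_of_nonpos hu hpn.le
      have h3 : a ^ 2 * ((u.re - c) * (p.re - c)) ≤ 0 := by nlinarith
      have ha : a ≠ 0 := by rintro rfl; simp at hpn
      have : 0 < a ^ 2 * ((u.re - c) * (p.re - c)) := by positivity
      linarith
    have h2 : Real.cosh (dist u p') < Real.cosh (dist u p) := by
      rw [UpperHalfPlane.cosh_dist', UpperHalfPlane.cosh_dist']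
      have e1 : p'.re = c := rfl
      have e2 : p'.im = y := rfl
      have hu0 := u.im_pos
      rw [e1, e2, hy2]
      have e3 : (u.re - p.re) ^ 2 = (u.re - c) ^ 2 + (p.re - c) ^ 2 - 2 * ((u.re - c) * (p.re - c)) := by
        ring
      rw [e3]
      apply div_lt_div₀' <;> nlinarith [mul_pos hu0 hu0, sq_nonneg (u.re - c), mul_pos hu0 him,
        sq_nonneg (p.re - c)]
    rwa [Real.cosh_lt_cosh, abs_of_nonneg dist_nonneg, abs_of_nonneg dist_nonneg] at h2
  have h1 := key z hz
  have h2 := key w hw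
  rw [dist_comm w p', dist_comm w p] at h2
  have := dist_triangle z p' w
  linarith

theorem IsHypConvex.inter {A B : Set ℍ} (hA : IsHypConvex A) (hB : IsHypConvex B) :
    IsHypConvex (A ∩ B) := fun z hz w hw p hp =>
  ⟨hA z hz.1 w hw.1 p hp, hB z hz.2 w hw.2 p hp⟩

section
variable {q : ℕ}

theorem IsHypConvex.preimage {A : Set ℍ} (hA : IsHypConvex A) (g : Gam q) :
    IsHypConvex {z | g • z ∈ A} := fun z hz w hw p hp =>
  hA _ hz _ hw _ (by rw [dist_smul, dist_smul, dist_smul]; exact hp)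

theorem IsHypConvex.biInter {ι : Type*} {s : Set ι} {A : ι → Set ℍ}
    (hA : ∀ i ∈ s, IsHypConvex (A i)) : IsHypConvex {z | ∀ i ∈ s, z ∈ A i} :=
  fun z hz w hw p hp i hi => hA i hi z (hz i hi) w (hw i hi) p hp

theorem isHypConvex_lhp : IsHypConvex {z | z.re ≤ 0} := by
  simpa using isHypConvex_halfPlane (-1) 0

theorem ray_R_pow_smul_nonpos (k : ℕ) (t : ℝ) (z : ℍ) :
    ray q t (R q ^ k • z) ≤ 0 ↔ ray q (t - k) z ≤ 0 := by
  induction k generalizing t with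
  | zero => simp
  | succ k ih =>
    rw [pow_succ', mul_smul, ray_R_smul_nonpos, ih]
    push_cast
    rw [show t - 1 - k = t - (k + 1) by ring]

/-- The sector at the odd vertex spanned by the first `r` of the `q` sectors is convex if it is the
whole plane or if its angle is at most `π`. -/
theorem isHypConvex_wedge (hq : 3 ≤ q) {r : ℕ} (hr : 1 ≤ r) (hrq : r = q ∨ 2 * r ≤ q) :
    IsHypConvex {z | ∃ k < r, z ∈ sector q k} := by
  rcases hrq with rfl | hrq
  · have : {z | ∃ k < r, z ∈ sector r k} = Set.univ := by
      ext z; simpa using exists_sector hq z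
    rw [this]
    exact fun _ _ _ _ _ _ => trivial
  · have : {z | ∃ k < r, z ∈ sector q k} = {z | 0 ≤ -1 * (z.re - lam q / 2)} ∩
        {z | (gR q ^ r)⁻¹ • z ∈ {z | 0 ≤ 1 * (z.re - lam q / 2)}} := by
      ext z
      rw [Set.mem_ofPred_eq, ← mem_wedge_iff hq hr hrq]
      apply and_congr
      · rw [ray_zero hq, Set.mem_ofPred_eq]
        constructor <;> intro h <;> linarith
      · have h1 := ray_R_pow_smul_nonpos (q := q) r r ((gR q ^ r)⁻¹ • z)
        rw [← gR_pow_smul, smul_inv_smul, sub_self, ray_zero hq] at h1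
        rw [h1, Set.mem_ofPred_eq, Set.mem_ofPred_eq]
        constructor <;> intro h <;> linarith
    rw [this]
    exact (isHypConvex_halfPlane _ _).inter ((isHypConvex_halfPlane _ _).preimage _)

/-! ### Convexity of triangulated unions -/

theorem smul_mem_sector_of_branch (hq : 3 ≤ q) {g h : Gam q} (hh : h ∈ branch g) {z : ℍ}
    (hz : h⁻¹ • z ∈ triangle q) : g⁻¹ • z ∈ sector q 0 := by
  rcases hh with rfl | hh
  · exact ((mem_triangle_iff hq _).1 hz).2
  · apply mem_sector_of_re_nonpos hq
    have := re_nonpos_of_not_pos hq hh (triangle_subset_fan (by omega) hz)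
    rwa [mul_smul, smul_inv_smul] at this

theorem re_nonpos_of_neg (hq : 3 ≤ q) {g h : Gam q} (hh : ¬ Pos (g⁻¹ * h)) {z : ℍ}
    (hz : h⁻¹ • z ∈ triangle q) : (g⁻¹ • z).re ≤ 0 := by
  have := re_nonpos_of_not_pos hq hh (triangle_subset_fan (by omega) hz)
  rwa [mul_smul, smul_inv_smul] at this

/-- A point on the left of a triangle is on the right of the other triangles of its `q`-gon. -/
theorem re_pos_of_sector (hq : 3 ≤ q) {g : Gam q} {j k : ℕ} (hj : j < q) (hk : k < q)
    (hjk : j ≠ k) {z : ℍ} (hz : (g * gR q ^ j)⁻¹ • z ∈ sector q 0) :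
    0 < ((g * gR q ^ k)⁻¹ • z).re := by
  have e : (g * gR q ^ k)⁻¹ • z = gR q ^ ((q - k + j) % q) • (g * gR q ^ j)⁻¹ • z := by
    rw [gR_pow_mod hq, pow_add, ← gR_pow_inv hq hk.le, ← mul_smul]
    congr 1
    group
  rw [e, gR_pow_smul]
  refine re_R_pow_smul_pos hq hz ?_ (Nat.mod_lt _ (by omega))
  rcases lt_or_gt_of_ne hjk with h | h
  · rw [Nat.mod_eq_of_lt (by omega)]; omega
  · rw [show q - k + j = (j - k) + q by omega, Nat.add_mod_right, Nat.mod_eq_of_lt (by omega)]; omega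

theorem smul_mem_sector_iff (hq : 3 ≤ q) (g : Gam q) (k : ℕ) (z : ℍ) :
    (g * gR q ^ k)⁻¹ • z ∈ sector q 0 ↔ g⁻¹ • z ∈ sector q k := by
  rw [← R_pow_smul_mem_sector k, ← gR_pow_smul, ← mul_smul]
  congr! 2
  group

/-- The union of the triangles of `𝒢` and the half plane beyond the line of `g` is convex. -/
theorem IsTriangulated.convex_union_halfPlane (hq : 3 ≤ q) {𝒢 : Set (Gam q)}
    (h𝒢 : IsTriangulated 𝒢) (hfin : 𝒢.Finite) (n : ℕ) :
    ∀ g : Gam q, {h ∈ 𝒢 | Pos (g⁻¹ * h)}.ncard ≤ n → (g ∈ 𝒢 ∨ g * gS q ∈ 𝒢) →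
      IsHypConvex (poly 𝒢 ∪ {z | (g⁻¹ • z).re ≤ 0}) := by
  induction n with
  | zero =>
    intro g hn hg
    have hem : {h ∈ 𝒢 | Pos (g⁻¹ * h)} = ∅ :=
      (Set.ncard_eq_zero (hfin.subset fun _ h => h.1)).1 (Nat.le_zero.1 hn)
    have hsub : poly 𝒢 ⊆ {z | (g⁻¹ • z).re ≤ 0} := by
      rintro z ⟨h, hh, hz⟩
      refine re_nonpos_of_neg hq (fun hp => ?_) hz
      exact Set.eq_empty_iff_forall_notMem.1 hem h ⟨hh, hp⟩
    rw [Set.union_eq_self_of_subset_left hsub]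
    exact isHypConvex_lhp.preimage g⁻¹
  | succ n ih =>
    intro g hn hg
    by_cases hgm : g ∈ 𝒢
    · -- `g = g₀ R ^ j` belongs to the tile consisting of the `g₀ R ^ k Φ` with `k < r`
      obtain ⟨g₀, r, j, hr, hrq, hjr, rfl, hmem, hbr⟩ : ∃ g₀ r j, 1 ≤ r ∧ (r = q ∨ 2 * r ≤ q) ∧
          j < r ∧ g = g₀ * gR q ^ j ∧ (∀ k < r, g₀ * gR q ^ k ∈ 𝒢) ∧
          ∀ h ∈ 𝒢, ∃ k < r, h ∈ branch (g₀ * gR q ^ k) := by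
        rcases h𝒢.tile g hgm with h1 | ⟨g₀, r, j, hp, hj, rfl⟩
        · exact ⟨g, q, 0, by omega, Or.inl rfl, by omega, by simp, fun k _ => h1 k,
            fun h _ => exists_mem_branch hq g h⟩
        · obtain ⟨hd, hr, hrq, hmem⟩ := hp.resolve_left (by omega)
          refine ⟨g₀, r, j, hr, Or.inr ?_, hj, rfl, fun k hk => (hmem k (by omega)).2 hk, ?_⟩
          · obtain ⟨c, rfl⟩ := hd
            have : c ≠ 1 := by rintro rfl; omega
            have : c ≠ 0 := by rintro rfl; omega
            have : 2 ≤ c := by omega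
            nlinarith
          · intro h hh
            obtain ⟨k, hkq, hk⟩ := exists_mem_branch hq g₀ h
            refine ⟨k, ?_, hk⟩
            by_contra hkr
            exact h𝒢.disjoint_beyond hq hp ((mem_beyond_of_one_le hr).2
              ⟨k, by omega, hkq, hk⟩) hh
      have hrq' : r ≤ q := by omega
      have heq : poly 𝒢 ∪ {z | ((g₀ * gR q ^ j)⁻¹ • z).re ≤ 0} =
          {z | g₀⁻¹ • z ∈ {z | ∃ k < r, z ∈ sector q k}} ∩ {z | ∀ k ∈ {k | k < r ∧ k ≠ j},
            z ∈ poly 𝒢 ∪ {z | ((g₀ * gR q ^ k * gS q)⁻¹ • z).re ≤ 0}} := by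
        have hS : ∀ (k : ℕ) (z : ℍ), ((g₀ * gR q ^ k * gS q)⁻¹ • z).re ≤ 0 ↔
            0 ≤ ((g₀ * gR q ^ k)⁻¹ • z).re := by
          intro k z
          rw [mul_inv_rev _ (gS q), mul_smul, gS_inv, gS_smul, S_smul_re_nonpos]
        ext z
        constructor
        · rintro (hz | hz)
          · refine ⟨?_, fun k _ => Or.inl hz⟩
            obtain ⟨h, hh, hz⟩ := hz
            obtain ⟨k, hk, hk'⟩ := hbr h hh
            exact ⟨k, hk, (smul_mem_sector_iff hq g₀ k z).1 (smul_mem_sector_of_branch hq hk' hz)⟩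
          · have hz1 := mem_sector_of_re_nonpos hq hz
            refine ⟨⟨j, hjr, (smul_mem_sector_iff hq g₀ j z).1 hz1⟩, ?_⟩
            rintro k ⟨hk, hkj⟩
            right
            rw [Set.mem_ofPred_eq, hS]
            exact (re_pos_of_sector hq (by omega) (by omega) (Ne.symm hkj) hz1).le
        · rintro ⟨⟨k, hk, hzk⟩, hall⟩
          by_cases hzp : z ∈ poly 𝒢
          · exact Or.inl hzp
          right
          rw [← smul_mem_sector_iff hq] at hzk
          have hneg : ((g₀ * gR q ^ k)⁻¹ • z).re < 0 := by
            by_contra hc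
            push Not at hc
            exact hzp ⟨_, hmem k hk, (mem_triangle_iff hq _).2 ⟨hc, hzk⟩⟩
          by_cases hkj : k = j
          · rw [hkj] at hneg; exact hneg.le
          · have := (hall k ⟨hk, hkj⟩).resolve_left hzp
            rw [Set.mem_ofPred_eq, hS] at this
            linarith
      rw [heq]
      refine ((isHypConvex_wedge hq hr hrq).preimage _).inter (IsHypConvex.biInter ?_)
      rintro k ⟨hk, hkj⟩
      refine ih _ ?_ (Or.inr (by rw [mul_gS_mul_gS]; exact hmem k hk))
      have hlt : {h ∈ 𝒢 | Pos ((g₀ * gR q ^ k * gS q)⁻¹ * h)}.ncard <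
          {h ∈ 𝒢 | Pos ((g₀ * gR q ^ j)⁻¹ * h)}.ncard := by
        have hfin' : {h ∈ 𝒢 | Pos ((g₀ * gR q ^ j)⁻¹ * h)}.Finite := hfin.subset fun _ h => h.1
        have hS : ∀ h, Pos ((g₀ * gR q ^ k * gS q)⁻¹ * h) ↔ ¬ Pos ((g₀ * gR q ^ k)⁻¹ * h) := by
          intro h
          rw [mul_inv_rev _ (gS q), mul_assoc, gS_inv, pos_S_mul hq]
        refine Set.ncard_lt_ncard ⟨?_, ?_⟩ hfin'
        · rintro h ⟨hh, hp⟩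
          rw [hS] at hp
          exact ⟨hh, pos_of_mem_branch hq (by omega) (by omega) (Ne.symm hkj) (Or.inr hp)⟩
        · intro hsub
          have h1 : g₀ * gR q ^ j ∈ {h ∈ 𝒢 | Pos ((g₀ * gR q ^ j)⁻¹ * h)} :=
            ⟨hmem j hjr, by rw [inv_mul_cancel]; exact pos_one hq⟩
          have h2 := (hsub h1).2
          rw [hS] at h2
          exact h2 (pos_of_mem_branch hq (by omega) (by omega) hkj (self_mem_branch _))
      omega
    · have hsub : poly 𝒢 ⊆ {z | (g⁻¹ • z).re ≤ 0} := by
        rintro z ⟨h, hh, hz⟩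
        refine re_nonpos_of_neg hq (fun hp => ?_) hz
        refine hgm (h𝒢.convex g h _ hh (hg.resolve_left hgm) hp ?_)
        rw [inv_mul_cancel_left]; exact not_pos_S hq
      rw [Set.union_eq_self_of_subset_left hsub]
      exact isHypConvex_lhp.preimage g⁻¹

theorem IsTriangulated.isHypConvex (hq : 3 ≤ q) {𝒢 : Set (Gam q)} (h𝒢 : IsTriangulated 𝒢)
    (hfin : 𝒢.Finite) (hbase : 1 ∈ 𝒢 ∨ gS q ∈ 𝒢) : IsHypConvex (poly 𝒢) := by
  have h1 := h𝒢.convex_union_halfPlane hq hfin _ 1 le_rfl (by rwa [one_mul])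
  have h2 := h𝒢.convex_union_halfPlane hq hfin _ (gS q) le_rfl (by rw [gS_mul_gS]; exact hbase.symm)
  have : poly 𝒢 = (poly 𝒢 ∪ {z | ((1 : Gam q)⁻¹ • z).re ≤ 0}) ∩
      (poly 𝒢 ∪ {z | ((gS q)⁻¹ • z).re ≤ 0}) := by
    rw [← Set.union_inter_distrib_left, eq_comm, Set.union_eq_left]
    rintro z ⟨h1, h2⟩
    rw [Set.mem_ofPred_eq, inv_one, one_smul] at h1
    rw [Set.mem_ofPred_eq, gS_inv, gS_smul, S_smul_re_nonpos] at h2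
    have hz : z.re = 0 := le_antisymm h1 h2
    rcases hbase with h | h
    · exact ⟨_, h, by rw [inv_one, one_smul]; exact mem_triangle_of_line hq hz⟩
    · exact ⟨_, h, by rw [gS_inv, gS_smul]; exact mem_triangle_of_line hq (S_smul_re_zero hz)⟩
  rw [this]
  exact h1.inter h2

/-! ### Convex polygons and triangulated sets -/

theorem mem_smul_fan_iff (g : Gam q) (r : ℕ) (z : ℍ) :
    z ∈ g • fan q r ↔ ∃ k < r, (g * gR q ^ k)⁻¹ • z ∈ triangle q := by
  rw [Set.mem_smul_set_iff_inv_smul_mem, mem_fan_iff]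
  refine exists_congr fun k => and_congr_right fun _ => ?_
  constructor
  · rintro ⟨w, hw, e⟩
    rw [mul_inv_rev, mul_smul, e, ← gR_pow_smul, inv_smul_smul]
    exact hw
  · intro h
    refine ⟨_, h, ?_⟩
    rw [← gR_pow_smul, ← mul_smul]
    congr 1
    group

theorem smul_triangle_subset_fan {g : Gam q} {r k : ℕ} (hk : k < r) :
    (g * gR q ^ k) • triangle q ⊆ g • fan q r := by
  intro z hz
  rw [Set.mem_smul_set_iff_inv_smul_mem] at hz
  exact (mem_smul_fan_iff g r z).2 ⟨k, hk, hz⟩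

theorem smul_tau_mem_fan (hq : 3 ≤ q) {g h : Gam q} {r : ℕ} (hh : h • tau q ∈ g • fan q r) :
    ∃ k < r, h = g * gR q ^ k := by
  obtain ⟨k, hk, hz⟩ := (mem_smul_fan_iff g r _).1 hh
  exact ⟨k, hk, eq_of_mem_openTriangle hq (by rw [inv_smul_smul]; exact tau_mem hq) hz⟩

theorem smul_fan_full (hq : 3 ≤ q) (g : Gam q) (j : ℕ) :
    (g * gR q ^ j) • fan q q = g • fan q q := by
  have h1 : ∀ j, gR q ^ j • fan q q ⊆ fan q q := by
    rintro j _ ⟨z, hz, rfl⟩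
    exact R_pow_smul_mem_fan hq j hz
  rw [mul_smul]
  congr 1
  refine (h1 j).antisymm ?_
  have h2 := h1 (q - j % q)
  rw [← gR_pow_inv hq (Nat.mod_lt _ (by omega)).le, gR_pow_mod hq] at h2
  exact Set.subset_smul_set_iff.2 h2

/-- The set of triangles contained in `P`. -/
def trianglesOf (q : ℕ) (P : Set ℍ) : Set (Gam q) := {g | g • triangle q ⊆ P}

theorem isTile_cases {t : Set ℍ} (ht : IsTile q t) :
    ∃ (g : Gam q) (r : ℕ), (r = q ∨ (r ∣ q ∧ 1 ≤ r ∧ r < q)) ∧ t = g • fan q r := by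
  rcases ht with ⟨g, hg, rfl⟩ | ⟨r, hd, h1, h2, g, hg, rfl⟩
  · exact ⟨⟨g, hg⟩, q, Or.inl rfl, rfl⟩
  · exact ⟨⟨g, hg⟩, r, Or.inr ⟨hd, h1, h2⟩, rfl⟩

theorem smul_rho_mem_fan (hq : 3 ≤ q) (g : Gam q) {r : ℕ} (hr : 1 ≤ r) :
    g • rho hq ∈ g • fan q r :=
  Set.smul_mem_smul_set (triangle_subset_fan hr (rho_mem_triangle hq))

theorem smul_rho_R_pow (hq : 3 ≤ q) (g : Gam q) (k : ℕ) : (g * gR q ^ k) • rho hq = g • rho hq := by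
  rw [mul_smul, gR_pow_smul, R_pow_smul_rho]

/-- A convex polygon is a triangulated union of triangles. -/
theorem isTriangulated_of_isConvexPolygon (hq : 3 ≤ q) {P : Set ℍ} (hP : IsConvexPolygon q P) :
    IsTriangulated (trianglesOf q P) ∧ (trianglesOf q P).Finite ∧ poly (trianglesOf q P) = P := by
  obtain ⟨hconv, tiles, hfin, htile, hmeet, rfl⟩ := hP
  set P := ⋃₀ tiles
  have htri : ∀ g ∈ trianglesOf q P, ∃ t ∈ tiles, g • tau q ∈ t := fun g hg =>
    hg (Set.smul_mem_smul_set (mem_triangle_tau hq))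
  have hsub : ∀ {g : Gam q} {r k : ℕ}, g • fan q r ∈ tiles → k < r →
      g * gR q ^ k ∈ trianglesOf q P := fun ht hk =>
    (smul_triangle_subset_fan hk).trans (Set.subset_sUnion_of_mem ht)
  have hpoly : poly (trianglesOf q P) = P := by
    apply Set.Subset.antisymm
    · rintro z ⟨g, hg, hz⟩
      exact hg ((Set.mem_smul_set_iff_inv_smul_mem).2 hz)
    · rintro z ⟨t, ht, hz⟩
      obtain ⟨g, r, hr, rfl⟩ := isTile_cases (htile t ht)
      obtain ⟨k, hk, hz⟩ := (mem_smul_fan_iff g r z).1 hz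
      exact ⟨_, hsub ht hk, hz⟩
  refine ⟨⟨?_, ?_⟩, ?_, hpoly⟩
  · intro h hh
    obtain ⟨t, ht, hht⟩ := htri h hh
    obtain ⟨g, r, hr, rfl⟩ := isTile_cases (htile t ht)
    obtain ⟨j, hj, rfl⟩ := smul_tau_mem_fan hq hht
    rcases hr with rfl | ⟨hd, hr1, hrq⟩
    · left
      intro k
      rw [mul_assoc, ← pow_add, ← gR_pow_mod hq]
      exact hsub ht (Nat.mod_lt _ (by omega))
    · refine Or.inr ⟨g, r, j, Or.inr ⟨hd, hr1, hrq, fun k hkq => ⟨fun hk => ?_, hsub ht⟩⟩, hj, rfl⟩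
      by_contra hkr
      -- another tile of the same `q`-gon would meet this one in an odd vertex
      obtain ⟨t', ht', hkt'⟩ := htri _ hk
      obtain ⟨g', r', hr', rfl⟩ := isTile_cases (htile t' ht')
      have hne : g • fan q r ≠ g' • fan q r' := by
        intro e
        rw [← e] at hkt'
        obtain ⟨k', hk', e'⟩ := smul_tau_mem_fan hq hkt'
        have := R_pow_injective hq hkq (by omega) (mul_left_cancel e')
        omega
      obtain ⟨i, hi, hi'⟩ := smul_tau_mem_fan hq hkt'
      have hm : g • rho hq ∈ g • fan q r ∩ g' • fan q r' := by
        refine ⟨smul_rho_mem_fan hq g hr1, ?_⟩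
        rw [← smul_rho_R_pow hq g k, hi', smul_rho_R_pow]
        exact smul_rho_mem_fan hq g' (by omega)
      rcases hmeet _ ht _ ht' hne with h | ⟨a, ha, h⟩
      · rw [h] at hm; exact hm
      · rw [h, Set.mem_smul_set_iff_inv_smul_mem, gam_smul_def, ← mul_smul] at hm
        exact rho_not_mem_line hq ((⟨a, ha⟩ : Gam q)⁻¹ * g).2 hm
  · intro g h₁ h₂ hh₁ hh₂ hp hn
    have m1 : h₁ • tau q ∈ P := hh₁ (Set.smul_mem_smul_set (mem_triangle_tau hq))
    have m2 : h₂ • tau q ∈ P := hh₂ (Set.smul_mem_smul_set (mem_triangle_tau hq))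
    obtain ⟨s, hs, hs1, hs2, hs3⟩ := exists_preconnected_between (h₁ • tau q) (h₂ • tau q)
    have hp' : 0 < (g⁻¹ • h₁ • tau q).re := by rw [← mul_smul]; exact hp
    have hn' : (g⁻¹ • h₂ • tau q).re ≤ 0 := by
      rw [← mul_smul]; exact ((not_pos_iff hq _).1 hn).le
    let U : Set ℍ := {w | 0 < w.re}
    let V : Set ℍ := {w | 0 < ray q 0 w} ∩ {w | ray q 1 w < 0}
    have hU : IsOpen U := isOpen_lt continuous_const UpperHalfPlane.continuous_re
    have hV : IsOpen V := (isOpen_lt continuous_const (continuous_ray 0)).inter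
      (isOpen_lt (continuous_ray 1) continuous_const)
    obtain ⟨p, hp1, hpU, hpV⟩ := hs {z | g⁻¹ • z ∈ U} {z | g⁻¹ • z ∈ V}
      (isOpen_preimage_smul hU _) (isOpen_preimage_smul hV _) (fun z _ => by
        rcases lt_or_ge 0 (g⁻¹ • z).re with h | h
        · exact Or.inl h
        · exact Or.inr (rays_of_re_nonpos hq h))
      ⟨_, hs1, hp'⟩ ⟨_, hs2, rays_of_re_nonpos hq hn'⟩
    have hpP : p ∈ P := hconv _ m1 _ m2 p (hs3 p hp1)
    rw [← hpoly] at hpP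
    obtain ⟨h, hh, hhp⟩ := hpP
    have : g = h := eq_of_mem_openTriangle hq ⟨hpU, hpV.1, hpV.2⟩ hhp
    rwa [this]
  · refine (Set.Finite.biUnion hfin (t := fun t => {h : Gam q | h • tau q ∈ t}) ?_).subset ?_
    · intro t ht
      obtain ⟨g, r, hr, rfl⟩ := isTile_cases (htile t ht)
      refine ((Set.finite_Iio r).image fun k => g * gR q ^ k).subset ?_
      intro h hh
      obtain ⟨k, hk, rfl⟩ := smul_tau_mem_fan hq hh
      exact ⟨k, hk, rfl⟩
    · intro g hg
      obtain ⟨t, ht, h⟩ := htri g hg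
      exact Set.mem_biUnion ht h

/-- A finite triangulated set of triangles yields a convex polygon. -/
theorem IsTriangulated.isConvexPolygon (hq : 3 ≤ q) {𝒢 : Set (Gam q)} (h𝒢 : IsTriangulated 𝒢)
    (hfin : 𝒢.Finite) (hbase : 1 ∈ 𝒢 ∨ gS q ∈ 𝒢) : IsConvexPolygon q (poly 𝒢) := by
  let full : Gam q → ℕ → Prop := fun g r => (r = q ∧ ∀ k, g * gR q ^ k ∈ 𝒢) ∨ (1 ≤ r ∧ IsPiece 𝒢 g r)
  have hmem : ∀ {g r}, full g r → 1 ≤ r ∧ r ≤ q ∧ ∀ k < r, g * gR q ^ k ∈ 𝒢 := by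
    rintro g r (⟨rfl, h⟩ | ⟨hr, hp⟩)
    · exact ⟨by omega, le_rfl, fun k _ => h k⟩
    · obtain ⟨-, -, hrq, h⟩ := hp.resolve_left (by omega)
      exact ⟨hr, hrq.le, fun k hk => (h k (by omega)).2 hk⟩
  refine ⟨h𝒢.isHypConvex hq hfin hbase, {t | ∃ g r, full g r ∧ t = g • fan q r}, ?_, ?_, ?_, ?_⟩
  · refine ((hfin.prod (Set.finite_Iic q)).image fun x : Gam q × ℕ => x.1 • fan q x.2).subset ?_
    rintro t ⟨g, r, hf, rfl⟩
    obtain ⟨h1, h2, h3⟩ := hmem hf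
    exact ⟨(g, r), ⟨by simpa using h3 0 (by omega), h2⟩, rfl⟩
  · rintro t ⟨g, r, ⟨rfl, h⟩ | ⟨hr, hp⟩, rfl⟩
    · exact Or.inl ⟨g, g.2, rfl⟩
    · obtain ⟨hd, -, hrq, h⟩ := hp.resolve_left (by omega)
      exact Or.inr ⟨r, hd, hr, hrq, g, g.2, rfl⟩
  · rintro t ⟨g, r, hf, rfl⟩ t' ⟨g', r', hf', rfl⟩ hne
    obtain ⟨hr, hrq, hm⟩ := hmem hf
    obtain ⟨hr', hrq', hm'⟩ := hmem hf'
    -- tiles of the same `q`-gon coincide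
    have hgon : ∀ j, g' = g * gR q ^ j → g • fan q r = g' • fan q r' := by
      rintro j rfl
      rcases hf with ⟨rfl, h⟩ | ⟨-, hp⟩
      · rcases hf' with ⟨rfl, h'⟩ | ⟨-, hp'⟩
        · rw [smul_fan_full hq]
        · obtain ⟨-, -, hr'q, h'⟩ := hp'.resolve_left (by omega)
          exact absurd ((h' r' hr'q).1 (by rw [mul_assoc, ← pow_add]; exact h _)) (lt_irrefl _)
      · rcases hf' with ⟨rfl, h'⟩ | ⟨-, hp'⟩
        · obtain ⟨-, -, hr'q, hh⟩ := hp.resolve_left (by omega)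
          have := h' (r' - j % r' + r)
          rw [← gR_pow_mod hq j, mul_assoc, ← pow_add, ← add_assoc,
            Nat.add_sub_cancel' (Nat.mod_lt j (by omega)).le, pow_add, gR_pow_q hq, one_mul,
            hh r hr'q] at this
          exact absurd this (lt_irrefl _)
        · obtain ⟨e1, e2⟩ := hp.unique_in_gon hq hr hp' hr'
          rw [e1, e2]
    have key : ∀ z : ℍ, z ∈ g • fan q r ∩ g' • fan q r' → ∃ j < r, ∃ i < r',
        g' * gR q ^ i = g * gR q ^ j * gS q ∧ ((g * gR q ^ j)⁻¹ • z).re = 0 := by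
      rintro z ⟨h1, h2⟩
      obtain ⟨j, hj, h1⟩ := (mem_smul_fan_iff _ _ _).1 h1
      obtain ⟨i, hi, h2⟩ := (mem_smul_fan_iff _ _ _).1 h2
      rcases meet_cases hq ((g * gR q ^ j)⁻¹ * (g' * gR q ^ i)).2 h1 h2 (by
        change _ = ((g * gR q ^ j)⁻¹ * (g' * gR q ^ i)) • (g' * gR q ^ i)⁻¹ • z
        rw [mul_smul, smul_inv_smul]) with ⟨k, hk, h3⟩ | ⟨h3, h4⟩
      · have h3 : (g * gR q ^ j)⁻¹ * (g' * gR q ^ i) = gR q ^ k := Subtype.ext h3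
        rw [inv_mul_eq_iff_eq_mul, mul_assoc, ← pow_add] at h3
        refine absurd (hgon (j + k + (q - i)) ?_) hne
        rw [pow_add, ← mul_assoc, ← h3, mul_assoc, ← pow_add, show i + (q - i) = q by omega,
          gR_pow_q hq, mul_one]
      · have h3 : (g * gR q ^ j)⁻¹ * (g' * gR q ^ i) = gS q := Subtype.ext h3
        exact ⟨j, hj, i, hi, inv_mul_eq_iff_eq_mul.1 h3, h4⟩
    rcases Set.eq_empty_or_nonempty (g • fan q r ∩ g' • fan q r') with h | ⟨z, hz⟩
    · exact Or.inl h
    · right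
      obtain ⟨j, hj, i, hi, e, -⟩ := key z hz
      refine ⟨g * gR q ^ j, (g * gR q ^ j).2, ?_⟩
      change _ = (g * gR q ^ j) • baseLine
      apply Set.Subset.antisymm
      · intro w hw
        obtain ⟨j', hj', i', hi', e', hw0⟩ := key w hw
        have hjj : j' = j := by
          by_contra hjj
          have p1 := pos_of_mem_branch hq (by omega) (by omega) hjj
            (mul_S_mem_branch hq (self_mem_branch (g * gR q ^ j)))
          rw [← e, ← mul_assoc, pos_mul_R_pow hq, ← pos_mul_R_pow hq _ i', mul_assoc, e',
            inv_mul_cancel_left] at p1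
          exact not_pos_S hq p1
        rw [hjj] at hw0
        exact Set.mem_smul_set_iff_inv_smul_mem.2 hw0
      · rintro _ ⟨w, hw, rfl⟩
        have hw : w.re = 0 := hw
        constructor
        · refine (mem_smul_fan_iff _ _ _).2 ⟨j, hj, ?_⟩
          change (g * gR q ^ j)⁻¹ • (g * gR q ^ j) • w ∈ _
          rw [inv_smul_smul]; exact mem_triangle_of_line hq hw
        · refine (mem_smul_fan_iff _ _ _).2 ⟨i, hi, ?_⟩
          change (g' * gR q ^ i)⁻¹ • (g * gR q ^ j) • w ∈ _
          rw [e, mul_inv_rev _ (gS q), mul_smul, inv_smul_smul, gS_inv]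
          exact mem_triangle_of_line hq (S_smul_re_zero hw)
  · apply Set.Subset.antisymm
    · rintro z ⟨g, hg, hz⟩
      rcases h𝒢.tile g hg with h1 | ⟨g₀, r, j, hp, hj, rfl⟩
      · exact ⟨_, ⟨g, q, Or.inl ⟨rfl, h1⟩, rfl⟩,
          (mem_smul_fan_iff _ _ _).2 ⟨0, by omega, by simpa using hz⟩⟩
      · exact ⟨_, ⟨g₀, r, Or.inr ⟨by omega, hp⟩, rfl⟩, (mem_smul_fan_iff _ _ _).2 ⟨j, hj, hz⟩⟩
    · rintro z ⟨_, ⟨g, r, hf, rfl⟩, hz⟩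
      obtain ⟨k, hk, hz⟩ := (mem_smul_fan_iff _ _ _).1 hz
      exact ⟨_, (hmem hf).2.2 k hk, hz⟩

theorem isCuspOf_poly (hq : 3 ≤ q) (𝒢 : Set (Gam q)) (c : OnePoint ℝ) :
    IsCuspOf q (poly 𝒢) c ↔ c ∈ cuspSet 𝒢 := by
  constructor
  · rintro ⟨g, hg, hsub, h⟩
    exact ⟨⟨g, hg⟩, (smul_triangle_subset_poly hq ⟨g, hg⟩).1 hsub, h⟩
  · rintro ⟨g, hg, h⟩
    exact ⟨g, g.2, (smul_triangle_subset_poly hq g).2 hg, h⟩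

end

/-! ### End points of boundary pieces -/

section
variable {q : ℕ}

/-- `c` and `c'` are the end points `g v_m` and `g ∞` of the arc cut off by `g Φ_m`. For `m = 1` they
are `g 0` and `g ∞`. -/
def IsEnds (g : Gam q) (m : ℕ) (c c' : OnePoint ℝ) : Prop :=
  m ∣ q ∧ 1 ≤ m ∧ m < q ∧ (g * gR q ^ m) • OnePoint.infty = c ∧ g • OnePoint.infty = c'

theorem two_mul_le_of_dvd {m : ℕ} (hd : m ∣ q) (h1 : 1 ≤ m) (hq : m < q) : 2 * m ≤ q := by
  obtain ⟨c, rfl⟩ := hd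
  have : c ≠ 1 := by rintro rfl; omega
  have : c ≠ 0 := by rintro rfl; omega
  have : 2 ≤ c := by omega
  nlinarith

theorem IsEnds.two_mul_le {g : Gam q} {m : ℕ} {c c' : OnePoint ℝ} (h : IsEnds g m c c') :
    2 * m ≤ q := two_mul_le_of_dvd h.1 h.2.1 h.2.2.1

theorem toPoint_eq_infty {a b : ℝ} : toPoint a b = OnePoint.infty ↔ b = 0 := by
  unfold toPoint
  split_ifs with h <;> simp [h]

theorem exists_mul_of_toPoint_eq {a b a' b' : ℝ} (h : a ≠ 0 ∨ b ≠ 0) (h' : a' ≠ 0 ∨ b' ≠ 0)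
    (e : toPoint a b = toPoint a' b') : ∃ c : ℝ, a = c * a' ∧ b = c * b' := by
  by_cases hb : b = 0
  · have hb' : b' = 0 := by rw [← toPoint_eq_infty (a := a'), ← e, toPoint_eq_infty]; exact hb
    have ha' : a' ≠ 0 := h'.resolve_right (not_not.2 hb')
    exact ⟨a / a', by field_simp, by rw [hb, hb', mul_zero]⟩
  · have hb' : b' ≠ 0 := fun h0 => hb (by
      rw [← toPoint_eq_infty (a := a), e, toPoint_eq_infty]; exact h0)
    rw [toPoint, toPoint, if_neg hb, if_neg hb'] at e
    have e := OnePoint.coe_injective e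
    refine ⟨b / b', ?_, by field_simp⟩
    rw [div_eq_div_iff hb hb'] at e
    field_simp
    linarith

theorem column_ne_zero (A : SL(2, ℝ)) : (A 0 0 ≠ 0 ∨ A 1 0 ≠ 0) ∧ (A 0 1 ≠ 0 ∨ A 1 1 ≠ 0) := by
  have h := det_eq A
  constructor <;> by_contra hc <;> push Not at hc <;> rw [hc.1, hc.2] at h <;> simp at h

theorem smul_zero_eq (A : SL(2, ℝ)) :
    (A : PSL(2, ℝ)) • ((0 : ℝ) : OnePoint ℝ) = toPoint (A 0 1) (A 1 1) := by
  rw [smul_real_eq]; simp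

theorem matU_smul_coe (x y : ℝ) :
    (matU x : PSL(2, ℝ)) • (y : OnePoint ℝ) = ((y + x : ℝ) : OnePoint ℝ) := by
  rw [smul_real_eq]; simp [matU_coe, toPoint]

theorem matU_smul_infty (x : ℝ) :
    (matU x : PSL(2, ℝ)) • (OnePoint.infty : OnePoint ℝ) = OnePoint.infty := by
  rw [smul_infty_eq]; simp [matU_coe, toPoint]

theorem matU_inv (x : ℝ) : (matU x : PSL(2, ℝ))⁻¹ = (matU (-x) : PSL(2, ℝ)) := by
  apply inv_eq_of_mul_eq_one_left
  rw [← coe_mul_psl, ← matU_add, neg_add_cancel]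
  have : matU 0 = 1 := by simp [sl_ext_iff, matU_coe]
  rw [this]; rfl

theorem matU_smul_re (x : ℝ) (z : ℍ) : ((matU x : PSL(2, ℝ)) • z).re = z.re + x := by
  have := re_sl_smul (matU x) z
  rw [matU_coe] at this
  change (matU x • z).re = _
  simpa using this

/-- A Möbius transformation which maps `0` and `∞` to the end points of an arc and the right half
plane to the half plane bounded by the arc. -/
def IsFrame (g : Gam q) (m : ℕ) (B : SL(2, ℝ)) : Prop :=
  (B : PSL(2, ℝ)) = (g : PSL(2, ℝ)) * (matU (vtx q m) : PSL(2, ℝ))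

theorem exists_isFrame (g : Gam q) (m : ℕ) : ∃ B, IsFrame g m B := by
  obtain ⟨A, hA⟩ := QuotientGroup.mk_surjective (g : PSL(2, ℝ))
  exact ⟨A * matU (vtx q m), by rw [IsFrame, coe_mul_psl, ← hA]⟩

theorem IsFrame.ends (hq : 3 ≤ q) {g : Gam q} {m : ℕ} {B : SL(2, ℝ)} (hB : IsFrame g m B)
    (hm : 1 ≤ m) (hmq : m < q) : (g * gR q ^ m) • OnePoint.infty = toPoint (B 0 1) (B 1 1) ∧
      g • OnePoint.infty = toPoint (B 0 0) (B 1 0) := by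
  constructor
  · rw [← smul_zero_eq, hB, mul_smul, mul_smul, matU_smul_coe, zero_add, gR_pow_smul_infty hq hm hmq]
    rfl
  · rw [← smul_infty_eq, hB, mul_smul, matU_smul_infty]
    rfl

theorem IsEnds.frame_coe (hq : 3 ≤ q) {g : Gam q} {m : ℕ} {B : SL(2, ℝ)} (hB : IsFrame g m B)
    {a b a' b' : ℝ} (h : IsEnds g m (toPoint a b) (toPoint a' b')) (h1 : a ≠ 0 ∨ b ≠ 0)
    (h2 : a' ≠ 0 ∨ b' ≠ 0) : ∃ c c' : ℝ, B 0 0 = c' * a' ∧ B 1 0 = c' * b' ∧ B 0 1 = c * a ∧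
      B 1 1 = c * b ∧ c * c' * (a' * b - a * b') = 1 := by
  obtain ⟨-, hm, hmq, e1, e2⟩ := h
  obtain ⟨f1, f2⟩ := hB.ends hq hm hmq
  rw [e1] at f1
  rw [e2] at f2
  obtain ⟨c, hc1, hc2⟩ := exists_mul_of_toPoint_eq (column_ne_zero B).2 h1 f1.symm
  obtain ⟨c', hc1', hc2'⟩ := exists_mul_of_toPoint_eq (column_ne_zero B).1 h2 f2.symm
  refine ⟨c, c', hc1', hc2', hc1, hc2, ?_⟩
  have := det_eq B
  rw [hc1, hc2, hc1', hc2'] at this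
  linarith

theorem frame_inv_smul_re (B : SL(2, ℝ)) (z : ℍ) : ∃ D : ℝ, 0 < D ∧
    ((B : PSL(2, ℝ))⁻¹ • z).re * D =
      -((B 1 1 * z.re - B 0 1) * (B 1 0 * z.re - B 0 0) + B 1 0 * B 1 1 * z.im ^ 2) := by
  refine ⟨_, denom_pos B⁻¹ z, ?_⟩
  have h := re_sl_smul B⁻¹ z
  refine Eq.trans ?_ (h.trans ?_)
  · rfl
  · rw [sl_inv_coe]
    simp
    ring

theorem posPt_frame_inv (B : SL(2, ℝ)) (x : ℝ) : PosPt ((B : PSL(2, ℝ))⁻¹ • (x : OnePoint ℝ)) ↔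
    0 < (B 1 1 * x - B 0 1) * (B 0 0 - B 1 0 * x) := by
  have h : (B : PSL(2, ℝ))⁻¹ • (x : OnePoint ℝ) = _ := smul_real_eq B⁻¹ x
  rw [h, posPt_toPoint, sl_inv_coe]
  simp
  constructor <;> intro h <;> linarith

theorem posPt_frame_inv_infty (B : SL(2, ℝ)) :
    PosPt ((B : PSL(2, ℝ))⁻¹ • (OnePoint.infty : OnePoint ℝ)) ↔ B 1 0 * B 1 1 < 0 := by
  have h : (B : PSL(2, ℝ))⁻¹ • (OnePoint.infty : OnePoint ℝ) = _ := smul_infty_eq B⁻¹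
  rw [h, posPt_toPoint, sl_inv_coe]
  simp
  constructor <;> intro h <;> linarith

theorem IsFrame.inArc_iff {g : Gam q} {m r : ℕ} {B : SL(2, ℝ)} (hB : IsFrame g m B)
    (hr : (r = 0 ∧ m = 1) ∨ (1 ≤ r ∧ m = r)) (c : OnePoint ℝ) :
    InArc g r c ↔ PosPt ((B : PSL(2, ℝ))⁻¹ • c) := by
  have e : (B : PSL(2, ℝ))⁻¹ • c = (matU (-vtx q m) : PSL(2, ℝ)) • g⁻¹ • c := by
    rw [hB, mul_inv_rev, mul_smul, matU_inv]; rfl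
  have key : PosPt ((B : PSL(2, ℝ))⁻¹ • c) ↔ ∃ x : ℝ, vtx q m < x ∧ g⁻¹ • c = (x : OnePoint ℝ) := by
    rw [e]
    generalize g⁻¹ • c = d
    induction d using OnePoint.rec with
    | infty =>
      rw [matU_smul_infty]
      refine iff_of_false not_posPt_infty ?_
      rintro ⟨x, -, h⟩; exact OnePoint.infty_ne_coe x h
    | coe y =>
      rw [matU_smul_coe, posPt_coe]
      constructor
      · intro h; exact ⟨y, by linarith, rfl⟩
      · rintro ⟨x, hx, h⟩; rw [OnePoint.coe_injective h]; linarith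
  rw [key, InArc]
  rcases hr with ⟨rfl, rfl⟩ | ⟨hr, rfl⟩
  · simp [vtx_one, PosPt]
  · simp [hr, show m ≠ 0 by omega]

theorem lt_re_of_not_mem_wedge (hq : 3 ≤ q) {r : ℕ} (hr : 1 ≤ r) (hrq : 2 * r ≤ q) {z : ℍ}
    (hz : ¬ (0 ≤ ray q 0 z ∧ ray q r z ≤ 0)) : vtx q r < z.re := by
  by_contra hx
  push Not at hx
  apply hz
  have ht := theta_pos hq
  have hqt := q_mul_theta hq
  have hs := sin_theta_pos hq
  have hsr := sn_pos_nat hq hr (by omega : r < q)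
  have hr' : (1 : ℝ) ≤ r := by exact_mod_cast hr
  have hrq' : 2 * (r : ℝ) ≤ q := by exact_mod_cast hrq
  simp only [vtx, sn] at hx hsr
  rw [div_div_div_cancel_right₀ hs.ne'] at hx
  rw [ray_zero hq]
  simp only [ray, sn, lam]
  set t := Real.pi / q
  have hS : 0 < Real.sin (r * t) := by
    rcases div_pos_iff.1 hsr with h | h
    · exact h.1
    · linarith [h.2]
  have hC : 0 ≤ Real.cos (r * t) := by
    apply Real.cos_nonneg_of_mem_Icc
    constructor
    · have : 0 ≤ r * t := by positivity
      linarith [Real.pi_pos]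
    · nlinarith
  rw [le_div_iff₀ hS] at hx
  have e1 : Real.sin ((r - 1) * t) = Real.sin (r * t) * Real.cos t - Real.cos (r * t) * Real.sin t := by
    rw [sub_mul, one_mul, Real.sin_sub]
  have e2 : Real.cos ((r - 1) * t) = Real.cos (r * t) * Real.cos t + Real.sin (r * t) * Real.sin t := by
    rw [sub_mul, one_mul, Real.cos_sub]
  have e3 : Real.sin ((2 * r - 2) * t) = 2 * Real.sin ((r - 1) * t) * Real.cos ((r - 1) * t) := by
    rw [← Real.sin_two_mul]; ring_nf
  have e4 : Real.sin ((2 * r - 1) * t) = Real.sin (r * t) * Real.cos ((r - 1) * t) +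
      Real.cos (r * t) * Real.sin ((r - 1) * t) := by
    rw [← Real.sin_add]; ring_nf
  have e5 : Real.sin (2 * r * t) = 2 * Real.sin (r * t) * Real.cos (r * t) := by
    rw [← Real.sin_two_mul]; ring_nf
  have hpy := Real.sin_sq_add_cos_sq (r * t)
  set σ := Real.sin (r * t)
  set κ := Real.cos (r * t)
  set s := Real.sin t
  set k := Real.cos t
  set x := z.re
  have h1 : x * σ ≤ σ * k - κ * s := by rw [← e1]; exact hx
  constructor
  · have : x * σ ≤ k * σ := by nlinarith [mul_nonneg hC hs.le]
    have := le_of_mul_le_mul_right this hS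
    linarith
  · have h2 : x * κ - (κ * k + σ * s) ≤ 0 := by
      have h3 : (x * κ - (κ * k + σ * s)) * σ ≤ 0 := by
        have h4 : (x * κ) * σ ≤ (σ * k - κ * s) * κ := by nlinarith
        nlinarith [hpy]
      by_contra hc
      push Not at hc
      nlinarith [mul_pos hc hS]
    have h3 : x * σ - (σ * k - κ * s) ≤ 0 := by linarith
    have h4 := mul_nonneg_of_nonpos_of_nonpos h2 h3
    rw [e3, e4, e5, e1, e2]
    have h5 : -(2 * σ * κ / s) * (x ^ 2 + z.im ^ 2) +
        2 * ((σ * (κ * k + σ * s) + κ * (σ * k - κ * s)) / s) * x -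
          2 * (σ * k - κ * s) * (κ * k + σ * s) / s =
        -2 * ((x * κ - (κ * k + σ * s)) * (x * σ - (σ * k - κ * s)) + σ * κ * z.im ^ 2) / s := by
      field_simp
      ring
    rw [h5]
    apply div_nonpos_of_nonpos_of_nonneg _ hs.le
    have : 0 ≤ σ * κ * z.im ^ 2 := by positivity
    linarith

theorem interior_sector_of_branch (hq : 3 ≤ q) {g h : Gam q} (hh : h ∈ branch g) :
    0 < ray q 0 (g⁻¹ • h • tau q) ∧ ray q 1 (g⁻¹ • h • tau q) < 0 := by
  rcases hh with rfl | hh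
  · rw [inv_smul_smul]; exact (tau_mem hq).2
  · rw [not_pos_iff hq, mul_smul] at hh
    exact rays_of_re_nonpos hq hh.le

/-- What lies beyond a boundary piece lies above its arc. -/
theorem IsFrame.re_pos_of_mem_beyond (hq : 3 ≤ q) {g h : Gam q} {m r : ℕ} {B : SL(2, ℝ)}
    (hB : IsFrame g m B) (hr : (r = 0 ∧ m = 1) ∨ (1 ≤ r ∧ m = r)) (hm : 2 * m ≤ q)
    (hh : h ∈ beyond g r) : 0 < ((B : PSL(2, ℝ))⁻¹ • h • tau q).re := by
  have e : (B : PSL(2, ℝ))⁻¹ • h • tau q = (matU (-vtx q m) : PSL(2, ℝ)) • g⁻¹ • h • tau q := by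
    rw [hB, mul_inv_rev, mul_smul, matU_inv]; rfl
  rw [e, matU_smul_re]
  rcases hr with ⟨rfl, rfl⟩ | ⟨hr, rfl⟩
  · rw [mem_beyond_zero, Pos, mul_smul] at hh
    rw [vtx_one]; linarith
  · have := lt_re_of_not_mem_wedge hq hr hm (z := g⁻¹ • h • tau q) ?_
    · linarith
    · rw [mem_wedge_iff hq hr hm]
      rintro ⟨k, hk, hkz⟩
      rw [mem_beyond_of_one_le hr] at hh
      obtain ⟨k', hk', hk'q, hh⟩ := hh
      obtain ⟨h0, h1⟩ := interior_sector_of_branch hq hh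
      rw [← smul_mem_sector_iff hq] at hkz
      set u := (g * gR q ^ k')⁻¹ • h • tau q with hu
      refine not_mem_sector_of_interior hq h0 h1 (k := q - (k' - k)) (by omega) (by omega) ?_
      rw [← R_pow_smul_mem_sector (q - (k' - k))] at hkz
      have e' : gR q ^ k' = gR q ^ k * gR q ^ (k' - k) := by rw [← pow_add]; congr 1; omega
      have : u = gR q ^ (q - (k' - k)) • (g * gR q ^ k)⁻¹ • h • tau q := by
        rw [hu, e', ← mul_assoc, mul_inv_rev, mul_smul, gR_pow_inv hq (by omega)]
      rw [this]
      exact hkz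

theorem lam_eq_vtx (hq : 3 ≤ q) : vtx q (q - 1) = lam q := by
  have h1 : ((q - 1 : ℕ) : ℝ) = q - 1 := by push_cast [show 1 ≤ q by omega]; ring
  rw [vtx, h1, sn_sub_self hq, show (q : ℝ) - 1 - 1 = q - 2 by ring, sn_sub_self hq, sn_one hq,
    sn_two hq, div_one]

/-- The end points of an arc determine it. -/
theorem IsEnds.unique (hq : 3 ≤ q) {g g' : Gam q} {m m' : ℕ} {c c' : OnePoint ℝ}
    (h : IsEnds g m c c') (h' : IsEnds g' m' c c') : g = g' ∧ m = m' := by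
  have hm2 := h.two_mul_le
  have hm2' := h'.two_mul_le
  obtain ⟨-, hm, hmq, e1, e2⟩ := h
  obtain ⟨-, hm', hmq', e1', e2'⟩ := h'
  obtain ⟨A, hA⟩ := QuotientGroup.mk_surjective ((g⁻¹ * g' : Gam q) : PSL(2, ℝ))
  have hinf : (g⁻¹ * g') • (OnePoint.infty : OnePoint ℝ) = OnePoint.infty := by
    rw [mul_smul, e2', ← e2, inv_smul_smul]
  have h10 : A 1 0 = 0 := by
    rw [gam_smul_cusp, ← hA] at hinf
    have := smul_infty_eq A
    rw [show ((A : PSL(2, ℝ)) • (OnePoint.infty : OnePoint ℝ)) = OnePoint.infty from hinf] at this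
    exact toPoint_eq_infty.1 this.symm
  have hAm : (A : PSL(2, ℝ)) ∈ heckeGroup q := by
    change QuotientGroup.mk A ∈ _
    rw [hA]; exact (g⁻¹ * g').2
  obtain ⟨x, hx⟩ := eq_matU_of_lower_left hq hAm h10
  have hAx : (A : PSL(2, ℝ)) = (matU x : PSL(2, ℝ)) := (psl_eq_iff _ _).2 hx
  rw [hAx] at hAm
  obtain ⟨n, hn⟩ := matU_mem_iff hq hAm
  have hgx : ((g⁻¹ * g' : Gam q) : PSL(2, ℝ)) = (matU x : PSL(2, ℝ)) := by rw [← hAx]; exact hA.symm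
  have hv : vtx q m = vtx q m' + x := by
    have : (gR q ^ m) • (OnePoint.infty : OnePoint ℝ) =
        (g⁻¹ * g') • (gR q ^ m') • OnePoint.infty := by
      rw [mul_smul, ← mul_smul g', e1', ← e1, mul_smul, inv_smul_smul]
    rw [gR_pow_smul_infty hq hm hmq, gR_pow_smul_infty hq hm' hmq', gam_smul_cusp, hgx,
      matU_smul_coe] at this
    exact OnePoint.coe_injective this
  have hl := one_le_lam hq
  have b1 := vtx_nonneg hq hm hmq
  have b2 := vtx_nonneg hq hm' hmq'
  have b3 := vtx_lt hq hm (show m < q - 1 by omega) (by omega)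
  have b4 := vtx_lt hq hm' (show m' < q - 1 by omega) (by omega)
  rw [lam_eq_vtx hq] at b3 b4
  have hn0 : n = 0 := by
    have h1 : (n : ℝ) < 1 := by
      by_contra hc; push Not at hc
      nlinarith
    have h2 : (-1 : ℝ) < n := by
      by_contra hc; push Not at hc
      nlinarith
    have h1 : n < 1 := by exact_mod_cast h1
    have h2 : -1 < n := by exact_mod_cast h2
    omega
  have hx0 : x = 0 := by rw [hn, hn0]; simp
  constructor
  · have : (g⁻¹ * g' : Gam q) = 1 := by
      apply Subtype.ext
      rw [hgx, hx0]
      have : matU 0 = 1 := by simp [sl_ext_iff, matU_coe]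
      rw [this]; rfl
    exact inv_mul_eq_one.1 this
  · rw [hx0, add_zero] at hv
    rcases lt_trichotomy m m' with h | h | h
    · exact absurd hv (vtx_lt hq hm h hmq').ne
    · exact h
    · exact absurd hv (vtx_lt hq hm' h hmq).ne'

/-- Two first columns of matrices in `G_q` which define the same point agree up to sign. -/
theorem column_eq_of_toPoint (hq : 3 ≤ q) {A B : SL(2, ℝ)} (hA : (A : PSL(2, ℝ)) ∈ heckeGroup q)
    (hB : (B : PSL(2, ℝ)) ∈ heckeGroup q) (h : toPoint (A 0 0) (A 1 0) = toPoint (B 0 0) (B 1 0)) :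
    ∃ ε : ℝ, (ε = 1 ∨ ε = -1) ∧ A 0 0 = ε * B 0 0 ∧ A 1 0 = ε * B 1 0 := by
  obtain ⟨c, h1, h2⟩ := exists_mul_of_toPoint_eq (column_ne_zero A).1 (column_ne_zero B).1 h
  rcases column_unique hq hA hB (by rw [h1, h2]; ring) with h | h
  · exact ⟨1, Or.inl rfl, by simp [h.1], by simp [h.2]⟩
  · exact ⟨-1, Or.inr rfl, by simp [h.1], by simp [h.2]⟩

end

/-! ### The intervals of a Hecke-Farey sequence -/

/-- `(g, r)` with `r = m`, or `r = 0` and `m = 1`, is a possible boundary piece at the interval with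
end points `g v_m` and `g ∞`. -/
def RankOf (m r : ℕ) : Prop := (r = 0 ∧ m = 1) ∨ (1 ≤ r ∧ m = r)

namespace HeckeFareySequence

variable {q : ℕ} (F : HeckeFareySequence q)

/-- The linear form `b x - a` which is positive to the right of the `j`-th term `a / b`. -/
def lin (j : Fin (F.n + 3)) (x : ℝ) : ℝ := F.den j * x - F.num j

theorem lin_first (x : ℝ) : F.lin 0 x = 1 := by simp [lin, F.num_first, F.den_first]

theorem lin_last (x : ℝ) : F.lin (Fin.last _) x = -1 := by simp [lin, F.num_last, F.den_last]

theorem den_nonneg (j : Fin (F.n + 3)) : 0 ≤ F.den j := (F.reduced j).1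

theorem lin_pos_of_le {j k : Fin (F.n + 3)} (h : j ≤ k) {x : ℝ} (hx : 0 < F.lin k x) :
    0 < F.lin j x := by
  rcases h.eq_or_lt with rfl | h
  · exact hx
  rcases (Fin.zero_le j).eq_or_lt with rfl | h0
  · rw [lin_first]; exact one_pos
  rcases (Fin.le_last k).eq_or_lt with rfl | hl
  · rw [lin_last] at hx; linarith
  have hj := F.den_pos j h0 (h.trans hl)
  have hk := F.den_pos k (h0.trans h) hl
  have hi := F.increasing j k h0 h hl
  unfold lin at hx ⊢
  have h1 : F.num k / F.den k < x := by rw [div_lt_iff₀ hk]; linarith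
  have h2 := hi.trans h1
  rw [div_lt_iff₀ hj] at h2
  linarith

theorem column_ne (j : Fin (F.n + 3)) : F.num j ≠ 0 ∨ F.den j ≠ 0 := by
  obtain ⟨-, A, -, h1, h2⟩ := F.reduced j
  rw [← h1, ← h2]
  exact (column_ne_zero A).1

theorem det_pos (i : Fin (F.n + 2)) :
    0 < F.num i.succ * F.den i.castSucc - F.num i.castSucc * F.den i.succ := by
  have hs : 0 < i.succ := Fin.succ_pos i
  have hc : i.castSucc < Fin.last (F.n + 2) := Fin.castSucc_lt_last i
  by_cases h0 : 0 < i.castSucc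
  · have hd := F.den_pos _ h0 hc
    by_cases hl : i.succ < Fin.last (F.n + 2)
    · have hd' := F.den_pos _ hs hl
      have := F.increasing _ _ h0 (Fin.castSucc_lt_succ (i := i)) hl
      rw [div_lt_div_iff₀ hd hd'] at this
      linarith
    · have hl : i.succ = Fin.last (F.n + 2) := le_antisymm (Fin.le_last _) (not_lt.1 hl)
      rw [hl, F.num_last, F.den_last]
      linarith
  · have h0 : i.castSucc = 0 := le_antisymm (not_lt.1 h0) (Fin.zero_le _)
    have hl : i.succ < Fin.last (F.n + 2) := by
      have hv : i.castSucc.val = 0 := by rw [h0]; rfl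
      rw [Fin.val_castSucc] at hv
      rw [Fin.lt_def, Fin.val_succ, Fin.val_last]
      omega
    have hd' := F.den_pos _ hs hl
    rw [h0, F.num_first, F.den_first]
    linarith

/-- The real number `x` lies in the open `i`-th interval. -/
def Inside (i : Fin (F.n + 2)) (x : ℝ) : Prop := 0 < F.lin i.castSucc x ∧ F.lin i.succ x < 0

theorem Inside.unique {F : HeckeFareySequence q} {i j : Fin (F.n + 2)} {x : ℝ} (hi : F.Inside i x)
    (hj : F.Inside j x) : i = j := by
  have key : ∀ {i j : Fin (F.n + 2)}, F.Inside i x → F.Inside j x → ¬ i < j := by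
    intro i j hi hj h
    have h1 : i.succ ≤ j.castSucc := Fin.succ_le_castSucc_iff.2 h
    exact absurd (F.lin_pos_of_le h1 hj.1) (not_lt.2 hi.2.le)
  exact le_antisymm (not_lt.1 (key hj hi)) (not_lt.1 (key hi hj))

theorem exists_inside {x : ℝ} (hx : ∀ j, F.point j ≠ (x : OnePoint ℝ)) : ∃ i, F.Inside i x := by
  by_contra hc
  push Not at hc
  have h0 : ∀ j, F.lin j x ≠ 0 := by
    intro j h
    apply hx j
    have hd : F.den j ≠ 0 := by
      intro hd
      rw [lin, hd, zero_mul, zero_sub, neg_eq_zero] at h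
      exact (F.column_ne j).elim (fun h' => h' h) fun h' => h' hd
    rw [point, toPoint, if_neg hd]
    congr 1
    unfold lin at h
    field_simp
    linarith
  have h : ∀ j, 0 < F.lin j x := by
    intro j
    induction j using Fin.induction with
    | zero => rw [lin_first]; exact one_pos
    | succ i ih =>
      have := h0 i.succ
      by_contra h
      exact hc i ⟨ih, lt_of_le_of_ne (not_lt.1 h) this⟩
  have := h (Fin.last _)
  rw [lin_last] at this
  linarith

theorem point_first : F.point 0 = OnePoint.infty := by simp [point, toPoint, F.den_first]

theorem point_last : F.point (Fin.last _) = OnePoint.infty := by simp [point, toPoint, F.den_last]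

theorem point_mid {j : Fin (F.n + 3)} (h0 : 0 < j) (hl : j < Fin.last (F.n + 2)) :
    F.point j = ((F.num j / F.den j : ℝ) : OnePoint ℝ) := by
  rw [point, toPoint, if_neg (F.den_pos j h0 hl).ne']

theorem point_eq_infty {j : Fin (F.n + 3)} (h : F.point j = OnePoint.infty) :
    j = 0 ∨ j = Fin.last (F.n + 2) := by
  by_contra hc
  push Not at hc
  rw [F.point_mid (Fin.pos_iff_ne_zero.2 hc.1) (Fin.lt_last_iff_ne_last.2 hc.2)] at h
  exact OnePoint.coe_ne_infty _ h

theorem point_injective {j k : Fin (F.n + 3)} (h : F.point j = F.point k) :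
    j = k ∨ ((j = 0 ∨ j = Fin.last (F.n + 2)) ∧ (k = 0 ∨ k = Fin.last (F.n + 2))) := by
  by_cases hj : F.point j = OnePoint.infty
  · exact Or.inr ⟨F.point_eq_infty hj, F.point_eq_infty (h ▸ hj)⟩
  · left
    have hk : F.point k ≠ OnePoint.infty := h ▸ hj
    have key : ∀ l, F.point l ≠ OnePoint.infty → 0 < l ∧ l < Fin.last (F.n + 2) := by
      intro l hl
      constructor
      · rw [Fin.pos_iff_ne_zero]; rintro rfl; exact hl F.point_first
      · rw [Fin.lt_last_iff_ne_last]; rintro rfl; exact hl F.point_last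
    obtain ⟨j1, j2⟩ := key j hj
    obtain ⟨k1, k2⟩ := key k hk
    rw [F.point_mid j1 j2, F.point_mid k1 k2] at h
    have h := OnePoint.coe_injective h
    rcases lt_trichotomy j k with hlt | hlt | hlt
    · exact absurd h (F.increasing j k j1 hlt k2).ne
    · exact hlt
    · exact absurd h (F.increasing k j k1 hlt j2).ne'

/-- `g` and `m` describe the `i`-th interval: its end points are `g v_m` and `g ∞`. -/
def Ends (i : Fin (F.n + 2)) (g : Gam q) (m : ℕ) : Prop :=
  IsEnds g m (F.point i.castSucc) (F.point i.succ)

theorem Ends.unique {F : HeckeFareySequence q} (hq : 3 ≤ q) {i : Fin (F.n + 2)} {g g' : Gam q}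
    {m m' : ℕ} (h : F.Ends i g m) (h' : F.Ends i g' m') : g = g' ∧ m = m' :=
  IsEnds.unique hq h h'

theorem ends_of_isIntervalMatrix (hq : 3 ≤ q) {i : Fin (F.n + 2)} {A : SL(2, ℝ)}
    (hA : F.IsIntervalMatrix i A) : ∃ hA : (A : PSL(2, ℝ)) ∈ heckeGroup q, F.Ends i ⟨_, hA⟩ 1 := by
  have hA' : (A : Matrix (Fin 2) (Fin 2) ℝ) = _ := hA
  have e00 : A 0 0 = F.num i.succ := by rw [hA']; rfl
  have e10 : A 1 0 = F.den i.succ := by rw [hA']; rfl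
  have e01 : A 0 1 = F.num i.castSucc := by rw [hA']; rfl
  have e11 : A 1 1 = F.den i.castSucc := by rw [hA']; rfl
  obtain ⟨-, B, hB, b1, b2⟩ := F.reduced i.succ
  obtain ⟨-, C, hC, c1, c2⟩ := F.reduced i.castSucc
  have hm : (A : PSL(2, ℝ)) ∈ heckeGroup q := mem_of_columns hq hB hC (by rw [e00, b1])
    (by rw [e10, b2]) (by rw [e01, c1]) (by rw [e11, c2])
  refine ⟨hm, one_dvd q, le_rfl, by omega, ?_, ?_⟩
  · rw [mul_smul, gR_pow_smul_infty hq le_rfl (by omega), vtx_one]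
    refine (smul_zero_eq A).trans ?_
    rw [e01, e11]; rfl
  · refine (smul_infty_eq A).trans ?_
    rw [e00, e10]; rfl

theorem isIntervalMatrix_of_ends (hq : 3 ≤ q) {i : Fin (F.n + 2)} {g : Gam q} (h : F.Ends i g 1) :
    ∃ A : SL(2, ℝ), F.IsIntervalMatrix i A ∧ (A : PSL(2, ℝ)) = g := by
  obtain ⟨A, hA⟩ := QuotientGroup.mk_surjective (g : PSL(2, ℝ))
  have hA : (A : PSL(2, ℝ)) = g := hA
  have hAm : (A : PSL(2, ℝ)) ∈ heckeGroup q := hA ▸ g.2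
  have hASm : ((A * matS : SL(2, ℝ)) : PSL(2, ℝ)) ∈ heckeGroup q := by
    rw [coe_mul_psl]; exact (heckeGroup q).mul_mem hAm S_mem
  obtain ⟨-, -, -, e1, e2⟩ := h
  rw [mul_smul, gR_pow_smul_infty hq le_rfl (by omega), vtx_one, gam_smul_cusp, ← hA,
    smul_zero_eq] at e1
  rw [gam_smul_cusp, ← hA, smul_infty_eq] at e2
  obtain ⟨-, B, hB, b1, b2⟩ := F.reduced i.succ
  obtain ⟨-, C, hC, c1, c2⟩ := F.reduced i.castSucc
  rw [point, ← b1, ← b2] at e2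
  rw [point, ← c1, ← c2] at e1
  obtain ⟨ε, hε, h00, h10⟩ := column_eq_of_toPoint hq hAm hB e2
  have s00 : (A * matS : SL(2, ℝ)) 0 0 = - A 0 1 := by simp [sl_mul_apply, matS_coe]
  have s10 : (A * matS : SL(2, ℝ)) 1 0 = - A 1 1 := by simp [sl_mul_apply, matS_coe]
  have e1' : toPoint ((A * matS : SL(2, ℝ)) 0 0) ((A * matS : SL(2, ℝ)) 1 0) =
      toPoint (C 0 0) (C 1 0) := by
    rw [← e1, s00, s10, toPoint, toPoint]
    simp
  obtain ⟨δ, hδ, h01, h11⟩ := column_eq_of_toPoint hq hASm hC e1'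
  rw [s00, c1] at h01
  rw [s10, c2] at h11
  rw [b1] at h00
  rw [b2] at h10
  have hd := det_eq A
  have hp := F.det_pos i
  have hde : (ε * -δ) * (F.num i.succ * F.den i.castSucc - F.num i.castSucc * F.den i.succ) = 1 := by
    rw [h00, h10] at hd
    linear_combination hd + ε * F.num i.succ * h11 - ε * F.den i.succ * h01
  -- the determinant is positive, so both columns carry the same sign
  have hεδ : δ = -ε := by
    rcases hε with rfl | rfl <;> rcases hδ with rfl | rfl <;> first | (exfalso; linarith) | norm_num
  have k01 : A 0 1 = ε * F.num i.castSucc := by rw [hεδ] at h01; linarith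
  have k11 : A 1 1 = ε * F.den i.castSucc := by rw [hεδ] at h11; linarith
  rcases hε with rfl | rfl
  · refine ⟨A, ?_, hA⟩
    rw [IsIntervalMatrix, Matrix.eta_fin_two (A : Matrix (Fin 2) (Fin 2) ℝ), h00, h10, k01, k11]
    simp
  · refine ⟨-A, ?_, ?_⟩
    · rw [IsIntervalMatrix, Matrix.SpecialLinearGroup.coe_neg,
        Matrix.eta_fin_two (A : Matrix (Fin 2) (Fin 2) ℝ), h00, h10, k01, k11]
      simp
    · rw [← hA, psl_eq_iff]; exact Or.inr rfl

theorem isOrdinary_iff (hq : 3 ≤ q) {i : Fin (F.n + 2)} : F.IsOrdinary i ↔ ∃ g, F.Ends i g 1 := by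
  constructor
  · intro h
    let A : SL(2, ℝ) := ⟨!![F.num i.succ, F.num i.castSucc; F.den i.succ, F.den i.castSucc], by
      rw [Matrix.det_fin_two_of]; exact h⟩
    obtain ⟨hm, h⟩ := F.ends_of_isIntervalMatrix hq (A := A) rfl
    exact ⟨_, h⟩
  · rintro ⟨g, hg⟩
    obtain ⟨A, hA, -⟩ := F.isIntervalMatrix_of_ends hq hg
    have hA' : (A : Matrix (Fin 2) (Fin 2) ℝ) = _ := hA
    have := A.2
    rw [hA', Matrix.det_fin_two_of] at this
    exact this

theorem isRInterval_iff (hq : 3 ≤ q) {i : Fin (F.n + 2)} {r : ℕ} {g : PSL(2, ℝ)} :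
    F.IsRInterval i r g ↔ ∃ g' : Gam q, 1 < r ∧ F.Ends i g' r ∧ (g' : PSL(2, ℝ)) = g := by
  have hcq : baseCusp q q = OnePoint.infty := by
    rw [baseCusp, R_pow_q hq, one_smul]
  constructor
  · rintro ⟨hd, h1, hrq, hg, e1, e2⟩
    rw [hcq] at e2
    refine ⟨⟨g, hg⟩, h1, ⟨hd, h1.le, hrq, ?_, e2⟩, rfl⟩
    rw [mul_smul]; exact e1
  · rintro ⟨g', h1, ⟨hd, -, hrq, e1, e2⟩, rfl⟩
    refine ⟨hd, h1, hrq, g'.2, ?_, ?_⟩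
    · rw [mul_smul] at e1; exact e1
    · rw [hcq]; exact e2

theorem exists_ends (hq : 3 ≤ q) (i : Fin (F.n + 2)) : ∃ g m, F.Ends i g m := by
  by_cases h : F.IsOrdinary i
  · obtain ⟨g, hg⟩ := (F.isOrdinary_iff hq).1 h
    exact ⟨g, 1, hg⟩
  · obtain ⟨r, g, hg⟩ := F.cluster i h
    obtain ⟨g', -, h, -⟩ := (F.isRInterval_iff hq).1 hg
    exact ⟨g', r, h⟩

theorem Ends.inside_of_re_pos {F : HeckeFareySequence q} (hq : 3 ≤ q) {i : Fin (F.n + 2)} {g : Gam q}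
    {m : ℕ} (h : F.Ends i g m) {B : SL(2, ℝ)} (hB : IsFrame g m B) {z : ℍ}
    (hz : 0 < ((B : PSL(2, ℝ))⁻¹ • z).re) : F.Inside i z.re := by
  obtain ⟨c, c', h00, h10, h01, h11, hdet⟩ := h.frame_coe hq hB (F.column_ne _) (F.column_ne _)
  obtain ⟨D, hD, hre⟩ := frame_inv_smul_re B z
  have hp := F.det_pos i
  have hcc : 0 < c * c' := by
    by_contra hc; push Not at hc
    nlinarith
  have h1 := mul_pos hz hD
  rw [hre, h00, h10, h01, h11] at h1
  have h2 : c * c' * (F.lin i.castSucc z.re * F.lin i.succ z.re +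
      F.den i.castSucc * F.den i.succ * z.im ^ 2) < 0 := by
    unfold lin; linarith
  have h3 : 0 ≤ F.den i.castSucc * F.den i.succ * z.im ^ 2 :=
    mul_nonneg (mul_nonneg (F.den_nonneg _) (F.den_nonneg _)) (sq_nonneg _)
  have h4 : F.lin i.castSucc z.re * F.lin i.succ z.re < 0 := by
    by_contra hc; push Not at hc
    have : 0 ≤ c * c' * (F.lin i.castSucc z.re * F.lin i.succ z.re +
      F.den i.castSucc * F.den i.succ * z.im ^ 2) := by positivity
    linarith
  rcases mul_neg_iff.1 h4 with h | h
  · exact h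
  · have := F.lin_pos_of_le (Fin.castSucc_lt_succ (i := i)).le h.2
    linarith [h.1]

theorem Ends.inside_of_beyond {F : HeckeFareySequence q} (hq : 3 ≤ q) {i : Fin (F.n + 2)}
    {g h : Gam q} {m r : ℕ} (he : F.Ends i g m) (hr : RankOf m r) (hh : h ∈ beyond g r) :
    F.Inside i (h • tau q).re := by
  obtain ⟨B, hB⟩ := exists_isFrame g m
  exact he.inside_of_re_pos hq hB (hB.re_pos_of_mem_beyond hq hr (IsEnds.two_mul_le he) hh)

theorem Ends.inArc_of_inside {F : HeckeFareySequence q} (hq : 3 ≤ q) {i : Fin (F.n + 2)}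
    {g : Gam q} {m r : ℕ} (he : F.Ends i g m) (hr : RankOf m r) {x : ℝ} (hx : F.Inside i x) :
    InArc g r (x : OnePoint ℝ) := by
  obtain ⟨B, hB⟩ := exists_isFrame g m
  rw [hB.inArc_iff hr, posPt_frame_inv]
  obtain ⟨c, c', h00, h10, h01, h11, hdet⟩ := he.frame_coe hq hB (F.column_ne _) (F.column_ne _)
  have hp := F.det_pos i
  have hcc : 0 < c * c' := by
    by_contra hc; push Not at hc
    nlinarith
  rw [h00, h10, h01, h11]
  have := mul_pos hcc (mul_pos hx.1 (neg_pos.2 hx.2))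
  unfold lin at this
  linarith

theorem Ends.disjoint_beyond {F : HeckeFareySequence q} (hq : 3 ≤ q) {i j : Fin (F.n + 2)}
    {g g' h : Gam q} {m m' r r' : ℕ} (he : F.Ends i g m) (hr : RankOf m r) (he' : F.Ends j g' m')
    (hr' : RankOf m' r') (h1 : h ∈ beyond g r) (h2 : h ∈ beyond g' r') : i = j :=
  (he.inside_of_beyond hq hr h1).unique (he'.inside_of_beyond hq hr' h2)

/-- A sequence with two intervals with the same end points in opposite order consists of `-∞`, `0`
and `∞`. -/
theorem n_eq_zero_of_swap {i j : Fin (F.n + 2)} (h1 : F.point j.castSucc = F.point i.succ)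
    (h2 : F.point j.succ = F.point i.castSucc) : F.n = 0 ∧ i ≠ j := by
  have key : ∀ a b : Fin (F.n + 3), F.point a = F.point b →
      a.val = b.val ∨ ((a.val = 0 ∨ a.val = F.n + 2) ∧ (b.val = 0 ∨ b.val = F.n + 2)) := by
    intro a b h
    rcases F.point_injective h with h | ⟨h, h'⟩
    · exact Or.inl (congrArg _ h)
    · exact Or.inr ⟨h.imp (congrArg Fin.val) (congrArg Fin.val),
        h'.imp (congrArg Fin.val) (congrArg Fin.val)⟩
  have k1 := key _ _ h1
  have k2 := key _ _ h2
  simp only [Fin.val_castSucc, Fin.val_succ] at k1 k2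
  have hi := i.2
  have hj := j.2
  refine ⟨by omega, ?_⟩
  rintro rfl
  omega

theorem isOrdinary_of_n_eq_zero (hq : 3 ≤ q) (hn : F.n = 0) (i : Fin (F.n + 2)) :
    F.IsOrdinary i := by
  obtain ⟨j, j1, j2, hj⟩ := F.zero_mem
  have hjv : j.val = 1 := by
    rw [Fin.lt_def] at j1 j2
    simp at j1 j2
    omega
  have hd := F.den_pos j j1 j2
  have hnum : F.num j = 0 := by
    rcases div_eq_zero_iff.1 hj with h | h
    · exact h
    · linarith
  have hred : IsReduced q 0 1 := by
    refine ⟨zero_le_one, matS⁻¹, ?_, ?_, ?_⟩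
    · exact (heckeGroup q).inv_mem S_mem
    · rw [sl_inv_coe]; simp [matS_coe]
    · rw [sl_inv_coe]; simp [matS_coe]
  have hden : F.den j = 1 := by
    have h1 := F.reduced j
    rw [hnum] at h1
    exact (isReduced_unique hq h1 hred hd one_pos (by simp)).2
  have hi := i.2
  have hcases : (i.castSucc = 0 ∧ i.succ = j) ∨ (i.castSucc = j ∧ i.succ = Fin.last (F.n + 2)) := by
    have : i.val = 0 ∨ i.val = 1 := by omega
    rcases this with h | h
    · left
      constructor <;> apply Fin.ext <;> simp [h, hjv]
    · right
      constructor <;> apply Fin.ext <;> simp [h, hjv, hn]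
  unfold IsOrdinary
  rcases hcases with ⟨h1, h2⟩ | ⟨h1, h2⟩
  · rw [h1, h2, F.num_first, F.den_first, hnum, hden]; norm_num
  · rw [h1, h2, F.num_last, F.den_last, hnum, hden]; norm_num

end HeckeFareySequence

section
variable {q : ℕ}

theorem nested_beyond (hq : 3 ≤ q) {g g' : Gam q} {r : ℕ} (hg : g ∈ beyond g' r) :
    (∀ h, Pos (g⁻¹ * h) → h ∈ beyond g' r) ∨ (∀ h, ¬ Pos (g⁻¹ * h) → h ∈ beyond g' r) := by
  rcases Nat.eq_zero_or_pos r with rfl | hr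
  · rw [mem_beyond_zero] at hg
    have e : ∀ h, (g'⁻¹ * g)⁻¹ * (g'⁻¹ * h) = g⁻¹ * h := fun h => by group
    refine (hg.nested hq).imp (fun H h hh => ?_) (fun H h hh => ?_)
    · rw [mem_beyond_zero]; exact H _ (by rwa [e])
    · rw [mem_beyond_zero]; exact H _ (by rwa [e])
  · rw [mem_beyond_of_one_le hr] at hg
    obtain ⟨k, hk, hkq, hb⟩ := hg
    have key : ∀ h, h ∈ branch (g' * gR q ^ k) → h ∈ beyond g' r := fun h hh =>
      (mem_beyond_of_one_le hr).2 ⟨k, hk, hkq, hh⟩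
    rcases hb with rfl | hb
    · exact Or.inr fun h hh => key h (Or.inr hh)
    · set a := g' * gR q ^ k
      have hp : Pos (gS q * (a⁻¹ * g)) := (pos_S_mul hq _).2 hb
      have e : ∀ h, (gS q * (a⁻¹ * g))⁻¹ * (gS q * (a⁻¹ * h)) = g⁻¹ * h := fun h => by group
      refine (hp.nested hq).imp (fun H h hh => ?_) (fun H h hh => ?_)
      · exact key h (Or.inr ((pos_S_mul hq _).1 (H _ (by rwa [e]))))
      · exact key h (Or.inr ((pos_S_mul hq _).1 (H _ (by rwa [e]))))

theorem IsPiece.ends_mem_cuspSet {𝒢 : Set (Gam q)} {g : Gam q} {m r : ℕ}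
    (hp : IsPiece 𝒢 g r) (hr : RankOf m r) : g • OnePoint.infty ∈ cuspSet 𝒢 ∧
      (g * gR q ^ m) • OnePoint.infty ∈ cuspSet 𝒢 := by
  rcases hp with ⟨rfl, -, h⟩ | ⟨-, h1, hrq, h⟩
  · have hm : m = 1 := by rcases hr with h | h <;> omega
    refine ⟨⟨_, h, Or.inl ?_⟩, ⟨_, h, Or.inr ?_⟩⟩
    · rw [mul_smul, gS_smul_zero]
    · rw [hm, mul_smul, mul_smul, gS_smul_infty, ← zero_add 1, ← gR_smul_zero, pow_zero, one_smul]
  · have hm : m = r := by rcases hr with h | h <;> omega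
    refine ⟨⟨_, by simpa using (h 0 (by omega)).2 h1, Or.inr rfl⟩,
      ⟨_, (h (r - 1) (by omega)).2 (by omega), Or.inl ?_⟩⟩
    rw [hm, mul_smul, mul_smul, gR_smul_zero, show r - 1 + 1 = r by omega]

/-- An element of the Hecke group is determined by the images of `0` and `∞`. -/
theorem eq_of_smul_cusps (hq : 3 ≤ q) {g h : Gam q}
    (h0 : g • ((0 : ℝ) : OnePoint ℝ) = h • ((0 : ℝ) : OnePoint ℝ))
    (h1 : g • (OnePoint.infty : OnePoint ℝ) = h • OnePoint.infty) : g = h := by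
  have key : ∀ k : Gam q, IsEnds k 1 (k • ((0 : ℝ) : OnePoint ℝ)) (k • OnePoint.infty) := by
    intro k
    refine ⟨one_dvd q, le_rfl, by omega, ?_, rfl⟩
    rw [mul_smul, gR_pow_smul_infty hq le_rfl (by omega), vtx_one]
  have h2 := key h
  rw [← h0, ← h1] at h2
  exact ((key g).unique hq h2).1

end

/-! ### Side pairings in terms of group elements -/

namespace HeckeFareySequence

variable {q : ℕ} (F : HeckeFareySequence q)

theorem isPairing_cluster_iff (hq : 3 ≤ q) (i : Fin (F.n + 2)) (γ : PSL(2, ℝ)) :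
    F.IsPairing i .cluster γ ↔ ∃ (g : Gam q) (r : ℕ), 1 < r ∧ F.Ends i g r ∧
      γ = (g * gR q ^ r * g⁻¹ : Gam q) := by
  constructor
  · rintro ⟨r, g, hg, rfl⟩
    obtain ⟨g', h1, he, rfl⟩ := (F.isRInterval_iff hq).1 hg
    exact ⟨g', r, h1, he, rfl⟩
  · rintro ⟨g, r, h1, he, rfl⟩
    exact ⟨r, g, (F.isRInterval_iff hq).2 ⟨g, h1, he, rfl⟩, rfl⟩

theorem isPairing_odd_iff (hq : 3 ≤ q) (i : Fin (F.n + 2)) (γ : PSL(2, ℝ)) :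
    F.IsPairing i .odd γ ↔ ∃ g : Gam q, F.Ends i g 1 ∧ γ = (g * gR q ^ 1 * g⁻¹ : Gam q) := by
  simp only [pow_one]
  constructor
  · rintro ⟨A, hA, rfl⟩
    obtain ⟨hm, he⟩ := F.ends_of_isIntervalMatrix hq hA
    exact ⟨_, he, rfl⟩
  · rintro ⟨g, he, rfl⟩
    obtain ⟨A, hA, hAg⟩ := F.isIntervalMatrix_of_ends hq he
    refine ⟨A, hA, ?_⟩
    change (g : PSL(2, ℝ)) * R q * (g : PSL(2, ℝ))⁻¹ = _
    rw [← hAg]; rfl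

theorem isPairing_even_iff (hq : 3 ≤ q) (i : Fin (F.n + 2)) (γ : PSL(2, ℝ)) :
    F.IsPairing i .even γ ↔ ∃ g : Gam q, F.Ends i g 1 ∧ γ = (g * gS q * g⁻¹ : Gam q) := by
  constructor
  · rintro ⟨A, hA, rfl⟩
    obtain ⟨hm, he⟩ := F.ends_of_isIntervalMatrix hq hA
    exact ⟨_, he, rfl⟩
  · rintro ⟨g, he, rfl⟩
    obtain ⟨A, hA, hAg⟩ := F.isIntervalMatrix_of_ends hq he
    refine ⟨A, hA, ?_⟩
    change (g : PSL(2, ℝ)) * S * (g : PSL(2, ℝ))⁻¹ = _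
    rw [← hAg]; rfl

theorem isPairing_free_iff (hq : 3 ≤ q) (i j : Fin (F.n + 2)) (γ : PSL(2, ℝ)) :
    F.IsPairing i (.free j) γ ↔ ∃ g h : Gam q, F.Ends i g 1 ∧ F.Ends j h 1 ∧
      γ = (h * gS q * g⁻¹ : Gam q) := by
  have hB : ∀ A B : SL(2, ℝ), F.IsIntervalMatrix j A →
      ((B : Matrix (Fin 2) (Fin 2) ℝ) =
        !![F.num j.castSucc, -F.num j.succ; F.den j.castSucc, -F.den j.succ] ↔
        B = -(A * matS)) := by
    intro A B hA
    have hA' : (A : Matrix (Fin 2) (Fin 2) ℝ) = _ := hA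
    have e : ((-(A * matS) : SL(2, ℝ)) : Matrix (Fin 2) (Fin 2) ℝ) =
        !![F.num j.castSucc, -F.num j.succ; F.den j.castSucc, -F.den j.succ] := by
      rw [Matrix.SpecialLinearGroup.coe_neg, Matrix.SpecialLinearGroup.coe_mul, hA', matS_coe]
      simp
    rw [← e]
    exact ⟨fun h => Subtype.ext h, fun h => by rw [h]⟩
  have hS : ∀ A C : SL(2, ℝ), ((-(A * matS) * C⁻¹ : SL(2, ℝ)) : PSL(2, ℝ)) =
      (A : PSL(2, ℝ)) * S * (C : PSL(2, ℝ))⁻¹ := by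
    intro A C
    have : ((-(A * matS) : SL(2, ℝ)) : PSL(2, ℝ)) = ((A * matS : SL(2, ℝ)) : PSL(2, ℝ)) :=
      (psl_eq_iff _ _).2 (Or.inr rfl)
    rw [coe_mul_psl, this]; rfl
  constructor
  · rintro ⟨A, B, hA, hB', rfl⟩
    obtain ⟨hm, he⟩ := F.ends_of_isIntervalMatrix hq hA
    have hj : F.IsOrdinary j := by
      have h := B.det_coe
      rw [hB', Matrix.det_fin_two_of] at h
      rw [IsOrdinary]; linarith
    obtain ⟨h, hh⟩ := (F.isOrdinary_iff hq).1 hj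
    obtain ⟨C, hC, hCh⟩ := F.isIntervalMatrix_of_ends hq hh
    rw [hB C B hC] at hB'
    refine ⟨_, h, he, hh, ?_⟩
    rw [hB', hS, hCh]; rfl
  · rintro ⟨g, h, hg, hh, rfl⟩
    obtain ⟨A, hA, hAg⟩ := F.isIntervalMatrix_of_ends hq hg
    obtain ⟨C, hC, hCh⟩ := F.isIntervalMatrix_of_ends hq hh
    refine ⟨A, _, hA, (hB C _ hC).2 rfl, ?_⟩
    rw [hS, hCh, hAg]; rfl

end HeckeFareySequence

/-! ### The region described by a Hecke-Farey symbol -/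

/-- The rank of the boundary piece with decoration `l` at an interval with end points `g v_m` and
`g ∞`: an even line (rank `0`) or the cluster `g Φ_m`. -/
def IntervalLabel.rank {n : ℕ} (l : IntervalLabel n) (m : ℕ) : ℕ :=
  match l with
  | .cluster => m
  | .even => 0
  | .odd => m
  | .free _ => 0

namespace HeckeFareySymbol

variable {q : ℕ} (F : HeckeFareySymbol q)

/-- `(g, r)` is the boundary piece at the `i`-th interval. -/
def IsPieceAt (i : Fin (F.n + 2)) (g : Gam q) (r : ℕ) : Prop :=
  ∃ m, F.Ends i g m ∧ r = (F.label i).rank m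

/-- The even line of the `i`-th interval is paired with that of the `j`-th interval; `i = j` if it is
folded. -/
def Partner (i j : Fin (F.n + 2)) : Prop := (F.label i = .even ∧ j = i) ∨ F.label i = .free j

/-- `γ` is the side pairing of the `i`-th interval. -/
def PairAt (i : Fin (F.n + 2)) (γ : Gam q) : Prop :=
  (∃ j g h, F.Partner i j ∧ F.Ends i g 1 ∧ F.Ends j h 1 ∧ γ = h * gS q * g⁻¹) ∨
    (∃ g m, (F.label i = .odd ∨ F.label i = .cluster) ∧ F.Ends i g m ∧ γ = g * gR q ^ m * g⁻¹)

variable {F}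

theorem eq_one_of_ends (hq : 3 ≤ q) {i : Fin (F.n + 2)} (hl : F.label i ≠ .cluster) {g : Gam q}
    {m : ℕ} (h : F.Ends i g m) : m = 1 := by
  have ho : F.IsOrdinary i := by
    by_contra ho; exact hl ((F.cluster_iff i).2 ho)
  obtain ⟨g', hg'⟩ := (F.isOrdinary_iff hq).1 ho
  exact (h.unique hq hg').2

theorem ne_one_of_cluster (hq : 3 ≤ q) {i : Fin (F.n + 2)} (hl : F.label i = .cluster) {g : Gam q}
    {m : ℕ} (h : F.Ends i g m) : m ≠ 1 := by
  rintro rfl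
  exact (F.cluster_iff i).1 hl ((F.isOrdinary_iff hq).2 ⟨g, h⟩)

theorem rankOf (hq : 3 ≤ q) {i : Fin (F.n + 2)} {g : Gam q} {m : ℕ} (h : F.Ends i g m) :
    RankOf m ((F.label i).rank m) := by
  have hm := h.2.1
  cases hl : F.label i with
  | cluster => exact Or.inr ⟨hm, rfl⟩
  | even => exact Or.inl ⟨rfl, eq_one_of_ends hq (by rw [hl]; simp) h⟩
  | odd => exact Or.inr ⟨hm, rfl⟩
  | free j => exact Or.inl ⟨rfl, eq_one_of_ends hq (by rw [hl]; simp) h⟩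

theorem IsPieceAt.unique (hq : 3 ≤ q) {i : Fin (F.n + 2)} {g g' : Gam q} {r r' : ℕ}
    (h : F.IsPieceAt i g r) (h' : F.IsPieceAt i g' r') : g = g' ∧ r = r' := by
  obtain ⟨m, h, rfl⟩ := h
  obtain ⟨m', h', rfl⟩ := h'
  obtain ⟨rfl, rfl⟩ := h.unique hq h'
  exact ⟨rfl, rfl⟩

theorem exists_isPieceAt (hq : 3 ≤ q) (i : Fin (F.n + 2)) : ∃ g r, F.IsPieceAt i g r := by
  obtain ⟨g, m, h⟩ := F.exists_ends hq i
  exact ⟨g, _, m, h, rfl⟩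

theorem IsPieceAt.disjoint_beyond (hq : 3 ≤ q) {i j : Fin (F.n + 2)} {g g' h : Gam q} {r r' : ℕ}
    (hp : F.IsPieceAt i g r) (hp' : F.IsPieceAt j g' r') (h1 : h ∈ beyond g r)
    (h2 : h ∈ beyond g' r') : i = j := by
  obtain ⟨m, he, rfl⟩ := hp
  obtain ⟨m', he', rfl⟩ := hp'
  exact he.disjoint_beyond hq (rankOf hq he) he' (rankOf hq he') h1 h2

theorem Partner.symm {i j : Fin (F.n + 2)} (h : F.Partner i j) : F.Partner j i := by
  rcases h with ⟨h, rfl⟩ | h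
  · exact Or.inl ⟨h, rfl⟩
  · exact Or.inr (F.free_symm i j h).2

theorem Partner.rank {i j : Fin (F.n + 2)} (h : F.Partner i j) (m : ℕ) : (F.label i).rank m = 0 := by
  rcases h with ⟨h, -⟩ | h <;> rw [h] <;> rfl

theorem Partner.isPieceAt {i j : Fin (F.n + 2)} (h : F.Partner i j) {g : Gam q} {m : ℕ}
    (he : F.Ends i g m) : F.IsPieceAt i g 0 := ⟨m, he, (h.rank m).symm⟩

theorem exists_partner_of_rank_zero {i : Fin (F.n + 2)} {g : Gam q} (h : F.IsPieceAt i g 0) :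
    ∃ j, F.Partner i j := by
  obtain ⟨m, he, hr⟩ := h
  have hm := he.2.1
  cases hl : F.label i with
  | cluster => rw [hl, IntervalLabel.rank] at hr; omega
  | even => exact ⟨i, Or.inl ⟨hl, rfl⟩⟩
  | odd => rw [hl, IntervalLabel.rank] at hr; omega
  | free j => exact ⟨j, Or.inr hl⟩

theorem IsPieceAt.ends_of_zero (hq : 3 ≤ q) {i : Fin (F.n + 2)} {g : Gam q}
    (h : F.IsPieceAt i g 0) : F.Ends i g 1 := by
  obtain ⟨m, he, hr⟩ := h
  have h1 := rankOf hq he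
  rw [← hr] at h1
  rcases h1 with ⟨-, rfl⟩ | h1
  · exact he
  · omega

theorem label_of_one_le {i : Fin (F.n + 2)} {g : Gam q} {r : ℕ} (h : F.IsPieceAt i g r)
    (hr : 1 ≤ r) : (F.label i = .odd ∨ F.label i = .cluster) ∧ F.Ends i g r := by
  obtain ⟨m, he, hr'⟩ := h
  cases hl : F.label i with
  | cluster => rw [hl, IntervalLabel.rank] at hr'; subst hr'; exact ⟨Or.inr rfl, he⟩
  | even => rw [hl, IntervalLabel.rank] at hr'; omega
  | odd => rw [hl, IntervalLabel.rank] at hr'; subst hr'; exact ⟨Or.inl rfl, he⟩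
  | free j => rw [hl, IntervalLabel.rank] at hr'; omega

theorem isPieceAt_of_label {i : Fin (F.n + 2)} {g : Gam q} {m : ℕ}
    (hl : F.label i = .odd ∨ F.label i = .cluster) (he : F.Ends i g m) : F.IsPieceAt i g m := by
  refine ⟨m, he, ?_⟩
  rcases hl with hl | hl <;> rw [hl] <;> rfl

theorem isPairing_iff (hq : 3 ≤ q) (i : Fin (F.n + 2)) (γ : PSL(2, ℝ)) :
    F.IsPairing i (F.label i) γ ↔ ∃ γ' : Gam q, F.PairAt i γ' ∧ (γ' : PSL(2, ℝ)) = γ := by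
  have hnotS : ∀ j, F.Partner i j → F.label i ≠ .odd ∧ F.label i ≠ .cluster := by
    rintro j (⟨h, -⟩ | h) <;> rw [h] <;> simp
  cases hl : F.label i with
  | cluster =>
    rw [F.isPairing_cluster_iff hq]
    constructor
    · rintro ⟨g, r, -, he, rfl⟩
      exact ⟨_, Or.inr ⟨g, r, Or.inr hl, he, rfl⟩, rfl⟩
    · rintro ⟨γ, ⟨j, g, h, hp, -⟩ | ⟨g, m, -, he, rfl⟩, rfl⟩
      · exact absurd hl (hnotS j hp).2
      · have := ne_one_of_cluster hq hl he
        have hm := he.2.1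
        exact ⟨g, m, by omega, he, rfl⟩
  | odd =>
    rw [F.isPairing_odd_iff hq]
    constructor
    · rintro ⟨g, he, rfl⟩
      exact ⟨_, Or.inr ⟨g, 1, Or.inl hl, he, rfl⟩, rfl⟩
    · rintro ⟨γ, ⟨j, g, h, hp, -⟩ | ⟨g, m, -, he, rfl⟩, rfl⟩
      · exact absurd hl (hnotS j hp).1
      · obtain rfl : m = 1 := eq_one_of_ends hq (by rw [hl]; simp) he
        exact ⟨g, he, rfl⟩
  | even =>
    rw [F.isPairing_even_iff hq]
    constructor
    · rintro ⟨g, he, rfl⟩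
      exact ⟨_, Or.inl ⟨i, g, g, Or.inl ⟨hl, rfl⟩, he, he, rfl⟩, rfl⟩
    · rintro ⟨γ, ⟨j, g, h, hp, hg, hh, rfl⟩ | ⟨g, m, h, -⟩, rfl⟩
      · have hj : j = i := by
          rcases hp with ⟨-, h⟩ | h
          · exact h
          · rw [hl] at h; simp at h
        subst hj
        obtain ⟨rfl, -⟩ := hg.unique hq hh
        exact ⟨g, hg, rfl⟩
      · rw [hl] at h; simp at h
  | free j =>
    rw [F.isPairing_free_iff hq]
    constructor
    · rintro ⟨g, h, hg, hh, rfl⟩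
      exact ⟨_, Or.inl ⟨j, g, h, Or.inr hl, hg, hh, rfl⟩, rfl⟩
    · rintro ⟨γ, ⟨j', g, h, hp, hg, hh, rfl⟩ | ⟨g, m, h, -⟩, rfl⟩
      · have hjj : j' = j := by
          rcases hp with ⟨h, -⟩ | h
          · rw [hl] at h; simp at h
          · rw [hl] at h; simpa using h.symm
        subst hjj
        exact ⟨g, h, hg, hh, rfl⟩
      · rw [hl] at h; simp at h

theorem mem_pairings_iff (hq : 3 ≤ q) (γ : PSL(2, ℝ)) :
    γ ∈ F.pairings ↔ ∃ γ' : Gam q, (γ' : PSL(2, ℝ)) = γ ∧ ∃ i, F.PairAt i γ' ∨ F.PairAt i γ'⁻¹ := by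
  constructor
  · rintro ⟨i, h | h⟩
    · obtain ⟨γ', h1, h2⟩ := (isPairing_iff hq i γ).1 h
      exact ⟨γ', h2, i, Or.inl h1⟩
    · obtain ⟨γ', h1, h2⟩ := (isPairing_iff hq i _).1 h
      exact ⟨γ'⁻¹, by rw [← inv_inv γ, ← h2]; rfl, i, Or.inr (by rwa [inv_inv])⟩
  · rintro ⟨γ', rfl, i, h | h⟩
    · exact ⟨i, Or.inl ((isPairing_iff hq i _).2 ⟨_, h, rfl⟩)⟩
    · exact ⟨i, Or.inr ((isPairing_iff hq i _).2 ⟨_, h, rfl⟩)⟩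

theorem PairAt.unique (hq : 3 ≤ q) {i : Fin (F.n + 2)} {γ γ' : Gam q} (h : F.PairAt i γ)
    (h' : F.PairAt i γ') : γ = γ' := by
  have hne : ∀ j, F.Partner i j → ¬ (F.label i = .odd ∨ F.label i = .cluster) := by
    rintro j (⟨h, -⟩ | h) <;> rw [h] <;> simp
  rcases h with ⟨j, g, k, hj, hg, hk, rfl⟩ | ⟨g, m, hl, hg, rfl⟩
  · rcases h' with ⟨j', g', k', hj', hg', hk', rfl⟩ | ⟨g', m', hl', -⟩
    · have hjj : j = j' := by
        rcases hj with ⟨h, rfl⟩ | h <;> rcases hj' with ⟨h', rfl⟩ | h' <;> simp_all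
      subst hjj
      obtain ⟨rfl, -⟩ := hg.unique hq hg'
      obtain ⟨rfl, -⟩ := hk.unique hq hk'
      rfl
    · exact absurd hl' (hne j hj)
  · rcases h' with ⟨j', g', k', hj', -⟩ | ⟨g', m', hl', hg', rfl⟩
    · exact absurd hl (hne j' hj')
    · obtain ⟨rfl, rfl⟩ := hg.unique hq hg'
      rfl

/-- Two lines `g (0, ∞)` and `g S (0, ∞)` cannot both be boundary lines: the sequence would consist
of `-∞`, `0`, `∞` only, with at most one side pairing. -/
theorem not_swap (hq : 3 ≤ q) {i j : Fin (F.n + 2)} {g : Gam q} (hi : F.IsPieceAt i g 0)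
    (hj : F.IsPieceAt j (g * gS q) 0) : False := by
  have ei := hi.ends_of_zero hq
  have ej := hj.ends_of_zero hq
  have h0 : ∀ k : Gam q, (k * gR q ^ 1) • (OnePoint.infty : OnePoint ℝ) = k • ((0 : ℝ) : OnePoint ℝ) := by
    intro k; rw [mul_smul, gR_pow_smul_infty hq le_rfl (by omega), vtx_one]
  obtain ⟨-, -, -, a1, a2⟩ := ei
  obtain ⟨-, -, -, b1, b2⟩ := ej
  rw [h0] at a1 b1
  rw [mul_smul, gS_smul_zero] at b1
  rw [mul_smul, gS_smul_infty] at b2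
  obtain ⟨hn, hij⟩ := F.n_eq_zero_of_swap (i := i) (j := j) (by rw [← a2, ← b1])
    (by rw [← a1, ← b2])
  have ei := hi.ends_of_zero hq
  have ej := hj.ends_of_zero hq
  have hall : ∀ k, k = i ∨ k = j := by
    intro k
    have h1 := k.2
    have h2 := i.2
    have h3 := j.2
    have h4 : i.val ≠ j.val := fun h => hij (Fin.ext h)
    by_contra hc
    push Not at hc
    have h5 : k.val ≠ i.val := fun h => hc.1 (Fin.ext h)
    have h6 : k.val ≠ j.val := fun h => hc.2 (Fin.ext h)
    omega
  obtain ⟨i', hi'⟩ := exists_partner_of_rank_zero hi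
  obtain ⟨j', hj'⟩ := exists_partner_of_rank_zero hj
  have hsingle : ∃ γ₀ : Gam q, ∀ k γ, F.PairAt k γ → γ = γ₀ := by
    by_cases h : i' = i
    · subst h
      have hjj : j' = j := by
        rcases hall j' with rfl | h
        · rcases hj' with ⟨-, h⟩ | h
          · exact h
          · rcases hi' with ⟨h', -⟩ | h'
            · rw [(F.free_symm _ _ h).2] at h'; simp at h'
            · exact absurd rfl (F.free_symm _ _ h').1
        · exact h
      subst hjj
      refine ⟨g * gS q * g⁻¹, fun k γ hk => ?_⟩
      rcases hall k with rfl | rfl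
      · exact hk.unique hq (Or.inl ⟨_, g, g, hi', ei, ei, rfl⟩)
      · refine (hk.unique hq (Or.inl ⟨_, _, _, hj', ej, ej, rfl⟩)).trans ?_
        rw [mul_gS_mul_gS, mul_inv_rev, gS_inv, mul_assoc]
    · have hij' : i' = j := (hall i').resolve_left h
      subst hij'
      refine ⟨1, fun k γ hk => ?_⟩
      rcases hall k with rfl | rfl
      · refine (hk.unique hq (Or.inl ⟨_, _, _, hi', ei, ej, rfl⟩)).trans ?_
        rw [mul_gS_mul_gS, mul_inv_cancel]
      · refine (hk.unique hq (Or.inl ⟨_, _, _, hi'.symm, ej, ei, rfl⟩)).trans ?_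
        rw [mul_inv_cancel]
  obtain ⟨γ₀, hγ₀⟩ := hsingle
  obtain ⟨a, b, γ, δ, h1, h2, h3, -⟩ := F.two_pairings
  obtain ⟨γ', k1, rfl⟩ := (isPairing_iff hq a _).1 h1
  obtain ⟨δ', k2, rfl⟩ := (isPairing_iff hq b _).1 h2
  exact h3 (by rw [hγ₀ _ _ k1, hγ₀ _ _ k2])

variable (F)

/-- The set of triangles described by the symbol: all that is not beyond a boundary piece. -/
def region : Set (Gam q) := {h | ∀ i g r, F.IsPieceAt i g r → h ∉ beyond g r}

variable {F}

theorem mul_S_mem_region (hq : 3 ≤ q) {i : Fin (F.n + 2)} {g : Gam q} (hi : F.IsPieceAt i g 0) :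
    g ∉ F.region ∧ g * gS q ∈ F.region := by
  have hg : g ∈ beyond g 0 := by rw [mem_beyond_zero, inv_mul_cancel]; exact pos_one hq
  refine ⟨fun h => h i g 0 hi hg, fun j g' r hj hb => ?_⟩
  have hback : g ∈ beyond g' r → i = j := fun h => hi.disjoint_beyond hq hj hg h
  have hgS : g * gS q ∉ beyond g 0 := by
    rw [mem_beyond_zero, inv_mul_cancel_left]; exact not_pos_S hq
  have hij : i ≠ j := by
    rintro rfl
    obtain ⟨rfl, rfl⟩ := hi.unique hq hj
    exact hgS hb
  rcases Nat.eq_zero_or_pos r with rfl | hr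
  · by_cases h : g * gS q = g'
    · rw [← h] at hj
      exact not_swap hq hi hj
    · have := mul_S_mem_beyond_zero hq hb h
      rw [mul_gS_mul_gS] at this
      exact hij (hback this)
  · have := mul_S_mem_beyond hq hr hb
    rw [mul_gS_mul_gS] at this
    exact hij (hback this)

theorem isPiece_region (hq : 3 ≤ q) {i : Fin (F.n + 2)} {g : Gam q} {r : ℕ} (hr : 1 ≤ r)
    (hi : F.IsPieceAt i g r) : IsPiece F.region g r := by
  obtain ⟨hl, he⟩ := label_of_one_le hi hr
  have hrq := he.2.2.1
  have h2r := IsEnds.two_mul_le he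
  refine Or.inr ⟨he.1, hr, hrq, fun k hk => ⟨fun hm => ?_, fun hkr j g' r' hj hb => ?_⟩⟩
  · by_contra hkr
    exact hm i g r hi ((mul_R_pow_mem_beyond_iff hq hr hk).2 (by omega))
  · have hgr : g * gR q ^ r ∈ beyond g r := (mul_R_pow_mem_beyond_iff hq hr hrq).2 le_rfl
    have hij : i ≠ j := by
      rintro rfl
      obtain ⟨rfl, rfl⟩ := hi.unique hq hj
      exact absurd ((mul_R_pow_mem_beyond_iff hq hr hk).1 hb) (by omega)
    by_cases hc : r' = 0 ∨ ∀ l, g * gR q ^ k ≠ g' * gR q ^ l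
    · have := mul_R_pow_mem_beyond hq hb hc (r - k)
      rw [mul_assoc, ← pow_add, show k + (r - k) = r by omega] at this
      exact hij (hi.disjoint_beyond hq hj hgr this)
    · -- two clusters in the same `q`-gon fill it; there are only the intervals of `-∞, 0, ∞`
      push Not at hc
      obtain ⟨hr', l, hl'⟩ := hc
      have hr' : 1 ≤ r' := by omega
      obtain ⟨-, he'⟩ := label_of_one_le hj hr'
      have h2r' := IsEnds.two_mul_le he'
      have hr'q := he'.2.2.1
      obtain ⟨s, hs, rfl⟩ : ∃ s < q, g' = g * gR q ^ s := by
        refine ⟨(k + (q - l % q)) % q, Nat.mod_lt _ (by omega), ?_⟩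
        rw [gR_pow_mod hq, pow_add, ← mul_assoc, hl', ← gR_pow_mod hq l, mul_assoc, ← pow_add,
          Nat.add_sub_cancel' (Nat.mod_lt l (by omega)).le, gR_pow_q hq, mul_one]
      have hmem : ∀ t < q, r' ≤ t → g * gR q ^ (s + t) ∉ beyond g r := by
        intro t ht hrt h
        refine hij (hi.disjoint_beyond hq hj h ?_)
        rw [pow_add, ← mul_assoc]
        exact (mul_R_pow_mem_beyond_iff hq hr' ht).2 hrt
      have hlt : ∀ t < q, r' ≤ t → (s + t) % q < r := by
        intro t ht hrt
        have h1 := hmem t ht hrt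
        rw [← gR_pow_mod hq, mul_R_pow_mem_beyond_iff hq hr (Nat.mod_lt _ (by omega))] at h1
        omega
      have key : s = r ∧ r' = r ∧ 2 * r = q := by
        have h1 := hlt (q - 1) (by omega) (by omega)
        have h2 := hlt r' (by omega) le_rfl
        have hmod : ∀ t < q, ((s + t) % q = s + t ∧ s + t < q) ∨ ((s + t) % q + q = s + t) := by
          intro t ht
          by_cases h : s + t < q
          · exact Or.inl ⟨Nat.mod_eq_of_lt h, h⟩
          · right
            rw [Nat.mod_eq_sub_mod (by omega), Nat.mod_eq_of_lt (by omega)]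
            omega
        have h3 := hmod (q - 1) (by omega)
        have h4 := hmod r' (by omega)
        have h5 : s ≠ 0 := by
          rintro rfl
          simp only [zero_add] at h1
          rw [Nat.mod_eq_of_lt (by omega)] at h1
          omega
        -- the complement of the second cluster is mapped injectively into the first one
        have h6 : s + r' ≥ q := by
          by_contra hc
          have h7 := hlt (q - s - 1) (by omega) (by omega)
          rw [show s + (q - s - 1) = q - 1 by omega, Nat.mod_eq_of_lt (by omega)] at h7
          omega
        omega
      obtain ⟨rfl, rfl, h2⟩ := key
      obtain ⟨-, -, -, a1, a2⟩ := he
      obtain ⟨-, -, -, b1, b2⟩ := he'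
      rw [mul_assoc, ← pow_add, ← two_mul, h2, gR_pow_q hq, mul_one] at b1
      obtain ⟨hn, -⟩ := F.n_eq_zero_of_swap (i := i) (j := j) (by rw [← a2, ← b1])
        (by rw [← a1, ← b2])
      have ho := F.isOrdinary_of_n_eq_zero hq hn i
      obtain ⟨g₁, h₁⟩ := (F.isOrdinary_iff hq).1 ho
      obtain ⟨-, he⟩ := label_of_one_le hi hr
      have := (he.unique hq h₁).2
      omega

theorem region_isTriangulated (hq : 3 ≤ q) : IsTriangulated F.region := by
  constructor
  · intro g hg
    by_cases hall : ∀ k, g * gR q ^ k ∈ F.region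
    · exact Or.inl hall
    right
    push Not at hall
    obtain ⟨k, hk⟩ := hall
    simp only [region, Set.mem_ofPred_eq, not_forall, not_not] at hk
    obtain ⟨i, g', r, hi, hb⟩ := hk
    by_cases hc : r = 0 ∨ ∀ l, g * gR q ^ k ≠ g' * gR q ^ l
    · exfalso
      have := mul_R_pow_mem_beyond hq hb hc (q - k % q)
      rw [← gR_pow_mod hq k, mul_assoc, ← pow_add,
        Nat.add_sub_cancel' (Nat.mod_lt k (by omega)).le, gR_pow_q hq, mul_one] at this
      exact hg i g' r hi this
    · push Not at hc
      obtain ⟨hr, l, hl⟩ := hc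
      have hr : 1 ≤ r := by omega
      have hp := isPiece_region hq hr hi
      have e : g = g' * gR q ^ ((l + (q - k % q)) % q) := by
        rw [gR_pow_mod hq, pow_add, ← mul_assoc, ← hl, ← gR_pow_mod hq k, mul_assoc, ← pow_add,
          Nat.add_sub_cancel' (Nat.mod_lt k (by omega)).le, gR_pow_q hq, mul_one]
      refine ⟨g', r, _, hp, ?_, e⟩
      obtain ⟨-, -, -, h⟩ := hp.resolve_left (by omega)
      rw [e] at hg
      exact (h _ (Nat.mod_lt _ (by omega))).1 hg
  · intro g h₁ h₂ hh₁ hh₂ hp hn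
    by_contra hg
    simp only [region, Set.mem_ofPred_eq, not_forall, not_not] at hg
    obtain ⟨i, g', r, hi, hb⟩ := hg
    rcases nested_beyond hq hb with H | H
    · exact hh₁ i g' r hi (H _ hp)
    · exact hh₂ i g' r hi (H _ hn)

theorem isPiece_region_iff (hq : 3 ≤ q) (g : Gam q) (r : ℕ) :
    IsPiece F.region g r ↔ ∃ i, F.IsPieceAt i g r := by
  constructor
  · rintro hp
    have hp' := hp
    rcases hp with ⟨rfl, h1, h2⟩ | ⟨hd, hr, hrq, h⟩
    · simp only [region, Set.mem_ofPred_eq, not_forall, not_not] at h1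
      obtain ⟨i, g', r, hi, hb⟩ := h1
      rcases Nat.eq_zero_or_pos r with rfl | hr
      · by_cases hg : g = g'
        · subst hg; exact ⟨i, hi⟩
        · exact absurd (mul_S_mem_beyond_zero hq hb hg) (h2 i g' 0 hi)
      · exact absurd (mul_S_mem_beyond hq hr hb) (h2 i g' r hi)
    · have h1 : g * gR q ^ r ∉ F.region := by rw [h r hrq]; omega
      have h0 : g ∈ F.region := by simpa using (h 0 (by omega)).2 hr
      simp only [region, Set.mem_ofPred_eq, not_forall, not_not] at h1
      obtain ⟨i, g', r', hi, hb⟩ := h1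
      by_cases hc : r' = 0 ∨ ∀ l, g * gR q ^ r ≠ g' * gR q ^ l
      · exfalso
        have := mul_R_pow_mem_beyond hq hb hc (q - r)
        rw [mul_assoc, ← pow_add, Nat.add_sub_cancel' hrq.le, gR_pow_q hq, mul_one] at this
        exact h0 i g' r' hi this
      · push Not at hc
        obtain ⟨hr', l, hl⟩ := hc
        have hr' : 1 ≤ r' := by omega
        have hp2 := isPiece_region hq hr' hi
        have e : g' = g * gR q ^ (r + (q - l % q)) := by
          rw [pow_add, ← mul_assoc, hl, ← gR_pow_mod hq l, mul_assoc, ← pow_add,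
            Nat.add_sub_cancel' (Nat.mod_lt l (by omega)).le, gR_pow_q hq, mul_one]
        rw [e] at hp2
        obtain ⟨e1, e2⟩ := hp'.unique_in_gon hq hr hp2 hr'
        rw [e, e1, ← e2] at hi
        exact ⟨i, hi⟩
  · rintro ⟨i, hi⟩
    rcases Nat.eq_zero_or_pos r with rfl | hr
    · exact Or.inl ⟨rfl, mul_S_mem_region hq hi⟩
    · exact isPiece_region hq hr hi

theorem cuspSet_region (hq : 3 ≤ q) : cuspSet F.region = F.points := by
  apply Set.Subset.antisymm
  · intro c hc
    by_contra hcp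
    have hne : ∀ j, F.point j ≠ c := fun j h => hcp ⟨j, h⟩
    induction c using OnePoint.rec with
    | infty => exact hne 0 F.point_first
    | coe x =>
      obtain ⟨i, hi⟩ := F.exists_inside hne
      obtain ⟨g, m, he⟩ := F.exists_ends hq i
      have hr := rankOf hq he
      have harc := he.inArc_of_inside hq hr hi
      obtain ⟨h, hh, hhc⟩ := hc
      have hrq : (F.label i).rank m < q := by
        have := he.2.2.1
        rcases hr with hr | hr <;> omega
      exact hh i g _ ⟨m, he, rfl⟩ (mem_beyond_of_inArc hq hrq harc hhc)
  · rintro _ ⟨j, rfl⟩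
    obtain ⟨i, h⟩ : ∃ i : Fin (F.n + 2), j = i.succ ∨ j = i.castSucc := by
      induction j using Fin.cases with
      | zero => exact ⟨0, Or.inr rfl⟩
      | succ i => exact ⟨i, Or.inl rfl⟩
    obtain ⟨g, m, he⟩ := F.exists_ends hq i
    have hp := (isPiece_region_iff hq g _).2 ⟨i, m, he, rfl⟩
    obtain ⟨h1, h2⟩ := hp.ends_mem_cuspSet (rankOf hq he)
    obtain ⟨-, -, -, e1, e2⟩ := he
    rw [e2] at h1
    rw [e1] at h2
    rcases h with rfl | rfl
    · exact h1
    · exact h2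

theorem region_finite (hq : 3 ≤ q) : F.region.Finite := by
  have hfin : F.points.Finite := Set.finite_range _
  refine Set.Finite.of_finite_image (f := fun g : Gam q =>
    (g • ((0 : ℝ) : OnePoint ℝ), g • (OnePoint.infty : OnePoint ℝ))) ?_ ?_
  · refine (hfin.prod hfin).subset ?_
    rintro _ ⟨g, hg, rfl⟩
    rw [← cuspSet_region hq]
    exact ⟨⟨g, hg, Or.inl rfl⟩, ⟨g, hg, Or.inr rfl⟩⟩
  · intro g _ h _ e
    exact eq_of_smul_cusps hq (congrArg Prod.fst e) (congrArg Prod.snd e)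

variable (F)

/-- The triangulated set `𝒢` and the symbol `F` describe the same polygon. -/
structure IsMatch (𝒢 : Set (Gam q)) : Prop where
  tri : IsTriangulated 𝒢
  finite : 𝒢.Finite
  base : 1 ∈ 𝒢 ∨ gS q ∈ 𝒢
  piece : ∀ g r, IsPiece 𝒢 g r ↔ ∃ i, F.IsPieceAt i g r
  cusps : cuspSet 𝒢 = F.points

theorem zero_mem_points : ((0 : ℝ) : OnePoint ℝ) ∈ F.points := by
  obtain ⟨j, h0, h1, h2⟩ := F.zero_mem
  exact ⟨j, by rw [F.point_mid h0 h1, h2]⟩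

theorem infty_mem_points : OnePoint.infty ∈ F.points := ⟨0, F.point_first⟩

theorem isMatch_region (hq : 3 ≤ q) : F.IsMatch F.region where
  tri := region_isTriangulated hq
  finite := region_finite hq
  base := (region_isTriangulated hq).base hq
    (by rw [cuspSet_region hq]; exact F.zero_mem_points)
    (by rw [cuspSet_region hq]; exact F.infty_mem_points)
  piece := isPiece_region_iff hq
  cusps := cuspSet_region hq

variable {F}

theorem IsMatch.eq_region (hq : 3 ≤ q) {𝒢 : Set (Gam q)} (h : F.IsMatch 𝒢) : 𝒢 = F.region := by
  ext g
  constructor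
  · intro hg i k r hi hb
    exact h.tri.disjoint_beyond hq ((h.piece k r).2 ⟨i, hi⟩) hb hg
  · intro hg
    by_contra hn
    obtain ⟨k, r, hp, hb⟩ := h.tri.exists_piece hq h.base g hn
    obtain ⟨i, hi⟩ := (h.piece k r).1 hp
    exact hg i k r hi hb

end HeckeFareySymbol

/-! ### Sides of a polygon and its boundary pieces -/

section
variable {q : ℕ}

theorem mul_mem_branch_iff (a g h : Gam q) : a * h ∈ branch (a * g) ↔ h ∈ branch g := by
  unfold branch
  rw [Set.mem_ofPred_eq, Set.mem_ofPred_eq, mul_right_inj]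
  have : (a * g)⁻¹ * (a * h) = g⁻¹ * h := by group
  rw [this]

theorem IsTriangulated.exists_branch (hq : 3 ≤ q) {𝒢 : Set (Gam q)} (h𝒢 : IsTriangulated 𝒢)
    {g x : Gam q} {r : ℕ} (hp : IsPiece 𝒢 g r) (hr : 1 ≤ r) (hx : x ∈ 𝒢) :
    ∃ k < r, x ∈ branch (g * gR q ^ k) := by
  obtain ⟨k, hkq, hk⟩ := exists_mem_branch hq g x
  refine ⟨k, ?_, hk⟩
  by_contra hkr
  exact h𝒢.disjoint_beyond hq hp ((mem_beyond_of_one_le hr).2 ⟨k, by omega, hkq, hk⟩) hx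

/-- The inverse of the element pairing the line of `g` with a boundary line `h (0, ∞)` moves the
polygon beyond the line of `g`. -/
theorem IsTriangulated.line_source (hq : 3 ≤ q) {𝒢 : Set (Gam q)} (h𝒢 : IsTriangulated 𝒢)
    {g h x : Gam q} (hp : IsPiece 𝒢 h 0) (hx : x ∈ 𝒢) : (h * gS q * g⁻¹)⁻¹ * x ∈ beyond g 0 := by
  have h1 : x ∉ beyond h 0 := fun hb => h𝒢.disjoint_beyond hq hp hb hx
  rw [mem_beyond_zero] at h1 ⊢
  have e : g⁻¹ * ((h * gS q * g⁻¹)⁻¹ * x) = gS q * (h⁻¹ * x) := by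
    rw [mul_inv_rev, mul_inv_rev, inv_inv, gS_inv]; group
  rw [e, pos_S_mul hq]
  exact h1

/-- The rotation of a cluster, in both directions, moves the polygon beyond the cluster. -/
theorem IsTriangulated.rotation_source (hq : 3 ≤ q) {𝒢 : Set (Gam q)} (h𝒢 : IsTriangulated 𝒢)
    {g x : Gam q} {r : ℕ} (hp : IsPiece 𝒢 g r) (hr : 1 ≤ r) (hx : x ∈ 𝒢) :
    (g * gR q ^ r * g⁻¹) * x ∈ beyond g r ∧ (g * gR q ^ r * g⁻¹)⁻¹ * x ∈ beyond g r := by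
  obtain ⟨hd, -, hrq, -⟩ := hp.resolve_left (by omega)
  have h2r := two_mul_le_of_dvd hd hr hrq
  obtain ⟨k, hk, hb⟩ := h𝒢.exists_branch hq hp hr hx
  constructor
  · refine (mem_beyond_of_one_le hr).2 ⟨r + k, by omega, by omega, ?_⟩
    have e : g * gR q ^ (r + k) = g * gR q ^ r * g⁻¹ * (g * gR q ^ k) := by
      rw [pow_add]; group
    rw [e, mul_mem_branch_iff]
    exact hb
  · refine (mem_beyond_of_one_le hr).2 ⟨q - r + k, by omega, by omega, ?_⟩
    have e : g * gR q ^ (q - r + k) = (g * gR q ^ r * g⁻¹)⁻¹ * (g * gR q ^ k) := by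
      rw [pow_add, ← gR_pow_inv hq hrq.le]; group
    rw [e, mul_mem_branch_iff]
    exact hb

theorem mul_gR_inv (hq : 3 ≤ q) (g : Gam q) : g * (gR q)⁻¹ = g * gR q ^ (q - 1) := by
  have := gR_pow_inv hq (show 1 ≤ q by omega)
  rw [pow_one] at this
  rw [this]

/-- The odd edges in the boundary are the outer edges of the clusters. -/
theorem IsTriangulated.oddEdge_cases (hq : 3 ≤ q) {𝒢 : Set (Gam q)} (h𝒢 : IsTriangulated 𝒢)
    {g : Gam q} (hg : ¬ (g ∈ 𝒢 ↔ g * (gR q)⁻¹ ∈ 𝒢)) :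
    ∃ a r, 1 ≤ r ∧ IsPiece 𝒢 a r ∧ (g = a ∨ g = a * gR q ^ r) := by
  rw [mul_gR_inv hq] at hg
  by_cases h : g ∈ 𝒢
  · have h' : g * gR q ^ (q - 1) ∉ 𝒢 := fun h' => hg ⟨fun _ => h', fun _ => h⟩
    rcases h𝒢.tile g h with h1 | ⟨a, r, j, hp, hj, rfl⟩
    · exact absurd (h1 _) h'
    · refine ⟨a, r, by omega, hp, Or.inl ?_⟩
      obtain ⟨-, hr, hrq, hm⟩ := hp.resolve_left (by omega)
      rcases Nat.eq_zero_or_pos j with rfl | hj0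
      · simp
      · rw [mul_assoc, ← pow_add, show j + (q - 1) = (j - 1) + q by omega, pow_add, gR_pow_q hq,
          mul_one] at h'
        exact absurd ((hm _ (by omega)).2 (by omega)) h'
  · have h' : g * gR q ^ (q - 1) ∈ 𝒢 := by
      by_contra h'; exact hg ⟨fun h1 => absurd h1 h, fun h1 => absurd h1 h'⟩
    have e : g = g * gR q ^ (q - 1) * gR q ^ 1 := by
      rw [mul_assoc, ← pow_add, show q - 1 + 1 = q by omega, gR_pow_q hq, mul_one]
    rcases h𝒢.tile _ h' with h1 | ⟨a, r, j, hp, hj, hga⟩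
    · exact absurd (e ▸ h1 1) h
    · refine ⟨a, r, by omega, hp, Or.inr ?_⟩
      obtain ⟨-, hr, hrq, hm⟩ := hp.resolve_left (by omega)
      rw [hga, mul_assoc, ← pow_add] at e
      have hjr : j + 1 = r := by
        by_contra hc
        exact h (e ▸ (hm _ (by omega)).2 (by omega))
      rw [e, hjr]

theorem IsPiece.oddEdge (hq : 3 ≤ q) {𝒢 : Set (Gam q)} {a : Gam q} {r : ℕ} (hp : IsPiece 𝒢 a r)
    (hr : 1 ≤ r) : (a ∈ 𝒢 ∧ a * (gR q)⁻¹ ∉ 𝒢) ∧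
      (a * gR q ^ r ∉ 𝒢 ∧ a * gR q ^ r * (gR q)⁻¹ ∈ 𝒢) := by
  obtain ⟨hd, -, hrq, hm⟩ := hp.resolve_left (by omega)
  have h2 := two_mul_le_of_dvd hd hr hrq
  refine ⟨⟨hp.inner_mem hr, ?_⟩, ?_, ?_⟩
  · rw [mul_gR_inv hq, hm _ (by omega)]; omega
  · rw [hm _ hrq]; omega
  · have : a * gR q ^ r * (gR q)⁻¹ = a * gR q ^ (r - 1) := by
      obtain ⟨k, rfl⟩ : ∃ k, r = k + 1 := ⟨r - 1, by omega⟩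
      rw [pow_succ, ← mul_assoc, mul_inv_cancel_right, Nat.add_sub_cancel]
    rw [this, hm _ (by omega)]; omega

theorem line_cases {𝒢 : Set (Gam q)} {g : Gam q} (hg : ¬ (g ∈ 𝒢 ↔ g * gS q ∈ 𝒢)) :
    ∃ a, IsPiece 𝒢 a 0 ∧ (g = a ∨ g = a * gS q) := by
  by_cases h : g ∈ 𝒢
  · have h' : g * gS q ∉ 𝒢 := fun h' => hg ⟨fun _ => h', fun _ => h⟩
    exact ⟨g * gS q, Or.inl ⟨rfl, h', by rwa [mul_gS_mul_gS]⟩, Or.inr (by rw [mul_gS_mul_gS])⟩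
  · have h' : g * gS q ∈ 𝒢 := by
      by_contra h'; exact hg ⟨fun h1 => absurd h1 h, fun h1 => absurd h1 h'⟩
    exact ⟨g, Or.inl ⟨rfl, h, h'⟩, Or.inl rfl⟩

theorem IsPiece.line {𝒢 : Set (Gam q)} {a : Gam q} (hp : IsPiece 𝒢 a 0) :
    a ∉ 𝒢 ∧ a * gS q ∈ 𝒢 := by
  rcases hp with h | h
  · exact h.2
  · omega

theorem IsPiece.line_iff {𝒢 : Set (Gam q)} {a g : Gam q} (hp : IsPiece 𝒢 a 0)
    (hg : g = a ∨ g = a * gS q) : ¬ (g ∈ 𝒢 ↔ g * gS q ∈ 𝒢) := by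
  obtain ⟨h1, h2⟩ := hp.line
  rcases hg with rfl | rfl
  · exact fun h => h1 (h.2 h2)
  · rw [mul_gS_mul_gS]; exact fun h => h1 (h.1 h2)

theorem conj_S_eq {a g : Gam q} (hg : g = a ∨ g = a * gS q) :
    g * gS q * g⁻¹ = a * gS q * a⁻¹ := by
  rcases hg with rfl | rfl
  · rfl
  · rw [mul_gS_mul_gS, mul_inv_rev, gS_inv, mul_assoc]

theorem line_smul_eq {a g : Gam q} (hg : g = a ∨ g = a * gS q) : g • baseLine = a • baseLine := by
  rcases hg with rfl | rfl
  · rfl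
  · rw [mul_smul, gS_smul_line]

/-- A line is folded by the half turn about its even vertex. -/
theorem isFoldedLine_iff (hq : 3 ≤ q) {𝒢 : Set (Gam q)} (hfin : 𝒢.Finite) {I : Set PSL(2, ℝ)}
    (hI : ∀ γ ∈ I, γ ∈ heckeGroup q) (g : Gam q) : IsFoldedLine (poly 𝒢) I g ↔
      ¬ (g ∈ 𝒢 ↔ g * gS q ∈ 𝒢) ∧ ((g * gS q * g⁻¹ : Gam q) : PSL(2, ℝ)) ∈ I := by
  unfold IsFoldedLine
  refine and_congr (line_subset_frontier hq hfin) ?_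
  constructor
  · rintro ⟨γ, hγ, e⟩
    have e' : (⟨γ, hI γ hγ⟩ * g : Gam q) • baseEvenEdge = (g * gS q) • baseEvenEdge := by
      rw [mul_smul]; exact e
    have := evenEdge_injective hq e'
    have e2 : g * gS q * g⁻¹ = ⟨γ, hI γ hγ⟩ := by rw [← this, mul_inv_cancel_right]
    rw [e2]; exact hγ
  · intro h
    refine ⟨_, h, ?_⟩
    change (g * gS q * g⁻¹ : Gam q) • g • baseEvenEdge = (g * gS q) • baseEvenEdge
    rw [← mul_smul, inv_mul_cancel_right]

theorem isOddSide_iff (hq : 3 ≤ q) {𝒢 : Set (Gam q)} (hfin : 𝒢.Finite) (s : Set ℍ) :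
    IsOddSide q (poly 𝒢) s ↔ ∃ g : Gam q, s = g • baseOddEdge q ∧ ¬ (g ∈ 𝒢 ↔ g * (gR q)⁻¹ ∈ 𝒢) := by
  constructor
  · rintro ⟨⟨g, hg, rfl⟩, hs⟩
    exact ⟨⟨g, hg⟩, rfl, (oddEdge_subset_frontier hq hfin (g := ⟨g, hg⟩)).1 hs⟩
  · rintro ⟨g, rfl, h⟩
    exact ⟨⟨g, g.2, rfl⟩, (oddEdge_subset_frontier hq hfin).2 h⟩

theorem isEvenSide_iff (hq : 3 ≤ q) {𝒢 : Set (Gam q)} (hfin : 𝒢.Finite) {I : Set PSL(2, ℝ)}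
    (hI : ∀ γ ∈ I, γ ∈ heckeGroup q) (s : Set ℍ) : IsEvenSide q (poly 𝒢) I s ↔
      ∃ g : Gam q, s = g • baseEvenEdge ∧ ¬ (g ∈ 𝒢 ↔ g * gS q ∈ 𝒢) ∧
        ((g * gS q * g⁻¹ : Gam q) : PSL(2, ℝ)) ∈ I := by
  constructor
  · rintro ⟨g, hg, hf, rfl⟩
    exact ⟨⟨g, hg⟩, rfl, (isFoldedLine_iff hq hfin hI ⟨g, hg⟩).1 hf⟩
  · rintro ⟨g, rfl, h⟩
    exact ⟨g, g.2, (isFoldedLine_iff hq hfin hI g).2 h, rfl⟩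

theorem isFreeSide_iff (hq : 3 ≤ q) {𝒢 : Set (Gam q)} (hfin : 𝒢.Finite) {I : Set PSL(2, ℝ)}
    (hI : ∀ γ ∈ I, γ ∈ heckeGroup q) (s : Set ℍ) : IsFreeSide q (poly 𝒢) I s ↔
      ∃ g : Gam q, s = g • baseLine ∧ ¬ (g ∈ 𝒢 ↔ g * gS q ∈ 𝒢) ∧
        ((g * gS q * g⁻¹ : Gam q) : PSL(2, ℝ)) ∉ I := by
  constructor
  · rintro ⟨g, hg, rfl, hs, hf⟩
    have h1 := (line_subset_frontier hq hfin (g := ⟨g, hg⟩)).1 hs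
    exact ⟨⟨g, hg⟩, rfl, h1, fun h2 => hf ((isFoldedLine_iff hq hfin hI ⟨g, hg⟩).2 ⟨h1, h2⟩)⟩
  · rintro ⟨g, rfl, h1, h2⟩
    exact ⟨g, g.2, rfl, (line_subset_frontier hq hfin).2 h1,
      fun hf => h2 ((isFoldedLine_iff hq hfin hI g).1 hf).2⟩

theorem IsPiece.isOddSide (hq : 3 ≤ q) {𝒢 : Set (Gam q)} (hfin : 𝒢.Finite) {a : Gam q} {r : ℕ}
    (hp : IsPiece 𝒢 a r) (hr : 1 ≤ r) : IsOddSide q (poly 𝒢) (a • baseOddEdge q) ∧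
      IsOddSide q (poly 𝒢) ((a * gR q ^ r) • baseOddEdge q) := by
  obtain ⟨⟨m1, m2⟩, m3, m4⟩ := hp.oddEdge hq hr
  exact ⟨(isOddSide_iff hq hfin _).2 ⟨_, rfl, fun h => m2 (h.1 m1)⟩,
    (isOddSide_iff hq hfin _).2 ⟨_, rfl, fun h => m3 (h.2 m4)⟩⟩

/-- If an odd edge is a side, it is an odd side. -/
theorem isSide_oddEdge (hq : 3 ≤ q) {𝒢 : Set (Gam q)} (hfin : 𝒢.Finite) {I : Set PSL(2, ℝ)}
    (hI : ∀ γ ∈ I, γ ∈ heckeGroup q) {g : Gam q} (h : IsSide q (poly 𝒢) I (g • baseOddEdge q)) :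
    ¬ (g ∈ 𝒢 ↔ g * (gR q)⁻¹ ∈ 𝒢) := by
  rcases h with h | h | h
  · obtain ⟨k, e, hk⟩ := (isOddSide_iff hq hfin _).1 h
    rwa [oddEdge_injective hq e]
  · obtain ⟨k, e, -⟩ := (isEvenSide_iff hq hfin hI _).1 h
    exact absurd (e.subset.trans (Set.smul_set_mono baseEvenEdge_subset))
      (oddEdge_not_subset_line hq g k)
  · obtain ⟨k, e, -⟩ := (isFreeSide_iff hq hfin hI _).1 h
    exact absurd e.subset (oddEdge_not_subset_line hq g k)

/-- If an even edge is a side, it lies on a line in the boundary. -/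
theorem isSide_evenEdge (hq : 3 ≤ q) {𝒢 : Set (Gam q)} (hfin : 𝒢.Finite) {I : Set PSL(2, ℝ)}
    (hI : ∀ γ ∈ I, γ ∈ heckeGroup q) {g : Gam q} (h : IsSide q (poly 𝒢) I (g • baseEvenEdge)) :
    ¬ (g ∈ 𝒢 ↔ g * gS q ∈ 𝒢) := by
  rcases h with h | h | h
  · obtain ⟨k, e, hk⟩ := (isOddSide_iff hq hfin _).1 h
    exact absurd (e.symm.subset.trans (Set.smul_set_mono baseEvenEdge_subset))
      (oddEdge_not_subset_line hq k g)
  · obtain ⟨k, e, h, -⟩ := (isEvenSide_iff hq hfin hI _).1 h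
    rwa [evenEdge_injective hq e]
  · obtain ⟨k, e, -⟩ := (isFreeSide_iff hq hfin hI _).1 h
    exact absurd e (evenEdge_ne_line hq g k)

/-- If an even line is a side, it lies in the boundary. -/
theorem isSide_line (hq : 3 ≤ q) {𝒢 : Set (Gam q)} (hfin : 𝒢.Finite) {I : Set PSL(2, ℝ)}
    (hI : ∀ γ ∈ I, γ ∈ heckeGroup q) {g : Gam q} (h : IsSide q (poly 𝒢) I (g • baseLine)) :
    ¬ (g ∈ 𝒢 ↔ g * gS q ∈ 𝒢) := by
  rcases h with h | h | h
  · obtain ⟨k, e, hk⟩ := (isOddSide_iff hq hfin _).1 h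
    exact absurd e.symm.subset (oddEdge_not_subset_line hq k g)
  · obtain ⟨k, e, h, -⟩ := (isEvenSide_iff hq hfin hI _).1 h
    exact absurd e.symm (evenEdge_ne_line hq k g)
  · obtain ⟨k, e, h, -⟩ := (isFreeSide_iff hq hfin hI _).1 h
    rw [← line_subset_frontier hq hfin, e]
    exact (line_subset_frontier hq hfin).2 h

theorem mul_S_ne (hq : 3 ≤ q) (g : Gam q) : g * gS q ≠ g := fun h => gS_ne_one hq (mul_eq_left.1 h)

theorem oddEdge_ne (hq : 3 ≤ q) {a : Gam q} {r : ℕ} (hr : 1 ≤ r) (hrq : r < q) :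
    (a * gR q ^ r) • baseOddEdge q ≠ a • baseOddEdge q := fun e =>
  R_pow_ne_one hq hr hrq (mul_eq_left.1 (oddEdge_injective hq e))

end

/-! ### Side pairings move the polygon across its boundary pieces -/

namespace HeckeFareySymbol

variable {q : ℕ} {F : HeckeFareySymbol q}

theorem coe_mem_pairings_iff (hq : 3 ≤ q) (γ : Gam q) :
    (γ : PSL(2, ℝ)) ∈ F.pairings ↔ ∃ i, F.PairAt i γ ∨ F.PairAt i γ⁻¹ := by
  rw [mem_pairings_iff hq]
  constructor
  · rintro ⟨γ', e, h⟩
    rwa [← Subtype.ext e]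
  · intro h; exact ⟨γ, rfl, h⟩

theorem mem_heckeGroup_of_mem_pairings (hq : 3 ≤ q) {γ : PSL(2, ℝ)} (h : γ ∈ F.pairings) :
    γ ∈ heckeGroup q := by
  obtain ⟨γ', rfl, -⟩ := (mem_pairings_iff hq γ).1 h
  exact γ'.2

variable {𝒢 : Set (Gam q)}

/-- A side pairing `γ` has a source: a boundary piece beyond which `γ⁻¹ P` lies. -/
theorem IsMatch.exists_source (hq : 3 ≤ q) (hM : F.IsMatch 𝒢) {γ : Gam q}
    (hγ : ∃ i, F.PairAt i γ ∨ F.PairAt i γ⁻¹) : ∃ i g r, F.IsPieceAt i g r ∧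
      (∀ x ∈ 𝒢, γ⁻¹ * x ∈ beyond g r) ∧ (F.PairAt i γ ∨ (1 ≤ r ∧ F.PairAt i γ⁻¹)) := by
  have hline : ∀ {i j : Fin (F.n + 2)} {g h : Gam q}, F.Partner i j → F.Ends i g 1 → F.Ends j h 1 →
      ∀ x ∈ 𝒢, (h * gS q * g⁻¹)⁻¹ * x ∈ beyond g 0 := fun hp _ hh x hx =>
    hM.tri.line_source hq ((hM.piece _ 0).2 ⟨_, hp.symm.isPieceAt hh⟩) hx
  obtain ⟨i, h | h⟩ := hγ
  · rcases h with ⟨j, g, h, hp, hg, hh, rfl⟩ | ⟨g, m, hl, hg, rfl⟩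
    · exact ⟨i, g, 0, hp.isPieceAt hg, hline hp hg hh, Or.inl (Or.inl ⟨j, g, h, hp, hg, hh, rfl⟩)⟩
    · have hp := isPieceAt_of_label hl hg
      exact ⟨i, g, m, hp, fun x hx =>
        (hM.tri.rotation_source hq ((hM.piece g m).2 ⟨i, hp⟩) hg.2.1 hx).2,
        Or.inl (Or.inr ⟨g, m, hl, hg, rfl⟩)⟩
  · rcases h with ⟨j, g, h, hp, hg, hh, e⟩ | ⟨g, m, hl, hg, e⟩
    · have hγ : γ = g * gS q * h⁻¹ := by
        rw [← inv_inv γ, e, mul_inv_rev, mul_inv_rev, inv_inv, gS_inv, mul_assoc]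
      refine ⟨j, h, 0, hp.symm.isPieceAt hh, ?_, Or.inl (Or.inl ⟨i, h, g, hp.symm, hh, hg, hγ⟩)⟩
      rw [hγ]; exact hline hp.symm hh hg
    · have hp := isPieceAt_of_label hl hg
      refine ⟨i, g, m, hp, fun x hx => ?_, Or.inr ⟨hg.2.1, Or.inr ⟨g, m, hl, hg, e⟩⟩⟩
      rw [e]
      exact (hM.tri.rotation_source hq ((hM.piece g m).2 ⟨i, hp⟩) hg.2.1 hx).1

/-- A side pairing which maps a triangle beyond a boundary piece into the polygon is the side pairing
of that piece, or its inverse. -/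
theorem IsMatch.pairAt_of_mem (hq : 3 ≤ q) (hM : F.IsMatch 𝒢) {γ : Gam q}
    (hγ : ∃ i, F.PairAt i γ ∨ F.PairAt i γ⁻¹) {i : Fin (F.n + 2)} {g y : Gam q} {r : ℕ}
    (hp : F.IsPieceAt i g r) (hy : y ∈ beyond g r) (hγy : γ * y ∈ 𝒢) :
    F.PairAt i γ ∨ (1 ≤ r ∧ F.PairAt i γ⁻¹) := by
  obtain ⟨j, g', r', hp', hb, h⟩ := hM.exists_source hq hγ
  have h1 := hb _ hγy
  rw [inv_mul_cancel_left] at h1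
  have hij := hp.disjoint_beyond hq hp' hy h1
  subst hij
  obtain ⟨rfl, rfl⟩ := hp.unique hq hp'
  exact h

theorem IsMatch.not_mem_of_mem (hq : 3 ≤ q) (hM : F.IsMatch 𝒢) {γ : Gam q}
    (hγ : ∃ i, F.PairAt i γ ∨ F.PairAt i γ⁻¹) {g : Gam q} (hg : g ∈ 𝒢) : γ * g ∉ 𝒢 := by
  intro h
  obtain ⟨j, g', r', hp', hb, -⟩ := hM.exists_source hq hγ
  have h1 := hb _ h
  rw [inv_mul_cancel_left] at h1
  exact hM.tri.disjoint_beyond hq ((hM.piece _ _).2 ⟨j, hp'⟩) h1 hg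

/-- The line of an interval is folded if and only if the interval is even. -/
theorem IsMatch.folded_iff (hq : 3 ≤ q) (hM : F.IsMatch 𝒢) {i : Fin (F.n + 2)} {a : Gam q}
    (hp : F.IsPieceAt i a 0) : (∃ j, F.PairAt j (a * gS q * a⁻¹) ∨ F.PairAt j (a * gS q * a⁻¹)⁻¹) ↔
      F.label i = .even := by
  have he := hp.ends_of_zero hq
  have ha : a ∈ beyond a 0 := by rw [mem_beyond_zero, inv_mul_cancel]; exact pos_one hq
  constructor
  · intro h
    have h1 := hM.pairAt_of_mem hq h hp ha
      (by rw [inv_mul_cancel_right]; exact ((hM.piece a 0).2 ⟨i, hp⟩).line.2)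
    obtain h1 : F.PairAt i (a * gS q * a⁻¹) := h1.resolve_right (by omega)
    rcases h1 with ⟨j, g, k, hpart, hg, hk, e⟩ | ⟨g, m, hl, hg, -⟩
    · obtain ⟨hga, -⟩ := hg.unique hq he
      rw [hga] at e
      have hka : a = k := mul_right_cancel (mul_right_cancel e)
      rw [← hka] at hk
      have hij := hp.disjoint_beyond hq (hpart.symm.isPieceAt hk) ha ha
      subst hij
      rcases hpart with h | h
      · exact h.1
      · exact absurd rfl (F.free_symm _ _ h).1
    · have := isPieceAt_of_label hl hg
      have := (this.unique hq hp).2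
      have := hg.2.1
      omega
  · intro h
    exact ⟨i, Or.inl (Or.inl ⟨i, a, a, Or.inl ⟨h, rfl⟩, he, he, rfl⟩)⟩

/-- The only side pairing that maps the boundary line of an interval to a boundary line is that of the
interval. -/
theorem IsMatch.pairAt_of_line (hq : 3 ≤ q) (hM : F.IsMatch 𝒢) {γ : Gam q}
    (hγ : ∃ i, F.PairAt i γ ∨ F.PairAt i γ⁻¹) {i : Fin (F.n + 2)} {a g : Gam q}
    (hp : F.IsPieceAt i a 0) (hg : g = a ∨ g = a * gS q)
    (h : ¬ (γ * g ∈ 𝒢 ↔ γ * g * gS q ∈ 𝒢)) : F.PairAt i γ := by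
  have ha : a ∈ beyond a 0 := by rw [mem_beyond_zero, inv_mul_cancel]; exact pos_one hq
  have h1 := hM.not_mem_of_mem hq hγ ((hM.piece a 0).2 ⟨i, hp⟩).line.2
  have h2 : γ * a ∈ 𝒢 := by
    by_contra h2
    apply h
    rcases hg with rfl | rfl
    · rw [mul_assoc]; exact iff_of_false h2 h1
    · rw [← mul_assoc, mul_gS_mul_gS]
      rw [← mul_assoc] at h1
      exact iff_of_false h1 h2
  exact (hM.pairAt_of_mem hq hγ hp ha h2).resolve_right (by omega)

/-- The only side pairing that maps an odd side to an odd side is the rotation of its cluster, in the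
appropriate direction. -/
theorem IsMatch.eq_of_oddEdge (hq : 3 ≤ q) (hM : F.IsMatch 𝒢) {γ : Gam q}
    (hγ : ∃ i, F.PairAt i γ ∨ F.PairAt i γ⁻¹) {i : Fin (F.n + 2)} {a : Gam q} {r : ℕ} (hr : 1 ≤ r)
    (hp : F.IsPieceAt i a r) :
    (¬ (γ * a ∈ 𝒢 ↔ γ * a * (gR q)⁻¹ ∈ 𝒢) → γ = a * gR q ^ r * a⁻¹) ∧
    (¬ (γ * (a * gR q ^ r) ∈ 𝒢 ↔ γ * (a * gR q ^ r) * (gR q)⁻¹ ∈ 𝒢) →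
      γ = (a * gR q ^ r * a⁻¹)⁻¹) := by
  obtain ⟨hl, he⟩ := label_of_one_le hp hr
  have hrq := he.2.2.1
  have h2r := IsEnds.two_mul_le he
  have hpc := (hM.piece a r).2 ⟨i, hp⟩
  obtain ⟨⟨m1, m2⟩, m3, m4⟩ := hpc.oddEdge hq hr
  obtain ⟨-, -, -, hm⟩ := hpc.resolve_left (by omega)
  have hδ : F.PairAt i (a * gR q ^ r * a⁻¹) := Or.inr ⟨a, r, hl, he, rfl⟩
  have hcase : F.PairAt i γ ∨ (1 ≤ r ∧ F.PairAt i γ⁻¹) →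
      γ = a * gR q ^ r * a⁻¹ ∨ γ = (a * gR q ^ r * a⁻¹)⁻¹ := by
    rintro (h | ⟨-, h⟩)
    · exact Or.inl (h.unique hq hδ)
    · right; rw [← h.unique hq hδ, inv_inv]
  have hhalf : 2 * r = q → (a * gR q ^ r * a⁻¹)⁻¹ = a * gR q ^ r * a⁻¹ := by
    intro h
    have : (gR q ^ r)⁻¹ = gR q ^ r := by
      rw [gR_pow_inv hq hrq.le]; congr 1; omega
    rw [mul_inv_rev, mul_inv_rev, inv_inv, this, mul_assoc]
  constructor
  · intro h
    have h1 := hM.not_mem_of_mem hq hγ m1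
    have h2 : γ * (a * (gR q)⁻¹) ∈ 𝒢 := by
      rw [← mul_assoc]
      by_contra h2; exact h (iff_of_false h1 h2)
    rw [mul_gR_inv hq] at h2
    rcases hcase (hM.pairAt_of_mem hq hγ hp
      ((mul_R_pow_mem_beyond_iff hq hr (by omega)).2 (by omega)) h2) with h3 | h3
    · exact h3
    · rw [h3, hhalf]
      have e : (a * gR q ^ r * a⁻¹)⁻¹ * (a * gR q ^ (q - 1)) = a * gR q ^ (q - r - 1) := by
        rw [show q - 1 = r + (q - r - 1) by omega, pow_add]; group
      rw [h3, e, hm _ (by omega)] at h2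
      omega
  · intro h
    have h1 := hM.not_mem_of_mem hq hγ m4
    rw [← mul_assoc] at h1
    have h2 : γ * (a * gR q ^ r) ∈ 𝒢 := by
      by_contra h2; exact h (iff_of_false h2 h1)
    rcases hcase (hM.pairAt_of_mem hq hγ hp
      ((mul_R_pow_mem_beyond_iff hq hr hrq).2 le_rfl) h2) with h3 | h3
    · rw [h3, hhalf]
      have e : (a * gR q ^ r * a⁻¹) * (a * gR q ^ r) = a * gR q ^ (2 * r) := by
        rw [two_mul, pow_add]; group
      rw [h3, e] at h2
      by_contra hne
      rw [hm _ (by omega)] at h2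
      omega
    · exact h3

end HeckeFareySymbol

/-! ### The special polygon of a Hecke-Farey symbol -/

namespace HeckeFareySymbol

variable {q : ℕ} {F : HeckeFareySymbol q} {𝒢 : Set (Gam q)}

theorem IsMatch.isOddSide (hq : 3 ≤ q) (hM : F.IsMatch 𝒢) {i : Fin (F.n + 2)} {a : Gam q} {r : ℕ}
    (hr : 1 ≤ r) (hp : F.IsPieceAt i a r) : IsOddSide q (poly 𝒢) (a • baseOddEdge q) ∧
      IsOddSide q (poly 𝒢) ((a * gR q ^ r) • baseOddEdge q) :=
  ((hM.piece a r).2 ⟨i, hp⟩).isOddSide hq hM.finite hr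

theorem IsMatch.isEvenSide (hq : 3 ≤ q) (hM : F.IsMatch 𝒢) {i : Fin (F.n + 2)} {a g : Gam q}
    (hp : F.IsPieceAt i a 0) (hl : F.label i = .even) (hg : g = a ∨ g = a * gS q) :
    IsEvenSide q (poly 𝒢) F.pairings (g • baseEvenEdge) := by
  refine (isEvenSide_iff hq hM.finite (fun _ => mem_heckeGroup_of_mem_pairings hq) _).2
    ⟨g, rfl, ((hM.piece a 0).2 ⟨i, hp⟩).line_iff hg, ?_⟩
  rw [conj_S_eq hg, coe_mem_pairings_iff hq]
  exact (hM.folded_iff hq hp).2 hl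

theorem IsMatch.isFreeSide (hq : 3 ≤ q) (hM : F.IsMatch 𝒢) {i : Fin (F.n + 2)} {a : Gam q}
    (hp : F.IsPieceAt i a 0) (hl : F.label i ≠ .even) :
    IsFreeSide q (poly 𝒢) F.pairings (a • baseLine) := by
  refine (isFreeSide_iff hq hM.finite (fun _ => mem_heckeGroup_of_mem_pairings hq) _).2
    ⟨a, rfl, ((hM.piece a 0).2 ⟨i, hp⟩).line_iff (Or.inl rfl), ?_⟩
  rw [coe_mem_pairings_iff hq]
  exact fun h => hl ((hM.folded_iff hq hp).1 h)

theorem IsMatch.oddSide_cases (hq : 3 ≤ q) (hM : F.IsMatch 𝒢) {s : Set ℍ}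
    (hs : IsOddSide q (poly 𝒢) s) : ∃ i a r, 1 ≤ r ∧ F.IsPieceAt i a r ∧
      (s = a • baseOddEdge q ∨ s = (a * gR q ^ r) • baseOddEdge q) := by
  obtain ⟨g, rfl, hg⟩ := (isOddSide_iff hq hM.finite _).1 hs
  obtain ⟨a, r, hr, hp, h⟩ := hM.tri.oddEdge_cases hq hg
  obtain ⟨i, hi⟩ := (hM.piece a r).1 hp
  refine ⟨i, a, r, hr, hi, h.imp ?_ ?_⟩ <;> rintro rfl <;> rfl

theorem IsMatch.evenSide_cases (hq : 3 ≤ q) (hM : F.IsMatch 𝒢) {s : Set ℍ}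
    (hs : IsEvenSide q (poly 𝒢) F.pairings s) : ∃ i a g, F.IsPieceAt i a 0 ∧ F.label i = .even ∧
      (g = a ∨ g = a * gS q) ∧ s = g • baseEvenEdge := by
  obtain ⟨g, rfl, hg, hm⟩ :=
    (isEvenSide_iff hq hM.finite (fun _ => mem_heckeGroup_of_mem_pairings hq) _).1 hs
  obtain ⟨a, hp, h⟩ := line_cases hg
  obtain ⟨i, hi⟩ := (hM.piece a 0).1 hp
  rw [conj_S_eq h, coe_mem_pairings_iff hq] at hm
  exact ⟨i, a, g, hi, (hM.folded_iff hq hi).1 hm, h, rfl⟩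

theorem IsMatch.freeSide_cases (hq : 3 ≤ q) (hM : F.IsMatch 𝒢) {s : Set ℍ}
    (hs : IsFreeSide q (poly 𝒢) F.pairings s) : ∃ i a j, F.IsPieceAt i a 0 ∧ F.label i = .free j ∧
      s = a • baseLine := by
  obtain ⟨g, rfl, hg, hm⟩ :=
    (isFreeSide_iff hq hM.finite (fun _ => mem_heckeGroup_of_mem_pairings hq) _).1 hs
  obtain ⟨a, hp, h⟩ := line_cases hg
  obtain ⟨i, hi⟩ := (hM.piece a 0).1 hp
  rw [conj_S_eq h, coe_mem_pairings_iff hq] at hm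
  have hl : F.label i ≠ .even := fun hl => hm ((hM.folded_iff hq hi).2 hl)
  obtain ⟨j, ⟨hj, -⟩ | hj⟩ := exists_partner_of_rank_zero hi
  · exact absurd hj hl
  · exact ⟨i, a, j, hi, hj, line_smul_eq h⟩

/-- The line of a free interval is mapped to that of its partner, which is a different one. -/
theorem IsMatch.free_pairing (hq : 3 ≤ q) (hM : F.IsMatch 𝒢) {i j : Fin (F.n + 2)} {a : Gam q}
    (hp : F.IsPieceAt i a 0) (hl : F.label i = .free j) : ∃ γ : Gam q, F.PairAt i γ ∧
      IsFreeSide q (poly 𝒢) F.pairings (γ • a • baseLine) ∧ γ • a • baseLine ≠ a • baseLine := by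
  have hpart : F.Partner i j := Or.inr hl
  obtain ⟨h, m, he⟩ := F.exists_ends hq j
  have hpj := hpart.symm.isPieceAt he
  have hej := hpj.ends_of_zero hq
  refine ⟨h * gS q * a⁻¹, Or.inl ⟨j, a, h, hpart, hp.ends_of_zero hq, hej, rfl⟩, ?_⟩
  rw [← mul_smul, inv_mul_cancel_right, line_smul_eq (Or.inr rfl)]
  refine ⟨hM.isFreeSide hq hpj (by rw [(F.free_symm _ _ hl).2]; simp), fun e => ?_⟩
  rcases eq_or_eq_of_line hq e with rfl | rfl
  · have ha : a ∈ beyond a 0 := by rw [mem_beyond_zero, inv_mul_cancel]; exact pos_one hq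
    exact (F.free_symm _ _ hl).1 (hp.disjoint_beyond hq hpj ha ha)
  · exact not_swap hq hpj hp

theorem even_pairing_smul {a g : Gam q} (hg : g = a ∨ g = a * gS q) :
    (a * gS q * a⁻¹) • g • baseEvenEdge = (g * gS q) • baseEvenEdge := by
  rw [← conj_S_eq hg, ← mul_smul, inv_mul_cancel_right]

theorem mul_S_cases {a g : Gam q} (hg : g = a ∨ g = a * gS q) :
    g * gS q = a ∨ g * gS q = a * gS q := by
  rcases hg with rfl | rfl
  · exact Or.inr rfl
  · exact Or.inl (mul_gS_mul_gS a)

theorem evenEdge_ne (hq : 3 ≤ q) (g : Gam q) : (g * gS q) • baseEvenEdge ≠ g • baseEvenEdge :=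
  fun e => mul_S_ne hq g (evenEdge_injective hq e)

theorem odd_pairing_smul (a : Gam q) (r : ℕ) :
    (a * gR q ^ r * a⁻¹) • a • baseOddEdge q = (a * gR q ^ r) • baseOddEdge q := by
  rw [← mul_smul, inv_mul_cancel_right]

theorem odd_pairing_inv_smul (a : Gam q) (r : ℕ) :
    (a * gR q ^ r * a⁻¹)⁻¹ • (a * gR q ^ r) • baseOddEdge q = a • baseOddEdge q := by
  rw [← odd_pairing_smul, inv_smul_smul]

theorem PairAt.of_isPieceAt {i : Fin (F.n + 2)} {a : Gam q} {r : ℕ} (hr : 1 ≤ r)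
    (hp : F.IsPieceAt i a r) : F.PairAt i (a * gR q ^ r * a⁻¹) := by
  obtain ⟨hl, he⟩ := label_of_one_le hp hr
  exact Or.inr ⟨a, r, hl, he, rfl⟩

theorem PairAt.of_even (hq : 3 ≤ q) {i : Fin (F.n + 2)} {a : Gam q} (hp : F.IsPieceAt i a 0)
    (hl : F.label i = .even) : F.PairAt i (a * gS q * a⁻¹) :=
  Or.inl ⟨i, a, a, Or.inl ⟨hl, rfl⟩, hp.ends_of_zero hq, hp.ends_of_zero hq, rfl⟩

/-- A side pairing of a symbol maps a side to another side. -/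
theorem IsMatch.exists_side (hq : 3 ≤ q) (hM : F.IsMatch 𝒢) {i : Fin (F.n + 2)} {γ : Gam q}
    (hγ : F.PairAt i γ) : ∃ s, IsSide q (poly 𝒢) F.pairings s ∧
      IsSide q (poly 𝒢) F.pairings (γ • s) ∧ γ • s ≠ s := by
  obtain ⟨a, r, hp⟩ := exists_isPieceAt hq i
  rcases Nat.eq_zero_or_pos r with rfl | hr
  · obtain ⟨j, ⟨hl, -⟩ | hl⟩ := exists_partner_of_rank_zero hp
    · obtain rfl := hγ.unique hq (PairAt.of_even hq hp hl)
      refine ⟨_, Or.inr (Or.inl (hM.isEvenSide hq hp hl (Or.inl rfl))), ?_⟩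
      rw [even_pairing_smul (Or.inl rfl)]
      exact ⟨Or.inr (Or.inl (hM.isEvenSide hq hp hl (Or.inr rfl))), evenEdge_ne hq a⟩
    · obtain ⟨γ', h1, h2, h3⟩ := hM.free_pairing hq hp hl
      obtain rfl := hγ.unique hq h1
      exact ⟨_, Or.inr (Or.inr (hM.isFreeSide hq hp (by rw [hl]; simp))), Or.inr (Or.inr h2), h3⟩
  · obtain rfl := hγ.unique hq (PairAt.of_isPieceAt hr hp)
    have hrq := (label_of_one_le hp hr).2.2.2.1
    refine ⟨_, Or.inl (hM.isOddSide hq hr hp).1, ?_⟩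
    rw [odd_pairing_smul]
    exact ⟨Or.inl (hM.isOddSide hq hr hp).2, oddEdge_ne hq hr hrq⟩

theorem IsMatch.paired (hq : 3 ≤ q) (hM : F.IsMatch 𝒢) {s : Set ℍ}
    (hs : IsSide q (poly 𝒢) F.pairings s) : ∃! γ : Gam q, (∃ i, F.PairAt i γ ∨ F.PairAt i γ⁻¹) ∧
      IsSide q (poly 𝒢) F.pairings (γ • s) ∧ γ • s ≠ s := by
  have hI : ∀ γ ∈ F.pairings, γ ∈ heckeGroup q := fun _ => mem_heckeGroup_of_mem_pairings hq
  rcases hs with hs | hs | hs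
  · obtain ⟨i, a, r, hr, hp, hs⟩ := hM.oddSide_cases hq hs
    have hrq := (label_of_one_le hp hr).2.2.2.1
    have hpair := PairAt.of_isPieceAt hr hp
    rcases hs with rfl | rfl
    · refine ⟨a * gR q ^ r * a⁻¹, ⟨⟨i, Or.inl hpair⟩, ?_⟩, ?_⟩
      · rw [odd_pairing_smul]
        exact ⟨Or.inl (hM.isOddSide hq hr hp).2, oddEdge_ne hq hr hrq⟩
      · rintro γ ⟨hγ, h1, -⟩
        rw [← mul_smul] at h1
        exact (hM.eq_of_oddEdge hq hγ hr hp).1 (isSide_oddEdge hq hM.finite hI h1)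
    · refine ⟨(a * gR q ^ r * a⁻¹)⁻¹, ⟨⟨i, Or.inr (by rwa [inv_inv])⟩, ?_⟩, ?_⟩
      · rw [odd_pairing_inv_smul]
        exact ⟨Or.inl (hM.isOddSide hq hr hp).1, (oddEdge_ne hq hr hrq).symm⟩
      · rintro γ ⟨hγ, h1, -⟩
        rw [← mul_smul] at h1
        exact (hM.eq_of_oddEdge hq hγ hr hp).2 (isSide_oddEdge hq hM.finite hI h1)
  · obtain ⟨i, a, g, hp, hl, hg, rfl⟩ := hM.evenSide_cases hq hs
    refine ⟨a * gS q * a⁻¹, ⟨⟨i, Or.inl (PairAt.of_even hq hp hl)⟩, ?_⟩, ?_⟩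
    · rw [even_pairing_smul hg]
      exact ⟨Or.inr (Or.inl (hM.isEvenSide hq hp hl (mul_S_cases hg))), evenEdge_ne hq g⟩
    · rintro γ ⟨hγ, h1, -⟩
      rw [← mul_smul] at h1
      exact (hM.pairAt_of_line hq hγ hp hg (isSide_evenEdge hq hM.finite hI h1)).unique hq
        (PairAt.of_even hq hp hl)
  · obtain ⟨i, a, j, hp, hl, rfl⟩ := hM.freeSide_cases hq hs
    obtain ⟨γ', h1, h2, h3⟩ := hM.free_pairing hq hp hl
    refine ⟨γ', ⟨⟨i, Or.inl h1⟩, Or.inr (Or.inr h2), h3⟩, ?_⟩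
    rintro γ ⟨hγ, h4, -⟩
    rw [← mul_smul] at h4
    exact (hM.pairAt_of_line hq hγ hp (Or.inl rfl) (isSide_line hq hM.finite hI h4)).unique hq h1

theorem IsMatch.odd_paired (hq : 3 ≤ q) (hM : F.IsMatch 𝒢) {s : Set ℍ}
    (hs : IsOddSide q (poly 𝒢) s) : ∃ t, IsOddSide q (poly 𝒢) t ∧ t ≠ s ∧
      (∃ γ ∈ F.pairings, γ • s = t) ∧
      ∃ g ∈ heckeGroup q, ∃ r, r ∣ q ∧ 1 ≤ r ∧ r < q ∧ g • fan q r ⊆ poly 𝒢 ∧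
        ({s, t} : Set (Set ℍ)) = {g • baseOddEdge q, (g * R q ^ r) • baseOddEdge q} := by
  obtain ⟨i, a, r, hr, hp, hs⟩ := hM.oddSide_cases hq hs
  have he := (label_of_one_le hp hr).2
  have hrq := he.2.2.1
  obtain ⟨-, -, -, hm⟩ := ((hM.piece a r).2 ⟨i, hp⟩).resolve_left (by omega)
  have hpair := PairAt.of_isPieceAt hr hp
  obtain ⟨h1, h2⟩ := hM.isOddSide hq hr hp
  have hfan : (a : PSL(2, ℝ)) • fan q r ⊆ poly 𝒢 := by
    intro z hz
    obtain ⟨k, hk, hz⟩ := (mem_smul_fan_iff a r z).1 hz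
    exact ⟨_, (hm k (by omega)).2 hk, hz⟩
  rcases hs with rfl | rfl
  · exact ⟨_, h2, oddEdge_ne hq hr hrq, ⟨((a * gR q ^ r * a⁻¹ : Gam q) : PSL(2, ℝ)),
      (coe_mem_pairings_iff hq _).2 ⟨i, Or.inl hpair⟩, odd_pairing_smul a r⟩,
      a, a.2, r, he.1, hr, hrq, hfan, rfl⟩
  · exact ⟨_, h1, (oddEdge_ne hq hr hrq).symm, ⟨(((a * gR q ^ r * a⁻¹)⁻¹ : Gam q) : PSL(2, ℝ)),
      (coe_mem_pairings_iff hq _).2 ⟨i, Or.inr (by rwa [inv_inv])⟩, odd_pairing_inv_smul a r⟩,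
      a, a.2, r, he.1, hr, hrq, hfan, Set.pair_comm _ _⟩

/-- The special polygon of a symbol. -/
def toSpecialPolygon (hq : 3 ≤ q) (F : HeckeFareySymbol q) : SpecialPolygon q where
  P := poly F.region
  I := F.pairings
  convexPolygon := (F.isMatch_region hq).tri.isConvexPolygon hq (F.isMatch_region hq).finite
    (F.isMatch_region hq).base
  mem_heckeGroup _ := mem_heckeGroup_of_mem_pairings hq
  inv_mem := by
    rintro γ ⟨i, h⟩
    exact ⟨i, by rw [inv_inv]; exact h.symm⟩
  disjoint_interior := by
    intro γ hγ
    obtain ⟨γ, rfl, h⟩ := (mem_pairings_iff hq γ).1 hγ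
    exact (disjoint_interior_poly hq γ).2 fun g hg => (F.isMatch_region hq).not_mem_of_mem hq h hg
  pairs := by
    intro γ hγ
    obtain ⟨γ, rfl, i, h | h⟩ := (mem_pairings_iff hq γ).1 hγ
    · exact (F.isMatch_region hq).exists_side hq h
    · obtain ⟨s, h1, h2, h3⟩ := (F.isMatch_region hq).exists_side hq h
      have e : γ • γ⁻¹ • s = s := smul_inv_smul γ s
      refine ⟨γ⁻¹ • s, h2, ?_⟩
      change IsSide _ _ _ (γ • γ⁻¹ • s) ∧ γ • γ⁻¹ • s ≠ γ⁻¹ • s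
      rw [e]
      exact ⟨h1, h3.symm⟩
  paired := by
    intro s hs
    obtain ⟨γ, ⟨h1, h2⟩, h3⟩ := (F.isMatch_region hq).paired hq hs
    refine ⟨γ, ⟨(coe_mem_pairings_iff hq _).2 h1, h2⟩, ?_⟩
    rintro δ ⟨hδ, h4⟩
    obtain ⟨δ, rfl, h⟩ := (mem_pairings_iff hq δ).1 hδ
    rw [h3 δ ⟨h, h4⟩]
  odd_paired _ hs := (F.isMatch_region hq).odd_paired hq hs
  free_paired := by
    intro s hs
    obtain ⟨i, a, j, hp, hl, rfl⟩ := (F.isMatch_region hq).freeSide_cases hq hs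
    obtain ⟨γ, h1, h2, h3⟩ := (F.isMatch_region hq).free_pairing hq hp hl
    exact ⟨_, h2, h3, γ, (coe_mem_pairings_iff hq _).2 ⟨i, Or.inl h1⟩, rfl⟩
  zero_cusp := by
    rw [isCuspOf_poly hq, cuspSet_region hq]; exact F.zero_mem_points
  infty_cusp := by
    rw [isCuspOf_poly hq, cuspSet_region hq]; exact F.infty_mem_points

/-! ### Vertices -/

theorem mem_oddVertices_iff (hq : 3 ≤ q) (z : ℍ) : z ∈ F.oddVertices ↔
    ∃ i g r, 1 ≤ r ∧ F.IsPieceAt i g r ∧ z = g • rho hq := by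
  constructor
  · rintro ⟨i, w, hw, h⟩
    obtain rfl := (isBaseOddVertex_iff hq w).1 hw
    rcases h with ⟨hl, r, g, hg, rfl⟩ | ⟨hl, A, hA, rfl⟩
    · obtain ⟨g', h1, he, rfl⟩ := (F.isRInterval_iff hq).1 hg
      exact ⟨i, g', r, h1.le, isPieceAt_of_label (Or.inr hl) he, rfl⟩
    · obtain ⟨hm, he⟩ := F.ends_of_isIntervalMatrix hq hA
      exact ⟨i, _, 1, le_rfl, isPieceAt_of_label (Or.inl hl) he, rfl⟩
  · rintro ⟨i, g, r, hr, hp, rfl⟩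
    refine ⟨i, rho hq, (isBaseOddVertex_iff hq _).2 rfl, ?_⟩
    obtain ⟨hl | hl, he⟩ := label_of_one_le hp hr
    · right
      obtain rfl : r = 1 := eq_one_of_ends hq (by rw [hl]; simp) he
      obtain ⟨A, hA, hAg⟩ := F.isIntervalMatrix_of_ends hq he
      refine ⟨hl, A, hA, ?_⟩
      rw [gam_smul_def, ← hAg]; rfl
    · left
      have := ne_one_of_cluster hq hl he
      exact ⟨hl, r, g, (F.isRInterval_iff hq).2 ⟨g, by omega, he, rfl⟩, rfl⟩

theorem eq_iPt {w : ℍ} (hw : (w : ℂ) = Complex.I) : w = iPt 1 one_pos :=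
  UpperHalfPlane.ext (hw.trans (by rw [iPt]; rfl))

theorem mem_evenVertices_iff (hq : 3 ≤ q) (z : ℍ) : z ∈ F.evenVertices ↔
    ∃ i g, F.label i = .even ∧ F.IsPieceAt i g 0 ∧ z = g • iPt 1 one_pos := by
  constructor
  · rintro ⟨i, w, hw, hl, A, hA, rfl⟩
    obtain rfl := eq_iPt hw
    obtain ⟨hm, he⟩ := F.ends_of_isIntervalMatrix hq hA
    exact ⟨i, _, hl, ⟨1, he, by rw [hl]; rfl⟩, rfl⟩
  · rintro ⟨i, g, hl, hp, rfl⟩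
    obtain ⟨A, hA, hAg⟩ := F.isIntervalMatrix_of_ends hq (hp.ends_of_zero hq)
    refine ⟨i, iPt 1 one_pos, rfl, hl, A, hA, ?_⟩
    rw [gam_smul_def, ← hAg]; rfl

theorem S_smul_iPt : S • iPt 1 one_pos = iPt 1 one_pos := by
  have h1 := S_smul_re_zero (iPt_re 1 one_pos)
  have h2 := S_iPt_im 1 one_pos
  rw [mul_one] at h2
  exact UpperHalfPlane.ext (Complex.ext h1 h2)

theorem rotation_of_smul_rho (hq : 3 ≤ q) {g k : Gam q} (e : g • rho hq = k • rho hq) :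
    ∃ l < q, k = g * gR q ^ l := by
  obtain ⟨l, hl, h⟩ := odd_vertex_in_triangle hq (g⁻¹ * k).2 (by
    change (g⁻¹ * k) • rho hq ∈ _
    rw [mul_smul, ← e, inv_smul_smul]
    exact rho_mem_triangle hq)
  refine ⟨l, hl, ?_⟩
  have h' : g⁻¹ * k = gR q ^ l := Subtype.ext h
  rw [← h', mul_inv_cancel_left]

/-- The odd vertex of the tessellation on an odd edge is its end point. -/
theorem eq_smul_rho_of_mem (hq : 3 ≤ q) {g k : Gam q} (h : k • rho hq ∈ g • baseOddEdge q) :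
    k • rho hq = g • rho hq := by
  rw [Set.mem_smul_set_iff_inv_smul_mem, ← mul_smul] at h
  obtain ⟨l, hl, e⟩ := odd_vertex_in_triangle hq (g⁻¹ * k).2 ((mem_baseOddEdge_iff hq _).1 h).1
  have e' : g⁻¹ * k = gR q ^ l := Subtype.ext e
  rw [← inv_smul_eq_iff, ← mul_smul, e', gR_pow_smul, R_pow_smul_rho]

theorem eq_smul_iPt_of_mem (hq : 3 ≤ q) {g k : Gam q} (h : k • iPt 1 one_pos ∈ g • baseEvenEdge) :
    k • iPt 1 one_pos = g • iPt 1 one_pos := by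
  obtain ⟨w, hw, e⟩ := h
  have e : g • w = k • iPt 1 one_pos := e
  rcases line_injective hq hw.1 (iPt_re 1 one_pos) e with rfl | rfl
  · rfl
  · rw [mul_smul, gS_smul, S_smul_iPt]

/-- If a polygon and a symbol have the same triangles and the same side pairings, they correspond to
each other. -/
theorem IsMatch.corresponds (hq : 3 ≤ q) (hM : F.IsMatch 𝒢) {M : SpecialPolygon q}
    (hP : M.P = poly 𝒢) (hI : M.I = F.pairings) : Corresponds M F := by
  refine ⟨?_, ?_, ?_, hI⟩
  · ext c
    rw [← hM.cusps, SpecialPolygon.freeVertices, Set.mem_ofPred_eq, hP, isCuspOf_poly hq]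
  · ext z
    rw [mem_oddVertices_iff hq, SpecialPolygon.oddVertices, Set.mem_ofPred_eq, hP]
    constructor
    · rintro ⟨⟨k, hk, w, hw, rfl⟩, s, hs, hz⟩
      obtain rfl := (isBaseOddVertex_iff hq w).1 hw
      obtain ⟨i, a, r, hr, hp, rfl | rfl⟩ := hM.oddSide_cases hq hs
      · exact ⟨i, a, r, hr, hp, eq_smul_rho_of_mem hq (k := ⟨k, hk⟩) hz⟩
      · refine ⟨i, a, r, hr, hp, ?_⟩
        rw [← smul_rho_R_pow hq a r]
        exact eq_smul_rho_of_mem hq (k := ⟨k, hk⟩) hz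
    · rintro ⟨i, a, r, hr, hp, rfl⟩
      exact ⟨⟨a, a.2, rho hq, (isBaseOddVertex_iff hq _).2 rfl, rfl⟩, _, (hM.isOddSide hq hr hp).1,
        Set.smul_mem_smul_set (rho_mem_oddEdge hq)⟩
  · ext z
    rw [mem_evenVertices_iff hq, SpecialPolygon.evenVertices, Set.mem_ofPred_eq, hP, hI]
    constructor
    · rintro ⟨⟨k, hk, w, hw, rfl⟩, s, hs, hz⟩
      obtain rfl := eq_iPt hw
      obtain ⟨i, a, g, hp, hl, hg, rfl⟩ := hM.evenSide_cases hq hs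
      refine ⟨i, a, hl, hp, (eq_smul_iPt_of_mem hq (k := ⟨k, hk⟩) hz).trans ?_⟩
      rcases hg with rfl | rfl
      · rfl
      · rw [mul_smul, gS_smul, S_smul_iPt]
    · rintro ⟨i, a, hl, hp, rfl⟩
      exact ⟨⟨a, a.2, iPt 1 one_pos, rfl, rfl⟩, _, hM.isEvenSide hq hp hl (Or.inl rfl),
        Set.smul_mem_smul_set ⟨rfl, le_rfl⟩⟩

theorem corresponds_toSpecialPolygon (hq : 3 ≤ q) : Corresponds (F.toSpecialPolygon hq) F :=
  (F.isMatch_region hq).corresponds hq rfl rfl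

end HeckeFareySymbol

/-! ### The side pairings of a special polygon -/

namespace SpecialPolygon

variable {q : ℕ} {M : SpecialPolygon q} {𝒢 : Set (Gam q)}

theorem not_mem_of_pairing (hq : 3 ≤ q) (hP : M.P = poly 𝒢) {γ g : Gam q}
    (hγ : (γ : PSL(2, ℝ)) ∈ M.I) (hg : g ∈ 𝒢) : γ * g ∉ 𝒢 := by
  have h := M.disjoint_interior γ hγ
  rw [hP] at h
  exact (disjoint_interior_poly hq γ).1 h g hg

theorem isSide_line (hq : 3 ≤ q) (hfin : 𝒢.Finite) (hP : M.P = poly 𝒢) {g : Gam q}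
    (hp : IsPiece 𝒢 g 0) (hf : ((g * gS q * g⁻¹ : Gam q) : PSL(2, ℝ)) ∉ M.I) :
    IsFreeSide q M.P M.I (g • baseLine) := by
  rw [hP]
  exact (isFreeSide_iff hq hfin M.mem_heckeGroup _).2 ⟨g, rfl, hp.line_iff (Or.inl rfl), hf⟩

theorem isOddSide (hq : 3 ≤ q) (hfin : 𝒢.Finite) (hP : M.P = poly 𝒢) {a : Gam q} {r : ℕ}
    (hp : IsPiece 𝒢 a r) (hr : 1 ≤ r) : IsOddSide q M.P (a • baseOddEdge q) ∧
      IsOddSide q M.P ((a * gR q ^ r) • baseOddEdge q) := by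
  rw [hP]; exact hp.isOddSide hq hfin hr

/-- The two odd sides of a cluster are paired by its rotation: the cluster that the definition
provides is the one with the given side. -/
theorem rotation_mem (hq : 3 ≤ q) (hfin : 𝒢.Finite) (hP : M.P = poly 𝒢) {g : Gam q} {r : ℕ}
    (hp : IsPiece 𝒢 g r) (hr : 1 ≤ r) : ((g * gR q ^ r * g⁻¹ : Gam q) : PSL(2, ℝ)) ∈ M.I := by
  obtain ⟨t, ht, hts, ⟨γ, hγ, e⟩, g', hg', r', hd, hr', hr'q, hfan, hpair⟩ :=
    M.odd_paired _ (isOddSide hq hfin hP hp hr).1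
  obtain ⟨-, -, hrq, hm⟩ := hp.resolve_left (by omega)
  obtain ⟨⟨m1, m2⟩, -⟩ := hp.oddEdge hq hr
  rw [hP] at hfan ht
  lift g' to Gam q using hg'
  have hmem : ∀ k < r', g' * gR q ^ k ∈ 𝒢 := fun k hk =>
    (smul_triangle_subset_poly hq _).1 ((smul_triangle_subset_fan hk).trans hfan)
  rcases Set.pair_eq_pair_iff.1 hpair with ⟨e1, e2⟩ | ⟨e1, -⟩
  · obtain rfl : g = g' := oddEdge_injective hq e1
    have e2 : t = (g * gR q ^ r') • baseOddEdge q := e2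
    have e3 : (⟨γ, M.mem_heckeGroup γ hγ⟩ * g : Gam q) • baseOddEdge q =
        (g * gR q ^ r') • baseOddEdge q := by
      rw [mul_smul, ← e2]; exact e
    have e4 := oddEdge_injective hq e3
    have hle : r' ≤ r := by
      by_contra hc
      exact absurd ((hm r hrq).1 (hmem r (by omega))) (lt_irrefl r)
    have hge : r ≤ r' := by
      by_contra hc
      obtain ⟨k, hk, hk'⟩ := (isOddSide_iff hq hfin _).1 ht
      obtain rfl : g * gR q ^ r' = k := oddEdge_injective hq (e2.symm.trans hk)
      refine hk' (iff_of_true ((hm r' hr'q).2 (by omega)) ?_)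
      obtain ⟨l, rfl⟩ : ∃ l, r' = l + 1 := ⟨r' - 1, by omega⟩
      rw [pow_succ, ← mul_assoc, mul_inv_cancel_right]
      exact hmem l (by omega)
    obtain rfl : r = r' := by omega
    have e5 : g * gR q ^ r * g⁻¹ = ⟨γ, M.mem_heckeGroup γ hγ⟩ := by
      rw [← e4, mul_inv_cancel_right]
    rw [e5]; exact hγ
  · exfalso
    have e1 : g = g' * gR q ^ r' := oddEdge_injective hq e1
    apply m2
    obtain ⟨l, rfl⟩ : ∃ l, r' = l + 1 := ⟨r' - 1, by omega⟩
    rw [e1, pow_succ, ← mul_assoc, mul_inv_cancel_right]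
    exact hmem l (by omega)

/-- A free side is paired with a different free side. -/
theorem exists_partner (hq : 3 ≤ q) (hfin : 𝒢.Finite) (hP : M.P = poly 𝒢) {g : Gam q}
    (hp : IsPiece 𝒢 g 0) (hf : ((g * gS q * g⁻¹ : Gam q) : PSL(2, ℝ)) ∉ M.I) :
    ∃ h, IsPiece 𝒢 h 0 ∧ h ≠ g ∧ ((h * gS q * h⁻¹ : Gam q) : PSL(2, ℝ)) ∉ M.I ∧
      ((h * gS q * g⁻¹ : Gam q) : PSL(2, ℝ)) ∈ M.I := by
  obtain ⟨t, ht, hts, γ, hγ, e⟩ := M.free_paired _ (isSide_line hq hfin hP hp hf)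
  rw [hP] at ht
  obtain ⟨k, rfl, hk, hkf⟩ := (isFreeSide_iff hq hfin M.mem_heckeGroup _).1 ht
  obtain ⟨h, hh, hkh⟩ := line_cases hk
  rw [conj_S_eq hkh] at hkf
  rw [line_smul_eq hkh] at e hts
  refine ⟨h, hh, fun hgh => hts (by rw [hgh]), hkf, ?_⟩
  lift γ to Gam q using M.mem_heckeGroup γ hγ
  have e' : (γ * g) • baseLine = h • baseLine := by rw [mul_smul]; exact e
  rcases eq_or_eq_of_line hq e' with h1 | h1
  · refine absurd ?_ (not_mem_of_pairing hq hP hγ hp.line.2)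
    rw [← mul_assoc, ← h1]
    exact hh.line.2
  · have : h * gS q * g⁻¹ = γ := by rw [h1, mul_gS_mul_gS, mul_inv_cancel_right]
    rwa [this]

theorem line_ne_of_piece (hq : 3 ≤ q) {g h : Gam q} (hg : IsPiece 𝒢 g 0) (hh : IsPiece 𝒢 h 0)
    (hne : h ≠ g) : h • baseLine ≠ g • baseLine := by
  intro e
  rcases eq_or_eq_of_line hq e with h1 | h1
  · exact hne h1.symm
  · exact hg.line.1 (by rw [h1]; exact hh.line.2)

/-- The partner of a free side is unique. -/
theorem partner_unique (hq : 3 ≤ q) (hfin : 𝒢.Finite) (hP : M.P = poly 𝒢) {g h h' : Gam q}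
    (hp : IsPiece 𝒢 g 0) (hf : ((g * gS q * g⁻¹ : Gam q) : PSL(2, ℝ)) ∉ M.I)
    (hh : IsPiece 𝒢 h 0 ∧ h ≠ g ∧ ((h * gS q * h⁻¹ : Gam q) : PSL(2, ℝ)) ∉ M.I ∧
      ((h * gS q * g⁻¹ : Gam q) : PSL(2, ℝ)) ∈ M.I)
    (hh' : IsPiece 𝒢 h' 0 ∧ h' ≠ g ∧ ((h' * gS q * h'⁻¹ : Gam q) : PSL(2, ℝ)) ∉ M.I ∧
      ((h' * gS q * g⁻¹ : Gam q) : PSL(2, ℝ)) ∈ M.I) : h = h' := by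
  have key : ∀ k : Gam q, IsPiece 𝒢 k 0 ∧ k ≠ g ∧ ((k * gS q * k⁻¹ : Gam q) : PSL(2, ℝ)) ∉ M.I ∧
      ((k * gS q * g⁻¹ : Gam q) : PSL(2, ℝ)) ∈ M.I →
      ((k * gS q * g⁻¹ : Gam q) : PSL(2, ℝ)) ∈ M.I ∧
      IsSide q M.P M.I ((k * gS q * g⁻¹ : Gam q) • g • baseLine) ∧
      (k * gS q * g⁻¹ : Gam q) • g • baseLine ≠ g • baseLine := by
    rintro k ⟨h1, h2, h3, h4⟩
    rw [← mul_smul, inv_mul_cancel_right, line_smul_eq (Or.inr rfl)]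
    exact ⟨h4, Or.inr (Or.inr (isSide_line hq hfin hP h1 h3)), line_ne_of_piece hq hp h1 h2⟩
  have := (M.paired _ (Or.inr (Or.inr (isSide_line hq hfin hP hp hf)))).unique (key h hh) (key h' hh')
  exact mul_right_cancel (mul_right_cancel (Subtype.ext this))

/-- Every side pairing is a rotation of a cluster, the half turn of a folded line or a pairing of two
free sides. -/
theorem pairing_cases (hq : 3 ≤ q) (h𝒢 : IsTriangulated 𝒢) (hfin : 𝒢.Finite) (hP : M.P = poly 𝒢)
    {γ : Gam q} (hγ : (γ : PSL(2, ℝ)) ∈ M.I) :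
    (∃ g r, 1 ≤ r ∧ IsPiece 𝒢 g r ∧ (γ = g * gR q ^ r * g⁻¹ ∨ γ⁻¹ = g * gR q ^ r * g⁻¹)) ∨
    (∃ g, IsPiece 𝒢 g 0 ∧ γ = g * gS q * g⁻¹) ∨
    (∃ g h, IsPiece 𝒢 g 0 ∧ ((g * gS q * g⁻¹ : Gam q) : PSL(2, ℝ)) ∉ M.I ∧ IsPiece 𝒢 h 0 ∧ h ≠ g ∧
      ((h * gS q * h⁻¹ : Gam q) : PSL(2, ℝ)) ∉ M.I ∧ γ = h * gS q * g⁻¹) := by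
  obtain ⟨s, hs, hγs, hne⟩ := M.pairs γ hγ
  have huniq : ∀ δ : Gam q, (δ : PSL(2, ℝ)) ∈ M.I → IsSide q M.P M.I (δ • s) → δ • s ≠ s → γ = δ :=
    fun δ h1 h2 h3 => Subtype.ext ((M.paired s hs).unique ⟨hγ, hγs, hne⟩ ⟨h1, h2, h3⟩)
  rcases hs with hs | hs | hs
  · left
    rw [hP] at hs
    obtain ⟨k, rfl, hk⟩ := (isOddSide_iff hq hfin _).1 hs
    obtain ⟨a, r, hr, hp, hka⟩ := h𝒢.oddEdge_cases hq hk
    obtain ⟨-, -, hrq, -⟩ := hp.resolve_left (by omega)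
    have hm := rotation_mem hq hfin hP hp hr
    obtain ⟨h1, h2⟩ := isOddSide hq hfin hP hp hr
    refine ⟨a, r, hr, hp, ?_⟩
    rcases hka with rfl | rfl
    · left
      refine huniq _ hm ?_ ?_ <;> rw [← mul_smul, inv_mul_cancel_right]
      · exact Or.inl h2
      · exact oddEdge_ne hq hr hrq
    · right
      rw [huniq (a * gR q ^ r * a⁻¹)⁻¹ (M.inv_mem _ hm) ?_ ?_, inv_inv]
      all_goals
        rw [← mul_smul, show (a * gR q ^ r * a⁻¹)⁻¹ * (a * gR q ^ r) = a by group]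
      · exact Or.inl h1
      · exact (oddEdge_ne hq hr hrq).symm
  · right; left
    rw [hP] at hs
    obtain ⟨k, rfl, hk, hkf⟩ := (isEvenSide_iff hq hfin M.mem_heckeGroup _).1 hs
    obtain ⟨a, hp, hka⟩ := line_cases hk
    refine ⟨a, hp, ?_⟩
    rw [← conj_S_eq hka]
    refine huniq _ hkf ?_ ?_ <;> rw [← mul_smul, inv_mul_cancel_right]
    · right; left
      rw [hP]
      refine (isEvenSide_iff hq hfin M.mem_heckeGroup _).2 ⟨_, rfl, ?_, ?_⟩
      · rw [mul_gS_mul_gS]; exact fun h => hk h.symm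
      · rwa [conj_S_eq (Or.inr rfl)]
    · exact HeckeFareySymbol.evenEdge_ne hq k
  · right; right
    rw [hP] at hs
    obtain ⟨k, rfl, hk, hkf⟩ := (isFreeSide_iff hq hfin M.mem_heckeGroup _).1 hs
    obtain ⟨g, hp, hka⟩ := line_cases hk
    rw [conj_S_eq hka] at hkf
    obtain ⟨h, h1, h2, h3, h4⟩ := exists_partner hq hfin hP hp hkf
    refine ⟨g, h, hp, hkf, h1, h2, h3, huniq _ h4 ?_ ?_⟩ <;>
      rw [line_smul_eq hka, ← mul_smul, inv_mul_cancel_right, line_smul_eq (Or.inr rfl)]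
    · exact Or.inr (Or.inr (isSide_line hq hfin hP h1 h3))
    · exact line_ne_of_piece hq hp h1 h2

end SpecialPolygon

/-! ### The sequence of cusps of a triangulated set -/

section
variable {q : ℕ}

theorem IsPiece.exists_rankOf (hq : 3 ≤ q) {𝒢 : Set (Gam q)} {g : Gam q} {r : ℕ}
    (hp : IsPiece 𝒢 g r) : ∃ m, RankOf m r ∧ m ∣ q ∧ 1 ≤ m ∧ m < q := by
  rcases hp with ⟨rfl, -⟩ | ⟨h1, h2, h3, -⟩
  · exact ⟨1, Or.inl ⟨rfl, rfl⟩, one_dvd q, le_rfl, by omega⟩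
  · exact ⟨r, Or.inr ⟨h2, rfl⟩, h1, h2, h3⟩

theorem IsTriangulated.not_inArc (hq : 3 ≤ q) {𝒢 : Set (Gam q)} (h𝒢 : IsTriangulated 𝒢) {g : Gam q}
    {r : ℕ} (hp : IsPiece 𝒢 g r) {c : OnePoint ℝ} (hc : c ∈ cuspSet 𝒢) : ¬ InArc g r c := by
  intro harc
  obtain ⟨h, hh, hhc⟩ := hc
  have hrq : r < q := by rcases hp with h | h <;> omega
  exact h𝒢.disjoint_beyond hq hp (mem_beyond_of_inArc hq hrq harc hhc) hh

/-- A boundary piece whose arc contains `y` joins the two consecutive cusps `a / b` and `a' / b'`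
between which `y` lies. -/
theorem IsTriangulated.isEnds (hq : 3 ≤ q) {𝒢 : Set (Gam q)} (h𝒢 : IsTriangulated 𝒢)
    (hinf : OnePoint.infty ∈ cuspSet 𝒢) {g : Gam q} {m r : ℕ} (hp : IsPiece 𝒢 g r)
    (hr : RankOf m r) {a b a' b' y : ℝ} (hb : 0 ≤ b) (hb' : 0 ≤ b') (h1 : 0 < b * y - a)
    (h2 : b' * y - a' < 0) (hc : toPoint a b ∈ cuspSet 𝒢) (hc' : toPoint a' b' ∈ cuspSet 𝒢)
    (hgap : ∀ x : ℝ, (x : OnePoint ℝ) ∈ cuspSet 𝒢 → b * x - a ≤ 0 ∨ 0 ≤ b' * x - a')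
    (hy : InArc g r (y : OnePoint ℝ)) : IsEnds g m (toPoint a b) (toPoint a' b') := by
  obtain ⟨m', hr', hd, h1m, hmq⟩ := hp.exists_rankOf hq
  obtain rfl : m = m' := by rcases hr with h | h <;> rcases hr' with h' | h' <;> omega
  obtain ⟨B, hB⟩ := exists_isFrame g m
  obtain ⟨e1, e2⟩ := hB.ends hq h1m hmq
  obtain ⟨c1, c2⟩ := hp.ends_mem_cuspSet hr
  have harc := fun c => hB.inArc_iff hr c
  have hdet : B 0 0 * B 1 1 - B 0 1 * B 1 0 = 1 := by
    have := B.det_coe; rwa [Matrix.det_fin_two] at this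
  rw [harc, posPt_frame_inv] at hy
  have hn := h𝒢.not_inArc hq hp hinf
  rw [harc, posPt_frame_inv_infty, not_lt] at hn
  have hno : ∀ x : ℝ, (x : OnePoint ℝ) ∈ cuspSet 𝒢 → (B 1 1 * x - B 0 1) * (B 0 0 - B 1 0 * x) ≤ 0 := by
    intro x hx
    have := h𝒢.not_inArc hq hp hx
    rwa [harc, posPt_frame_inv, not_lt] at this
  rw [e1] at c2
  rw [e2] at c1
  suffices H : toPoint (B 0 1) (B 1 1) = toPoint a b ∧ toPoint (B 0 0) (B 1 0) = toPoint a' b' from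
    ⟨hd, h1m, hmq, e1.trans H.1, e2.trans H.2⟩
  -- normalize the sign of the frame
  obtain ⟨ε, hε, k1⟩ : ∃ ε : ℝ, ε * ε = 1 ∧ 0 < ε * (B 1 1 * y - B 0 1) := by
    rcases lt_or_ge 0 (B 1 1 * y - B 0 1) with h | h
    · exact ⟨1, by ring, by linarith⟩
    · have : B 1 1 * y - B 0 1 ≠ 0 := by
        intro h0; rw [h0, zero_mul] at hy; exact lt_irrefl _ hy
      exact ⟨-1, by ring, by have := lt_of_le_of_ne h this; linarith⟩
  have hε0 : ε ≠ 0 := by rintro rfl; simp at hε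
  have hscale : ∀ u v : ℝ, toPoint (ε * u) (ε * v) = toPoint u v := by
    intro u v
    simp only [toPoint, mul_eq_zero, hε0, false_or]
    split_ifs
    · rfl
    · rw [mul_div_mul_left _ _ hε0]
  rw [← hscale (B 0 1), ← hscale (B 0 0)]
  rw [← hscale] at c1 c2
  have k2 : 0 < ε * (B 0 0 - B 1 0 * y) := by
    have h3 : 0 < (ε * (B 1 1 * y - B 0 1)) * (ε * (B 0 0 - B 1 0 * y)) := by
      have : (ε * (B 1 1 * y - B 0 1)) * (ε * (B 0 0 - B 1 0 * y)) =
        (ε * ε) * ((B 1 1 * y - B 0 1) * (B 0 0 - B 1 0 * y)) := by ring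
      rw [this, hε, one_mul]; exact hy
    exact (pos_iff_pos_of_mul_pos h3).1 k1
  have hno' : ∀ x : ℝ, (x : OnePoint ℝ) ∈ cuspSet 𝒢 →
      (ε * B 1 1 * x - ε * B 0 1) * (ε * B 0 0 - ε * B 1 0 * x) ≤ 0 := by
    intro x hx
    have : (ε * B 1 1 * x - ε * B 0 1) * (ε * B 0 0 - ε * B 1 0 * x) =
      (ε * ε) * ((B 1 1 * x - B 0 1) * (B 0 0 - B 1 0 * x)) := by ring
    rw [this, hε, one_mul]; exact hno x hx
  have hn' : 0 ≤ ε * B 1 0 * (ε * B 1 1) := by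
    have : ε * B 1 0 * (ε * B 1 1) = (ε * ε) * (B 1 0 * B 1 1) := by ring
    rw [this, hε, one_mul]; exact hn
  have hdet' : ε * B 1 0 * (ε * B 1 1 * y - ε * B 0 1) + ε * B 1 1 * (ε * B 0 0 - ε * B 1 0 * y) = 1 := by
    have : ε * B 1 0 * (ε * B 1 1 * y - ε * B 0 1) + ε * B 1 1 * (ε * B 0 0 - ε * B 1 0 * y) =
      (ε * ε) * (B 0 0 * B 1 1 - B 0 1 * B 1 0) := by ring
    rw [this, hε, hdet, one_mul]
  have k1 : 0 < ε * B 1 1 * y - ε * B 0 1 := by linarith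
  have k2 : 0 < ε * B 0 0 - ε * B 1 0 * y := by linarith
  clear hno hn hdet harc hy e1 e2 hscale hB
  generalize ε * B 1 1 = δ at *
  generalize ε * B 0 1 = β at *
  generalize ε * B 0 0 = α at *
  generalize ε * B 1 0 = γ at *
  have hsign : 0 ≤ γ ∧ 0 ≤ δ := by
    rcases lt_or_ge γ 0 with h | h
    · have h5 : δ ≤ 0 := by by_contra h5; push Not at h5; nlinarith
      nlinarith
    · refine ⟨h, ?_⟩
      by_contra h5; push Not at h5
      have h6 : γ = 0 := le_antisymm (by nlinarith) h
      subst h6; nlinarith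
  obtain ⟨hγ, hδ⟩ := hsign
  have hpt : ∀ u v : ℝ, 0 < v → toPoint u v = ((u / v : ℝ) : OnePoint ℝ) := fun u v hv => by
    rw [toPoint, if_neg hv.ne']
  constructor
  · rcases hδ.eq_or_lt with rfl | hδ
    · rcases hb.eq_or_lt with rfl | hb
      · simp [toPoint]
      · exfalso
        rw [hpt a b hb] at hc
        have h3 := hno' _ hc
        have h4 : a / b < y := by rw [div_lt_iff₀ hb]; linarith
        have h5 : γ * (a / b) ≤ γ * y := mul_le_mul_of_nonneg_left h4.le hγ
        nlinarith
    · rw [hpt β δ hδ] at c2 ⊢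
      have h3 : β / δ < y := by rw [div_lt_iff₀ hδ]; linarith
      have h4 : b * (β / δ) - a ≤ 0 := by
        rcases hgap _ c2 with h | h
        · exact h
        · have := mul_le_mul_of_nonneg_left h3.le hb'; linarith
      rcases hb.eq_or_lt with rfl | hb
      · linarith
      · rw [hpt a b hb] at hc ⊢
        have h5 : a / b < y := by rw [div_lt_iff₀ hb]; linarith
        have h6 := hno' _ hc
        have h7 : γ * (a / b) ≤ γ * y := mul_le_mul_of_nonneg_left h5.le hγ
        have h8 : δ * (a / b) - β ≤ 0 := by by_contra h8; push Not at h8; nlinarith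
        congr 1
        apply le_antisymm
        · rw [le_div_iff₀ hb]; linarith
        · rw [le_div_iff₀ hδ]; linarith
  · rcases hγ.eq_or_lt with rfl | hγ
    · rcases hb'.eq_or_lt with rfl | hb'
      · simp [toPoint]
      · exfalso
        rw [hpt a' b' hb'] at hc'
        have h3 := hno' _ hc'
        have h4 : y < a' / b' := by rw [lt_div_iff₀ hb']; linarith
        have h5 : δ * y ≤ δ * (a' / b') := mul_le_mul_of_nonneg_left h4.le hδ
        nlinarith
    · rw [hpt α γ hγ] at c1 ⊢
      have h3 : y < α / γ := by rw [lt_div_iff₀ hγ]; linarith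
      have h4 : 0 ≤ b' * (α / γ) - a' := by
        rcases hgap _ c1 with h | h
        · have := mul_le_mul_of_nonneg_left h3.le hb; linarith
        · exact h
      rcases hb'.eq_or_lt with rfl | hb'
      · linarith
      · rw [hpt a' b' hb'] at hc' ⊢
        have h5 : y < a' / b' := by rw [lt_div_iff₀ hb']; linarith
        have h6 := hno' _ hc'
        have h7 : δ * y ≤ δ * (a' / b') := mul_le_mul_of_nonneg_left h5.le hδ
        have h8 : α - γ * (a' / b') ≤ 0 := by by_contra h8; push Not at h8; nlinarith
        congr 1
        apply le_antisymm
        · rw [div_le_iff₀ hγ]; linarith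
        · rw [div_le_iff₀ hb']; linarith

theorem exists_isReduced {𝒢 : Set (Gam q)} {x : ℝ} (hx : (x : OnePoint ℝ) ∈ cuspSet 𝒢) :
    ∃ a b : ℝ, IsReduced q a b ∧ 0 < b ∧ a / b = x := by
  obtain ⟨h, hh⟩ : ∃ h : Gam q, (x : OnePoint ℝ) = h • OnePoint.infty := by
    obtain ⟨h, -, hh | hh⟩ := hx
    · exact ⟨h * gS q, by rw [hh, mul_smul, gS_smul_infty]⟩
    · exact ⟨h, hh⟩
  obtain ⟨A, hA⟩ := QuotientGroup.mk_surjective (h : PSL(2, ℝ))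
  have hA : (A : PSL(2, ℝ)) = h := hA
  rw [gam_smul_cusp, ← hA, smul_infty_eq] at hh
  have hA' : (A : PSL(2, ℝ)) ∈ heckeGroup q := hA ▸ h.2
  have h0 : A 1 0 ≠ 0 := by
    intro h0; rw [toPoint, if_pos h0] at hh; exact OnePoint.coe_ne_infty _ hh
  rw [toPoint, if_neg h0] at hh
  have hh : x = A 0 0 / A 1 0 := OnePoint.coe_injective hh
  rcases lt_or_gt_of_ne h0 with h | h
  · have hn : ((-A : SL(2, ℝ)) : PSL(2, ℝ)) ∈ heckeGroup q := by
      rwa [(psl_eq_iff (-A) A).2 (Or.inr rfl)]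
    refine ⟨-A 0 0, -A 1 0, ⟨by linarith, -A, hn, by simp, by simp⟩, by linarith, ?_⟩
    rw [neg_div_neg_eq, hh]
  · exact ⟨A 0 0, A 1 0, ⟨h.le, A, hA', rfl, rfl⟩, h, hh.symm⟩

theorem cuspSet_finite {𝒢 : Set (Gam q)} (hfin : 𝒢.Finite) : (cuspSet 𝒢).Finite := by
  have : cuspSet 𝒢 = (fun g : Gam q => g • ((0 : ℝ) : OnePoint ℝ)) '' 𝒢 ∪
      (fun g : Gam q => g • (OnePoint.infty : OnePoint ℝ)) '' 𝒢 := by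
    ext c
    simp only [cuspSet, Set.mem_ofPred_eq, Set.mem_union, Set.mem_image]
    constructor
    · rintro ⟨g, hg, h | h⟩
      · exact Or.inl ⟨g, hg, h.symm⟩
      · exact Or.inr ⟨g, hg, h.symm⟩
    · rintro (⟨g, hg, h⟩ | ⟨g, hg, h⟩)
      · exact ⟨g, hg, Or.inl h.symm⟩
      · exact ⟨g, hg, Or.inr h.symm⟩
  rw [this]
  exact (hfin.image _).union (hfin.image _)

/-- Reduced columns at the end points of an arc with `m = 1` have determinant `1`. -/
theorem IsEnds.det_eq_one (hq : 3 ≤ q) {g : Gam q} {a b a' b' : ℝ} (h : IsReduced q a b)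
    (h' : IsReduced q a' b') (he : IsEnds g 1 (toPoint a b) (toPoint a' b'))
    (hpos : 0 < a' * b - a * b') : a' * b - a * b' = 1 := by
  obtain ⟨-, A, hA, rfl, rfl⟩ := h
  obtain ⟨-, A', hA', rfl, rfl⟩ := h'
  obtain ⟨-, -, -, e1, e2⟩ := he
  obtain ⟨B, hB⟩ := QuotientGroup.mk_surjective (g : PSL(2, ℝ))
  have hB : (B : PSL(2, ℝ)) = g := hB
  have hBm : (B : PSL(2, ℝ)) ∈ heckeGroup q := hB ▸ g.2
  have hBS : ((B * matS : SL(2, ℝ)) : PSL(2, ℝ)) ∈ heckeGroup q := by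
    rw [coe_mul_psl]; exact (heckeGroup q).mul_mem hBm S_mem
  rw [gam_smul_cusp, ← hB, smul_infty_eq] at e2
  have e1' : toPoint ((B * matS) 0 0) ((B * matS) 1 0) = toPoint (A 0 0) (A 1 0) := by
    rw [← e1, mul_smul, gR_pow_smul_infty hq le_rfl (by omega), vtx_one, ← gS_smul_infty (q := q),
      ← mul_smul, gam_smul_cusp, ← smul_infty_eq]
    change _ = ((g : PSL(2, ℝ)) * S) • _
    rw [← hB]; rfl
  obtain ⟨ε, hε, k1, k2⟩ := column_eq_of_toPoint hq hA' hBm e2.symm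
  obtain ⟨η, hη, k3, k4⟩ := column_eq_of_toPoint hq hA hBS e1'.symm
  have hdet : B 0 0 * B 1 1 - B 0 1 * B 1 0 = 1 := by
    have := B.det_coe; rwa [Matrix.det_fin_two] at this
  have s1 : (B * matS) 0 0 = -B 0 1 := by
    rw [Matrix.SpecialLinearGroup.coe_mul, matS_coe, Matrix.mul_apply, Fin.sum_univ_two]; simp
  have s2 : (B * matS) 1 0 = -B 1 1 := by
    rw [Matrix.SpecialLinearGroup.coe_mul, matS_coe, Matrix.mul_apply, Fin.sum_univ_two]; simp
  rw [s1] at k3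
  rw [s2] at k4
  have key : A' 0 0 * A 1 0 - A 0 0 * A' 1 0 = -(ε * η) := by
    rw [k1, k2, k3, k4]; linear_combination (-(ε * η)) * hdet
  rw [key] at hpos ⊢
  rcases hε with rfl | rfl <;> rcases hη with rfl | rfl <;> linarith

end

section
variable {q : ℕ}

theorem isReduced_of_den_zero {a : ℝ} (ha : a = 1 ∨ a = -1) : IsReduced q a 0 := by
  refine ⟨le_rfl, ?_⟩
  rcases ha with rfl | rfl
  · exact ⟨1, (heckeGroup q).one_mem, by simp, by simp⟩
  · refine ⟨-1, ?_, by simp, by simp⟩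
    rw [neg_one_psl]; exact (heckeGroup q).one_mem

/-- A finite nonempty set of reals, in increasing order and with `-∞` and `∞` added at the ends; each
element `x` is written as `a x / b x`. -/
theorem exists_increasing (C : Finset ℝ) (hC : C.Nonempty) (a b : ℝ → ℝ)
    (hab : ∀ x ∈ C, a x / b x = x) : ∃ (n : ℕ) (num den : Fin (n + 3) → ℝ),
      (num 0 = -1 ∧ den 0 = 0) ∧ (num (Fin.last (n + 2)) = 1 ∧ den (Fin.last (n + 2)) = 0) ∧
      (∀ j, 0 < j → j < Fin.last (n + 2) → ∃ x ∈ C, num j = a x ∧ den j = b x) ∧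
      (∀ i j, 0 < i → i < j → j < Fin.last (n + 2) → num i / den i < num j / den j) ∧
      ∀ x ∈ C, ∃ j, 0 < j ∧ j < Fin.last (n + 2) ∧ num j = a x ∧ den j = b x := by
  obtain ⟨n, hn⟩ : ∃ n, C.card = n + 1 := ⟨C.card - 1, by have := hC.card_pos; omega⟩
  let e := C.orderEmbOfFin hn
  have he : ∀ k, e k ∈ C := fun k => C.orderEmbOfFin_mem hn k
  let f (c : ℝ → ℝ) (u v : ℝ) (j : Fin (n + 3)) : ℝ :=
    if h : 0 < j.val ∧ j.val < n + 2 then c (e ⟨j.val - 1, by omega⟩)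
    else if j.val = 0 then u else v
  have hmid : ∀ c u v (j : Fin (n + 3)) (h : 0 < j ∧ j < Fin.last (n + 2)),
      f c u v j = c (e ⟨j.val - 1, by
        have h1 : 0 < j.val := h.1
        have h2 : j.val < n + 2 := h.2
        omega⟩) := by
    intro c u v j h
    exact dif_pos ⟨h.1, h.2⟩
  refine ⟨n, f a (-1) 1, f b 0 0, ⟨by simp [f], by simp [f]⟩, ⟨by simp [f], by simp [f]⟩, ?_, ?_, ?_⟩
  · intro j h0 hl
    exact ⟨_, he _, hmid _ _ _ j ⟨h0, hl⟩, hmid _ _ _ j ⟨h0, hl⟩⟩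
  · intro i j h0 hij hl
    rw [hmid _ _ _ i ⟨h0, hij.trans hl⟩, hmid _ _ _ i ⟨h0, hij.trans hl⟩,
      hmid _ _ _ j ⟨h0.trans hij, hl⟩, hmid _ _ _ j ⟨h0.trans hij, hl⟩, hab _ (he _), hab _ (he _)]
    refine e.strictMono ?_
    have h1 : 0 < i.val := h0
    have h2 : i.val < j.val := hij
    exact Fin.mk_lt_mk.2 (by omega)
  · intro x hx
    have hr : x ∈ Set.range e := by rw [C.range_orderEmbOfFin hn]; exact hx
    obtain ⟨k, rfl⟩ := hr
    have h0 : 0 < (⟨k.val + 1, by omega⟩ : Fin (n + 3)) := Fin.lt_def.2 (by simp)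
    have hl : (⟨k.val + 1, by omega⟩ : Fin (n + 3)) < Fin.last (n + 2) := Fin.mk_lt_mk.2 (by omega)
    exact ⟨_, h0, hl, hmid _ _ _ _ ⟨h0, hl⟩, hmid _ _ _ _ ⟨h0, hl⟩⟩

/-- A real number between two consecutive terms of an increasing sequence with `-∞` and `∞` at its
ends; no term lies strictly between these two. -/
theorem exists_between_consecutive {n : ℕ} {num den : Fin (n + 3) → ℝ}
    (h0 : num 0 = -1 ∧ den 0 = 0) (hl : num (Fin.last (n + 2)) = 1 ∧ den (Fin.last (n + 2)) = 0)
    (hpos : ∀ j, 0 < j → j < Fin.last (n + 2) → 0 < den j)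
    (hinc : ∀ i j, 0 < i → i < j → j < Fin.last (n + 2) → num i / den i < num j / den j)
    (i : Fin (n + 2)) : (∃ y : ℝ, 0 < den i.castSucc * y - num i.castSucc ∧
      den i.succ * y - num i.succ < 0) ∧ ∀ j, 0 < j → j < Fin.last (n + 2) →
        den i.castSucc * (num j / den j) - num i.castSucc ≤ 0 ∨
          0 ≤ den i.succ * (num j / den j) - num i.succ := by
  have hs : 0 < i.succ := Fin.succ_pos i
  have hc : i.castSucc < Fin.last (n + 2) := Fin.castSucc_lt_last i
  constructor
  · rcases (Fin.zero_le i.castSucc).eq_or_lt with h1 | h1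
    · rw [← h1, h0.1, h0.2]
      rcases (Fin.le_last i.succ).eq_or_lt with h2 | h2
      · rw [h2, hl.1, hl.2]; exact ⟨0, by norm_num, by norm_num⟩
      · refine ⟨num i.succ / den i.succ - 1, by norm_num, ?_⟩
        have := hpos _ hs h2
        rw [mul_sub, mul_div_cancel₀ _ this.ne']; linarith
    · have hd := hpos _ h1 hc
      rcases (Fin.le_last i.succ).eq_or_lt with h2 | h2
      · rw [h2, hl.1, hl.2]
        refine ⟨num i.castSucc / den i.castSucc + 1, ?_, by norm_num⟩
        rw [mul_add, mul_div_cancel₀ _ hd.ne']; linarith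
      · have hd' := hpos _ hs h2
        obtain ⟨y, hy1, hy2⟩ := exists_between (hinc _ _ h1 Fin.castSucc_lt_succ h2)
        rw [div_lt_iff₀ hd] at hy1
        rw [lt_div_iff₀ hd'] at hy2
        exact ⟨y, by linarith, by linarith⟩
  · intro j hj0 hjl
    have hdj := hpos j hj0 hjl
    rcases le_or_gt j i.castSucc with h | h
    · left
      have hd := hpos _ (hj0.trans_le h) hc
      have : num j / den j ≤ num i.castSucc / den i.castSucc := by
        rcases h.eq_or_lt with rfl | h
        · exact le_rfl
        · exact (hinc _ _ hj0 h hc).le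
      rw [le_div_iff₀ hd] at this
      linarith
    · right
      have h : i.succ ≤ j := Fin.castSucc_lt_iff_succ_le.1 h
      have hd := hpos _ hs (h.trans_lt hjl)
      have : num i.succ / den i.succ ≤ num j / den j := by
        rcases h.eq_or_lt with h | h
        · rw [h]
        · exact (hinc _ _ hs h hjl).le
      rw [div_le_iff₀ hd] at this
      linarith

/-- The cusps of a triangulated set form a Hecke-Farey sequence. -/
theorem IsTriangulated.exists_sequence (hq : 3 ≤ q) {𝒢 : Set (Gam q)} (h𝒢 : IsTriangulated 𝒢)
    (hfin : 𝒢.Finite) (hzero : ((0 : ℝ) : OnePoint ℝ) ∈ cuspSet 𝒢)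
    (hinf : OnePoint.infty ∈ cuspSet 𝒢) :
    ∃ X : HeckeFareySequence q, Set.range X.point = cuspSet 𝒢 := by
  have hbase := h𝒢.base hq hzero hinf
  have hCfin : {x : ℝ | (x : OnePoint ℝ) ∈ cuspSet 𝒢}.Finite :=
    (cuspSet_finite hfin).preimage OnePoint.coe_injective.injOn
  have hred : ∀ x : ℝ, ∃ p : ℝ × ℝ, (x : OnePoint ℝ) ∈ cuspSet 𝒢 →
      IsReduced q p.1 p.2 ∧ 0 < p.2 ∧ p.1 / p.2 = x := by
    intro x
    by_cases hx : (x : OnePoint ℝ) ∈ cuspSet 𝒢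
    · obtain ⟨a, b, h⟩ := exists_isReduced hx
      exact ⟨(a, b), fun _ => h⟩
    · exact ⟨(0, 0), fun h => absurd h hx⟩
  choose p hp using hred
  have hmemC : ∀ x : ℝ, x ∈ hCfin.toFinset ↔ (x : OnePoint ℝ) ∈ cuspSet 𝒢 := fun x => by
    rw [Set.Finite.mem_toFinset, Set.mem_ofPred_eq]
  obtain ⟨n, num, den, hfirst, hlast, hmid, hinc, hall⟩ := exists_increasing hCfin.toFinset
    ⟨0, (hmemC 0).2 hzero⟩ (fun x => (p x).1) (fun x => (p x).2)
    (fun x hx => (hp x ((hmemC x).1 hx)).2.2)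
  have hmid' : ∀ j, 0 < j → j < Fin.last (n + 2) → IsReduced q (num j) (den j) ∧ 0 < den j ∧
      ((num j / den j : ℝ) : OnePoint ℝ) ∈ cuspSet 𝒢 := by
    intro j h0 hl
    obtain ⟨x, hx, e1, e2⟩ := hmid j h0 hl
    rw [hmemC] at hx
    obtain ⟨k1, k2, k3⟩ := hp x hx
    rw [e1, e2, k3]
    exact ⟨k1, k2, hx⟩
  have hall' : ∀ x : ℝ, (x : OnePoint ℝ) ∈ cuspSet 𝒢 →
      ∃ j, 0 < j ∧ j < Fin.last (n + 2) ∧ num j / den j = x := by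
    intro x hx
    obtain ⟨j, h1, h2, h3, h4⟩ := hall x ((hmemC x).2 hx)
    exact ⟨j, h1, h2, by rw [h3, h4]; exact (hp x hx).2.2⟩
  have hcases : ∀ j : Fin (n + 3), j = 0 ∨ j = Fin.last (n + 2) ∨ (0 < j ∧ j < Fin.last (n + 2)) := by
    intro j
    rcases (Fin.zero_le j).eq_or_lt with h | h
    · exact Or.inl h.symm
    · rcases (Fin.le_last j).eq_or_lt with h' | h'
      · exact Or.inr (Or.inl h')
      · exact Or.inr (Or.inr ⟨h, h'⟩)
  have hreduced : ∀ j, IsReduced q (num j) (den j) := by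
    intro j
    rcases hcases j with rfl | rfl | ⟨h, h'⟩
    · rw [hfirst.2]; exact isReduced_of_den_zero (Or.inr hfirst.1)
    · rw [hlast.2]; exact isReduced_of_den_zero (Or.inl hlast.1)
    · exact (hmid' j h h').1
  have hpt : ∀ j, toPoint (num j) (den j) ∈ cuspSet 𝒢 := by
    intro j
    rcases hcases j with rfl | rfl | ⟨h, h'⟩
    · rw [hfirst.2, toPoint, if_pos rfl]; exact hinf
    · rw [hlast.2, toPoint, if_pos rfl]; exact hinf
    · rw [toPoint, if_neg (hmid' j h h').2.1.ne']; exact (hmid' j h h').2.2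
  have hpos : ∀ j, 0 < j → j < Fin.last (n + 2) → 0 < den j := fun j h h' => (hmid' j h h').2.1
  let X : HeckeFareySequence q :=
    { n := n
      num := num
      den := den
      num_first := hfirst.1
      den_first := hfirst.2
      num_last := hlast.1
      den_last := hlast.2
      den_pos := hpos
      reduced := hreduced
      mem_field := by
        intro j
        obtain ⟨-, A, hA, e1, e2⟩ := hreduced j
        rw [← e1, ← e2]
        exact div_mem (entries_mem_field A hA 0 0) (entries_mem_field A hA 1 0)
      increasing := hinc
      zero_mem := hall' 0 hzero
      cluster := by
        intro i hne
        obtain ⟨⟨y, hy1, hy2⟩, hgap⟩ := exists_between_consecutive hfirst hlast hpos hinc i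
        have hgap' : ∀ x : ℝ, (x : OnePoint ℝ) ∈ cuspSet 𝒢 →
            den i.castSucc * x - num i.castSucc ≤ 0 ∨ 0 ≤ den i.succ * x - num i.succ := by
          intro x hx
          obtain ⟨j, h1, h2, rfl⟩ := hall' x hx
          exact hgap j h1 h2
        have hy : (y : OnePoint ℝ) ∉ cuspSet 𝒢 := by
          intro hy
          rcases hgap' y hy with h | h <;> linarith
        obtain ⟨g, r, hpc, harc⟩ := h𝒢.exists_inArc hq hfin hbase hy
        obtain ⟨m, hr, -⟩ := hpc.exists_rankOf hq
        have he := h𝒢.isEnds hq hinf hpc hr (hreduced _).1 (hreduced _).1 hy1 hy2 (hpt _) (hpt _)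
          hgap' harc
        have hdet : 0 < num i.succ * den i.castSucc - num i.castSucc * den i.succ := by
          have b1 := (hreduced i.castSucc).1
          have b2 := (hreduced i.succ).1
          rcases b1.eq_or_lt with b1 | b1
          · rcases b2.eq_or_lt with b2 | b2
            · exfalso
              have k1 : i.castSucc = 0 := by
                by_contra h
                exact (hpos _ (Fin.pos_iff_ne_zero.2 h) (Fin.castSucc_lt_last i)).ne b1
              have k2 : i.succ = Fin.last (n + 2) := by
                by_contra h
                exact (hpos _ (Fin.succ_pos i) (Fin.lt_last_iff_ne_last.2 h)).ne b2
              have k1 : i.val = 0 := congrArg Fin.val k1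
              have k2 : i.val + 1 = n + 2 := congrArg Fin.val k2
              omega
            · rw [← b1] at hy1 ⊢; nlinarith
          · nlinarith
        have hm1 : m ≠ 1 := by
          rintro rfl
          exact hne (he.det_eq_one hq (hreduced _) (hreduced _) hdet)
        obtain ⟨hd, h1m, hmq, e1, e2⟩ := he
        refine ⟨m, g, hd, by omega, hmq, g.2, ?_, ?_⟩
        · rw [← e1, mul_smul]; rfl
        · rw [← e2, baseCusp, R_pow_q hq, one_smul]; rfl }
  refine ⟨X, ?_⟩
  ext c
  constructor
  · rintro ⟨j, rfl⟩
    exact hpt j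
  · intro hc
    induction c using OnePoint.rec with
    | infty => exact ⟨0, X.point_first⟩
    | coe x =>
      obtain ⟨j, h1, h2, h3⟩ := hall' x hc
      exact ⟨j, by rw [X.point_mid h1 h2]; exact congrArg _ h3⟩

end

/-! ### The Hecke-Farey symbol of a special polygon -/

section
variable {q : ℕ}

/-- An enumeration of the boundary pieces `(g i, r i)` of a triangulated set by the intervals of the
sequence of its cusps: the `i`-th piece has the end points `g i v_(m i)` and `g i ∞` of the `i`-th
interval. -/
structure PieceEnumeration (𝒢 : Set (Gam q)) (X : HeckeFareySequence q) where
  g : Fin (X.n + 2) → Gam q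
  r : Fin (X.n + 2) → ℕ
  m : Fin (X.n + 2) → ℕ
  piece : ∀ i, IsPiece 𝒢 (g i) (r i)
  rankOf : ∀ i, RankOf (m i) (r i)
  ends : ∀ i, X.Ends i (g i) (m i)
  surj : ∀ a s, IsPiece 𝒢 a s → ∃ i, g i = a ∧ r i = s

theorem IsTriangulated.ends_of_inside (hq : 3 ≤ q) {𝒢 : Set (Gam q)} (h𝒢 : IsTriangulated 𝒢)
    {X : HeckeFareySequence q} (hX : Set.range X.point = cuspSet 𝒢) {g : Gam q} {m r : ℕ}
    (hp : IsPiece 𝒢 g r) (hr : RankOf m r) {i : Fin (X.n + 2)} {y : ℝ} (hi : X.Inside i y)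
    (hy : InArc g r (y : OnePoint ℝ)) : X.Ends i g m := by
  have hpt : ∀ j, X.point j ∈ cuspSet 𝒢 := fun j => hX ▸ ⟨j, rfl⟩
  refine h𝒢.isEnds hq (X.point_first ▸ hpt 0) hp hr (X.den_nonneg _) (X.den_nonneg _) hi.1 hi.2
    (hpt _) (hpt _) ?_ hy
  intro x hx
  rw [← hX] at hx
  obtain ⟨j, hj⟩ := hx
  have h0 : 0 < j := by
    rw [Fin.pos_iff_ne_zero]; rintro rfl
    rw [X.point_first] at hj; exact OnePoint.coe_ne_infty x hj.symm
  have hl : j < Fin.last (X.n + 2) := by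
    rw [Fin.lt_last_iff_ne_last]; rintro rfl
    rw [X.point_last] at hj; exact OnePoint.coe_ne_infty x hj.symm
  rw [X.point_mid h0 hl] at hj
  rw [← OnePoint.coe_injective hj]
  exact (exists_between_consecutive ⟨X.num_first, X.den_first⟩ ⟨X.num_last, X.den_last⟩ X.den_pos
    X.increasing i).2 j h0 hl

theorem IsPiece.exists_inArc (hq : 3 ≤ q) {𝒢 : Set (Gam q)} {g : Gam q} {r : ℕ}
    (hp : IsPiece 𝒢 g r) : ∃ c : OnePoint ℝ, InArc g r c := by
  rcases hp with ⟨rfl, -⟩ | ⟨-, h1, -⟩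
  · exact ⟨g • ((1 : ℝ) : OnePoint ℝ), Or.inl ⟨rfl, 1, one_pos, inv_smul_smul g _⟩⟩
  · exact ⟨g • ((vtx q r + 1 : ℝ) : OnePoint ℝ), Or.inr ⟨h1, _, lt_add_one _, inv_smul_smul g _⟩⟩

theorem IsTriangulated.exists_enumeration (hq : 3 ≤ q) {𝒢 : Set (Gam q)} (h𝒢 : IsTriangulated 𝒢)
    (hfin : 𝒢.Finite) (hbase : 1 ∈ 𝒢 ∨ gS q ∈ 𝒢) {X : HeckeFareySequence q}
    (hX : Set.range X.point = cuspSet 𝒢) : Nonempty (PieceEnumeration 𝒢 X) := by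
  have hpt : ∀ j, X.point j ∈ cuspSet 𝒢 := fun j => hX ▸ ⟨j, rfl⟩
  have hex : ∀ i, ∃ g r m, IsPiece 𝒢 g r ∧ RankOf m r ∧ X.Ends i g m := by
    intro i
    obtain ⟨⟨y, hy1, hy2⟩, hgap⟩ := exists_between_consecutive ⟨X.num_first, X.den_first⟩
      ⟨X.num_last, X.den_last⟩ X.den_pos X.increasing i
    have hi : X.Inside i y := ⟨hy1, hy2⟩
    have hy : (y : OnePoint ℝ) ∉ cuspSet 𝒢 := by
      rw [← hX]
      rintro ⟨j, hj⟩
      have h0 : 0 < j := by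
        rw [Fin.pos_iff_ne_zero]; rintro rfl
        rw [X.point_first] at hj; exact OnePoint.coe_ne_infty y hj.symm
      have hl : j < Fin.last (X.n + 2) := by
        rw [Fin.lt_last_iff_ne_last]; rintro rfl
        rw [X.point_last] at hj; exact OnePoint.coe_ne_infty y hj.symm
      rw [X.point_mid h0 hl] at hj
      have hj := OnePoint.coe_injective hj
      have := hgap j h0 hl
      rw [hj] at this
      rcases this with h | h <;> linarith
    obtain ⟨g, r, hp, harc⟩ := h𝒢.exists_inArc hq hfin hbase hy
    obtain ⟨m, hr, -⟩ := hp.exists_rankOf hq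
    exact ⟨g, r, m, hp, hr, h𝒢.ends_of_inside hq hX hp hr hi harc⟩
  choose g r m hp hr he using hex
  refine ⟨⟨g, r, m, hp, hr, he, fun a s has => ?_⟩⟩
  obtain ⟨c, hc⟩ := has.exists_inArc hq
  have hcn : c ∉ cuspSet 𝒢 := fun h => h𝒢.not_inArc hq has h hc
  induction c using OnePoint.rec with
  | infty => exact absurd (X.point_first ▸ hpt 0) hcn
  | coe y =>
    obtain ⟨i, hi⟩ := X.exists_inside (x := y) fun j hj => hcn (hj ▸ hpt j)
    obtain ⟨m', hr', -⟩ := has.exists_rankOf hq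
    have he' := h𝒢.ends_of_inside hq hX has hr' hi hc
    obtain ⟨e1, e2⟩ := (he i).unique hq he'
    refine ⟨i, e1, ?_⟩
    have hpi := hp i
    have hri := hr i
    rw [e1] at hpi
    rw [e2] at hri
    rcases hri with ⟨h1, h2⟩ | ⟨h1, h2⟩ <;> rcases hr' with ⟨h3, h4⟩ | ⟨h3, h4⟩
    · omega
    · rw [h1] at hpi; exact absurd (has.inner_mem h3) hpi.line.1
    · rw [h3] at has; exact absurd (hpi.inner_mem h1) has.line.1
    · omega

namespace PieceEnumeration

variable {𝒢 : Set (Gam q)} {X : HeckeFareySequence q} (E : PieceEnumeration 𝒢 X)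

theorem disjoint_beyond (hq : 3 ≤ q) {i j : Fin (X.n + 2)} {h : Gam q}
    (h1 : h ∈ beyond (E.g i) (E.r i)) (h2 : h ∈ beyond (E.g j) (E.r j)) : i = j :=
  (E.ends i).disjoint_beyond hq (E.rankOf i) (E.ends j) (E.rankOf j) h1 h2

theorem injective_of_rank_zero (hq : 3 ≤ q) {i j : Fin (X.n + 2)} (hi : E.r i = 0) (hj : E.r j = 0)
    (h : E.g i = E.g j) : i = j := by
  have ha : E.g i ∈ beyond (E.g i) 0 := by rw [mem_beyond_zero, inv_mul_cancel]; exact pos_one hq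
  refine E.disjoint_beyond hq (h := E.g i) ?_ ?_
  · rw [hi]; exact ha
  · rw [hj, ← h]; exact ha

theorem m_eq_one {i : Fin (X.n + 2)} (hi : E.r i = 0) : E.m i = 1 := by
  rcases E.rankOf i with h | h <;> omega

theorem m_eq_r {i : Fin (X.n + 2)} (hi : 1 ≤ E.r i) : E.m i = E.r i := by
  rcases E.rankOf i with h | h <;> omega

/-- `l` is the decoration of the `i`-th interval prescribed by a set `I` of side pairings. -/
def IsLabel (I : Set PSL(2, ℝ)) (i : Fin (X.n + 2)) (l : IntervalLabel (X.n + 2)) : Prop :=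
  match l with
  | .cluster => 1 ≤ E.r i ∧ E.m i ≠ 1
  | .odd => 1 ≤ E.r i ∧ E.m i = 1
  | .even => E.r i = 0 ∧ ((E.g i * gS q * (E.g i)⁻¹ : Gam q) : PSL(2, ℝ)) ∈ I
  | .free j => (E.r i = 0 ∧ ((E.g i * gS q * (E.g i)⁻¹ : Gam q) : PSL(2, ℝ)) ∉ I) ∧ E.r j = 0 ∧
      E.g j ≠ E.g i ∧ ((E.g j * gS q * (E.g j)⁻¹ : Gam q) : PSL(2, ℝ)) ∉ I ∧
      ((E.g j * gS q * (E.g i)⁻¹ : Gam q) : PSL(2, ℝ)) ∈ I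

theorem piece_zero {i : Fin (X.n + 2)} (hi : E.r i = 0) : IsPiece 𝒢 (E.g i) 0 := hi ▸ E.piece i

variable {M : SpecialPolygon q}

theorem exists_label (hq : 3 ≤ q) (hfin : 𝒢.Finite) (hP : M.P = poly 𝒢) (i : Fin (X.n + 2)) :
    ∃ l, E.IsLabel M.I i l := by
  rcases Nat.eq_zero_or_pos (E.r i) with h0 | h1
  · by_cases hf : ((E.g i * gS q * (E.g i)⁻¹ : Gam q) : PSL(2, ℝ)) ∈ M.I
    · exact ⟨.even, h0, hf⟩
    · obtain ⟨h, k1, k2, k3, k4⟩ := SpecialPolygon.exists_partner hq hfin hP (E.piece_zero h0) hf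
      obtain ⟨j, rfl, hj⟩ := E.surj _ _ k1
      exact ⟨.free j, ⟨h0, hf⟩, hj, k2, k3, k4⟩
  · by_cases hm : E.m i = 1
    · exact ⟨.odd, h1, hm⟩
    · exact ⟨.cluster, h1, hm⟩

variable {E}

theorem IsLabel.rank {i : Fin (X.n + 2)} {l : IntervalLabel (X.n + 2)} (h : E.IsLabel M.I i l) :
    E.r i = l.rank (E.m i) := by
  cases l with
  | cluster => exact (E.m_eq_r h.1).symm
  | odd => exact (E.m_eq_r h.1).symm
  | even => exact h.1
  | free j => exact h.1.1

theorem IsLabel.cluster_iff (hq : 3 ≤ q) {i : Fin (X.n + 2)} {l : IntervalLabel (X.n + 2)}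
    (h : E.IsLabel M.I i l) : l = .cluster ↔ ¬ X.IsOrdinary i := by
  have hm : X.IsOrdinary i ↔ E.m i = 1 := by
    rw [X.isOrdinary_iff hq]
    constructor
    · rintro ⟨g, hg⟩; exact ((E.ends i).unique hq hg).2
    · intro hm; exact ⟨_, hm ▸ E.ends i⟩
  rw [hm]
  cases l with
  | cluster => exact iff_of_true rfl h.2
  | odd => exact iff_of_false (by simp) (not_not.2 h.2)
  | even => exact iff_of_false (by simp) (not_not.2 (E.m_eq_one h.1))
  | free j => exact iff_of_false (by simp) (not_not.2 (E.m_eq_one h.1.1))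

theorem IsLabel.free_unique (hq : 3 ≤ q) (hfin : 𝒢.Finite) (hP : M.P = poly 𝒢)
    {i j k : Fin (X.n + 2)} (h : E.IsLabel M.I i (.free j)) (h' : E.IsLabel M.I i (.free k)) :
    j = k := by
  obtain ⟨⟨h0, hf⟩, h1, h2⟩ := h
  obtain ⟨-, h1', h2'⟩ := h'
  exact E.injective_of_rank_zero hq h1 h1' (SpecialPolygon.partner_unique hq hfin hP
    (E.piece_zero h0) hf ⟨E.piece_zero h1, h2⟩ ⟨E.piece_zero h1', h2'⟩)

theorem IsLabel.symm {i j : Fin (X.n + 2)} (h : E.IsLabel M.I i (.free j)) :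
    E.IsLabel M.I j (.free i) := by
  obtain ⟨⟨h0, hf⟩, h1, h2, h3, h4⟩ := h
  refine ⟨⟨h1, h3⟩, h0, h2.symm, hf, ?_⟩
  have e : E.g i * gS q * (E.g j)⁻¹ = (E.g j * gS q * (E.g i)⁻¹)⁻¹ := by
    rw [mul_inv_rev, mul_inv_rev, inv_inv, gS_inv, mul_assoc]
  rw [e]
  exact M.inv_mem _ h4

theorem IsLabel.eq_free (hq : 3 ≤ q) (hfin : 𝒢.Finite) (hP : M.P = poly 𝒢) {i j : Fin (X.n + 2)}
    {l : IntervalLabel (X.n + 2)} (h : E.IsLabel M.I i (.free j)) (hl : E.IsLabel M.I i l) :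
    l = .free j := by
  cases l with
  | cluster => have := hl.1; have := h.1.1; omega
  | odd => have := hl.1; have := h.1.1; omega
  | even => exact absurd hl.2 h.1.2
  | free k => rw [hl.free_unique hq hfin hP h]

theorem IsLabel.eq_even {i : Fin (X.n + 2)} {l : IntervalLabel (X.n + 2)}
    (h : E.IsLabel M.I i .even) (hl : E.IsLabel M.I i l) : l = .even := by
  cases l with
  | cluster => have := hl.1; have := h.1; omega
  | odd => have := hl.1; have := h.1; omega
  | even => rfl
  | free k => exact absurd h.2 hl.1.2

/-- The inverse of the side pairing of an interval maps the polygon beyond the piece of that interval,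
and the side pairing maps the polygon beyond the same piece or beyond its partner. -/
theorem IsLabel.exists_pairing (hq : 3 ≤ q) (h𝒢 : IsTriangulated 𝒢) (hfin : 𝒢.Finite)
    (hP : M.P = poly 𝒢) {i : Fin (X.n + 2)} {l : IntervalLabel (X.n + 2)} (h : E.IsLabel M.I i l) :
    ∃ γ : Gam q, X.IsPairing i l γ ∧ (γ : PSL(2, ℝ)) ∈ M.I ∧
      (∀ x ∈ 𝒢, γ⁻¹ * x ∈ beyond (E.g i) (E.r i)) ∧
      ∃ k, (k = i ∨ l = .free k) ∧ ∀ x ∈ 𝒢, γ * x ∈ beyond (E.g k) (E.r k) := by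
  have hrot : 1 ≤ E.r i → ((E.g i * gR q ^ E.m i * (E.g i)⁻¹ : Gam q) : PSL(2, ℝ)) ∈ M.I ∧
      (∀ x ∈ 𝒢, (E.g i * gR q ^ E.m i * (E.g i)⁻¹)⁻¹ * x ∈ beyond (E.g i) (E.r i)) ∧
      ∃ k, (k = i ∨ l = .free k) ∧
        ∀ x ∈ 𝒢, (E.g i * gR q ^ E.m i * (E.g i)⁻¹) * x ∈ beyond (E.g k) (E.r k) := by
    intro hr
    rw [E.m_eq_r hr]
    exact ⟨SpecialPolygon.rotation_mem hq hfin hP (E.piece i) hr,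
      fun x hx => (h𝒢.rotation_source hq (E.piece i) hr hx).2, i, Or.inl rfl,
      fun x hx => (h𝒢.rotation_source hq (E.piece i) hr hx).1⟩
  have hline : ∀ j, E.r i = 0 → E.r j = 0 →
      (∀ x ∈ 𝒢, (E.g j * gS q * (E.g i)⁻¹)⁻¹ * x ∈ beyond (E.g i) (E.r i)) ∧
      ∀ x ∈ 𝒢, (E.g j * gS q * (E.g i)⁻¹) * x ∈ beyond (E.g j) (E.r j) := by
    intro j hi hj
    rw [hi, hj]
    refine ⟨fun x hx => h𝒢.line_source hq (E.piece_zero hj) hx, fun x hx => ?_⟩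
    have := h𝒢.line_source hq (g := E.g j) (E.piece_zero hi) hx
    rwa [mul_inv_rev, mul_inv_rev, inv_inv, gS_inv, ← mul_assoc (E.g j)] at this
  cases l with
  | cluster =>
    have := (E.ends i).2.1
    have hm := h.2
    exact ⟨_, (X.isPairing_cluster_iff hq i _).2 ⟨_, _, by omega, E.ends i, rfl⟩, hrot h.1⟩
  | odd =>
    have he := E.ends i
    have hr := hrot h.1
    rw [h.2] at he hr
    exact ⟨_, (X.isPairing_odd_iff hq i _).2 ⟨_, he, rfl⟩, hr⟩
  | even =>
    have he := E.ends i
    rw [E.m_eq_one h.1] at he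
    obtain ⟨h1, h2⟩ := hline i h.1 h.1
    exact ⟨_, (X.isPairing_even_iff hq i _).2 ⟨_, he, rfl⟩, h.2, h1, i, Or.inl rfl, h2⟩
  | free j =>
    obtain ⟨⟨h0, -⟩, h1, -, -, h4⟩ := h
    have he := E.ends i
    have he' := E.ends j
    rw [E.m_eq_one h0] at he
    rw [E.m_eq_one h1] at he'
    obtain ⟨k1, k2⟩ := hline j h0 h1
    exact ⟨_, (X.isPairing_free_iff hq i j _).2 ⟨_, _, he, he', rfl⟩, h4, k1, j, Or.inr rfl, k2⟩

/-- There are two different intervals that are not paired with each other. -/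
theorem exists_ne_not_free (hq : 3 ≤ q) {l : Fin (X.n + 2) → IntervalLabel (X.n + 2)}
    (hl : ∀ i, E.IsLabel M.I i (l i)) : ∃ i j, i ≠ j ∧ l i ≠ .free j := by
  have h01 : (0 : Fin (X.n + 2)) ≠ 1 := by simp [Fin.ext_iff]
  by_cases h : l 0 = .free 1
  · rcases Nat.eq_zero_or_pos X.n with hn | hn
    · exfalso
      -- the lines of `-∞ < 0` and `0 < ∞` are the two sides of a single line
      have hlab := hl 0
      rw [h] at hlab
      obtain ⟨⟨h0, -⟩, h1, -⟩ := hlab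
      have e0 := E.ends 0
      have e1 := E.ends 1
      rw [E.m_eq_one h0] at e0
      rw [E.m_eq_one h1] at e1
      have hz : ∀ k : Gam q, (k * gR q ^ 1) • (OnePoint.infty : OnePoint ℝ) =
          k • ((0 : ℝ) : OnePoint ℝ) := by
        intro k; rw [mul_smul, gR_pow_smul_infty hq le_rfl (by omega), vtx_one]
      obtain ⟨-, -, -, a1, a2⟩ := e0
      obtain ⟨-, -, -, b1, b2⟩ := e1
      rw [hz] at a1 b1
      have k1 : (0 : Fin (X.n + 2)).succ = (1 : Fin (X.n + 2)).castSucc := by simp [Fin.ext_iff]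
      have k2 : (1 : Fin (X.n + 2)).succ = Fin.last (X.n + 2) := by simp [Fin.ext_iff, hn]
      have k3 : (0 : Fin (X.n + 2)).castSucc = 0 := rfl
      rw [k2, X.point_last] at b2
      rw [k3, X.point_first] at a1
      rw [← k1] at b1
      have e : E.g 1 = E.g 0 * gS q := by
        refine eq_of_smul_cusps hq ?_ ?_
        · rw [b1, mul_smul, gS_smul_zero, a2]
        · rw [b2, mul_smul, gS_smul_infty, a1]
      exact (E.piece_zero h1).line.1 (e ▸ (E.piece_zero h0).line.2)
    · have h2 : (⟨2, by omega⟩ : Fin (X.n + 2)) ≠ 1 := by simp [Fin.ext_iff]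
      refine ⟨0, ⟨2, by omega⟩, by simp [Fin.ext_iff], ?_⟩
      rw [h]
      intro h'
      injection h' with h'
      exact h2 h'.symm
  · exact ⟨0, 1, h01, h⟩

theorem exists_symbol (E : PieceEnumeration 𝒢 X) (hq : 3 ≤ q) (h𝒢 : IsTriangulated 𝒢) (hfin : 𝒢.Finite)
    (hbase : 1 ∈ 𝒢 ∨ gS q ∈ 𝒢) (hX : Set.range X.point = cuspSet 𝒢) (hP : M.P = poly 𝒢) :
    ∃ F : HeckeFareySymbol q, F.IsMatch 𝒢 ∧ M.I = F.pairings := by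
  choose l hl using fun i => E.exists_label hq hfin hP (M := M) i
  have hfree : ∀ i j, l i = .free j → E.IsLabel M.I i (.free j) := fun i j h => h ▸ hl i
  let F : HeckeFareySymbol q :=
    { X with
      label := l
      cluster_iff := fun i => (hl i).cluster_iff hq
      free_symm := by
        intro i j h
        refine ⟨?_, (hfree i j h).symm.eq_free hq hfin hP (hl j)⟩
        rintro rfl
        exact (hfree i i h).2.2.1 rfl
      two_pairings := by
        obtain ⟨i, j, hij, hlij⟩ := exists_ne_not_free hq hl
        obtain ⟨γ, h1, -, h2, k, hk, h3⟩ := (hl i).exists_pairing hq h𝒢 hfin hP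
        obtain ⟨δ, h1', -, h2', -⟩ := (hl j).exists_pairing hq h𝒢 hfin hP
        obtain ⟨x, hx⟩ : ∃ x, x ∈ 𝒢 := by
          rcases hbase with h | h <;> exact ⟨_, h⟩
        refine ⟨i, j, γ, δ, h1, h1', fun e => ?_, fun e => ?_⟩
        · have e : γ = δ := Subtype.ext e
          exact hij (E.disjoint_beyond hq (h2 x hx) (e ▸ h2' x hx))
        · have e : γ = δ⁻¹ := Subtype.ext e
          have hkj := E.disjoint_beyond hq (h3 x hx) (e ▸ h2' x hx)
          rcases hk with rfl | hk
          · exact hij hkj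
          · exact hlij (hkj ▸ hk) }
  have hpiece : ∀ i, F.IsPieceAt i (E.g i) (E.r i) := fun i => ⟨E.m i, E.ends i, (hl i).rank⟩
  refine ⟨F, ⟨h𝒢, hfin, hbase, fun g r => ⟨fun h => ?_, fun ⟨i, h⟩ => ?_⟩, hX.symm⟩, ?_⟩
  · obtain ⟨i, rfl, rfl⟩ := E.surj g r h
    exact ⟨i, hpiece i⟩
  · obtain ⟨rfl, rfl⟩ := h.unique hq (hpiece i)
    exact E.piece i
  · have hI : ∀ i (γ : Gam q), F.PairAt i γ → (γ : PSL(2, ℝ)) ∈ M.I := by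
      intro i γ hγ
      obtain ⟨δ, h1, h2, -⟩ := (hl i).exists_pairing hq h𝒢 hfin hP
      obtain ⟨δ', h3, h4⟩ := (HeckeFareySymbol.isPairing_iff (F := F) hq i _).1 h1
      rw [← Subtype.ext h4, h3.unique hq hγ] at h2
      exact h2
    apply Set.Subset.antisymm
    · intro γ hγ
      lift γ to Gam q using M.mem_heckeGroup γ hγ
      rw [HeckeFareySymbol.coe_mem_pairings_iff hq]
      rcases SpecialPolygon.pairing_cases hq h𝒢 hfin hP hγ with
        ⟨g, r, hr, hp, h⟩ | ⟨g, hp, rfl⟩ | ⟨g, h, hp, hf, hh, hne, hhf, rfl⟩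
      · obtain ⟨i, rfl, rfl⟩ := E.surj g r hp
        have hpair := HeckeFareySymbol.PairAt.of_isPieceAt hr (hpiece i)
        rcases h with h | h
        · exact ⟨i, Or.inl (h ▸ hpair)⟩
        · exact ⟨i, Or.inr (h ▸ hpair)⟩
      · obtain ⟨i, rfl, hi⟩ := E.surj g 0 hp
        have hlab : E.IsLabel M.I i .even := ⟨hi, hγ⟩
        exact ⟨i, Or.inl (HeckeFareySymbol.PairAt.of_even hq (hi ▸ hpiece i)
          (hlab.eq_even (hl i)))⟩
      · obtain ⟨i, rfl, hi⟩ := E.surj g 0 hp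
        obtain ⟨j, rfl, hj⟩ := E.surj h 0 hh
        have hlab : E.IsLabel M.I i (.free j) := ⟨⟨hi, hf⟩, hj, hne, hhf, hγ⟩
        have he := E.ends i
        have he' := E.ends j
        rw [E.m_eq_one hi] at he
        rw [E.m_eq_one hj] at he'
        exact ⟨i, Or.inl (Or.inl ⟨j, _, _, Or.inr (hlab.eq_free hq hfin hP (hl i)), he, he', rfl⟩)⟩
    · intro γ hγ
      obtain ⟨γ, rfl, i, h | h⟩ := (HeckeFareySymbol.mem_pairings_iff hq γ).1 hγ
      · exact hI i γ h
      · have := M.inv_mem _ (hI i _ h)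
        rwa [← Subgroup.coe_inv, inv_inv] at this

end PieceEnumeration

/-- Every special polygon comes from a Hecke-Farey symbol. -/
theorem SpecialPolygon.exists_symbol (hq : 3 ≤ q) (M : SpecialPolygon q) :
    ∃ F : HeckeFareySymbol q, F.IsMatch (trianglesOf q M.P) ∧ M.I = F.pairings := by
  obtain ⟨h𝒢, hfin, hP⟩ := isTriangulated_of_isConvexPolygon hq M.convexPolygon
  have h0 := M.zero_cusp
  have h1 := M.infty_cusp
  rw [← hP, isCuspOf_poly hq] at h0 h1
  obtain ⟨X, hX⟩ := h𝒢.exists_sequence hq hfin h0 h1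
  have hbase := h𝒢.base hq h0 h1
  obtain ⟨E⟩ := h𝒢.exists_enumeration hq hfin hbase hX
  exact E.exists_symbol hq h𝒢 hfin hbase hX hP.symm

end

/-! ### A symbol is determined by its points, vertices and side pairings -/

namespace HeckeFareySequence

variable {q : ℕ}

/-- The finite terms of a sequence, in increasing order. -/
noncomputable def term (F : HeckeFareySequence q) (k : Fin (F.n + 1)) : ℝ :=
  F.num k.succ.castSucc / F.den k.succ.castSucc

theorem mid_succ (F : HeckeFareySequence q) (k : Fin (F.n + 1)) :
    0 < k.succ.castSucc ∧ k.succ.castSucc < Fin.last (F.n + 2) :=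
  ⟨by rw [Fin.lt_def]; simp, Fin.castSucc_lt_last _⟩

theorem term_strictMono (F : HeckeFareySequence q) : StrictMono F.term := fun i j h =>
  F.increasing _ _ (F.mid_succ i).1
    (Fin.castSucc_lt_castSucc_iff.2 (Fin.succ_lt_succ_iff.2 h)) (F.mid_succ j).2

theorem mem_range_term (F : HeckeFareySequence q) (x : ℝ) :
    x ∈ Set.range F.term ↔ (x : OnePoint ℝ) ∈ Set.range F.point := by
  constructor
  · rintro ⟨k, rfl⟩
    exact ⟨_, F.point_mid (F.mid_succ k).1 (F.mid_succ k).2⟩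
  · rintro ⟨j, hj⟩
    have h0 : 0 < j := by
      rw [Fin.pos_iff_ne_zero]; rintro rfl
      rw [F.point_first] at hj; exact OnePoint.coe_ne_infty x hj.symm
    have hl : j < Fin.last (F.n + 2) := by
      rw [Fin.lt_last_iff_ne_last]; rintro rfl
      rw [F.point_last] at hj; exact OnePoint.coe_ne_infty x hj.symm
    have h0' : 0 < j.val := h0
    have hl' : j.val < F.n + 2 := hl
    rw [F.point_mid h0 hl] at hj
    have e : (⟨j.val - 1, by omega⟩ : Fin (F.n + 1)).succ.castSucc = j :=
      Fin.ext (by simp; omega)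
    exact ⟨⟨j.val - 1, by omega⟩, by rw [term, e]; exact OnePoint.coe_injective hj⟩

/-- A Hecke-Farey sequence is determined by the set of its points. -/
theorem eq_of_range_point (hq : 3 ≤ q) {F F' : HeckeFareySequence q}
    (h : Set.range F.point = Set.range F'.point) : F = F' := by
  have hr : Set.range F.term = Set.range F'.term := by
    ext x; rw [mem_range_term, mem_range_term, h]
  have hm := F.term_strictMono
  have hm' := F'.term_strictMono
  have hn : F.n = F'.n := by
    have h1 := Nat.card_range_of_injective hm.injective
    have h2 := Nat.card_range_of_injective hm'.injective
    rw [hr, h2, Nat.card_fin, Nat.card_fin] at h1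
    omega
  clear h
  obtain ⟨n, num, den, f1, f2, l1, l2, dp, red, mf, inc, zm, cl⟩ := F
  obtain ⟨n', num', den', f1', f2', l1', l2', dp', red', mf', inc', zm', cl'⟩ := F'
  obtain rfl : n = n' := hn
  have ht := (StrictMono.range_inj hm hm').1 hr
  have key : ∀ j, num j = num' j ∧ den j = den' j := by
    intro j
    rcases (Fin.zero_le j).eq_or_lt with rfl | h0
    · exact ⟨f1.trans f1'.symm, f2.trans f2'.symm⟩
    rcases (Fin.le_last j).eq_or_lt with rfl | hl
    · exact ⟨l1.trans l1'.symm, l2.trans l2'.symm⟩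
    have h0' : 0 < j.val := h0
    have hl' : j.val < n + 2 := hl
    have e : (⟨j.val - 1, by omega⟩ : Fin (n + 1)).succ.castSucc = j := Fin.ext (by simp; omega)
    have := congrFun ht (⟨j.val - 1, by omega⟩ : Fin (n + 1))
    simp only [term] at this
    rw [e] at this
    exact isReduced_unique hq (red j) (red' j) (dp j h0 hl) (dp' j h0 hl) this
  obtain rfl : num = num' := funext fun j => (key j).1
  obtain rfl : den = den' := funext fun j => (key j).2
  rfl

end HeckeFareySequence

namespace HeckeFareySymbol

variable {q : ℕ}

/-- If the rotation centre of an interval with `m = 1` is that of another interval, the two intervals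
coincide: otherwise the complements of the two clusters in their common `q`-gon would be disjoint, but
the first one is all of the `q`-gon except for one triangle. -/
theorem eq_of_smul_rho (hq : 3 ≤ q) {X : HeckeFareySequence q} {i k : Fin (X.n + 2)} {g g' : Gam q}
    {r : ℕ} (hi : X.Ends i g 1) (hk : X.Ends k g' r) (e : g • rho hq = g' • rho hq) : i = k := by
  obtain ⟨l, hl, rfl⟩ := rotation_of_smul_rho hq e
  have h2r := IsEnds.two_mul_le hk
  have h1r := hk.2.1
  have key : ∀ s, r ≤ s → s < q → (l + s) % q ≠ 0 → i = k := by
    intro s hs hsq hne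
    refine hi.disjoint_beyond hq (Or.inr ⟨le_rfl, rfl⟩) hk (Or.inr ⟨h1r, rfl⟩)
      (h := g * gR q ^ l * gR q ^ s) ?_ ((mul_R_pow_mem_beyond_iff hq h1r hsq).2 hs)
    rw [mul_assoc, ← pow_add, ← gR_pow_mod hq]
    exact (mul_R_pow_mem_beyond_iff hq le_rfl (Nat.mod_lt _ (by omega))).2 (by omega)
  by_cases h : (l + (q - 1)) % q = 0
  · refine key (q - 2) (by omega) (by omega) fun h' => ?_
    have h1 := Nat.dvd_of_mod_eq_zero h
    have h2 := Nat.dvd_of_mod_eq_zero h'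
    have h3 := Nat.dvd_sub h1 h2
    rw [show l + (q - 1) - (l + (q - 2)) = 1 by omega] at h3
    have := Nat.le_of_dvd one_pos h3
    omega
  · exact key (q - 1) (by omega) (by omega) h

theorem label_odd_of_odd (hq : 3 ≤ q) {X : HeckeFareySequence q}
    {l l' : Fin (X.n + 2) → IntervalLabel (X.n + 2)} {c f t c' f' t'}
    (h : (⟨X, l, c, f, t⟩ : HeckeFareySymbol q).oddVertices =
      (⟨X, l', c', f', t'⟩ : HeckeFareySymbol q).oddVertices) {i : Fin (X.n + 2)} (hi : l i = .odd) :
    l' i = .odd := by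
  set F : HeckeFareySymbol q := ⟨X, l, c, f, t⟩
  set F' : HeckeFareySymbol q := ⟨X, l', c', f', t'⟩
  obtain ⟨g, m, he⟩ := X.exists_ends hq i
  have hp : F.IsPieceAt i g m := isPieceAt_of_label (F := F) (Or.inl hi) he
  obtain rfl : m = 1 := eq_one_of_ends (F := F) hq (i := i) (by
    change l i ≠ _
    rw [hi]; simp) he
  have hz := (mem_oddVertices_iff (F := F) hq (g • rho hq)).2 ⟨i, g, 1, le_rfl, hp, rfl⟩
  rw [h, mem_oddVertices_iff hq] at hz
  obtain ⟨k, g', r, hr, hp', e⟩ := hz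
  obtain ⟨hl, he'⟩ := label_of_one_le hp' hr
  obtain rfl : i = k := eq_of_smul_rho hq he he' e
  rcases hl with hl | hl
  · exact hl
  · exact absurd ((X.isOrdinary_iff hq).2 ⟨g, he⟩) ((c' i).1 hl)

theorem label_cluster_of_cluster {X : HeckeFareySequence q}
    {l l' : Fin (X.n + 2) → IntervalLabel (X.n + 2)}
    (c : ∀ i, l i = .cluster ↔ ¬ X.IsOrdinary i) (c' : ∀ i, l' i = .cluster ↔ ¬ X.IsOrdinary i)
    {i : Fin (X.n + 2)} (hi : l i = .cluster) : l' i = .cluster := (c' i).2 ((c i).1 hi)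

theorem label_even_of_even (hq : 3 ≤ q) {X : HeckeFareySequence q}
    {l l' : Fin (X.n + 2) → IntervalLabel (X.n + 2)} {c f t c' f' t'}
    (hodd : (⟨X, l, c, f, t⟩ : HeckeFareySymbol q).oddVertices =
      (⟨X, l', c', f', t'⟩ : HeckeFareySymbol q).oddVertices)
    (h : (⟨X, l, c, f, t⟩ : HeckeFareySymbol q).evenVertices =
      (⟨X, l', c', f', t'⟩ : HeckeFareySymbol q).evenVertices)
    {i : Fin (X.n + 2)} (hi : l i = .even) : l' i = .even := by
  have hodd' : l' i ≠ .odd := fun h' => by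
    have := label_odd_of_odd hq hodd.symm h'
    rw [hi] at this; simp at this
  have hclu' : l' i ≠ .cluster := fun h' => by
    have := label_cluster_of_cluster c' c h'
    rw [hi] at this; simp at this
  set F : HeckeFareySymbol q := ⟨X, l, c, f, t⟩
  set F' : HeckeFareySymbol q := ⟨X, l', c', f', t'⟩
  obtain ⟨g, m, he⟩ := X.exists_ends hq i
  have hp : F.IsPieceAt i g 0 := Partner.isPieceAt (F := F) (j := i) (Or.inl ⟨hi, rfl⟩) he
  have he := hp.ends_of_zero hq
  have hz := (mem_evenVertices_iff (F := F) hq (g • iPt 1 one_pos)).2 ⟨i, g, hi, hp, rfl⟩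
  rw [h, mem_evenVertices_iff hq] at hz
  obtain ⟨k, g', hk, hp', e⟩ := hz
  rcases line_injective hq (iPt_re 1 one_pos) (iPt_re 1 one_pos) e with rfl | rfl
  · have ha : g' ∈ beyond g' 0 := by rw [mem_beyond_zero, inv_mul_cancel]; exact pos_one hq
    obtain rfl : i = k := he.disjoint_beyond hq (Or.inl ⟨rfl, rfl⟩) (hp'.ends_of_zero hq)
      (Or.inl ⟨rfl, rfl⟩) ha ha
    exact hk
  · -- in the remaining case the `i`-th interval of `F'` would be a line as well
    cases hl : l' i with
    | cluster => exact absurd hl hclu'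
    | odd => exact absurd hl hodd'
    | even => rfl
    | free j => exact (not_swap hq (Partner.isPieceAt (F := F') (i := i) (j := j) (Or.inr hl) he) hp').elim

theorem label_free_of_free (hq : 3 ≤ q) {X : HeckeFareySequence q}
    {l l' : Fin (X.n + 2) → IntervalLabel (X.n + 2)} {c f t c' f' t'}
    (hodd : (⟨X, l, c, f, t⟩ : HeckeFareySymbol q).oddVertices =
      (⟨X, l', c', f', t'⟩ : HeckeFareySymbol q).oddVertices)
    (heven : (⟨X, l, c, f, t⟩ : HeckeFareySymbol q).evenVertices =
      (⟨X, l', c', f', t'⟩ : HeckeFareySymbol q).evenVertices)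
    (h : (⟨X, l, c, f, t⟩ : HeckeFareySymbol q).pairings =
      (⟨X, l', c', f', t'⟩ : HeckeFareySymbol q).pairings)
    {i j : Fin (X.n + 2)} (hi : l i = .free j) : l' i = .free j := by
  have hex : ∀ {i j}, l i = .free j → ∃ j', l' i = .free j' := by
    intro i j hi
    cases hl : l' i with
    | cluster =>
      have := label_cluster_of_cluster c' c hl
      rw [hi] at this; simp at this
    | odd =>
      have := label_odd_of_odd hq hodd.symm hl
      rw [hi] at this; simp at this
    | even =>
      have := label_even_of_even hq hodd.symm heven.symm hl
      rw [hi] at this; simp at this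
    | free j' => exact ⟨j', rfl⟩
  obtain ⟨j', hj'⟩ := hex hi
  obtain ⟨i', hi'⟩ := hex (f i j hi).2
  set F : HeckeFareySymbol q := ⟨X, l, c, f, t⟩
  set F' : HeckeFareySymbol q := ⟨X, l', c', f', t'⟩
  have hpart : F.Partner i j := Or.inr hi
  obtain ⟨g, m, he⟩ := X.exists_ends hq i
  obtain ⟨k, m', hk⟩ := X.exists_ends hq j
  have he := (hpart.isPieceAt he).ends_of_zero hq
  have hk := (hpart.symm.isPieceAt hk).ends_of_zero hq
  have hp : F'.IsPieceAt i g 0 := Partner.isPieceAt (F := F') (j := j') (Or.inr hj') he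
  have hp' : F'.IsPieceAt j k 0 := Partner.isPieceAt (F := F') (j := i') (Or.inr hi') hk
  have hpair : F.PairAt i (k * gS q * g⁻¹) := Or.inl ⟨j, g, k, hpart, he, hk, rfl⟩
  have hmem := (coe_mem_pairings_iff (F := F) hq _).2 ⟨i, Or.inl hpair⟩
  rw [h, coe_mem_pairings_iff hq] at hmem
  have hself : ∀ a : Gam q, a ∈ beyond a 0 := fun a => by
    rw [mem_beyond_zero, inv_mul_cancel]; exact pos_one hq
  have h1 := ((F'.isMatch_region hq).pairAt_of_mem hq hmem hp (hself g)
    (by rw [inv_mul_cancel_right]; exact (mul_S_mem_region hq hp').2)).resolve_right (by omega)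
  obtain ⟨k', m'', hk'⟩ := X.exists_ends hq j'
  have hpart' : F'.Partner i j' := Or.inr hj'
  have hk' := (hpart'.symm.isPieceAt hk').ends_of_zero hq
  have h2 : F'.PairAt i (k' * gS q * g⁻¹) := Or.inl ⟨j', g, k', hpart', he, hk', rfl⟩
  obtain rfl : k = k' := mul_right_cancel (mul_right_cancel (h1.unique hq h2))
  obtain rfl : j = j' := hk.disjoint_beyond hq (Or.inl ⟨rfl, rfl⟩) hk' (Or.inl ⟨rfl, rfl⟩)
    (hself k) (hself k)
  exact hj'

/-- A symbol is determined by its points, its vertices and its side pairings. -/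
theorem eq_of_data (hq : 3 ≤ q) {F F' : HeckeFareySymbol q} (hpt : F.points = F'.points)
    (hodd : F.oddVertices = F'.oddVertices) (heven : F.evenVertices = F'.evenVertices)
    (hpair : F.pairings = F'.pairings) : F = F' := by
  obtain ⟨X, l, c, f, t⟩ := F
  obtain ⟨X', l', c', f', t'⟩ := F'
  obtain rfl : X = X' := HeckeFareySequence.eq_of_range_point hq hpt
  obtain rfl : l = l' := by
    funext i
    cases hl : l i with
    | cluster => exact (label_cluster_of_cluster c c' hl).symm
    | odd => exact (label_odd_of_odd hq hodd hl).symm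
    | even => exact (label_even_of_even hq hodd heven hl).symm
    | free j => exact (label_free_of_free hq hodd heven hpair hl).symm
  rfl

end HeckeFareySymbol

section
variable {q : ℕ}

/-- A special polygon and a symbol correspond to each other if and only if they have the same triangles
and the same side pairings. -/
theorem corresponds_iff (hq : 3 ≤ q) (M : SpecialPolygon q) (F : HeckeFareySymbol q) :
    Corresponds M F ↔ F.IsMatch (trianglesOf q M.P) ∧ M.I = F.pairings := by
  have hP := (isTriangulated_of_isConvexPolygon hq M.convexPolygon).2.2.symm
  constructor
  · rintro ⟨h1, h2, h3, h4⟩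
    obtain ⟨F', hm, hI⟩ := M.exists_symbol hq
    obtain ⟨k1, k2, k3, k4⟩ := hm.corresponds hq hP hI
    obtain rfl : F' = F := HeckeFareySymbol.eq_of_data hq (k1.symm.trans h1) (k2.symm.trans h2)
      (k3.symm.trans h3) (k4.symm.trans h4)
    exact ⟨hm, hI⟩
  · rintro ⟨hm, hI⟩
    exact hm.corresponds hq hP hI

theorem existsUnique_symbol (hq : 3 ≤ q) (M : SpecialPolygon q) :
    ∃! F : HeckeFareySymbol q, Corresponds M F := by
  obtain ⟨F, h⟩ := M.exists_symbol hq
  have hc := (corresponds_iff hq M F).2 h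
  refine ⟨F, hc, fun F' hc' => ?_⟩
  obtain ⟨h1, h2, h3, h4⟩ := hc
  obtain ⟨k1, k2, k3, k4⟩ := hc'
  exact HeckeFareySymbol.eq_of_data hq (k1.symm.trans h1) (k2.symm.trans h2) (k3.symm.trans h3)
    (k4.symm.trans h4)

theorem polygon_unique (hq : 3 ≤ q) {M M' : SpecialPolygon q} {F : HeckeFareySymbol q}
    (h : Corresponds M F) (h' : Corresponds M' F) : M = M' := by
  have key : ∀ {M : SpecialPolygon q}, Corresponds M F → M.P = poly F.region := by
    intro M h
    have hP := (isTriangulated_of_isConvexPolygon hq M.convexPolygon).2.2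
    rw [← ((corresponds_iff hq M F).1 h).1.eq_region hq, hP]
  exact SpecialPolygon.ext ((key h).trans (key h').symm) (h.2.2.2.trans h'.2.2.2.symm)

end

end HeckeFarey

theorem proposition4p4 (q : ℕ) (hq : 3 ≤ q) :
    ∃ e : HeckeFarey.SpecialPolygon q ≃ HeckeFarey.HeckeFareySymbol q,
      ∀ (M : HeckeFarey.SpecialPolygon q) (F : HeckeFarey.HeckeFareySymbol q),
        HeckeFarey.Corresponds M F ↔ e M = F := by
  choose e he huniq using fun M : HeckeFarey.SpecialPolygon q => HeckeFarey.existsUnique_symbol hq M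
  have hiff : ∀ M F, HeckeFarey.Corresponds M F ↔ e M = F := fun M F =>
    ⟨fun h => (huniq M F h).symm, fun h => h ▸ he M⟩
  refine ⟨Equiv.ofBijective e ⟨fun M M' h => ?_, fun F => ?_⟩, hiff⟩
  · exact HeckeFarey.polygon_unique hq (he M) ((hiff M' (e M)).2 h.symm)
  · exact ⟨_, (hiff _ F).1 (HeckeFarey.HeckeFareySymbol.corresponds_toSpecialPolygon hq)⟩
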